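/- **Setting.** Majorana operators are Hermitian matrices with $\gamma_j\gamma_k+\gamma_k\gamma_j=2\delta_{jk}$. On a register of $2m+2$ Majoranas put $s_j=i\gamma_{2j-1}\gamma_{2j}$ ($1\le j\le m$) and $\Gamma=i^{m+1}\gamma_1\cdots\gamma_{2m+2}$ (total parity). A *fermion parity* is an operator $\pm\Gamma_S$ with $\Gamma_S=i^{|S|/2}\prod_{j\in S}\gamma_j$ and $|S|$ even. The gates are the logical braids $\exp(\pm i\frac{\pi}{4}\Gamma_S)$ ($|S|$ even) and $T_{2,ab}=\exp(\frac{\pi}{8}\gamma_a\gamma_b)$ ($a\ne b$). Let $C$ be a circuit consisting of $L$ such gates, exactly $t$ of which are $T_2$ gates, on a register $\mathcal R_n$ of $2n+2$ Majoranas. $\mathcal R_n$ starts in a unit vector that is a $+1$-eigenvector of $s_1,\dots,s_n$ and has a known total parity, and $C$ ends with the measurement of $s_1,\dots,s_n$, whose results are the output bit string $\mathbf b\in\{0,1\}^n$. Let $\mathcal R_t$ be a separate register of $2t+2$ Majoranas with a known total parity. Let $X_1,\dots,X_t$ be fermion parities on it with $\{s_j,X_j\}=0$ and $[s_k,X_j]=[X_k,X_j]=0$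 for $k\neq j$. Let $\mathcal R_t$ be in the magic state $|\psi^{(t)}\rangle=T_{2,12}T_{2,34}\cdots T_{2,2t-1\,2t}|\psi^X\rangle$, where $|\psi^X\rangle$ is a unit vector of the given total parity with $X_j|\psi^X\rangle=|\psi^X\rangle$ for all $j$. A *hybrid program* is a program of a classical random access machine (unit cost, with addition and truncated subtraction) that may also toss fair coins and have fermion parities of $\mathcal R_t$ projectively measured. It acts on $\mathcal R_t$ in no other way, and what it does may depend on the earlier outcomes. **Theorem.** There are one hybrid program and one polynomial $p$ such that for all $n$, $t$, $C$, $\mathcal R_n$, $\mathcal R_t$, $X_1,\dots,X_t$ as above, the program, given as input $n$, $t$, the gate list of $C$, the operators $X_j$ and the total parities of the two registers, and given access to $\mathcal R_t$ in the state $|\psi^{(t)}\rangle$, satisfies: 1. every run halts after at most $p(n+L)$ steps, with an output of $n$ bits (so the classical processing takes time $\mathrm{poly}(n)$ whenever the circuit has $\mathrm{poly}(n)$ gates); 2. in every run at most $t$ measurements are made, all of them of fermion parities on $\mathcal R_t$, and the measured parities commute with each other; 3. for every $\mathbf b\in\{0,1\}^n$, the probability that the program outputs $\mathbf b$ is exactly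 the probability that $C$ outputs $\mathbf b$. -/

import Mathlib

open Matrix

/-! ### Majorana operators -/

/-- `N` Majorana operators acting on the Hilbert space `ℂ^ι`:
`γ_j = γ_j†` and `γ_j γ_k + γ_k γ_j = 2 δ_{jk}`. -/
structure MajoranaRegister (N : ℕ) (ι : Type*) [Fintype ι] [DecidableEq ι] where
  γ : Fin N → Matrix ι ι ℂ
  hermitian : ∀ j, (γ j).IsHermitian
  anticomm : ∀ j k, γ j * γ k + γ k * γ j = if j = k then 2 else 0

section JordanWigner

/-- Flip the occupation of mode `k`. -/
def flipBit {m : ℕ} (k : Fin m) (f : Fin m → Bool) : Fin m → Bool :=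
  Function.update f k (!f k)

theorem flipBit_flipBit {m : ℕ} (k : Fin m) (f : Fin m → Bool) :
    flipBit k (flipBit k f) = f := by
  simp [flipBit]

theorem flipBit_comm {m : ℕ} (k l : Fin m) (f : Fin m → Bool) :
    flipBit k (flipBit l f) = flipBit l (flipBit k f) := by
  rcases eq_or_ne k l with rfl | h
  · rfl
  · funext x
    simp only [flipBit, Function.update_apply]
    split_ifs <;> simp_all

/-- `(-1)^b` as a complex number. -/
def bitSign (b : Bool) : ℂ := if b then -1 else 1

/-- The Jordan–Wigner string of the modes before `k`. -/
noncomputable def jwString {m : ℕ} (k : Fin m) (f : Fin m → Bool) : ℂ :=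
  ∏ l : Fin m, if l < k then bitSign (f l) else 1

/-- The matrix element of the Majorana operator number `j`, which belongs to mode `⌊j / 2⌋`. -/
noncomputable def jwCoeff {m : ℕ} (j : Fin (2 * m)) (f : Fin m → Bool) : ℂ :=
  (if (j : ℕ) % 2 = 0 then 1 else Complex.I * bitSign (f ⟨j / 2, by omega⟩)) *
    jwString ⟨j / 2, by omega⟩ f

/-- The Jordan–Wigner Majorana operators on the Fock space of `m` fermionic modes. -/
noncomputable def jwGamma {m : ℕ} (j : Fin (2 * m)) :
    Matrix (Fin m → Bool) (Fin m → Bool) ℂ :=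
  Matrix.of fun g f => if g = flipBit ⟨j / 2, by omega⟩ f then jwCoeff j f else 0

theorem jwString_flipBit {m : ℕ} (k l : Fin m) (f : Fin m → Bool) :
    jwString k (flipBit l f) = (if l < k then -1 else 1) * jwString k f := by
  unfold jwString
  have h : (if l < k then (-1 : ℂ) else 1) = ∏ x : Fin m, if x = l then (if l < k then -1 else 1) else 1 := by
    simp
  rw [h, ← Finset.prod_mul_distrib]
  refine Finset.prod_congr rfl fun x _ => ?_
  by_cases hx : x = l
  · subst hx
    by_cases hk : x < k
    · cases hf : f x <;> simp [hk, flipBit, bitSign, hf]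
    · simp [hk]
  · simp [hx, flipBit, Function.update_of_ne]

theorem bitSign_flipBit {m : ℕ} (k l : Fin m) (f : Fin m → Bool) :
    bitSign (flipBit l f k) = (if k = l then -1 else 1) * bitSign (f k) := by
  by_cases h : k = l
  · subst h
    cases hf : f k <;> simp [flipBit, bitSign, hf]
  · simp [flipBit, h]

theorem bitSign_sq (b : Bool) : bitSign b * bitSign b = 1 := by
  cases b <;> simp [bitSign]

theorem star_bitSign (b : Bool) : star (bitSign b) = bitSign b := by
  cases b <;> simp [bitSign]

theorem jwString_sq {m : ℕ} (k : Fin m) (f : Fin m → Bool) :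
    jwString k f * jwString k f = 1 := by
  unfold jwString
  rw [← Finset.prod_mul_distrib]
  refine Finset.prod_eq_one fun x _ => ?_
  split_ifs
  · exact bitSign_sq _
  · simp

theorem star_jwString {m : ℕ} (k : Fin m) (f : Fin m → Bool) :
    star (jwString k f) = jwString k f := by
  unfold jwString
  rw [star_prod]
  refine Finset.prod_congr rfl fun x _ => ?_
  split_ifs
  · exact star_bitSign _
  · simp

theorem jwGamma_mul_apply {m : ℕ} (i j : Fin (2 * m)) (g f : Fin m → Bool) :
    (jwGamma i * jwGamma j) g f =
      if g = flipBit ⟨i / 2, by omega⟩ (flipBit ⟨j / 2, by omega⟩ f) then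
        jwCoeff i (flipBit ⟨j / 2, by omega⟩ f) * jwCoeff j f else 0 := by
  rw [Matrix.mul_apply, Finset.sum_eq_single (flipBit ⟨j / 2, by omega⟩ f)]
  · simp [jwGamma]
  · intro b _ hb
    simp [jwGamma, hb]
  · simp

/-- The Fock space of `m` fermionic modes carries `2 m` Majorana operators. -/
noncomputable def jordanWigner (m : ℕ) : MajoranaRegister (2 * m) (Fin m → Bool) where
  γ := jwGamma
  hermitian j := by
    ext g f
    by_cases h : g = flipBit ⟨j / 2, by omega⟩ f
    · have h' : f = flipBit ⟨j / 2, by omega⟩ g := by rw [h, flipBit_flipBit]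
      rw [Matrix.conjTranspose_apply]
      simp only [jwGamma, Matrix.of_apply]
      rw [if_pos h', if_pos h, h]
      unfold jwCoeff
      rw [star_mul, star_jwString, jwString_flipBit, bitSign_flipBit, if_neg (lt_irrefl _),
        if_pos rfl]
      rcases Nat.mod_two_eq_zero_or_one (j : ℕ) with h2 | h2
      · simp [h2]
      · simp only [h2, one_ne_zero, if_false, star_mul, star_bitSign]
        rw [show star Complex.I = -Complex.I from Complex.conj_I, star_neg, star_one]
        ring_nf
    · have h' : ¬ f = flipBit ⟨j / 2, by omega⟩ g := fun e => h (by rw [e, flipBit_flipBit])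
      rw [Matrix.conjTranspose_apply]
      simp [jwGamma, h, h']
  anticomm i j := by
    ext g f
    rw [Matrix.add_apply, jwGamma_mul_apply, jwGamma_mul_apply,
      flipBit_comm ⟨j / 2, by omega⟩ ⟨i / 2, by omega⟩]
    by_cases hg : g = flipBit ⟨i / 2, by omega⟩ (flipBit ⟨j / 2, by omega⟩ f)
    · rw [if_pos hg, if_pos hg]
      unfold jwCoeff
      simp only [jwString_flipBit, bitSign_flipBit, Fin.mk_lt_mk, Fin.mk.injEq]
      rcases lt_trichotomy ((i : ℕ) / 2) ((j : ℕ) / 2) with h | h | h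
      · have hij : i ≠ j := fun e => by subst e; omega
        simp only [h, h.ne, h.ne', not_lt_of_gt h, if_true, if_false, if_neg hij,
          Matrix.zero_apply]
        ring_nf
      · have hm : (⟨i / 2, by omega⟩ : Fin m) = ⟨j / 2, by omega⟩ := Fin.ext h
        rw [hm, flipBit_flipBit] at hg
        rw [hm]
        simp only [h, lt_irrefl, if_true, if_false]
        have hs := jwString_sq (⟨j / 2, by omega⟩ : Fin m) f
        have hb := bitSign_sq (f ⟨j / 2, by omega⟩)
        have hI := Complex.I_mul_I
        subst hg
        rcases Nat.mod_two_eq_zero_or_one (i : ℕ) with hi | hi <;>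
          rcases Nat.mod_two_eq_zero_or_one (j : ℕ) with hj | hj
        · have hij : i = j := Fin.ext (by omega)
          simp only [hj, if_true, hij, Matrix.ofNat_apply]
          linear_combination 2 * hs
        · have hij : i ≠ j := fun e => by subst e; omega
          simp only [hi, hj, if_true, if_neg hij, Matrix.zero_apply, one_ne_zero, if_false]
          ring_nf
        · have hij : i ≠ j := fun e => by subst e; omega
          simp only [hi, hj, if_true, if_neg hij, Matrix.zero_apply, one_ne_zero, if_false]
          ring_nf
        · have hij : i = j := Fin.ext (by omega)
          simp only [hj, if_true, hij, Matrix.ofNat_apply, one_ne_zero, if_false]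
          generalize bitSign (g ⟨j / 2, by omega⟩) = b at *
          generalize jwString (⟨j / 2, by omega⟩ : Fin m) g = s at *
          linear_combination 2 * hs + 2 * s * s * hb - 2 * b * b * s * s * hI
      · have hij : i ≠ j := fun e => by subst e; omega
        simp only [h, h.ne, h.ne', not_lt_of_gt h, if_true, if_false, if_neg hij,
          Matrix.zero_apply]
        ring_nf
    · rw [if_neg hg, if_neg hg]
      by_cases hij : i = j
      · subst hij
        rw [flipBit_flipBit] at hg
        simp [Matrix.ofNat_apply, hg]
      · simp [hij]

end JordanWigner

namespace MajoranaRegister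

variable {N m : ℕ} {ι : Type*} [Fintype ι] [DecidableEq ι]

/-- The fermion parity `i^{|S|/2} ∏_{j ∈ S} γ_j` (factors in increasing order) of an even set `S`
of Majoranas. Up to sign, these are all the Hermitian Majorana strings that commute with the total
parity. -/
noncomputable def parity (R : MajoranaRegister N ι) (S : Finset (Fin N)) : Matrix ι ι ℂ :=
  Complex.I ^ (S.card / 2) • ((S.sort (· ≤ ·)).map R.γ).prod

/-- The total fermion parity `Γ_{2m+2} = i^{m+1} γ_1 ⋯ γ_{2m+2}`. -/
noncomputable def totalParity (R : MajoranaRegister (2 * m + 2) ι) : Matrix ι ι ℂ :=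
  R.parity Finset.univ

/-- `s_j = i γ_{2j-1} γ_{2j}` for `j = 1, …, m` (the code counts from `0`). -/
noncomputable def s (R : MajoranaRegister (2 * m + 2) ι) (j : Fin m) : Matrix ι ι ℂ :=
  Complex.I • (R.γ ⟨2 * j, by omega⟩ * R.γ ⟨2 * j + 1, by omega⟩)

/-- The logical braid `W_{2k} = exp(± i^{k+1} (π/4) ∏_{j ∈ S} γ_j)`, `|S| = 2k`. -/
noncomputable def braid (R : MajoranaRegister N ι) (inv : Bool) (S : Finset (Fin N)) :
    Matrix ι ι ℂ :=
  NormedSpace.exp ((bitSign inv * Complex.I * (Real.pi / 4 : ℂ)) • R.parity S)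

/-- `T_{2,ab} = exp((π/8) γ_a γ_b)`. -/
noncomputable def T2 (R : MajoranaRegister N ι) (a b : Fin N) : Matrix ι ι ℂ :=
  NormedSpace.exp ((Real.pi / 8 : ℂ) • (R.γ a * R.γ b))

end MajoranaRegister

section Measurement

variable {ι : Type*} [Fintype ι] [DecidableEq ι]

/-- The projector onto the outcome `(-1)^b` of a measurement of the Hermitian involution `A`. -/
noncomputable def outcomeProj (A : Matrix ι ι ℂ) (b : Bool) : Matrix ι ι ℂ :=
  (1 / 2 : ℂ) • (1 + bitSign b • A)

/-- The squared Hilbert space norm of a vector of `ℂ^ι`. -/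
noncomputable def sqNorm (v : ι → ℂ) : ℝ := ∑ i, ‖v i‖ ^ 2

end Measurement

/-! ### Fermionic circuits -/

/-- The gates of a fermionic circuit on `N` Majoranas: logical braids `W_{2k}` and `T_2` gates. -/
inductive Gate (N : ℕ) : Type
  | braid (inv : Bool) (S : Finset (Fin N)) (even : Even S.card) : Gate N
  | T2 (a b : Fin N) (ne : a ≠ b) : Gate N

/-- A circuit is a list of gates, in the order in which they are applied. -/
abbrev Circuit (n : ℕ) : Type := List (Gate (2 * n + 2))

section Circuit

variable {n : ℕ} {ι : Type*} [Fintype ι] [DecidableEq ι]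

/-- Is the gate a `T_2` gate? -/
def Gate.isT2 {N : ℕ} : Gate N → Bool
  | .braid _ _ _ => false
  | .T2 _ _ _ => true

/-- The number of `T_2` gates of a circuit. -/
def Circuit.numT2 (C : Circuit n) : ℕ := C.countP Gate.isT2

/-- The unitary of a gate. -/
noncomputable def Gate.op {N : ℕ} (R : MajoranaRegister N ι) : Gate N → Matrix ι ι ℂ
  | .braid inv S _ => R.braid inv S
  | .T2 a b _ => R.T2 a b

/-- The state of the register after the circuit. -/
noncomputable def Circuit.apply (C : Circuit n) (R : MajoranaRegister (2 * n + 2) ι)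
    (φ : ι → ℂ) : ι → ℂ :=
  C.foldl (fun v g => g.op R *ᵥ v) φ

/-- The probability that the circuit, run on the state `φ` and followed by the measurement of
`s_1, …, s_n`, yields the outcomes `(-1)^{b_1}, …, (-1)^{b_n}`. -/
noncomputable def Circuit.prob (C : Circuit n) (R : MajoranaRegister (2 * n + 2) ι)
    (φ : ι → ℂ) (b : Fin n → Bool) : ℝ :=
  sqNorm ((List.finRange n).foldl (fun v j => outcomeProj (R.s j) (b j) *ᵥ v) (C.apply R φ))

end Circuit

/-! ### The magic state register -/

/-- The fermion parity operator `± i^{|S|/2} ∏_{j ∈ S} γ_j`, given by its sign and its even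
support `S`. -/
structure FermionParity (N : ℕ) where
  neg : Bool
  support : Finset (Fin N)
  even : Even support.card

section Magic

variable {t : ℕ} {κ : Type*} [Fintype κ] [DecidableEq κ]

/-- The operator that a fermion parity denotes. -/
noncomputable def FermionParity.op {N : ℕ} (R : MajoranaRegister N κ) (X : FermionParity N) :
    Matrix κ κ ℂ :=
  bitSign X.neg • R.parity X.support

/-- `{s_j, X_j} = 0`, and `[s_{j'}, X_j] = [X_{j'}, X_j] = 0` for `j' ≠ j`. -/
def IsMagicFrame (R : MajoranaRegister (2 * t + 2) κ) (X : Fin t → FermionParity (2 * t + 2)) :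
    Prop :=
  (∀ j, R.s j * (X j).op R + (X j).op R * R.s j = 0) ∧
  (∀ j k, k ≠ j → Commute (R.s k) ((X j).op R)) ∧
  (∀ j k, k ≠ j → Commute ((X k).op R) ((X j).op R))

/-- `|ψ^{(t)}⟩ = T_{2,12} T_{2,34} ⋯ T_{2,2t-1 2t} |ψ^X⟩`. -/
noncomputable def magicState (R : MajoranaRegister (2 * t + 2) κ) (ψX : κ → ℂ) : κ → ℂ :=
  (List.ofFn fun j : Fin t => R.T2 ⟨2 * j, by omega⟩ ⟨2 * j + 1, by omega⟩).prod *ᵥ ψX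

end Magic

/-! ### The hybrid machine

A classical random access machine (unit cost, with addition and truncated subtraction as its only
arithmetic) that can toss fair coins and can have fermion parities of an attached register of `N`
Majoranas measured. It acts on this register in no other way. -/

/-- Programs. `reg` are the registers, `mem` is the indirectly addressed memory. -/
inductive Cmd : Type
  /-- `reg x := k` -/
  | const (x k : ℕ)
  /-- `reg x := reg y + reg z` -/
  | add (x y z : ℕ)
  /-- `reg x := reg y - reg z`, or `0` if this is negative -/
  | sub (x y z : ℕ)
  /-- `reg x := mem (reg y)` -/
  | load (x y : ℕ)
  /-- `mem (reg x) := reg y` -/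
  | store (x y : ℕ)
  /-- `reg x :=` the entry number `reg y` of the input -/
  | input (x y : ℕ)
  /-- append a bit to the output, namely whether `reg x ≠ 0` -/
  | output (x : ℕ)
  /-- `reg x :=` a random bit -/
  | coin (x : ℕ)
  /-- measure the parity of the Majoranas `γ_j` with `mem (reg y + j) ≠ 0`, `j = 0, …, N - 1`, and
  set `reg x` to `0` on the outcome `+1` and to `1` on the outcome `-1` -/
  | measure (x y : ℕ)
  | seq (c d : Cmd)
  /-- if `reg x ≠ 0` then `c` else `d` -/
  | ite (x : ℕ) (c d : Cmd)
  /-- while `reg x ≠ 0` do `c` -/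
  | loop (x : ℕ) (c : Cmd)

/-- The random events in a run: coin tosses, and parity measurements with outcome `(-1)^b`. -/
inductive RunEvent (N : ℕ) : Type
  | coin (b : Bool)
  | measured (S : Finset (Fin N)) (b : Bool)

/-- A configuration of the machine: the commands still to be executed, the contents of the
registers and of the memory, the output so far, and the random events so far. -/
structure Config (N : ℕ) where
  todo : List Cmd
  reg : ℕ → ℕ
  mem : ℕ → ℕ
  out : List Bool
  hist : List (RunEvent N)

namespace Config

variable {N : ℕ}

/-- The initial configuration of a program. -/
def start (P : Cmd) : Config N := ⟨[P], fun _ => 0, fun _ => 0, [], []⟩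

/-- The configurations that one step can lead to: two for a coin toss or a measurement, one
otherwise. A halted configuration stays as it is. -/
def step (inp : List ℕ) (c : Config N) : List (Config N) :=
  match c.todo with
  | [] => [c]
  | .const x k :: r => [{ c with todo := r, reg := Function.update c.reg x k }]
  | .add x y z :: r => [{ c with todo := r, reg := Function.update c.reg x (c.reg y + c.reg z) }]
  | .sub x y z :: r => [{ c with todo := r, reg := Function.update c.reg x (c.reg y - c.reg z) }]
  | .load x y :: r => [{ c with todo := r, reg := Function.update c.reg x (c.mem (c.reg y)) }]
  | .store x y :: r => [{ c with todo := r, mem := Function.update c.mem (c.reg x) (c.reg y) }]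
  | .input x y :: r =>
      [{ c with todo := r, reg := Function.update c.reg x (inp.getD (c.reg y) 0) }]
  | .output x :: r => [{ c with todo := r, out := c.out ++ [decide (c.reg x ≠ 0)] }]
  | .coin x :: r => [false, true].map fun b =>
      { c with
        todo := r
        reg := Function.update c.reg x b.toNat
        hist := c.hist ++ [.coin b] }
  | .measure x y :: r => [false, true].map fun b =>
      { c with
        todo := r
        reg := Function.update c.reg x b.toNat
        hist := c.hist ++
          [.measured (Finset.univ.filter fun j : Fin N => c.mem (c.reg y + j) ≠ 0) b] }
  | .seq d e :: r => [{ c with todo := d :: e :: r }]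
  | .ite x d e :: r => [{ c with todo := (if c.reg x ≠ 0 then d else e) :: r }]
  | .loop x d :: r => [{ c with todo := if c.reg x ≠ 0 then d :: .loop x d :: r else r }]

/-- The configurations of all runs after `T` steps. -/
def run (inp : List ℕ) : ℕ → Config N → List (Config N)
  | 0, c => [c]
  | T + 1, c => (c.step inp).flatMap (run inp T)

/-- The supports of the parities that have been measured, in order. -/
def measuredParities (c : Config N) : List (Finset (Fin N)) :=
  c.hist.filterMap fun
    | .coin _ => none
    | .measured S _ => some S

/-- The number of coin tosses. -/
def numCoins (c : Config N) : ℕ :=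
  c.hist.countP fun
    | .coin _ => true
    | .measured _ _ => false

variable {κ : Type*} [Fintype κ] [DecidableEq κ]

/-- The probability of the events of a run if the register starts in the state `ψ`: a factor `1/2`
for each coin toss, and Born's rule for the measurements. -/
noncomputable def weight (R : MajoranaRegister N κ) (ψ : κ → ℂ) (c : Config N) : ℝ :=
  (1 / 2) ^ c.numCoins *
    sqNorm (c.hist.foldl (fun v e => match e with
      | .coin _ => v
      | .measured S b => outcomeProj (R.parity S) b *ᵥ v) ψ)

end Config

/-- The probability that the program `P`, run for `T` steps on the input `inp` with the register
initially in the state `ψ`, halts and has the output `w`. -/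
noncomputable def outputProb {N : ℕ} {κ : Type*} [Fintype κ] [DecidableEq κ] (P : Cmd)
    (inp : List ℕ) (T : ℕ) (R : MajoranaRegister N κ) (ψ : κ → ℂ) (w : List Bool) : ℝ :=
  (((Config.run inp T (Config.start P)).filter fun c => c.todo.isEmpty && c.out == w).map
    fun c => c.weight R ψ).sum

/-! ### Encoding of the input -/

/-- The indicator word of a set. -/
def bitsOf {N : ℕ} (S : Finset (Fin N)) : List ℕ := List.ofFn fun j => if j ∈ S then 1 else 0

/-- A gate as a word of length `N + 2`. -/
def Gate.encode {N : ℕ} : Gate N → List ℕ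
  | .braid inv S _ => [0, inv.toNat] ++ bitsOf S
  | .T2 a b _ => [1, (a : ℕ), (b : ℕ)] ++ List.replicate (N - 1) 0

/-- A fermion parity as a word of length `N + 1`. -/
def FermionParity.encode {N : ℕ} (X : FermionParity N) : List ℕ :=
  X.neg.toNat :: bitsOf X.support

/-- The input of the machine: the sizes, the total parities `(-1)^{p_n}` and `(-1)^{p_t}` of the
two registers, the operators `X_j`, and the circuit. -/
def encodeInput {n t : ℕ} (C : Circuit n) (pn pt : Bool) (X : Fin t → FermionParity (2 * t + 2)) :
    List ℕ :=
  [n, t, C.length, pn.toNat, pt.toNat] ++ (List.ofFn fun j => (X j).encode).flatten ++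
    (C.map Gate.encode).flatten

/-! The two registers are joined into one system of `total n t` Majoranas, and everything is
computed in the Heisenberg picture on Majorana strings, that is, on pairs of a phase in ℤ/4 and a
bit vector over 𝔽₂. Nothing is ever done to `R_n`: its initial state is known so well that coins and
bookkeeping replace it.

Teleportation. Let Q = i γ_a γ_b and S = s_i. A `T2` gate is exp(-iπQ/8), and the i-th magic state
is exp(-iπS/8) applied to a +1 eigenvector of X_i. After the outcome (-1)^c of a measurement of QS,
S may be replaced by (-1)^c Q. So this measurement performs the gate and resets the magic state, up
to a correction exp(iπQ/4) that is needed for c = 1 (`outcomeProj_mul_eighthTurn`). Both outcomes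
have probability 1/2, because X_i stabilises the reset state and anticommutes with QS.

Absorption. Braids and corrections send strings to strings under conjugation. They are never
executed; every later string is pulled back through them by a `Rule`. A later string w that
anticommutes with Q is first replaced by w X_i, which is legitimate because X_i acts as 1 on the
reset state; the new string commutes with QS (`teleport_conj`). Hence all strings that are ever
measured commute after the pullback. `Absorbed` records this through an operator V that intertwines
the circuit with its simulation and loses a factor 1/2 of squared norm per magic state
(`Absorbed.braid`, `Absorbed.magic`).

Elimination. A pulled-back string is multiplied by earlier strings, whose values are known, until it
vanishes on their pivots. This changes neither its outcome nor its commutation relations. Three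
cases remain (`Tracks.decide`). If the string anticommutes with some s_j of `R_n`, which stabilises
the initial state, its outcome is a fair coin; the projection is only noted in `stabProj`. If it
commutes with all s_j, then, the total parity of `R_n` having cleared the last Majorana, it acts on
`R_n` as a product of the s_j, hence trivially. What is left is, up to sign, a fermion parity of
`R_t`, which is measured; or it is a sign alone, and the outcome is certain.

The bound t. The measured parities commute and, together with the total parity of `R_t`, are
independent. They span an isotropic subspace of 𝔽₂^(2t+2), so there are at most t of them besides
the total parity (`length_le_of_isotropic`).

Probabilities. The weight of a run is the squared norm of the tracked joint vector
(`Tracks.weight_eq`). The gates lead to exactly 2^t branches, and each contributes 2^(-t) times the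
probability of the output (`ReadsOut.readouts`, `SimState.afterReadout_spec`).

The machine. The program is written with counting loops whose bounds are registers that it never
changes, so its time is polynomial (`Prog.leads_compile`). Its final configurations match the states
of the abstract simulation one by one and in order (`Prog.work_spec`). -/

/-! ### Runs of the machine -/

namespace Config

variable {N : ℕ}

/-- Every run from `c` passes through a member of `l` within `T` steps; `l` lists the members
in the order in which `Config.run` does. -/
inductive Leads (inp : List ℕ) : ℕ → Config N → List (Config N) → Prop
  | refl (T : ℕ) (c : Config N) : Leads inp T c [c]
  | step (T : ℕ) (c : Config N) (f : Config N → List (Config N))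
      (h : ∀ c' ∈ c.step inp, Leads inp T c' (f c')) :
      Leads inp (T + 1) c ((c.step inp).flatMap f)

theorem Leads.mono {inp : List ℕ} {T T' : ℕ} {c : Config N} {l : List (Config N)}
    (h : Leads inp T c l) (hT : T ≤ T') : Leads inp T' c l := by
  induction h generalizing T' with
  | refl T c => exact .refl _ _
  | step T c f _ ih =>
    obtain ⟨T', rfl⟩ : ∃ k, T' = k + 1 := ⟨T' - 1, by omega⟩
    exact .step _ _ _ fun c' hc' => ih c' hc' (by omega)

theorem Leads.trans {inp : List ℕ} {T T' : ℕ} {c : Config N} {l : List (Config N)}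
    (h : Leads inp T c l) {g : Config N → List (Config N)}
    (hg : ∀ x ∈ l, Leads inp T' x (g x)) : Leads inp (T + T') c (l.flatMap g) := by
  induction h with
  | refl T c =>
    simpa using (hg c (by simp)).mono (Nat.le_add_left _ _)
  | step T c f _ ih =>
    rw [List.flatMap_assoc, Nat.add_right_comm]
    refine .step _ _ _ fun c' hc' => ih c' hc' fun x hx => hg x ?_
    exact List.mem_flatMap.2 ⟨c', hc', hx⟩

theorem run_of_halted {inp : List ℕ} (T : ℕ) {c : Config N} (h : c.todo = []) :
    run inp T c = [c] := by
  induction T with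
  | zero => rfl
  | succ T ih => simp [run, step, h, ih]

/-- A halted configuration repeats itself, so runs of different lengths can all be read off at the
common time `T`. The result is an equality of lists, with order and multiplicity, as the sum in
`outputProb` requires. -/
theorem Leads.run_eq {inp : List ℕ} {T : ℕ} {c : Config N} {l : List (Config N)}
    (h : Leads inp T c l) (hl : ∀ x ∈ l, x.todo = []) : run inp T c = l := by
  induction h with
  | refl T c => exact run_of_halted T (hl c (by simp))
  | step T c f _ ih =>
    rw [run]
    refine List.flatMap_congr fun c' hc' => ih c' hc' fun x hx => hl x ?_
    exact List.mem_flatMap.2 ⟨c', hc', hx⟩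

theorem Leads.single {inp : List ℕ} {T : ℕ} {c c' : Config N} {l : List (Config N)}
    (hs : c.step inp = [c']) (h : Leads inp T c' l) : Leads inp (T + 1) c l := by
  have := Leads.step (inp := inp) T c (fun _ => l) (by simpa [hs] using h)
  simpa [hs] using this

/-- Overwrite a register. -/
def setReg (c : Config N) (x v : ℕ) : Config N := { c with reg := Function.update c.reg x v }

/-- Overwrite a memory cell. -/
def setMem (c : Config N) (a v : ℕ) : Config N := { c with mem := Function.update c.mem a v }

/-- Prepend a command. -/
def push (c : Config N) (d : Cmd) : Config N := { c with todo := d :: c.todo }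

@[simp] theorem setReg_mem (c : Config N) (x v : ℕ) : (c.setReg x v).mem = c.mem := rfl
@[simp] theorem setMem_reg (c : Config N) (x v : ℕ) : (c.setMem x v).reg = c.reg := rfl
theorem setReg_reg (c : Config N) (x v y : ℕ) :
    (c.setReg x v).reg y = if y = x then v else c.reg y := by
  simp [setReg, Function.update_apply]
theorem setMem_mem (c : Config N) (x v y : ℕ) :
    (c.setMem x v).mem y = if y = x then v else c.mem y := by
  simp [setMem, Function.update_apply]

end Config

/-! ### Programs with bounded loops -/

/-- Programs whose only loops are `for x < reg y`; `h` is an auxiliary register of the loop. -/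
inductive Prog : Type
  | op (c : Cmd)
  | seq (a b : Prog)
  | ite (x : ℕ) (a b : Prog)
  | count (x h y : ℕ) (a : Prog)

infixr:60 " ;; " => Prog.seq

/-- Apply a multivalued function `k` times. -/
def bindIter {α : Type*} (f : α → List α) : ℕ → List α → List α
  | 0, l => l
  | k + 1, l => bindIter f k (l.flatMap f)

theorem bindIter_flatMap {α β : Type*} (f : α → List α) (k : ℕ) (l : List β) (g : β → List α) :
    bindIter f k (l.flatMap g) = l.flatMap fun e => bindIter f k (g e) := by
  induction k generalizing g with
  | zero => rfl
  | succ k ih => simp only [bindIter, List.flatMap_assoc, ih]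

theorem bindIter_succ {α : Type*} (f : α → List α) (k : ℕ) (l : List α) :
    bindIter f (k + 1) l = (bindIter f k l).flatMap f := by
  induction k generalizing l with
  | zero => rfl
  | succ k ih => rw [bindIter, ih, bindIter]

namespace Cmd

/-- Not a compound command. -/
def basic : Cmd → Bool
  | seq _ _ => false
  | ite _ _ _ => false
  | loop _ _ => false
  | _ => true

/-- Without random events. -/
def det : Cmd → Bool
  | coin _ => false
  | measure _ _ => false
  | _ => true

/-- The register that a basic command may change. -/
def target : Cmd → List ℕ
  | const x _ => [x]
  | add x _ _ => [x]
  | sub x _ _ => [x]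
  | load x _ => [x]
  | input x _ => [x]
  | coin x => [x]
  | measure x _ => [x]
  | _ => []

/-- Does a basic command leave the memory alone? -/
def keepsMem : Cmd → Bool
  | store _ _ => false
  | _ => true

/-- Does a basic command leave the output alone? -/
def keepsOut : Cmd → Bool
  | output _ => false
  | _ => true

end Cmd

namespace Prog

/-- The machine program. -/
def compile : Prog → Cmd
  | op c => c
  | seq a b => .seq a.compile b.compile
  | ite x a b => .ite x a.compile b.compile
  | .count x h y a =>
      .seq (.const x 0) (.seq (.const h 0) (.seq (.sub h y x)
        (.loop h (.seq a.compile (.seq (.const h 1) (.seq (.add x x h) (.sub h y x)))))))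

/-- A property of all basic commands. -/
def all (p : Cmd → Bool) : Prog → Bool
  | op c => p c
  | seq a b => a.all p && b.all p
  | ite _ a b => a.all p && b.all p
  | .count _ _ _ a => a.all p

/-- The registers that a program may change. -/
def writes : Prog → List ℕ
  | op c => c.target
  | seq a b => a.writes ++ b.writes
  | ite _ a b => a.writes ++ b.writes
  | .count x h _ a => x :: h :: a.writes

/-- The bounds of the loops are registers of `K`, which the program does not change. -/
def wf (K : List ℕ) : Prog → Bool
  | op c => c.basic && c.target.all (fun x => !K.contains x)
  | seq a b => a.wf K && b.wf K
  | ite _ a b => a.wf K && b.wf K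
  | .count x h y a => a.wf K && K.contains y && !K.contains x && !K.contains h && x != h &&
      !a.writes.contains x && !a.writes.contains h

/-- A bound for the running time in terms of a bound for the registers of `K`. -/
noncomputable def time : Prog → Polynomial ℕ
  | op _ => 1
  | seq a b => a.time + b.time + 1
  | ite _ a b => a.time + b.time + 1
  | .count _ _ _ a => Polynomial.X * (a.time + 8) + 8

variable {N : ℕ}

/-- What the loop `for x < reg y` does after its body. -/
def next (x h y : ℕ) (c : Config N) : Config N :=
  (c.setReg x (c.reg x + 1)).setReg h (c.reg y - (c.reg x + 1))

/-- What the loop `for x < reg y` does before its first round. -/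
def first (x h y : ℕ) (c : Config N) : Config N := (c.setReg x 0).setReg h (c.reg y)

/-- The configurations in which the runs of the program end. -/
def den (inp : List ℕ) : Prog → Config N → List (Config N)
  | op d, c => (c.push d).step inp
  | seq a b, c => (a.den inp c).flatMap (b.den inp)
  | ite x a b, c => if c.reg x ≠ 0 then a.den inp c else b.den inp c
  | .count x h y a, c =>
      bindIter (fun d => (a.den inp d).map (next x h y)) (c.reg y) [first x h y c]

theorem step_todo {inp : List ℕ} {d : Cmd} (hd : d.basic) (c : Config N) :
    ∀ c' ∈ (c.push d).step inp, c'.todo = c.todo := by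
  cases d <;> simp_all [Config.push, Config.step, Cmd.basic]

theorem step_reg {inp : List ℕ} {d : Cmd} (hd : d.basic) (c : Config N) {x : ℕ}
    (hx : x ∉ d.target) : ∀ c' ∈ (c.push d).step inp, c'.reg x = c.reg x := by
  cases d <;> simp_all [Config.push, Config.step, Cmd.basic, Cmd.target]

theorem step_mem {inp : List ℕ} {d : Cmd} (hd : d.basic) (hm : d.keepsMem) (c : Config N) :
    ∀ c' ∈ (c.push d).step inp, c'.mem = c.mem := by
  cases d <;> simp_all [Config.push, Config.step, Cmd.basic, Cmd.keepsMem]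

theorem step_out {inp : List ℕ} {d : Cmd} (hd : d.basic) (hm : d.keepsOut) (c : Config N) :
    ∀ c' ∈ (c.push d).step inp, c'.out = c.out := by
  cases d <;> simp_all [Config.push, Config.step, Cmd.basic, Cmd.keepsOut]

theorem step_hist {inp : List ℕ} {d : Cmd} (hd : d.basic) (hm : d.det) (c : Config N) :
    ∀ c' ∈ (c.push d).step inp, c'.hist = c.hist := by
  cases d <;> simp_all [Config.push, Config.step, Cmd.basic, Cmd.det]

theorem step_det {inp : List ℕ} {d : Cmd} (hm : d.det) (c : Config N) :
    ∃ c', (c.push d).step inp = [c'] := by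
  cases d <;> simp_all [Config.push, Config.step, Cmd.det]

/-- A quantity that the basic commands and the loop bookkeeping preserve is preserved. -/
theorem den_preserves {β : Type*} (F : Config N → β) {inp : List ℕ} (P : Prog) (p : Cmd → Bool)
    (hp : P.all p)
    (hb : ∀ d, p d → (∀ x ∈ d.target, x ∈ P.writes) →
      ∀ c : Config N, ∀ c' ∈ (c.push d).step inp, F c' = F c)
    (hr : ∀ (c : Config N) (x v : ℕ), x ∈ P.writes → F (c.setReg x v) = F c) :
    ∀ c : Config N, ∀ c' ∈ P.den inp c, F c' = F c := by
  induction P with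
  | op d => exact fun c => hb d hp (by simp [writes]) c
  | seq a b iha ihb =>
    simp only [all, Bool.and_eq_true, writes] at *
    intro c c' hc'
    obtain ⟨e, he, hc'⟩ := List.mem_flatMap.1 hc'
    rw [ihb hp.2 (fun d hd hx => hb d hd fun x hx' => List.mem_append_right _ (hx x hx'))
      (fun c x v hx => hr c x v (List.mem_append_right _ hx)) e c' hc']
    exact iha hp.1 (fun d hd hx => hb d hd fun x hx' => List.mem_append_left _ (hx x hx'))
      (fun c x v hx => hr c x v (List.mem_append_left _ hx)) c e he
  | ite y a b iha ihb =>
    simp only [all, Bool.and_eq_true, writes] at *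
    intro c c' hc'
    simp only [den] at hc'
    split_ifs at hc' with h
    · exact iha hp.1 (fun d hd hx => hb d hd fun x hx' => List.mem_append_left _ (hx x hx'))
        (fun c x v hx => hr c x v (List.mem_append_left _ hx)) c c' hc'
    · exact ihb hp.2 (fun d hd hx => hb d hd fun x hx' => List.mem_append_right _ (hx x hx'))
        (fun c x v hx => hr c x v (List.mem_append_right _ hx)) c c' hc'
  | count x h y a iha =>
    simp only [all, writes] at *
    have iha := iha hp (fun d hd hx => hb d hd fun x hx' => by simp [hx x hx'])
      (fun c x v hx => hr c x v (by simp [hx]))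
    intro c c' hc'
    rw [den] at hc'
    generalize c.reg y = k at hc'
    induction k generalizing c' with
    | zero => simp only [bindIter, List.mem_singleton] at hc'; subst hc'; simp [first, hr]
    | succ k ih =>
      simp only [bindIter_succ, List.mem_flatMap, List.mem_map] at hc'
      obtain ⟨d, hd, e, he, rfl⟩ := hc'
      rw [next, hr _ _ _ (by simp), hr _ _ _ (by simp), iha d e he, ih d hd]

/-- A program built from basic commands never looks below its own entry on the stack, so a command
waiting there passes through unchanged. This allows the first half of a sequence to run while the
second half is pending. -/
theorem den_push {inp : List ℕ} {P : Prog} (hP : P.all Cmd.basic) (c : Config N) (d : Cmd) :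
    P.den inp (c.push d) = (P.den inp c).map fun c' => c'.push d := by
  induction P generalizing c with
  | op e =>
    cases e <;> first | rfl | simp_all [all, Cmd.basic]
  | seq a b iha ihb =>
    simp only [all, Bool.and_eq_true] at hP
    simp only [den, iha hP.1, List.flatMap_map, List.map_flatMap, ihb hP.2]
  | ite x a b iha ihb =>
    simp only [all, Bool.and_eq_true] at hP
    simp only [den]
    change (if c.reg x ≠ 0 then _ else _) = _
    split_ifs
    · exact iha hP.1 c
    · exact ihb hP.2 c
  | count x h y a iha =>
    simp only [den]
    change bindIter _ (c.reg y) _ = _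
    generalize c.reg y = k
    have h1 : first x h y (c.push d) = (first x h y c).push d := rfl
    rw [h1]
    induction k with
    | zero => rfl
    | succ k ih =>
      simp only [bindIter_succ, ih, List.flatMap_map, List.map_flatMap, iha hP, List.map_map]
      rfl

theorem leads_push {inp : List ℕ} {P : Prog} (hP : P.all Cmd.basic) {c : Config N} {d : Cmd} {T T' : ℕ} {g : Config N → List (Config N)}
    (h : Config.Leads inp T ((c.push d).push P.compile) (P.den inp (c.push d)))
    (hg : ∀ x ∈ P.den inp c, Config.Leads inp T' (x.push d) (g x)) :
    Config.Leads inp (T + T') ((c.push d).push P.compile) ((P.den inp c).flatMap g) := by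
  rw [den_push hP] at h
  -- Every configuration reached still has `d` on top; `tail` removes it again, because `g` takes
  -- the configuration without it.
  have h3 : (P.den inp c).flatMap g = ((P.den inp c).map fun c' => c'.push d).flatMap
      fun c' => g { c' with todo := c'.todo.tail } := by
    rw [List.flatMap_map]; rfl
  rw [h3]
  refine h.trans fun x hx => ?_
  obtain ⟨e, he, rfl⟩ := List.mem_map.1 hx
  exact hg e he

theorem den_reg {inp : List ℕ} {P : Prog} (hP : P.all Cmd.basic) {x : ℕ} (hx : x ∉ P.writes)
    (c : Config N) : ∀ c' ∈ P.den inp c, c'.reg x = c.reg x :=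
  den_preserves (fun c => c.reg x) P Cmd.basic hP
    (fun d hd hw c => step_reg hd c fun h => hx (hw x h))
    (fun c y v hy => by
      rw [Config.setReg_reg, if_neg]; rintro rfl; exact hx hy) c

theorem den_todo {inp : List ℕ} {P : Prog} (hP : P.all Cmd.basic)
    (c : Config N) : ∀ c' ∈ P.den inp c, c'.todo = c.todo :=
  den_preserves (fun c => c.todo) P Cmd.basic hP
    (fun _ hd _ c => step_todo hd c) (fun _ _ _ _ => rfl) c

theorem all_of_wf {K : List ℕ} {P : Prog} (h : P.wf K) : P.all Cmd.basic := by
  induction P <;> simp_all [wf, all]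

theorem not_mem_writes {K : List ℕ} {P : Prog} (h : P.wf K) {x : ℕ} (hx : x ∈ K) :
    x ∉ P.writes := by
  induction P with
  | op d =>
    simp only [wf, Bool.and_eq_true, List.all_eq_true] at h
    intro hx'
    have := h.2 x hx'
    simp [hx] at this
  | seq a b iha ihb => simp_all [wf, writes]
  | ite y a b iha ihb => simp_all [wf, writes]
  | count y h' z a iha =>
    simp only [wf, Bool.and_eq_true, Bool.not_eq_true', List.contains_eq_mem,
      decide_eq_false_iff_not, decide_eq_true_eq] at h
    simp only [writes, List.mem_cons, not_or]
    refine ⟨?_, ?_, iha h.1.1.1.1.1.1⟩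
    · rintro rfl; exact h.1.1.1.1.2 hx
    · rintro rfl; exact h.1.1.1.2 hx

/-- The registers of `K` bound all loops and are never written, so their initial bound `z` stays
valid at every depth of nesting. Each loop then multiplies the time by at most `z`, which is why the
total is a polynomial in `z`. -/
theorem leads_compile {inp : List ℕ} {K : List ℕ} {z : ℕ} (P : Prog) (hP : P.wf K)
    (c : Config N) (hz : ∀ k ∈ K, c.reg k ≤ z) :
    Config.Leads inp (P.time.eval z) (c.push P.compile) (P.den inp c) := by
  induction P generalizing c with
  | op d =>
    have := Config.Leads.step (inp := inp) 0 (c.push d) (fun c => [c]) (fun c' _ => .refl _ _)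
    simpa [time, compile, den] using this
  | seq a b iha ihb =>
    simp only [wf, Bool.and_eq_true] at hP
    simp only [time, Polynomial.eval_add, Polynomial.eval_one]
    refine Config.Leads.single (c' := (c.push b.compile).push a.compile) rfl ?_
    refine leads_push (all_of_wf hP.1) (iha hP.1 (c.push b.compile) hz) fun e he => ?_
    refine ihb hP.2 e fun k hk => ?_
    rw [den_reg (all_of_wf hP.1) (not_mem_writes hP.1 hk) c e he]
    exact hz k hk
  | ite x a b iha ihb =>
    simp only [wf, Bool.and_eq_true] at hP
    simp only [time, Polynomial.eval_add, Polynomial.eval_one]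
    by_cases h : c.reg x ≠ 0
    · refine Config.Leads.single (c' := c.push a.compile) (by simp [Config.push, Config.step,
        compile, h]) ?_
      rw [den, if_pos h]
      exact (iha hP.1 c hz).mono (by omega)
    · refine Config.Leads.single (c' := c.push b.compile) (by simp [Config.push, Config.step,
        compile, h]) ?_
      rw [den, if_neg h]
      exact (ihb hP.2 c hz).mono (by omega)
  | count x h y a iha =>
    have hwf := hP
    simp only [wf, Bool.and_eq_true, Bool.not_eq_true', List.contains_eq_mem,
      decide_eq_false_iff_not, decide_eq_true_eq, bne_iff_ne, ne_eq] at hP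
    obtain ⟨⟨⟨⟨⟨⟨ha, hy⟩, hx⟩, hh⟩, hxh⟩, hxa⟩, hha⟩ := hP
    have hyx : y ≠ x := by rintro rfl; exact hx hy
    have hyh : y ≠ h := by rintro rfl; exact hh hy
    have hya := not_mem_writes ha hy
    set lp : Cmd := .loop h (.seq a.compile (.seq (.const h 1) (.seq (.add x x h) (.sub h y x))))
      with hlp
    -- The machine only has "while nonzero". The auxiliary register `h` therefore holds the number
    -- `k` of rounds still to be done, which is the bound minus the counter.
    have hloop : ∀ (k : ℕ) (d : Config N),
        d.reg x + k = d.reg y → d.reg h = k → (∀ j ∈ K, d.reg j ≤ z) →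
        Config.Leads inp (k * (a.time.eval z + 8) + 1) (d.push lp)
          (bindIter (fun d => (a.den inp d).map (next x h y)) k [d]) := by
      intro k
      induction k with
      | zero =>
        intro d _ hd _
        refine Config.Leads.single (c' := d) (by simp [Config.push, Config.step, hlp, hd]) ?_
        exact Config.Leads.refl _ _
      | succ k ih =>
        intro d hd1 hd2 hdz
        -- Besides the body, a round takes two steps to enter it and five steps to update the
        -- counter and `h`; one of the eight units is slack.
        have e1 : (k + 1) * (a.time.eval z + 8) + 1 =
            ((a.time.eval z) + ((k * (a.time.eval z + 8) + 1) + 5 + 1)) + 1 + 1 := by ring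
        rw [e1]
        refine Config.Leads.single (c' := (d.push lp).push
          (.seq a.compile (.seq (.const h 1) (.seq (.add x x h) (.sub h y x)))))
          (by simp [Config.push, Config.step, hlp, hd2]) ?_
        refine Config.Leads.single (c' := ((d.push lp).push
          (.seq (.const h 1) (.seq (.add x x h) (.sub h y x)))).push a.compile) rfl ?_
        have h0 := leads_push (all_of_wf ha) (c := d.push lp)
          (d := .seq (.const h 1) (.seq (.add x x h) (.sub h y x)))
          (iha ha (d.push lp |>.push (.seq (.const h 1) (.seq (.add x x h) (.sub h y x)))) hdz)
          (T' := k * (a.time.eval z + 8) + 1 + 5 + 1)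
          (g := fun e => bindIter (fun d => (a.den inp d).map (next x h y)) k
            [next x h y { e with todo := e.todo.tail }])
          (by
            rw [den_push (all_of_wf ha)]
            intro e' he'
            obtain ⟨e, he, rfl⟩ := List.mem_map.1 he'
            have r1 : ∀ w, w ∉ a.writes → e.reg w = d.reg w := fun w hw =>
              den_reg (all_of_wf ha) hw d e he
            refine Config.Leads.single (c' := ((e.push lp).push
              (.seq (.add x x h) (.sub h y x))).push (.const h 1)) rfl ?_
            refine Config.Leads.single (c' := ((e.setReg h 1).push lp).push
              (.seq (.add x x h) (.sub h y x))) rfl ?_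
            refine Config.Leads.single (c' := (((e.setReg h 1).push lp).push
              (.sub h y x)).push (.add x x h)) rfl ?_
            refine Config.Leads.single (c' := (((e.setReg h 1).setReg x (e.reg x + 1)).push lp).push
              (.sub h y x)) ?_ ?_
            · simp [Config.push, Config.step, Config.setReg, Function.update_of_ne hxh]
            refine Config.Leads.single (c' := (next x h y e).push lp) ?_ ?_
            · simp [Config.push, Config.step, Config.setReg, next,
                Function.update_of_ne hyx, Function.update_of_ne hyh]
              funext w
              simp only [Function.update_apply]
              split_ifs <;> rfl
            refine (ih (next x h y e) ?_ ?_ ?_).mono (by omega)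
            · simp only [next, Config.setReg_reg, if_neg hyx, if_neg hyh, if_neg hxh,
                r1 x hxa, r1 y hya, if_true]
              omega
            · simp only [next, Config.setReg_reg, if_true, r1 x hxa, r1 y hya]
              omega
            · intro j hj
              have hjx : j ≠ x := by rintro rfl; exact hx hj
              have hjh : j ≠ h := by rintro rfl; exact hh hj
              simp only [next, Config.setReg_reg, if_neg hjx, if_neg hjh,
                r1 j (not_mem_writes ha hj)]
              exact hdz j hj)
        rw [den_push (all_of_wf ha), List.flatMap_map] at h0
        have h2 : bindIter (fun d => (a.den inp d).map (next x h y)) (k + 1) [d] =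
            (a.den inp d).flatMap fun e =>
              bindIter (fun d => (a.den inp d).map (next x h y)) k [next x h y e] := by
          rw [bindIter, ← bindIter_flatMap]
          simp [List.map_eq_flatMap]
        rw [h2]
        exact h0
    simp only [time, Polynomial.eval_add, Polynomial.eval_mul, Polynomial.eval_X,
      Polynomial.eval_ofNat, den]
    have e2 : c.reg y * (a.time.eval z + 8) + 1 + 1 + 1 + 1 + 1 + 1 + 1 ≤
        z * (a.time.eval z + 8) + 8 := by
      have := Nat.mul_le_mul_right (a.time.eval z + 8) (hz y hy)
      omega
    refine Config.Leads.mono ?_ e2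
    refine Config.Leads.single (c' := (c.push (.seq (.const h 0) (.seq (.sub h y x) lp))).push
      (.const x 0)) rfl ?_
    refine Config.Leads.single (c' := ((c.setReg x 0).push
      (.seq (.const h 0) (.seq (.sub h y x) lp)))) rfl ?_
    refine Config.Leads.single (c' := ((c.setReg x 0).push
      (.seq (.sub h y x) lp)).push (.const h 0)) rfl ?_
    refine Config.Leads.single (c' := (((c.setReg x 0).setReg h 0).push
      (.seq (.sub h y x) lp))) rfl ?_
    refine Config.Leads.single (c' := ((((c.setReg x 0).setReg h 0).push lp).push
      (.sub h y x))) rfl ?_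
    refine Config.Leads.single (c' := (first x h y c).push lp) ?_ ?_
    · simp [Config.push, Config.step, Config.setReg, Function.update_of_ne hxh, first,
        Function.update_of_ne hyx, Function.update_of_ne hyh]
    refine hloop _ _ ?_ ?_ ?_
    · simp [first, Config.setReg_reg, hxh, hyx, hyh]
    · simp [first, Config.setReg_reg]
    · intro j hj
      have hjx : j ≠ x := by rintro rfl; exact hx hj
      have hjh : j ≠ h := by rintro rfl; exact hh hj
      simp only [first, Config.setReg_reg, if_neg hjx, if_neg hjh]
      exact hz j hj

/-- The effect of a program without random events. -/
def run (inp : List ℕ) : Prog → Config N → Config N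
  | op d, c => ((c.push d).step inp).headD c
  | seq a b, c => b.run inp (a.run inp c)
  | ite x a b, c => if c.reg x ≠ 0 then a.run inp c else b.run inp c
  | .count x h y a, c => (fun d => next x h y (a.run inp d))^[c.reg y] (first x h y c)

theorem den_eq_run {inp : List ℕ} {P : Prog} (hP : P.all Cmd.det) (c : Config N) :
    P.den inp c = [P.run inp c] := by
  induction P generalizing c with
  | op d =>
    obtain ⟨c', hc'⟩ := step_det (inp := inp) hP c
    simp [den, run, hc']
  | seq a b iha ihb =>
    simp only [all, Bool.and_eq_true] at hP
    simp [den, run, iha hP.1, ihb hP.2]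
  | ite x a b iha ihb =>
    simp only [all, Bool.and_eq_true] at hP
    simp only [den, run]
    split_ifs
    · exact iha hP.1 c
    · exact ihb hP.2 c
  | count x h y a iha =>
    simp only [den, run]
    generalize first x h y c = d
    induction c.reg y generalizing d with
    | zero => rfl
    | succ k ih =>
      rw [bindIter, Function.iterate_succ_apply, ← ih]
      simp [iha hP]

theorem run_mem_den {inp : List ℕ} {P : Prog} (hP : P.all Cmd.det) (c : Config N) :
    P.run inp c ∈ P.den inp c := by
  simp [den_eq_run hP]

theorem run_reg {inp : List ℕ} {P : Prog} (hP : P.all fun d => d.basic && d.det) {x : ℕ}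
    (hx : x ∉ P.writes) (c : Config N) : (P.run inp c).reg x = c.reg x := by
  refine den_preserves (inp := inp) (fun c => c.reg x) P (fun d => d.basic && d.det) hP
    (fun d hd hw c => step_reg (by simp_all) c fun h => hx (hw x h))
    (fun c y v hy => by
      rw [Config.setReg_reg, if_neg]; rintro rfl; exact hx hy) c _ (run_mem_den ?_ c)
  clear hx
  induction P <;> simp_all [all]

theorem run_hist {inp : List ℕ} {P : Prog} (hP : P.all fun d => d.basic && d.det)
    (c : Config N) : (P.run inp c).hist = c.hist := by
  refine den_preserves (inp := inp) (fun c => c.hist) P (fun d => d.basic && d.det) hP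
    (fun d hd hw c => step_hist (by simp_all) (by simp_all) c) (fun c y v hy => rfl) c _
    (run_mem_den ?_ c)
  induction P <;> simp_all [all]

theorem run_mem {inp : List ℕ} {P : Prog} (hP : P.all fun d => d.basic && d.det && d.keepsMem)
    (c : Config N) : (P.run inp c).mem = c.mem := by
  refine den_preserves (inp := inp) (fun c => c.mem) P
    (fun d => d.basic && d.det && d.keepsMem) hP
    (fun d hd hw c => step_mem (by simp_all) (by simp_all) c) (fun c y v hy => rfl) c _
    (run_mem_den ?_ c)
  induction P <;> simp_all [all]

theorem run_out {inp : List ℕ} {P : Prog} (hP : P.all fun d => d.basic && d.det && d.keepsOut)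
    (c : Config N) : (P.run inp c).out = c.out := by
  refine den_preserves (inp := inp) (fun c => c.out) P
    (fun d => d.basic && d.det && d.keepsOut) hP
    (fun d hd hw c => step_out (by simp_all) (by simp_all) c) (fun c y v hy => rfl) c _
    (run_mem_den ?_ c)
  induction P <;> simp_all [all]

/-- The Hoare rule behind the specifications of the deterministic loops. The body may assume that
the counter equals `i` and that registers outside the write set are as they were on entry, so the
invariant `I` only has to speak of what the loop computes. -/
theorem run_for {inp : List ℕ} {x h y : ℕ} {a : Prog} (ha : a.all fun d => d.basic && d.det)
    (hxy : x ≠ h ∧ x ∉ a.writes) (c : Config N)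
    (I : ℕ → Config N → Prop) (h0 : I 0 (first x h y c))
    (hs : ∀ i d, i < c.reg y → d.reg x = i →
      (∀ r, r ∉ (Prog.count x h y a).writes → d.reg r = c.reg r) → I i d →
      I (i + 1) (next x h y (a.run inp d))) :
    I (c.reg y) ((Prog.count x h y a).run inp c) := by
  obtain ⟨hxh, hxa⟩ := hxy
  rw [run]
  have key : ∀ k ≤ c.reg y, ((fun d => next x h y (a.run inp d))^[k] (first x h y c)).reg x = k ∧
      (∀ r, r ∉ (Prog.count x h y a).writes →
        ((fun d => next x h y (a.run inp d))^[k] (first x h y c)).reg r = c.reg r) ∧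
      I k ((fun d => next x h y (a.run inp d))^[k] (first x h y c)) := by
    intro k
    induction k with
    | zero =>
      intro _
      refine ⟨by simp [first, Config.setReg_reg, hxh], fun r hr => ?_, h0⟩
      simp only [writes, List.mem_cons, not_or] at hr
      simp [first, Config.setReg_reg, hr.1, hr.2.1]
    | succ k ih =>
      intro hk
      obtain ⟨h1, h2, h3⟩ := ih (by omega)
      rw [Function.iterate_succ_apply']
      generalize (fun d => next x h y (a.run inp d))^[k] (first x h y c) = e at h1 h2 h3
      refine ⟨?_, fun r hr => ?_, hs k _ (by omega) h1 h2 h3⟩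
      · simp only [next, Config.setReg_reg, if_neg hxh, if_true, run_reg ha hxa, h1]
      · rw [← h2 r hr]
        simp only [writes, List.mem_cons, not_or] at hr
        simp only [next, Config.setReg_reg, if_neg hr.1, if_neg hr.2.1, run_reg ha hr.2.2]
  exact (key _ le_rfl).2.2

section Basic

variable (inp : List ℕ) (c : Config N)

@[simp] theorem run_const (x k : ℕ) : (op (.const x k)).run inp c = c.setReg x k := rfl
@[simp] theorem run_add (x y z : ℕ) :
    (op (.add x y z)).run inp c = c.setReg x (c.reg y + c.reg z) := rfl
@[simp] theorem run_sub (x y z : ℕ) :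
    (op (.sub x y z)).run inp c = c.setReg x (c.reg y - c.reg z) := rfl
@[simp] theorem run_load (x y : ℕ) :
    (op (.load x y)).run inp c = c.setReg x (c.mem (c.reg y)) := rfl
@[simp] theorem run_store (x y : ℕ) :
    (op (.store x y)).run inp c = c.setMem (c.reg x) (c.reg y) := rfl
@[simp] theorem run_input (x y : ℕ) :
    (op (.input x y)).run inp c = c.setReg x (inp.getD (c.reg y) 0) := rfl
@[simp] theorem run_seq (a b : Prog) : (a ;; b).run inp c = b.run inp (a.run inp c) := rfl
theorem run_ite (x : ℕ) (a b : Prog) :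
    (ite x a b).run inp c = if c.reg x ≠ 0 then a.run inp c else b.run inp c := rfl

end Basic

end Prog

/-! ### The simulation algorithm -/

/-- The Majorana string `i^ph ∏_j γ_j^{b_j}` on the joint register: the first `2n+2` bits belong
to `R_n`, the next `2t+2` bits to `R_t`. -/
structure Word where
  ph : ZMod 4
  b : ℕ → ZMod 2

/-- The overlap of two bit strings modulo two. -/
def dot (N : ℕ) (u v : ℕ → ZMod 2) : ZMod 2 := ∑ j ∈ Finset.range N, u j * v j

/-- The number of transpositions modulo two that sort the product of two ordered strings. -/
def cross (N : ℕ) (u v : ℕ → ZMod 2) : ZMod 2 :=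
  ∑ j ∈ Finset.range N, u j * ∑ k ∈ Finset.range j, v k

/-- Multiplication by two. -/
def dbl (x : ZMod 2) : ZMod 4 := if x = 0 then 0 else 2

/-- The product of Majorana strings. -/
def Word.mul (N : ℕ) (u v : Word) : Word := ⟨u.ph + v.ph + dbl (cross N u.b v.b), u.b + v.b⟩

/-- Half the weight of a bit string. -/
def halfCount (N : ℕ) (u : ℕ → ZMod 2) : ℕ := ((Finset.range N).filter fun j => u j ≠ 0).card / 2

/-- The rule "multiply by `y` the strings that overlap oddly with `q`". -/
structure Rule where
  q : ℕ → ZMod 2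
  y : Word

/-- The rule that does nothing. -/
def Rule.idle : Rule := ⟨0, ⟨0, 0⟩⟩

/-- Apply a rule to a string. -/
def Rule.app (N : ℕ) (r : Rule) (w : Word) : Word := if dot N w.b r.q = 0 then w else w.mul N r.y

/-- Apply a list of rules. -/
def reduce (N : ℕ) (l : List Rule) (w : Word) : Word := l.foldl (fun w r => r.app N w) w

/-- The greatest number below `k` that satisfies `p`. -/
def lastTrue (p : ℕ → Prop) [DecidablePred p] : ℕ → Option ℕ
  | 0 => none
  | k + 1 => if p k then some k else lastTrue p k

/-- The indicator of a set of positions. -/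
def ind (S : Finset ℕ) : ℕ → ZMod 2 := fun j => if j ∈ S then 1 else 0

/-- The indicator of a set of Majoranas, the first of which has position `o`. -/
def shiftInd {M : ℕ} (o : ℕ) (S : Finset (Fin M)) : ℕ → ZMod 2 :=
  ind (S.image fun x : Fin M => o + (x : ℕ))

/-- A pair `s_j` of `R_n` that anticommutes with the string. -/
def nPivot (n : ℕ) (b : ℕ → ZMod 2) : Option ℕ := lastTrue (fun j => b (2 * j) ≠ b (2 * j + 1)) n

/-- A Majorana of `R_t` in the support of the string. -/
def tPivot (n t : ℕ) (b : ℕ → ZMod 2) : Option ℕ :=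
  lastTrue (fun j => b (2 * n + 2 + j) ≠ 0) (2 * t + 2)

/-- The positions to be cleared in all later strings. -/
def pivotSet (n t : ℕ) (b : ℕ → ZMod 2) : Finset ℕ :=
  match nPivot n b with
  | some j => {2 * j, 2 * j + 1}
  | none => match tPivot n t b with
    | some j => {2 * n + 2 + j}
    | none => ∅

/-- The sign of a Hermitian string relative to the fermion parity with the same support. -/
def signBit (N : ℕ) (w : Word) : Bool := decide (w.ph ≠ (halfCount N w.b : ZMod 4))

/-- Change the sign. -/
def Word.flip (w : Word) (c : Bool) : Word := ⟨w.ph + if c then 2 else 0, w.b⟩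

/-- The number of Majoranas of the joint register. -/
abbrev total (n t : ℕ) : ℕ := 2 * n + 2 + (2 * t + 2)

/-- The support on `R_t`. -/
def tSupport (n t : ℕ) (b : ℕ → ZMod 2) : Finset (Fin (2 * t + 2)) :=
  Finset.univ.filter fun j => b (2 * n + 2 + j) ≠ 0

/-- The state of the simulation. -/
structure SimState (M : ℕ) where
  gates : List Rule
  elim : List Rule
  used : ℕ
  out : List Bool
  hist : List (RunEvent M)

/-- The state of the simulation after the outcome of a string has been found. -/
def SimState.record {n t : ℕ} (A : SimState (2 * t + 2)) (w : Word) (d : Bool)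
    (e : List (RunEvent (2 * t + 2))) : Bool × SimState (2 * t + 2) :=
  (xor d (signBit (total n t) w),
    { A with
      elim := A.elim ++ [⟨ind (pivotSet n t w.b), w.flip (xor d (signBit (total n t) w))⟩]
      hist := A.hist ++ e })

/-- Find the outcome of a reduced string. -/
def SimState.decide (n : ℕ) {t : ℕ} (A : SimState (2 * t + 2)) (w : Word) :
    List (Bool × SimState (2 * t + 2)) :=
  if nPivot n w.b ≠ none then
    [false, true].map fun d => A.record (n := n) w d [.coin d]
  else if tPivot n t w.b ≠ none then
    [false, true].map fun d => A.record (n := n) w d [.measured (tSupport n t w.b) d]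
  else [A.record (n := n) w false []]

/-- Find the outcome of a string. -/
def SimState.measure (n : ℕ) {t : ℕ} (A : SimState (2 * t + 2)) (w : Word) :
    List (Bool × SimState (2 * t + 2)) :=
  A.decide n (reduce (total n t) (A.gates ++ A.elim) w)

/-- The string of a fermion parity of `R_t`. -/
def frameWord (n : ℕ) {t : ℕ} (X : FermionParity (2 * t + 2)) : Word :=
  ⟨halfCount (total n t) (shiftInd (2 * n + 2) X.support) + if X.neg then 2 else 0,
    shiftInd (2 * n + 2) X.support⟩

/-- The rule of a braid. -/
def braidRule (n t : ℕ) (inv : Bool) (S : Finset (Fin (2 * n + 2))) : Rule :=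
  ⟨shiftInd 0 S, ⟨halfCount (total n t) (shiftInd 0 S) + 1 + if inv then 2 else 0, shiftInd 0 S⟩⟩

/-- The string that is measured for the `i`-th `T_2` gate. -/
def magicWord (n i a b : ℕ) : Word :=
  ⟨if a < b then 2 else 0, ind {a, b, 2 * n + 2 + 2 * i, 2 * n + 2 + 2 * i + 1}⟩

/-- The rule of the `i`-th `T_2` gate after the outcome `c`. -/
def magicRule (n : ℕ) {t : ℕ} (X : FermionParity (2 * t + 2)) (i a b : ℕ) (c : Bool) : Rule :=
  ⟨ind {a, b}, Word.mul (total n t)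
    ⟨0, ind (if c then {2 * n + 2 + 2 * i, 2 * n + 2 + 2 * i + 1} else ∅)⟩ (frameWord n X)⟩

/-- The string `s_j` of `R_n`. -/
def sWord (j : ℕ) : Word := ⟨1, ind {2 * j, 2 * j + 1}⟩

/-- The rule of a total parity. -/
def parityRule (N o k : ℕ) (p : Bool) : Rule :=
  ⟨ind {o + k - 1}, ⟨halfCount N (ind (Finset.Ico o (o + k))) + if p then 2 else 0,
    ind (Finset.Ico o (o + k))⟩⟩

/-- Process a gate. -/
def SimState.gate (n : ℕ) {t : ℕ} (X : Fin t → FermionParity (2 * t + 2))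
    (g : Gate (2 * n + 2)) (A : SimState (2 * t + 2)) : List (SimState (2 * t + 2)) :=
  match g with
  | .braid inv S _ => [{ A with gates := braidRule n t inv S :: A.gates }]
  | .T2 a b _ =>
    if h : A.used < t then
      (A.measure n (magicWord n A.used a b)).map fun x =>
        { x.2 with
          gates := magicRule n (X ⟨A.used, h⟩) A.used a b x.1 :: x.2.gates
          used := A.used + 1 }
    else []

/-- Process the measurement of `s_j`. -/
def SimState.readout (n : ℕ) {t : ℕ} (j : ℕ) (A : SimState (2 * t + 2)) :
    List (SimState (2 * t + 2)) :=
  (A.measure n (sWord j)).map fun x => { x.2 with out := x.2.out ++ [x.1] }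

/-- The initial state of the simulation. -/
def SimState.init (n t : ℕ) (pn pt : Bool) : SimState (2 * t + 2) :=
  ⟨[], [parityRule (total n t) 0 (2 * n + 2) pn, parityRule (total n t) (2 * n + 2) (2 * t + 2) pt],
    0, [], []⟩

theorem reduce_append (N : ℕ) (l l' : List Rule) (w : Word) :
    reduce N (l ++ l') w = reduce N l' (reduce N l w) := List.foldl_append

theorem Rule.app_idle (N : ℕ) (w : Word) : Rule.idle.app N w = w := by
  simp [Rule.app, Rule.idle, dot]

/-! ### The program -/

theorem dot_succ (i : ℕ) (u v : ℕ → ZMod 2) : dot (i + 1) u v = dot i u v + u i * v i :=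
  Finset.sum_range_succ _ _

theorem cross_succ (i : ℕ) (u v : ℕ → ZMod 2) :
    cross (i + 1) u v = cross i u v + u i * ∑ k ∈ Finset.range i, v k :=
  Finset.sum_range_succ _ _

theorem ZMod.two_cases (x : ZMod 2) : x = 0 ∨ x = 1 := by revert x; decide

/-- The machine has no exclusive or. The two truncated differences add up to the absolute
difference, which on bits is the sum modulo two. -/
theorem xor_val (a b : ZMod 2) : a.val - b.val + (b.val - a.val) = (a + b).val := by
  revert a b; decide

theorem one_sub_val (a : ZMod 2) : 1 - a.val = (a + 1).val := by revert a; decide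

/-- The memory holds the bit string `b` at the address `p`. -/
def HasBits (N : ℕ) (m : ℕ → ℕ) (p : ℕ) (b : ℕ → ZMod 2) : Prop := ∀ j < N, m (p + j) = (b j).val

/-- The memory holds the rule `r` at the address `p`. -/
structure HasRule (N : ℕ) (m : ℕ → ℕ) (p : ℕ) (r : Rule) : Prop where
  q : HasBits N m p r.q
  y : HasBits N m (p + N) r.y.b
  ph : m (p + N + N) = r.y.ph.val

/-- The current string is `w`. -/
structure HasWord (N : ℕ) {M : ℕ} (c : Config M) (w : Word) : Prop where
  b : HasBits N c.mem 0 w.b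
  ph : c.reg 28 = w.ph.val

theorem HasBits.mono {N : ℕ} {m m' : ℕ → ℕ} {p : ℕ} {b : ℕ → ZMod 2} (h : HasBits N m p b)
    (hm : ∀ a, p ≤ a → a < p + N → m' a = m a) : HasBits N m' p b := fun j hj => by
  rw [hm _ (by omega) (by omega), h j hj]

theorem HasRule.mono {N : ℕ} {m m' : ℕ → ℕ} {p : ℕ} {r : Rule} (h : HasRule N m p r)
    (hm : ∀ a, p ≤ a → a ≤ p + N + N → m' a = m a) : HasRule N m' p r :=
  ⟨h.q.mono fun a h1 h2 => hm a h1 (by omega), h.y.mono fun a h1 h2 => hm a (by omega) (by omega),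
    by rw [hm _ (by omega) le_rfl, h.ph]⟩

namespace Prog

/-- Do nothing. -/
def skip : Prog := op (.const 60 0)

/-- Store in register 31 whether the current string overlaps oddly with the string at the address
in register 30. Register 5 holds the length. -/
def test : Prog :=
  op (.const 31 0) ;;
  .count 32 33 5 (
    op (.add 34 30 32) ;; op (.load 34 34) ;; op (.load 35 32) ;;
    ite 34 (ite 35 (op (.sub 31 1 31)) skip) skip)

/-- Reduce a number below 8 modulo 4. -/
def mod4 (x : ℕ) : Prog :=
  op (.const 39 3) ;; op (.sub 39 x 39) ;;
  ite 39 (op (.const 39 4) ;; op (.sub x x 39)) skip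

/-- Multiply the bits of the current string by those of the rule at the address in
register 30, with the sign in register 37. -/
def mulBits : Prog :=
  op (.const 36 0) ;; op (.const 37 0) ;; op (.add 38 30 5) ;;
  .count 32 33 5 (
    op (.add 34 38 32) ;; op (.load 34 34) ;; op (.load 35 32) ;;
    ite 35 (op (.sub 39 37 36) ;; op (.sub 40 36 37) ;; op (.add 37 39 40)) skip ;;
    op (.sub 39 36 34) ;; op (.sub 40 34 36) ;; op (.add 36 39 40) ;;
    op (.sub 39 35 34) ;; op (.sub 40 34 35) ;; op (.add 39 39 40) ;;
    op (.store 32 39))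

/-- Multiply the current string by that of the rule at the address in register 30. -/
def mul : Prog :=
  mulBits ;;
  op (.add 38 38 5) ;; op (.load 38 38) ;;
  op (.add 28 28 38) ;; op (.add 28 28 37) ;; op (.add 28 28 37) ;;
  mod4 28 ;; mod4 28

/-- Apply the rule at the address in register 30. -/
def rule : Prog := test ;; ite 31 mul skip

/-- Apply all rules. Register 8 holds their number, register 9 the length of a rule. -/
def rules : Prog := op (.add 30 5 0) ;; .count 41 42 8 (rule ;; op (.add 30 30 9))

/-- Store half the weight of the current string, modulo 4, in register 43. -/
def half : Prog :=
  op (.const 43 0) ;; op (.const 44 0) ;;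
  .count 32 33 5 (
    op (.load 35 32) ;;
    ite 35
      (ite 44 (op (.const 44 0) ;; op (.add 43 43 1) ;; mod4 43) (op (.const 44 1)))
      skip)

/-- Search for the pivot of the current string: the kind goes to register 45, the positions to
registers 46 and 47. -/
def pivot : Prog :=
  op (.const 45 0) ;;
  .count 32 33 7 (
    op (.add 34 6 32) ;; op (.load 35 34) ;;
    ite 35 (op (.const 45 1) ;; op (.add 46 34 0) ;; op (.add 47 34 0)) skip) ;;
  .count 32 33 2 (
    op (.add 34 32 32) ;; op (.add 36 34 1) ;; op (.load 39 34) ;; op (.load 40 36) ;;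
    op (.sub 48 39 40) ;; op (.sub 49 40 39) ;; op (.add 48 48 49) ;;
    ite 48 (op (.const 45 2) ;; op (.add 46 34 0) ;; op (.add 47 36 0)) skip)

/-- Make the current string trivial. -/
def clear : Prog :=
  op (.const 39 0) ;; op (.const 28 0) ;; .count 32 33 5 (op (.store 32 39))

/-- Copy the current string to the string of the rule at the address in register 30. -/
def copy : Prog :=
  op (.add 38 30 5) ;;
  .count 32 33 5 (op (.load 34 32) ;; op (.add 39 38 32) ;; op (.store 39 34)) ;;
  op (.add 38 38 5) ;; op (.store 38 28)

/-- Copy the bits of the current string to the address in register 30. -/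
def copyBits : Prog :=
  .count 32 33 5 (op (.load 34 32) ;; op (.add 39 30 32) ;; op (.store 39 34))

/-- Fill `reg y` bits from the position in register 53 on. -/
def fill (y : ℕ) : Prog :=
  .count 32 33 y (op (.add 39 53 32) ;; op (.store 39 1))

/-- Read `reg y` bits from the input. -/
def read (y : ℕ) : Prog :=
  .count 32 33 y (op (.add 34 54 32) ;; op (.input 34 34) ;; op (.add 39 53 32) ;; op (.store 39 34))

variable {M : ℕ} {inp : List ℕ}

@[simp] theorem run_skip (c : Config M) : skip.run inp c = c.setReg 60 0 := rfl

theorem test_spec (c : Config M) (h1 : c.reg 1 = 1) {u q : ℕ → ZMod 2}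
    (hu : HasBits (c.reg 5) c.mem 0 u) (hq : HasBits (c.reg 5) c.mem (c.reg 30) q) :
    (test.run inp c).reg 31 = (dot (c.reg 5) u q).val := by
  rw [test, run_seq]
  refine (run_for (by decide) (by decide) _
    (fun i d => d.mem = c.mem ∧ d.reg 31 = (dot i u q).val) ?_ ?_).2
  · simp [first, Config.setReg_reg, dot]
  · rintro i d hi hx hr ⟨hm, hd⟩
    have r1 := hr 1 (by decide)
    have r5 := hr 5 (by decide)
    have r30 := hr 30 (by decide)
    simp [Config.setReg_reg] at r1 r5 r30 hi
    have e1 := hu i hi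
    have e2 := hq i hi
    rw [zero_add] at e1
    rw [dot_succ]
    rcases ZMod.two_cases (u i) with hu | hu <;> rcases ZMod.two_cases (q i) with hq | hq <;>
      simp [Config.setReg_reg, run_ite, next, hx, hm, hd, r30, r1, e1, e2, h1, hu, hq, one_sub_val]

theorem mod4_reg (x : ℕ) (hx : x ≠ 39 ∧ x ≠ 60) (c : Config M) :
    ((mod4 x).run inp c).reg x = if 3 < c.reg x then c.reg x - 4 else c.reg x := by
  have h1 := hx.1
  have h2 := hx.2
  by_cases h : 3 < c.reg x
  · have : c.reg x - 3 ≠ 0 := by omega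
    simp [mod4, run_ite, Config.setReg_reg, hx, this, h]
  · have : c.reg x - 3 = 0 := by omega
    simp [mod4, run_ite, Config.setReg_reg, hx, this, h]

/-- The product can be formed in place from left to right: position `i` needs only the two old bits
at `i` and the parity of the bits of `y` below `i`. That parity is kept in register 36, and the sign
in register 37 is updated before the bit `i` of `y` is added to it, as the strict inequality in
`cross` demands. -/
theorem mulBits_spec (c : Config M) {u y : ℕ → ZMod 2}
    (hu : HasBits (c.reg 5) c.mem 0 u) (hy : HasBits (c.reg 5) c.mem (c.reg 30 + c.reg 5) y) :
    (mulBits.run inp c).reg 37 = (cross (c.reg 5) u y).val ∧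
    (mulBits.run inp c).reg 38 = c.reg 30 + c.reg 5 ∧
    HasBits (c.reg 5) (mulBits.run inp c).mem 0 (u + y) ∧
    ∀ a, c.reg 5 ≤ a → (mulBits.run inp c).mem a = c.mem a := by
  have H : (∀ j < c.reg 5, (mulBits.run inp c).mem j = ((u + y) j).val) ∧
      (∀ j ≥ c.reg 5, (mulBits.run inp c).mem j = c.mem j) ∧
      (mulBits.run inp c).reg 36 = (∑ k ∈ Finset.range (c.reg 5), y k).val ∧
      (mulBits.run inp c).reg 37 = (cross (c.reg 5) u y).val ∧
      (mulBits.run inp c).reg 38 = c.reg 30 + c.reg 5 := by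
    refine run_for (x := 32) (h := 33) (y := 5) (by decide) (by decide)
      (((c.setReg 36 0).setReg 37 0).setReg 38 (c.reg 30 + c.reg 5))
      (fun i d => (∀ j < i, d.mem j = ((u + y) j).val) ∧ (∀ j ≥ i, d.mem j = c.mem j) ∧
        d.reg 36 = (∑ k ∈ Finset.range i, y k).val ∧ d.reg 37 = (cross i u y).val ∧
        d.reg 38 = c.reg 30 + c.reg 5) (by simp [first, Config.setReg_reg, cross]) ?_
    rintro i d hi hx hr ⟨h1, h2, h3, h4, h5⟩
    have r5 := hr 5 (by decide)
    simp [Config.setReg_reg] at r5 hi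
    have e1 := hu i hi
    have e2 := hy i hi
    rw [zero_add, ← h2 i le_rfl] at e1
    rw [← h2 _ (by omega)] at e2
    rw [cross_succ, Finset.sum_range_succ]
    refine ⟨fun j hj => ?_, fun j hj => ?_, ?_, ?_, ?_⟩
    · rcases ZMod.two_cases (u i) with hui | hui <;>
        simp [Config.setReg_reg, Config.setMem_mem, run_ite, next, hx, h3, h4, h5, e1, e2, hui] <;>
      · split_ifs with hji
        · subst hji; simp [hui, ← xor_val]
        · exact h1 j (by omega)
    · rcases ZMod.two_cases (u i) with hui | hui <;>
        simp [Config.setReg_reg, Config.setMem_mem, run_ite, next, hx, h3, h4, h5, e1, e2, hui] <;>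
      · rw [if_neg (by omega)]; exact h2 j (by omega)
    all_goals
      rcases ZMod.two_cases (u i) with hui | hui <;>
        simp [Config.setReg_reg, run_ite, next, hx, h3, h4, h5, e1, e2, hui, xor_val]
  obtain ⟨h1, h2, h3, h4, h5⟩ := H
  exact ⟨h4, h5, fun j hj => by rw [zero_add]; exact h1 j hj, h2⟩

/-- The sum of the phases and the doubled sign can be 3 + 3 + 2 = 8, so a single subtraction of 4
would not be enough. -/
theorem mod4_mod4_val (a b : ZMod 4) (z : ZMod 2) :
    (if 3 < (if 3 < a.val + b.val + z.val + z.val then a.val + b.val + z.val + z.val - 4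
        else a.val + b.val + z.val + z.val)
      then (if 3 < a.val + b.val + z.val + z.val then a.val + b.val + z.val + z.val - 4
        else a.val + b.val + z.val + z.val) - 4
      else (if 3 < a.val + b.val + z.val + z.val then a.val + b.val + z.val + z.val - 4
        else a.val + b.val + z.val + z.val)) = (a + b + dbl z).val := by
  revert a b z; decide

theorem mod4_mem (x : ℕ) (c : Config M) : ((mod4 x).run inp c).mem = c.mem :=
  run_mem rfl c

theorem mul_spec (c : Config M) {w y : Word}
    (hw : HasWord (c.reg 5) c w) (hy : HasBits (c.reg 5) c.mem (c.reg 30 + c.reg 5) y.b)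
    (hph : c.mem (c.reg 30 + c.reg 5 + c.reg 5) = y.ph.val) :
    HasWord (c.reg 5) (mul.run inp c) (w.mul (c.reg 5) y) ∧
    ∀ a, c.reg 5 ≤ a → (mul.run inp c).mem a = c.mem a := by
  obtain ⟨h1, h2, h3, h4⟩ := mulBits_spec (inp := inp) c hw.b hy
  have r28 : (mulBits.run inp c).reg 28 = c.reg 28 := run_reg (by decide) (by decide) c
  have r5 : (mulBits.run inp c).reg 5 = c.reg 5 := run_reg (by decide) (by decide) c
  refine ⟨⟨?_, ?_⟩, ?_⟩
  · simpa only [mul, run_seq, mod4_mem, run_add, run_load, Config.setReg_mem,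
      Word.mul] using h3
  · simp only [mul, run_seq]
    rw [mod4_reg _ (by decide), mod4_reg _ (by decide)]
    simp [Config.setReg_reg, h1, h2, r28, r5, h4, hph, hw.ph, mod4_mod4_val, Word.mul]
  · simpa only [mul, run_seq, mod4_mem, run_add, run_load, Config.setReg_mem] using h4

theorem rule_spec (c : Config M) (h1 : c.reg 1 = 1) {w : Word} {r : Rule}
    (hw : HasWord (c.reg 5) c w) (hr : HasRule (c.reg 5) c.mem (c.reg 30) r) :
    HasWord (c.reg 5) (rule.run inp c) (r.app (c.reg 5) w) ∧
    ∀ a, c.reg 5 ≤ a → (rule.run inp c).mem a = c.mem a := by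
  have ht := test_spec (inp := inp) c h1 hw.b hr.q
  have hm : (test.run inp c).mem = c.mem := run_mem (by decide) c
  have hg : ∀ x, x ∉ test.writes → (test.run inp c).reg x = c.reg x :=
    fun x hx => run_reg (by decide) hx c
  have r5 := hg 5 (by decide)
  have r28 := hg 28 (by decide)
  have r30 := hg 30 (by decide)
  have hw' : HasWord (c.reg 5) (test.run inp c) w := ⟨by rw [hm]; exact hw.b, by rw [r28, hw.ph]⟩
  rw [rule, run_seq, run_ite, ht, Rule.app]
  by_cases hd : dot (c.reg 5) w.b r.q = 0
  · simp only [hd, ZMod.val_zero, ne_eq, not_true_eq_false, if_false, if_true, run_skip]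
    exact ⟨⟨by simpa using hw'.b, by simpa [Config.setReg_reg] using hw'.ph⟩,
      fun a _ => by simp [hm]⟩
  · rw [if_pos (by simpa using hd), if_neg hd]
    have := mul_spec (inp := inp) (test.run inp c) (w := w) (y := r.y)
      (by rw [r5]; exact hw') (by rw [r5, r30, hm]; exact hr.y) (by rw [r5, r30, hm]; exact hr.ph)
    rw [r5, hm] at this
    exact this

theorem rules_spec (c : Config M) (h0 : c.reg 0 = 0) (h1 : c.reg 1 = 1)
    {w : Word} {R : ℕ → Rule} (hw : HasWord (c.reg 5) c w)
    (hR : ∀ r < c.reg 8, HasRule (c.reg 5) c.mem (c.reg 5 + r * c.reg 9) (R r)) :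
    HasWord (c.reg 5) (rules.run inp c) (reduce (c.reg 5) ((List.range (c.reg 8)).map R) w) ∧
    ∀ a, c.reg 5 ≤ a → (rules.run inp c).mem a = c.mem a := by
  have H : HasWord (c.reg 5) (rules.run inp c)
      (reduce (c.reg 5) ((List.range (c.reg 8)).map R) w) ∧
      (∀ a, c.reg 5 ≤ a → (rules.run inp c).mem a = c.mem a) ∧
      (rules.run inp c).reg 30 = c.reg 5 + c.reg 8 * c.reg 9 := by
    refine run_for (x := 41) (h := 42) (y := 8) (by decide) (by decide)
      (c.setReg 30 (c.reg 5 + c.reg 0))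
      (fun i d => HasWord (c.reg 5) d (reduce (c.reg 5) ((List.range i).map R) w) ∧
        (∀ a, c.reg 5 ≤ a → d.mem a = c.mem a) ∧ d.reg 30 = c.reg 5 + i * c.reg 9) ?_ ?_
    · refine ⟨⟨hw.b, hw.ph⟩, fun a _ => rfl, ?_⟩
      simp [first, Config.setReg_reg, h0]
    · rintro i d hi hx hr ⟨h2, h3, h4⟩
      have r5 := hr 5 (by decide)
      have r1 := hr 1 (by decide)
      have r9 := hr 9 (by decide)
      simp [Config.setReg_reg] at r5 r1 r9 hi
      obtain ⟨h5, h6⟩ := rule_spec (inp := inp) d (by rw [r1, h1])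
        (w := reduce (c.reg 5) ((List.range i).map R) w) (r := R i) (by rw [r5]; exact h2)
        (by
          rw [r5, h4]
          exact (hR i hi).mono fun a ha _ => h3 a (by omega))
      rw [r5] at h5 h6
      have e30 : (rule.run inp d).reg 30 = d.reg 30 := run_reg (by decide) (by decide) d
      have e9 : (rule.run inp d).reg 9 = d.reg 9 := run_reg (by decide) (by decide) d
      refine ⟨⟨?_, ?_⟩, fun a ha => ?_, ?_⟩
      · rw [List.range_succ, List.map_append, reduce_append]
        exact h5.b
      · rw [List.range_succ, List.map_append, reduce_append]
        exact h5.ph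
      · exact (h6 a ha).trans (h3 a ha)
      · simp [next, Config.setReg_reg, e30, e9, h4, r9]
        ring
  exact ⟨H.1, H.2.1⟩

/-- There is no division. Register 44 holds the parity of the number of ones met so far, and
register 43, half of that number modulo 4, goes up at every second one. -/
theorem half_spec (c : Config M) (h1 : c.reg 1 = 1) {b : ℕ → ZMod 2}
    (hb : HasBits (c.reg 5) c.mem 0 b) :
    (half.run inp c).reg 43 = ((halfCount (c.reg 5) b : ℕ) : ZMod 4).val ∧
    (half.run inp c).mem = c.mem := by
  have H : (half.run inp c).mem = c.mem ∧
      (half.run inp c).reg 43 = ((Finset.range (c.reg 5)).filter fun j => b j ≠ 0).card / 2 % 4 ∧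
      (half.run inp c).reg 44 = ((Finset.range (c.reg 5)).filter fun j => b j ≠ 0).card % 2 := by
    refine run_for (x := 32) (h := 33) (y := 5) (by decide) (by decide)
      ((c.setReg 43 0).setReg 44 0)
      (fun i d => d.mem = c.mem ∧
        d.reg 43 = ((Finset.range i).filter fun j => b j ≠ 0).card / 2 % 4 ∧
        d.reg 44 = ((Finset.range i).filter fun j => b j ≠ 0).card % 2)
      (by simp [first, Config.setReg_reg]) ?_
    rintro i d hi hx hr ⟨h2, h3, h4⟩
    have r1 := hr 1 (by decide)
    simp [Config.setReg_reg] at r1 hi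
    have e1 := hb i hi
    rw [zero_add] at e1
    rw [Finset.range_add_one, Finset.filter_insert]
    generalize hk : ((Finset.range i).filter fun j => b j ≠ 0).card = k at *
    rcases ZMod.two_cases (b i) with hbi | hbi
    · simp [Config.setReg_reg, run_ite, next, hx, h2, h3, h4, e1, hbi]
      simp [← hk]
    · rw [if_pos (by simp [hbi]), Finset.card_insert_of_notMem (by simp), hk]
      rcases Nat.mod_two_eq_zero_or_one k with hk2 | hk2
      · simp [Config.setReg_reg, run_ite, next, hx, h2, h3, h4, e1, hbi, hk2]
        omega
      · simp only [run_seq, run_ite, run_load, hx, h2, h4, e1, hbi, hk2, Config.setReg_reg,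
          next, if_true]
        norm_num [mod4_mem, mod4_reg, Config.setReg_reg, h2, h3, r1, h1]
        have e44 : ∀ e : Config M, ((mod4 43).run inp e).reg 44 = e.reg 44 :=
          run_reg (by decide) (by decide)
        simp only [e44, Config.setReg_reg]
        norm_num
        split_ifs <;> omega
  exact ⟨by rw [ZMod.val_natCast]; exact H.2.1, H.1⟩

/-- Both loops overwrite earlier finds, which is why `lastTrue` picks the greatest candidate. The
loop over the pairs of `R_n` comes second, so a pivot in `R_n` takes precedence over one in `R_t`.
-/
theorem pivot_spec {n t : ℕ} (c : Config M) (h0 : c.reg 0 = 0) (h1 : c.reg 1 = 1)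
    (h2 : c.reg 2 = n) (h6 : c.reg 6 = 2 * n + 2) (h7 : c.reg 7 = 2 * t + 2)
    {b : ℕ → ZMod 2} (hb : HasBits (total n t) c.mem 0 b) :
    (∀ j, nPivot n b = some j → (pivot.run inp c).reg 45 = 2 ∧
      (pivot.run inp c).reg 46 = 2 * j ∧ (pivot.run inp c).reg 47 = 2 * j + 1) ∧
    (nPivot n b = none → ∀ j, tPivot n t b = some j → (pivot.run inp c).reg 45 = 1 ∧
      (pivot.run inp c).reg 46 = 2 * n + 2 + j ∧ (pivot.run inp c).reg 47 = 2 * n + 2 + j) ∧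
    (nPivot n b = none → tPivot n t b = none → (pivot.run inp c).reg 45 = 0) := by
  simp only [HasBits, zero_add] at hb
  rw [pivot]
  simp only [run_seq, run_const]
  set L1 : Prog := .count 32 33 7 (
    op (.add 34 6 32) ;; op (.load 35 34) ;;
    ite 35 (op (.const 45 1) ;; op (.add 46 34 0) ;; op (.add 47 34 0)) skip) with hL1
  have m1 : (L1.run inp (c.setReg 45 0)).mem = c.mem := run_mem (by decide) _
  have g1 : ∀ x, x ∉ L1.writes → (L1.run inp (c.setReg 45 0)).reg x = (c.setReg 45 0).reg x :=
    fun x hx => run_reg (by decide) hx _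
  have H1 : (∀ j, tPivot n t b = some j → (L1.run inp (c.setReg 45 0)).reg 45 = 1 ∧
      (L1.run inp (c.setReg 45 0)).reg 46 = 2 * n + 2 + j ∧
      (L1.run inp (c.setReg 45 0)).reg 47 = 2 * n + 2 + j) ∧
      (tPivot n t b = none → (L1.run inp (c.setReg 45 0)).reg 45 = 0) ∧
      (L1.run inp (c.setReg 45 0)).mem = c.mem := by
    rw [tPivot, ← h7]
    refine run_for (x := 32) (h := 33) (y := 7) (by decide) (by decide) (c.setReg 45 0)
      (fun i d => (∀ j, lastTrue (fun j => b (2 * n + 2 + j) ≠ 0) i = some j → d.reg 45 = 1 ∧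
        d.reg 46 = 2 * n + 2 + j ∧ d.reg 47 = 2 * n + 2 + j) ∧
        (lastTrue (fun j => b (2 * n + 2 + j) ≠ 0) i = none → d.reg 45 = 0) ∧
        d.mem = c.mem) ?_ ?_
    · simp [lastTrue, first, Config.setReg_reg]
    · rintro i d hi hx hr ⟨h3, h4, h5⟩
      have r0 := hr 0 (by decide)
      have r6 := hr 6 (by decide)
      simp [Config.setReg_reg] at r0 r6 hi
      have e1 := hb (2 * n + 2 + i) (by unfold total; omega)
      by_cases hbi : b (2 * n + 2 + i) = 0
      · simp [Config.setReg_reg, run_ite, next, hx, h5, e1, hbi, r6, h6, lastTrue]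
        simp only [ne_eq] at h3 h4
        exact ⟨h3, h4⟩
      · simp [Config.setReg_reg, run_ite, next, hx, h5, e1, hbi, r6, h6, lastTrue, r0, h0]
  generalize L1.run inp (c.setReg 45 0) = c1 at m1 g1 H1
  obtain ⟨H1, H2, -⟩ := H1
  have q0 := g1 0 (by decide)
  have q1 := g1 1 (by decide)
  have q2 := g1 2 (by decide)
  simp [Config.setReg_reg] at q0 q1 q2
  set L2 : Prog := .count 32 33 2 (
    op (.add 34 32 32) ;; op (.add 36 34 1) ;; op (.load 39 34) ;; op (.load 40 36) ;;
    op (.sub 48 39 40) ;; op (.sub 49 40 39) ;; op (.add 48 48 49) ;;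
    ite 48 (op (.const 45 2) ;; op (.add 46 34 0) ;; op (.add 47 36 0)) skip) with hL2
  have H3 : (∀ j, nPivot n b = some j → (L2.run inp c1).reg 45 = 2 ∧
      (L2.run inp c1).reg 46 = 2 * j ∧ (L2.run inp c1).reg 47 = 2 * j + 1) ∧
      (nPivot n b = none → (L2.run inp c1).reg 45 = c1.reg 45 ∧
        (L2.run inp c1).reg 46 = c1.reg 46 ∧ (L2.run inp c1).reg 47 = c1.reg 47) ∧
      (L2.run inp c1).mem = c.mem := by
    rw [nPivot, ← h2, ← q2]
    refine run_for (x := 32) (h := 33) (y := 2) (by decide) (by decide) c1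
      (fun i d => (∀ j, lastTrue (fun j => b (2 * j) ≠ b (2 * j + 1)) i = some j →
        d.reg 45 = 2 ∧ d.reg 46 = 2 * j ∧ d.reg 47 = 2 * j + 1) ∧
        (lastTrue (fun j => b (2 * j) ≠ b (2 * j + 1)) i = none → d.reg 45 = c1.reg 45 ∧
        d.reg 46 = c1.reg 46 ∧ d.reg 47 = c1.reg 47) ∧
        d.mem = c.mem) ?_ ?_
    · simp [lastTrue, first, Config.setReg_reg, m1]
    · rintro i d hi hx hr ⟨h3, h4, h5⟩
      have r0 := hr 0 (by decide)
      have r1 := hr 1 (by decide)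
      simp only [q0, q1, q2, h0, h1, h2] at r0 r1 hi
      have e1 := hb (i + i) (by unfold total; omega)
      have e2 := hb (i + i + 1) (by unfold total; omega)
      by_cases hbi : b (i + i) = b (i + i + 1)
      · simp [Config.setReg_reg, run_ite, next, hx, h5, e1, e2, r1, lastTrue, two_mul, hbi]
        simp only [ne_eq, two_mul] at h3 h4
        exact ⟨h3, h4⟩
      · have : b (i + i) + b (i + i + 1) ≠ 0 := by
          intro h
          apply hbi
          revert h
          generalize b (i + i) = x, b (i + i + 1) = y
          revert x y; decide
        simp [Config.setReg_reg, run_ite, next, hx, h5, e1, e2, r1, lastTrue, two_mul, hbi, xor_val,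
          this, r0]
  obtain ⟨H3, H4, -⟩ := H3
  refine ⟨H3, fun hn j hj => ?_, fun hn ht => ?_⟩
  · obtain ⟨e1, e2, e3⟩ := H4 hn
    rw [e1, e2, e3]
    exact H1 j hj
  · rw [(H4 hn).1]; exact H2 ht

theorem clear_spec (c : Config M) :
    HasWord (c.reg 5) (clear.run inp c) ⟨0, 0⟩ ∧
    ∀ a, c.reg 5 ≤ a → (clear.run inp c).mem a = c.mem a := by
  have H : (∀ j < c.reg 5, (clear.run inp c).mem j = 0) ∧
      (∀ a, c.reg 5 ≤ a → (clear.run inp c).mem a = c.mem a) ∧ (clear.run inp c).reg 28 = 0 := by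
    refine run_for (x := 32) (h := 33) (y := 5) (by decide) (by decide)
      ((c.setReg 39 0).setReg 28 0)
      (fun i d => (∀ j < i, d.mem j = 0) ∧ (∀ a, c.reg 5 ≤ a → d.mem a = c.mem a) ∧
        d.reg 28 = 0) (by simp [first, Config.setReg_reg]) ?_
    rintro i d hi hx hr ⟨h1, h2, h3⟩
    have r39 := hr 39 (by decide)
    simp [Config.setReg_reg] at r39 hi
    simp [next, Config.setReg_reg, Config.setMem_mem, r39, h3, hx]
    refine ⟨fun j hj hji => h1 j (by omega), fun a ha => ?_⟩
    rw [if_neg (by omega), h2 a ha]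
  exact ⟨⟨fun j hj => by simp [H.1 j hj], by simp [H.2.2]⟩, H.2.1⟩

/-- The hypothesis on the address keeps the target disjoint from the current string, which occupies
the first cells of the memory. -/
theorem copyBits_spec (c : Config M) (hp : c.reg 5 ≤ c.reg 30) {b : ℕ → ZMod 2}
    (hb : HasBits (c.reg 5) c.mem 0 b) :
    HasBits (c.reg 5) (copyBits.run inp c).mem (c.reg 30) b ∧
    ∀ a, a < c.reg 30 ∨ c.reg 30 + c.reg 5 ≤ a → (copyBits.run inp c).mem a = c.mem a := by
  refine run_for (x := 32) (h := 33) (y := 5) (by decide) (by decide) c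
    (fun i d => HasBits i d.mem (c.reg 30) b ∧ 
      ∀ a, a < c.reg 30 ∨ c.reg 30 + c.reg 5 ≤ a → d.mem a = c.mem a)
    (by simp [first, HasBits]) ?_
  rintro i d hi hx hr ⟨h1, h2⟩
  have r30 := hr 30 (by decide)
  have e1 := hb i hi
  rw [zero_add, ← h2 i (by omega)] at e1
  refine ⟨fun j hj => ?_, fun a ha => ?_⟩
  · simp [next, Config.setReg_reg, Config.setMem_mem, r30, hx, e1]
    split_ifs with hji
    · rw [hji]
    · exact h1 j (by omega)
  · simp [next, Config.setReg_reg, Config.setMem_mem, r30, hx, e1]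
    rw [if_neg (by omega), h2 a ha]

theorem copy_spec (c : Config M) {w : Word}
    (hw : HasWord (c.reg 5) c w) :
    HasBits (c.reg 5) (copy.run inp c).mem (c.reg 30 + c.reg 5) w.b ∧
    (copy.run inp c).mem (c.reg 30 + c.reg 5 + c.reg 5) = w.ph.val ∧
    ∀ a, a < c.reg 30 + c.reg 5 ∨ c.reg 30 + c.reg 5 + c.reg 5 < a →
      (copy.run inp c).mem a = c.mem a := by
  simp only [copy, run_seq, run_add]
  set L : Prog := .count 32 33 5 (op (.load 34 32) ;; op (.add 39 38 32) ;; op (.store 39 34))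
  set c1 := c.setReg 38 (c.reg 30 + c.reg 5) with hc1
  have g : ∀ x, x ∉ L.writes → (L.run inp c1).reg x = c1.reg x := fun x hx =>
    run_reg (by decide) hx _
  have H : HasBits (c.reg 5) (L.run inp c1).mem (c.reg 30 + c.reg 5) w.b ∧ 
      ∀ a, a < c.reg 30 + c.reg 5 ∨ c.reg 30 + c.reg 5 + c.reg 5 ≤ a →
        (L.run inp c1).mem a = c.mem a := by
    refine run_for (x := 32) (h := 33) (y := 5) (by decide) (by decide) c1
      (fun i d => HasBits i d.mem (c.reg 30 + c.reg 5) w.b ∧ 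
        ∀ a, a < c.reg 30 + c.reg 5 ∨ c.reg 30 + c.reg 5 + c.reg 5 ≤ a → d.mem a = c.mem a)
      (by simp [first, HasBits, hc1]) ?_
    rintro i d hi hx hr ⟨h1, h2⟩
    have r38 := hr 38 (by decide)
    simp [hc1, Config.setReg_reg] at r38 hi
    have e1 := hw.b i hi
    rw [zero_add, ← h2 i (by omega)] at e1
    refine ⟨fun j hj => ?_, fun a ha => ?_⟩
    · simp [next, Config.setReg_reg, Config.setMem_mem, r38, hx, e1]
      split_ifs with hji
      · rw [hji]
      · exact h1 j (by omega)
    · simp [next, Config.setReg_reg, Config.setMem_mem, r38, hx, e1]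
      rw [if_neg (by omega), h2 a ha]
  have r38 : (L.run inp c1).reg 38 = c.reg 30 + c.reg 5 :=
    (g 38 (by decide)).trans (by simp [hc1, Config.setReg_reg])
  have r28 : (L.run inp c1).reg 28 = c.reg 28 :=
    (g 28 (by decide)).trans (by simp [hc1, Config.setReg_reg])
  have r5 : (L.run inp c1).reg 5 = c.reg 5 :=
    (g 5 (by decide)).trans (by simp [hc1, Config.setReg_reg])
  simp only [run_store, Config.setReg_reg, Config.setMem_mem, r38, r5, r28, if_true,
    Config.setReg_mem]
  norm_num
  refine ⟨fun j hj => ?_, by simpa using hw.ph, fun a ha => ?_⟩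
  · rw [Config.setMem_mem, if_neg (by omega)]; exact H.1 j hj
  · rw [if_neg (by omega)]; exact H.2 a (by omega)

theorem fill_spec (y : ℕ) (c : Config M) (h1 : c.reg 1 = 1) :
    ∀ a, ((fill y).run inp c).mem a =
      if c.reg 53 ≤ a ∧ a < c.reg 53 + c.reg y then 1 else c.mem a := by
  refine run_for (x := 32) (h := 33) (y := y) rfl (by simp [writes, Cmd.target]) c
    (fun i d => ∀ a, d.mem a = if c.reg 53 ≤ a ∧ a < c.reg 53 + i then 1 else c.mem a)
    (by simp [first]) ?_
  rintro i d hi hx hr h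
  have r53 := hr 53 (by simp [writes, Cmd.target])
  have r1 := hr 1 (by simp [writes, Cmd.target])
  intro a
  simp [next, Config.setReg_reg, Config.setMem_mem, r53, hx, h, r1, h1]
  split_ifs <;> first | rfl | omega

theorem read_spec (y : ℕ) (c : Config M) :
    ∀ a, ((read y).run inp c).mem a =
      if c.reg 53 ≤ a ∧ a < c.reg 53 + c.reg y then inp.getD (c.reg 54 + (a - c.reg 53)) 0
      else c.mem a := by
  refine run_for (x := 32) (h := 33) (y := y) rfl (by simp [writes, Cmd.target]) c
    (fun i d => ∀ a, d.mem a = if c.reg 53 ≤ a ∧ a < c.reg 53 + i then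
      inp.getD (c.reg 54 + (a - c.reg 53)) 0 else c.mem a)
    (by simp [first]) ?_
  rintro i d hi hx hr h
  have r53 := hr 53 (by simp [writes, Cmd.target])
  have r54 := hr 54 (by simp [writes, Cmd.target])
  intro a
  simp only [next, run_seq, run_add, run_input, run_store, Config.setReg_reg, Config.setReg_mem,
    Config.setMem_mem, r53, hx, h, r54]
  norm_num
  by_cases ha : a = c.reg 53 + i
  · subst ha; simp
  · simp only [ha, if_false]
    split_ifs <;> first | rfl | omega

end Prog

/-! ### The layout of the rules in the memory -/

/-- The number of places for rules. -/
abbrev places (n t L : ℕ) : ℕ := L + 2 + n + t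

/-- The rule in the place `r`. -/
def SimState.slot {M : ℕ} (L : ℕ) (A : SimState M) (r : ℕ) : Rule :=
  if r < L - A.gates.length then .idle
  else (A.gates ++ A.elim).getD (r - (L - A.gates.length)) .idle

theorem reduce_replicate_idle (N k : ℕ) (w : Word) :
    reduce N (List.replicate k Rule.idle) w = w := by
  induction k with
  | zero => rfl
  | succ k ih => rw [List.replicate_succ, reduce, List.foldl_cons, Rule.app_idle]; exact ih

/-- The program applies the rules in all places, filled or not. The empty places below the gates and
above the eliminations hold zeros, and a zero rule does nothing. -/
theorem SimState.reduce_slot {M : ℕ} (N L R : ℕ) (A : SimState M) (w : Word)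
    (h1 : A.gates.length ≤ L) (h2 : L + A.elim.length ≤ R) :
    reduce N ((List.range R).map (A.slot L)) w = reduce N (A.gates ++ A.elim) w := by
  have : (List.range R).map (A.slot L) = List.replicate (L - A.gates.length) Rule.idle ++
      (A.gates ++ A.elim) ++ List.replicate (R - (L + A.elim.length)) Rule.idle := by
    refine List.ext_getElem (by simp; omega) fun i hi hi' => ?_
    simp only [List.length_map, List.length_range] at hi
    rw [List.getElem_map, List.getElem_range, SimState.slot]
    split_ifs with h
    · rw [List.getElem_append_left (by simp; omega), List.getElem_append_left (by simpa using h),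
        List.getElem_replicate]
    · by_cases h3 : i - (L - A.gates.length) < (A.gates ++ A.elim).length
      · rw [List.getElem_append_left (by simp at h3 ⊢; omega),
          List.getElem_append_right (by simpa using h)]
        rw [List.getD_eq_getElem _ _ h3]
        simp only [List.length_replicate]
      · rw [List.getElem_append_right (by simp at h3 ⊢; omega), List.getElem_replicate,
          List.getD_eq_default _ _ (by omega)]
  rw [this, reduce_append, reduce_append, reduce_replicate_idle, reduce_replicate_idle]

/-- The registers that do not change after the initialization. -/
structure Consts (n t L : ℕ) {M : ℕ} (c : Config M) : Prop where
  h0 : c.reg 0 = 0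
  h1 : c.reg 1 = 1
  h2 : c.reg 2 = n
  h4 : c.reg 4 = L
  h5 : c.reg 5 = total n t
  h6 : c.reg 6 = 2 * n + 2
  h7 : c.reg 7 = 2 * t + 2
  h8 : c.reg 8 = places n t L
  h9 : c.reg 9 = 2 * total n t + 1
  h14 : c.reg 14 = 2 * t + 3
  h15 : c.reg 15 = 2 * n + 4

theorem Consts.of_eq {n t L M : ℕ} {c c' : Config M} (h : Consts n t L c)
    (he : ∀ x ∈ [0, 1, 2, 4, 5, 6, 7, 8, 9, 14, 15], c'.reg x = c.reg x) : Consts n t L c' := by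
  obtain ⟨h0, h1, h2, h4, h5, h6, h7, h8, h9, h14, h15⟩ := h
  constructor <;> (rw [he _ (by decide)]; assumption)

/-- The memory holds the rules. -/
def HasRules (n t L : ℕ) (m : ℕ → ℕ) (R : ℕ → Rule) : Prop :=
  ∀ r < places n t L, HasRule (total n t) m (total n t + r * (2 * total n t + 1)) (R r)

/-- The configuration represents the state `A` of the simulation. -/
structure Represents (n t L : ℕ) (A : SimState (2 * t + 2)) (c : Config (2 * t + 2)) : Prop where
  consts : Consts n t L c
  gates : A.gates.length ≤ L
  r22 : c.reg 22 = total n t + (L - A.gates.length) * (2 * total n t + 1)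
  r23 : c.reg 23 = total n t + (L + A.elim.length) * (2 * total n t + 1)
  r24 : c.reg 24 = 5 + t * (2 * t + 3) + A.gates.length * (2 * n + 4)
  r25 : c.reg 25 = 5 + A.used * (2 * t + 3)
  r26 : c.reg 26 = 2 * n + 2 + 2 * A.used
  rules : HasRules n t L c.mem (A.slot L)
  out : c.out = A.out
  hist : c.hist = A.hist

theorem HasRules.mono {n t L : ℕ} {m m' : ℕ → ℕ} {R : ℕ → Rule} (h : HasRules n t L m R)
    (hm : ∀ a, total n t ≤ a → m' a = m a) : HasRules n t L m' R :=
  fun r hr => (h r hr).mono fun a ha _ => hm a (by omega)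

/-- The blocks of length 2N + 1 are disjoint, so a write inside block `k` cannot affect another
rule. -/
theorem HasRules.update {n t L : ℕ} {m m' : ℕ → ℕ} {R R' : ℕ → Rule} (h : HasRules n t L m R)
    {k p : ℕ} (hp : p = total n t + k * (2 * total n t + 1))
    (hm : ∀ a, total n t ≤ a → a < p ∨ p + total n t + total n t < a → m' a = m a)
    (hk : HasRule (total n t) m' p (R' k)) (hR : ∀ r < places n t L, r ≠ k → R' r = R r) :
    HasRules n t L m' R' := by
  intro r hr
  by_cases hrk : r = k
  · subst hrk; rw [← hp]; exact hk
  · rw [hR r hr hrk]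
    refine (h r hr).mono fun a h1 h2 => hm a (by omega) ?_
    rcases lt_or_gt_of_ne hrk with h3 | h3
    · have := Nat.mul_le_mul_right (2 * total n t + 1) (Nat.succ_le_of_lt h3)
      rw [Nat.succ_mul] at this
      left; omega
    · have := Nat.mul_le_mul_right (2 * total n t + 1) (Nat.succ_le_of_lt h3)
      rw [Nat.succ_mul] at this
      right; omega

/-! ### Finding the outcome of one string -/

namespace Prog

/-- Reduce the current string, find its pivot and its sign (register 50). -/
def prepare : Prog :=
  rules ;; pivot ;; half ;;
  op (.const 50 0) ;; op (.sub 39 28 43) ;; op (.sub 40 43 28) ;; op (.add 39 39 40) ;;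
  ite 39 (op (.const 50 1)) skip ;; op (.const 51 0)

/-- Toss a coin or measure, depending on the kind of the pivot. -/
def random : Prog :=
  ite 45 (op (.sub 52 45 1) ;; ite 52 (op (.coin 51)) (op (.measure 51 6))) skip

/-- Compute the outcome (register 27) and record it as a new rule. -/
def record : Prog :=
  op (.sub 39 51 50) ;; op (.sub 40 50 51) ;; op (.add 27 39 40) ;;
  op (.add 28 28 27) ;; op (.add 28 28 27) ;; mod4 28 ;;
  op (.add 30 23 0) ;; copy ;;
  ite 45 (op (.add 39 23 46) ;; op (.store 39 1) ;; op (.add 39 23 47) ;; op (.store 39 1)) skip ;;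
  op (.add 23 23 9)

/-- Find the outcome of the current string. -/
def measure : Prog := prepare ;; random ;; record

variable {M : ℕ} {inp : List ℕ}

theorem den_seq_left {P Q : Prog} (hP : P.all Cmd.det) (c : Config M) :
    (P ;; Q).den inp c = Q.den inp (P.run inp c) := by
  simp [den, den_eq_run hP]

theorem den_seq_right {P Q : Prog} (hQ : Q.all Cmd.det) (c : Config M) :
    (P ;; Q).den inp c = (P.den inp c).map (Q.run inp) := by
  simp only [den, List.map_eq_flatMap]
  exact List.flatMap_congr fun d _ => den_eq_run hQ d

/-- The registers 45, 46, 47 describe the pivot of `b`. -/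
structure HasPivot (n t : ℕ) (c : Config M) (b : ℕ → ZMod 2) : Prop where
  coin : ∀ j, nPivot n b = some j → c.reg 45 = 2 ∧ c.reg 46 = 2 * j ∧ c.reg 47 = 2 * j + 1
  meas : nPivot n b = none → ∀ j, tPivot n t b = some j →
    c.reg 45 = 1 ∧ c.reg 46 = 2 * n + 2 + j ∧ c.reg 47 = 2 * n + 2 + j
  none : nPivot n b = none → tPivot n t b = none → c.reg 45 = 0

theorem HasPivot.of_eq {n t : ℕ} {c c' : Config M} {b : ℕ → ZMod 2} (h : HasPivot n t c b)
    (he : ∀ x ∈ [45, 46, 47], c'.reg x = c.reg x) : HasPivot n t c' b := by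
  have h1 := he 45 (by decide)
  have h2 := he 46 (by decide)
  have h3 := he 47 (by decide)
  constructor
  · rw [h1, h2, h3]; exact h.coin
  · rw [h1, h2, h3]; exact h.meas
  · rw [h1]; exact h.none

theorem prepare_spec {n t L : ℕ} (c : Config M) (hc : Consts n t L c) {w : Word} {R : ℕ → Rule}
    (hw : HasWord (total n t) c w) (hR : HasRules n t L c.mem R) {w' : Word}
    (hw' : w' = reduce (total n t) ((List.range (places n t L)).map R) w) :
    HasWord (total n t) (prepare.run inp c) w' ∧
    (∀ a, total n t ≤ a → (prepare.run inp c).mem a = c.mem a) ∧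
    HasPivot n t (prepare.run inp c) w'.b ∧
    (prepare.run inp c).reg 50 = (signBit (total n t) w').toNat ∧
    (prepare.run inp c).reg 51 = 0 := by
  obtain ⟨a1, a2⟩ := rules_spec (inp := inp) c hc.h0 hc.h1 (w := w) (R := R)
    (by rw [hc.h5]; exact hw) (by rw [hc.h5, hc.h8, hc.h9]; exact hR)
  rw [hc.h5, hc.h8, ← hw'] at a1
  rw [hc.h5] at a2
  have c1 : Consts n t L (rules.run inp c) := hc.of_eq fun x hx =>
    run_reg (by decide) (by revert x; decide) c
  rw [prepare, run_seq]
  generalize rules.run inp c = d1 at *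
  obtain ⟨b1, b2, b3⟩ := pivot_spec (inp := inp) d1 c1.h0 c1.h1 c1.h2 c1.h6 c1.h7 a1.b
  have b4 : (pivot.run inp d1).mem = d1.mem := run_mem (by decide) d1
  have b5 : (pivot.run inp d1).reg 28 = d1.reg 28 := run_reg (by decide) (by decide) d1
  have c2 : Consts n t L (pivot.run inp d1) := c1.of_eq fun x hx =>
    run_reg (by decide) (by revert x; decide) d1
  have e2 : HasPivot n t (pivot.run inp d1) w'.b := ⟨b1, b2, b3⟩
  rw [run_seq]
  generalize pivot.run inp d1 = d2 at *
  obtain ⟨f1, f2⟩ := half_spec (inp := inp) d2 c2.h1 (b := w'.b)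
    (by rw [c2.h5, b4]; exact a1.b)
  have g : ∀ x, x ∉ half.writes → (half.run inp d2).reg x = d2.reg x := fun x hx =>
    run_reg (by decide) hx d2
  rw [c2.h5] at f1
  have e3 : HasPivot n t (half.run inp d2) w'.b := e2.of_eq fun x hx => g x (by revert x; decide)
  have g28 := g 28 (by decide)
  rw [run_seq]
  generalize half.run inp d2 = d3 at *
  have h28 : d3.reg 28 = w'.ph.val := by rw [g28, b5, a1.ph]
  have hmem : d3.mem = d1.mem := by rw [f2, b4]
  -- The phase is compared with half the weight through the absolute difference; any nonzero
  -- difference counts as the sign -1. For the involutions measured here the only possible nonzero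
  -- difference is 2, see `op_eq_signBit`.
  have hsig : d3.reg 28 - d3.reg 43 + (d3.reg 43 - d3.reg 28) = 0 ↔
      signBit (total n t) w' = false := by
    rw [h28, f1, signBit, decide_eq_false_iff_not, not_not,
      ← (ZMod.val_injective 4).eq_iff (a := w'.ph)]
    omega
  by_cases hs : signBit (total n t) w' = false
  · have h0 := hsig.2 hs
    simp only [run_seq, run_const, run_sub, run_add, run_ite, Config.setReg_reg]
    norm_num
    simp only [show d3.reg 28 - d3.reg 43 = 0 by omega, show d3.reg 43 - d3.reg 28 = 0 by omega]
    norm_num [hs, Config.setReg_reg]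
    refine ⟨⟨?_, ?_⟩, ?_, e3.of_eq ?_⟩
    · simpa [hmem] using a1.b
    · simpa [Config.setReg_reg] using h28
    · intro a ha; rw [hmem]; exact a2 a ha
    · simp [Config.setReg_reg]
  · have h0 := mt hsig.1 hs
    simp only [Bool.not_eq_false] at hs
    simp only [run_seq, run_const, run_sub, run_add, run_ite, Config.setReg_reg]
    norm_num
    have h1 : d3.reg 28 - d3.reg 43 = 0 → ¬d3.reg 43 - d3.reg 28 = 0 := by omega
    norm_num [hs, Config.setReg_reg]
    simp only [if_pos h1]
    refine ⟨⟨?_, ?_⟩, ?_, e3.of_eq ?_, ?_⟩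
    · simpa [hmem] using a1.b
    · simpa [Config.setReg_reg] using h28
    · intro a ha; simp only [Config.setReg_mem]; rw [hmem]; exact a2 a ha
    · simp [Config.setReg_reg]
    · simp [Config.setReg_reg]

theorem mod4_flip (a : ZMod 4) (c : Bool) :
    (if 3 < a.val + c.toNat + c.toNat then a.val + c.toNat + c.toNat - 4
      else a.val + c.toNat + c.toNat) = (a + if c then 2 else 0).val := by
  revert a c; decide

theorem xor_toNat (a b : Bool) : a.toNat - b.toNat + (b.toNat - a.toNat) = (xor a b).toNat := by
  revert a b; decide

/-- Eliminations fill the places from `L` upwards. That the next place is still idle matters for the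
program: it writes only the ones of a pivot set and relies on zeros elsewhere. -/
theorem slot_elim {A : SimState M} {L : ℕ} (hg : A.gates.length ≤ L) (r : Rule) {B : SimState M}
    (hB : B.gates = A.gates) (hB' : B.elim = A.elim ++ [r]) :
    B.slot L (L + A.elim.length) = r ∧ A.slot L (L + A.elim.length) = .idle ∧
    ∀ k, k ≠ L + A.elim.length → B.slot L k = A.slot L k := by
  refine ⟨?_, ?_, fun k hk => ?_⟩
  · rw [SimState.slot, hB, hB', if_neg (by omega),
      show L + A.elim.length - (L - A.gates.length) = (A.gates ++ A.elim).length by simp; omega,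
      ← List.append_assoc, List.getD_eq_getElem _ _ (by simp)]
    simp
  · rw [SimState.slot, if_neg (by omega), List.getD_eq_default _ _ (by simp; omega)]
  · rw [SimState.slot, SimState.slot, hB, hB']
    split_ifs with h
    · rfl
    · rw [← List.append_assoc]
      by_cases h3 : k - (L - A.gates.length) < (A.gates ++ A.elim).length
      · rw [List.getD_append _ _ _ _ h3]
      · rw [List.getD_eq_default, List.getD_eq_default]
        · omega
        · simp at h3 ⊢; omega

theorem lastTrue_eq_some {p : ℕ → Prop} [DecidablePred p] {k j : ℕ}
    (h : lastTrue p k = some j) : j < k ∧ p j := by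
  induction k with
  | zero => simp [lastTrue] at h
  | succ k ih =>
    rw [lastTrue] at h
    split_ifs at h with hk
    · obtain rfl := Option.some.inj h
      exact ⟨by omega, hk⟩
    · exact ⟨by have := (ih h).1; omega, (ih h).2⟩

theorem lastTrue_eq_none {p : ℕ → Prop} [DecidablePred p] {k : ℕ} :
    lastTrue p k = none ↔ ∀ j < k, ¬p j := by
  induction k with
  | zero => simp [lastTrue]
  | succ k ih =>
    rw [lastTrue]
    split_ifs with hk
    · simp only [false_iff]
      exact fun h => h k (by omega) hk
    · rw [ih]
      refine ⟨fun h j hj => ?_, fun h j hj => h j (by omega)⟩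
      rcases Nat.lt_succ_iff_lt_or_eq.1 hj with h1 | rfl
      exacts [h j h1, hk]

/-- A pivot in `R_t` is stored as two equal positions, so that the same pair of store commands
serves both kinds of pivot. -/
theorem HasPivot.cases {n t : ℕ} {c : Config M} {b : ℕ → ZMod 2} (h : HasPivot n t c b) :
    (c.reg 45 = 0 ∧ pivotSet n t b = ∅) ∨
    (c.reg 45 ≠ 0 ∧ pivotSet n t b = {c.reg 46, c.reg 47} ∧ c.reg 46 < total n t ∧
      c.reg 47 < total n t) := by
  cases h1 : nPivot n b with
  | some j =>
    obtain ⟨e1, e2, e3⟩ := h.coin j h1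
    have := (lastTrue_eq_some h1).1
    right
    simp only [pivotSet, h1, e1, e2, e3]
    refine ⟨by simp, trivial, by simp only [total]; omega, by simp only [total]; omega⟩
  | none =>
    cases h2 : tPivot n t b with
    | some j =>
      obtain ⟨e1, e2, e3⟩ := h.meas h1 j h2
      have := (lastTrue_eq_some h2).1
      right
      simp only [pivotSet, h1, h2, e1, e2, e3]
      refine ⟨by simp, by simp, by simp only [total]; omega, by simp only [total]; omega⟩
    | none =>
      left
      simp [pivotSet, h1, h2, h.none h1 h2]

/-- The event `e` happens on the machine before `record` is executed. The hypothesis therefore has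
the history already extended while the list of rules is still the old one. -/
theorem record_spec {n t L : ℕ} (A : SimState (2 * t + 2)) (e : List (RunEvent (2 * t + 2)))
    (c : Config (2 * t + 2)) (hc : Represents n t L { A with hist := A.hist ++ e } c)
    (hl : L + A.elim.length < places n t L) {w : Word} (hw : HasWord (total n t) c w)
    (hp : HasPivot n t c w.b) (h50 : c.reg 50 = (signBit (total n t) w).toNat) {d : Bool}
    (h51 : c.reg 51 = d.toNat) :
    Represents n t L (A.record (n := n) w d e).2 (record.run inp c) ∧
    (record.run inp c).reg 27 = (A.record (n := n) w d e).1.toNat := by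
  have hframe : ∀ x, x ∉ record.writes → (record.run inp c).reg x = c.reg x := fun x hx =>
    run_reg (by decide) hx c
  have hcon : Consts n t L (record.run inp c) := hc.consts.of_eq fun x hx =>
    hframe x (by revert x; decide)
  have hout : (record.run inp c).out = c.out := run_out (by decide) c
  have hhist : (record.run inp c).hist = c.hist := run_hist (by decide) c
  set o := xor d (signBit (total n t) w) with ho
  -- the configuration before `copy`
  set c1 := (op (.add 30 23 0)).run inp ((mod4 28).run inp ((op (.add 28 28 27)).run inp
    ((op (.add 28 28 27)).run inp ((op (.add 27 39 40)).run inp ((op (.sub 40 50 51)).run inp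
    ((op (.sub 39 51 50)).run inp c)))))) with hc1
  have m1 : c1.mem = c.mem := by simp [hc1, mod4_mem]
  have g1 : ∀ x, x ∉ [27, 28, 30, 39, 40] → x ∉ (mod4 28).writes → c1.reg x = c.reg x := by
    intro x hx hx'
    simp only [List.mem_cons, not_or, List.not_mem_nil] at hx
    simp only [hc1, run_add, run_sub, Config.setReg_reg, run_reg (by decide : (mod4 28).all _) hx',
      hx, if_false]
  have e30 : c1.reg 30 = c.reg 23 := by
    have e1 : ∀ d : Config (2 * t + 2), ((mod4 28).run inp d).reg 23 = d.reg 23 :=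
      run_reg (by decide) (by decide)
    have e2 : ∀ d : Config (2 * t + 2), ((mod4 28).run inp d).reg 0 = d.reg 0 :=
      run_reg (by decide) (by decide)
    simp [hc1, Config.setReg_reg, e1, e2, hc.consts.h0]
  have e27 : c1.reg 27 = o.toNat := by
    have e1 : ∀ d : Config (2 * t + 2), ((mod4 28).run inp d).reg 27 = d.reg 27 :=
      run_reg (by decide) (by decide)
    simp [hc1, Config.setReg_reg, e1, h50, h51, xor_toNat, ho]
  have w1 : HasWord (total n t) c1 (w.flip o) := by
    refine ⟨by rw [m1]; exact hw.b, ?_⟩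
    simp only [hc1, run_add, run_sub, Config.setReg_reg, mod4_reg 28 (by decide), h50, h51, hw.ph]
    norm_num [xor_toNat, ← ho]
    rw [Word.flip, ← mod4_flip]
  have h5 : c1.reg 5 = total n t := (g1 5 (by decide) (by decide)).trans hc.consts.h5
  have h23 : c1.reg 23 = c.reg 23 := g1 23 (by decide) (by decide)
  obtain ⟨b1, b2, b3⟩ := copy_spec (inp := inp) c1
    (w := w.flip o) (by rw [h5]; exact w1)
  rw [h5, e30] at b1 b2 b3
  rw [m1] at b3
  have g2 : ∀ x, x ∉ copy.writes → (copy.run inp c1).reg x = c1.reg x := fun x hx =>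
    run_reg (by decide) hx c1
  have hrun : record.run inp c = (op (.add 23 23 9)).run inp
      ((ite 45 (op (.add 39 23 46) ;; op (.store 39 1) ;; op (.add 39 23 47) ;; op (.store 39 1))
        skip).run inp (copy.run inp c1)) := rfl
  have k23 := (g2 23 (by decide)).trans h23
  have k1 := ((g2 1 (by decide)).trans (g1 1 (by decide) (by decide))).trans hc.consts.h1
  have k45 := (g2 45 (by decide)).trans (g1 45 (by decide) (by decide))
  have k46 := (g2 46 (by decide)).trans (g1 46 (by decide) (by decide))
  have k47 := (g2 47 (by decide)).trans (g1 47 (by decide) (by decide))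
  have k9 := ((g2 9 (by decide)).trans (g1 9 (by decide) (by decide))).trans hc.consts.h9
  have k27 := (g2 27 (by decide)).trans e27
  generalize copy.run inp c1 = c2 at *
  have hmem : ∀ a, (record.run inp c).mem a =
      if a ∈ (pivotSet n t w.b).image (c.reg 23 + ·) then 1 else c2.mem a := by
    intro a
    rw [hrun]
    rcases hp.cases with ⟨h45, hps⟩ | ⟨h45, hps, h46, h47⟩
    · simp [run_ite, k45, h45, hps]
    · simp [run_ite, k45, h45, hps, k46, k47, k23, k1, Config.setReg_reg, Config.setMem_mem]
      split_ifs <;> simp_all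
  have hlt : ∀ x ∈ pivotSet n t w.b, x < total n t := by
    rcases hp.cases with ⟨h45, hps⟩ | ⟨h45, hps, h46, h47⟩ <;> rw [hps]
    · simp
    · simp [h46, h47]
  obtain ⟨s1, s2, s3⟩ := slot_elim (A := A) (L := L) hc.gates
    ⟨ind (pivotSet n t w.b), w.flip o⟩ (B := (A.record (n := n) w d e).2) rfl rfl
  have s2' : SimState.slot L ({ A with hist := A.hist ++ e } : SimState (2 * t + 2))
    (L + A.elim.length) = Rule.idle := s2
  -- The fresh place contains zeros, so the bits of `q` outside the pivot set are correct without
  -- being written.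
  have hidle := hc.rules _ hl
  rw [s2', ← hc.r23] at hidle
  refine ⟨⟨hcon, hc.gates, ?_, ?_, ?_, ?_, ?_, ?_, ?_, ?_⟩, ?_⟩
  · rw [hframe 22 (by decide), hc.r22]; rfl
  · rw [hrun]
    rcases hp.cases with ⟨h45, hps⟩ | ⟨h45, hps, h46, h47⟩
    · simp [run_ite, k45, h45, Config.setReg_reg, k23, k9, hc.r23, SimState.record]
      ring
    · simp [run_ite, k45, h45, Config.setReg_reg, k23, k9, hc.r23, SimState.record]
      ring
  · rw [hframe 24 (by decide), hc.r24]; rfl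
  · rw [hframe 25 (by decide), hc.r25]; rfl
  · rw [hframe 26 (by decide), hc.r26]; rfl
  · refine hc.rules.update (k := L + A.elim.length) (p := c.reg 23) hc.r23 ?_ ?_ ?_
    · intro a ha hap
      rw [hmem, if_neg, b3 a (by omega)]
      intro h
      obtain ⟨x, hx, rfl⟩ := Finset.mem_image.1 h
      have := hlt x hx
      omega
    · rw [s1]
      have hno : ∀ a, c.reg 23 + total n t ≤ a →
          a ∉ (pivotSet n t w.b).image (c.reg 23 + ·) := by
        intro a ha h
        obtain ⟨x, hx, rfl⟩ := Finset.mem_image.1 h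
        have := hlt x hx
        omega
      refine ⟨fun j hj => ?_, fun j hj => ?_, ?_⟩
      · rw [hmem]
        change _ = (if j ∈ pivotSet n t w.b then 1 else 0 : ZMod 2).val
        have hj' := hidle.q j hj
        by_cases hjp : j ∈ pivotSet n t w.b
        · rw [if_pos (Finset.mem_image_of_mem _ hjp), if_pos hjp]; rfl
        · rw [if_neg (by simpa using hjp), if_neg hjp, b3 _ (by omega)]
          simpa [Rule.idle] using hj'
      · rw [hmem, if_neg (hno _ (by omega))]; exact b1 j hj
      · rw [hmem, if_neg (hno _ (by omega))]; exact b2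
    · intro r _ hr
      exact s3 r hr
  · rw [hout, hc.out]; rfl
  · rw [hhist, hc.hist]; rfl
  · rw [hrun]
    change _ = o.toNat
    rcases hp.cases with ⟨h45, hps⟩ | ⟨h45, hps, h46, h47⟩
    · simp [run_ite, k45, h45, Config.setReg_reg, k27]
    · simp [run_ite, k45, h45, Config.setReg_reg, k27]

end Prog

theorem Represents.of_frame {n t L : ℕ} {A : SimState (2 * t + 2)} {c c' : Config (2 * t + 2)}
    (hc : Represents n t L A c)
    (hr : ∀ x ∈ [0, 1, 2, 4, 5, 6, 7, 8, 9, 14, 15, 22, 23, 24, 25, 26], c'.reg x = c.reg x)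
    (hm : ∀ a, total n t ≤ a → c'.mem a = c.mem a) (ho : c'.out = c.out)
    (hh : c'.hist = c.hist) : Represents n t L A c' := by
  refine ⟨hc.consts.of_eq fun x hx => hr x (by revert x; decide), hc.gates, ?_, ?_, ?_, ?_, ?_,
    hc.rules.mono hm, by rw [ho, hc.out], by rw [hh, hc.hist]⟩
  · rw [hr 22 (by decide), hc.r22]
  · rw [hr 23 (by decide), hc.r23]
  · rw [hr 24 (by decide), hc.r24]
  · rw [hr 25 (by decide), hc.r25]
  · rw [hr 26 (by decide), hc.r26]

namespace Prog

variable {M : ℕ} {inp : List ℕ}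

/-- Both lists have the outcome `false` before `true`, so they can be matched entry by entry. The
clause on unwritten registers preserves the data of the gate across the measurement. -/
theorem measure_spec {n t L : ℕ} (A : SimState (2 * t + 2)) (c : Config (2 * t + 2))
    (hc : Represents n t L A c) (hl : L + A.elim.length < places n t L) {w : Word}
    (hw : HasWord (total n t) c w) :
    List.Forall₂ (fun c' x => Represents n t L x.2 c' ∧ c'.reg 27 = x.1.toNat ∧
      ∀ x ∉ measure.writes, c'.reg x = c.reg x) (measure.den inp c) (A.measure n w) := by
  have hw' := SimState.reduce_slot (total n t) L (places n t L) A w hc.gates hl.le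
  obtain ⟨h1, h2, h3, h4, h5⟩ := prepare_spec (inp := inp) c hc.consts hw hc.rules hw'.symm
  have h6 : Represents n t L A (prepare.run inp c) := Represents.of_frame hc
    (fun x hx => run_reg (by decide) (by revert x; decide) c) h2 (run_out (by decide) c)
    (run_hist (by decide) c)
  have h7 : ∀ x ∉ measure.writes, (prepare.run inp c).reg x = c.reg x := fun x hx =>
    run_reg (by decide) (fun h => hx (List.mem_append_left _ h)) c
  rw [measure, den_seq_left (by decide), den_seq_right (by decide), SimState.measure]
  generalize reduce (total n t) (A.gates ++ A.elim) w = w' at *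
  generalize prepare.run inp c = c1 at *
  -- The cases of a coin, a measurement and a certain outcome differ only in the bit `d` and the
  -- recorded events `e`; what follows is common to them.
  have key : ∀ (d : Bool) (e : List (RunEvent (2 * t + 2))) (c2 : Config (2 * t + 2)),
      (∀ x ∉ [51, 52, 60], c2.reg x = c1.reg x) → c2.mem = c1.mem → c2.out = c1.out →
      c2.reg 51 = d.toNat → c2.hist = c1.hist ++ e →
      (fun (c' : Config (2 * t + 2)) (x : Bool × SimState (2 * t + 2)) =>
        Represents n t L x.2 c' ∧ c'.reg 27 = x.1.toNat ∧
        ∀ x ∉ measure.writes, c'.reg x = c.reg x) (record.run inp c2)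
        (A.record (n := n) w' d e) := by
    intro d e c2 g1 g2 g3 g4 g5
    have hc2 : Represents n t L { A with hist := A.hist ++ e } c2 := by
      have : Represents n t L { A with hist := A.hist ++ e } { c1 with hist := A.hist ++ e } :=
        ⟨h6.consts.of_eq fun _ _ => rfl, h6.gates, h6.r22, h6.r23, h6.r24, h6.r25, h6.r26, h6.rules,
          h6.out, rfl⟩
      exact Represents.of_frame this (fun x hx => g1 x (by revert x; decide))
        (fun a _ => by rw [g2]) g3 (by rw [g5, h6.hist])
    obtain ⟨e1, e2⟩ := record_spec (inp := inp) A e c2 hc2 hl (w := w') (d := d)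
      ⟨by rw [g2]; exact h1.b, by rw [g1 _ (by decide), h1.ph]⟩
      (h3.of_eq fun x hx => g1 x (by revert x; decide)) (by rw [g1 _ (by decide), h4]) g4
    refine ⟨e1, e2, fun x hx => ?_⟩
    rw [run_reg (by decide) (fun h => hx (by simp [measure, writes, h])) c2, g1, h7 x hx]
    intro h
    exact hx ((by decide : ∀ x ∈ [51, 52, 60], x ∈ measure.writes) x h)
  rw [SimState.decide]
  cases hn : nPivot n w'.b with
  | some j =>
    have e45 := (h3.coin j hn).1
    rw [if_pos (by simp)]
    simp only [random, den, e45, Config.push, Config.step]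
    norm_num [e45, h6.consts.h1, Function.update_apply]
    refine ⟨key false _ _ ?_ rfl rfl ?_ rfl, key true _ _ ?_ rfl rfl ?_ rfl⟩
    all_goals simp +contextual
  | none =>
    rw [if_neg (by simp)]
    cases ht : tPivot n t w'.b with
    | some j =>
      have e45 := (h3.meas hn j ht).1
      have e6 := h6.consts.h6
      -- Register 6 holds 2n + 2, the position where `R_t` begins in the current string, so the
      -- machine measures exactly the part of the string on `R_t`.
      have hS : (Finset.univ.filter fun j : Fin (2 * t + 2) => ¬c1.mem (2 * n + 2 + j) = 0) =
          tSupport n t w'.b := by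
        ext j
        have := h1.b (2 * n + 2 + j) (by simp only [total]; omega)
        rw [zero_add] at this
        simp [tSupport, this]
      rw [if_pos (by simp)]
      simp only [random, den, e45, Config.push, Config.step]
      norm_num [e45, h6.consts.h1, e6, hS, Function.update_apply]
      refine ⟨key false _ _ ?_ rfl rfl ?_ rfl, key true _ _ ?_ rfl rfl ?_ rfl⟩
      all_goals simp +contextual
    | none =>
      have e45 := h3.none hn ht
      rw [if_neg (by simp)]
      simp only [random, den, e45, skip, Config.push, Config.step]
      norm_num
      refine key false [] _ ?_ rfl rfl ?_ (by simp)
      · simp +contextual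
      · simpa [Function.update_apply] using h5

end Prog

/-- Gates fill the places from `L - 1` downwards, since a string has to be pulled back through the
newest gate first and the program applies the rules in ascending order. -/
theorem SimState.slot_gate {M L : ℕ} {A B : SimState M} (r : Rule) (hl : A.gates.length < L)
    (hB : B.gates = r :: A.gates) (hB' : B.elim = A.elim) :
    B.slot L (L - A.gates.length - 1) = r ∧ A.slot L (L - A.gates.length - 1) = .idle ∧
    ∀ k, k ≠ L - A.gates.length - 1 → B.slot L k = A.slot L k := by
  refine ⟨?_, ?_, fun k hk => ?_⟩
  · rw [SimState.slot, hB, List.length_cons, if_neg (by omega),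
      show L - A.gates.length - 1 - (L - (A.gates.length + 1)) = 0 by omega]
    rfl
  · rw [SimState.slot, if_pos (by omega)]
  · rw [SimState.slot, SimState.slot, hB, hB', List.length_cons]
    split_ifs with h1 h2 h2
    · rfl
    · omega
    · omega
    · rw [show k - (L - (A.gates.length + 1)) = k - (L - A.gates.length) + 1 by omega]
      rfl

theorem Represents.pushGate {n t L : ℕ} {A B : SimState (2 * t + 2)} {c c' : Config (2 * t + 2)}
    (hc : Represents n t L A c) (r : Rule) (hl : A.gates.length < L)
    (hBg : B.gates = r :: A.gates) (hBe : B.elim = A.elim) (hBo : B.out = A.out)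
    (hBh : B.hist = A.hist)
    (hr : ∀ x ∈ [0, 1, 2, 4, 5, 6, 7, 8, 9, 14, 15, 23], c'.reg x = c.reg x)
    (h22 : c'.reg 22 = c.reg 22 - (2 * total n t + 1)) (h24 : c'.reg 24 = c.reg 24 + (2 * n + 4))
    (h25 : c'.reg 25 = 5 + B.used * (2 * t + 3)) (h26 : c'.reg 26 = 2 * n + 2 + 2 * B.used)
    (hrule : HasRule (total n t) c'.mem (c.reg 22 - (2 * total n t + 1)) r)
    (hm : ∀ a, total n t ≤ a → a < c.reg 22 - (2 * total n t + 1) ∨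
      c.reg 22 - (2 * total n t + 1) + total n t + total n t < a → c'.mem a = c.mem a)
    (ho : c'.out = c.out) (hh : c'.hist = c.hist) : Represents n t L B c' := by
  have hp : c.reg 22 - (2 * total n t + 1) =
      total n t + (L - A.gates.length - 1) * (2 * total n t + 1) := by
    obtain ⟨k, hk⟩ : ∃ k, L - A.gates.length = k + 1 := ⟨L - A.gates.length - 1, by omega⟩
    rw [hc.r22, hk, Nat.add_sub_cancel, Nat.succ_mul]
    omega
  obtain ⟨s1, s2, s3⟩ := SimState.slot_gate r hl hBg hBe
  refine ⟨hc.consts.of_eq fun x hx => hr x (by revert x; decide), ?_, ?_, ?_, ?_, h25, h26, ?_, ?_,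
    ?_⟩
  · rw [hBg, List.length_cons]; omega
  · rw [h22, hp, hBg, List.length_cons]
    rfl
  · rw [hr 23 (by decide), hc.r23, hBe]
  · rw [h24, hc.r24, hBg, List.length_cons]; ring
  · refine hc.rules.update hp hm (by rw [s1]; exact hrule) fun k _ hk => s3 k hk
  · rw [ho, hc.out, hBo]
  · rw [hh, hc.hist, hBh]

/-! ### The program for a braid -/

namespace Prog

/-- Make the bits of the current string those of the input from the address in register 54 on,
`reg y` many, from the position `reg o` on. -/
def load (y o : ℕ) : Prog := clear ;; op (.add 53 o 0) ;; read y ;; half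

/-- Process a braid. -/
def braid : Prog :=
  op (.sub 22 22 9) ;; op (.const 39 2) ;; op (.add 54 24 39) ;; load 6 0 ;;
  op (.add 30 22 0) ;; copyBits ;;
  op (.add 39 24 1) ;; op (.input 57 39) ;; op (.add 28 43 1) ;; op (.add 28 28 57) ;;
  op (.add 28 28 57) ;; mod4 28 ;; copy ;; op (.add 24 24 15)

variable {M : ℕ} {inp : List ℕ}

theorem load_spec {n t L m : ℕ} (y o : ℕ) (c : Config M) (hc : Consts n t L c)
    (hy : (y = 6 ∧ o = 0) ∨ (y = 7 ∧ o = 6)) (hm : c.reg y = m) (hom : c.reg o + m ≤ total n t)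
    (S : Finset (Fin m))
    (hS : ∀ j : Fin m, inp.getD (c.reg 54 + j) 0 = if j ∈ S then 1 else 0) :
    HasBits (total n t) ((load y o).run inp c).mem 0 (shiftInd (c.reg o) S) ∧
    ((load y o).run inp c).reg 43 = (halfCount (total n t) (shiftInd (c.reg o) S) : ZMod 4).val ∧
    ∀ a, total n t ≤ a → ((load y o).run inp c).mem a = c.mem a := by
  obtain ⟨a1, a2⟩ := clear_spec (inp := inp) c
  have g1 : ∀ x, x ∉ clear.writes → (clear.run inp c).reg x = c.reg x := fun x hx =>
    run_reg (by decide) hx c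
  have k1 := g1 1 (by decide)
  have k0 := g1 0 (by decide)
  have k5 := g1 5 (by decide)
  have k54 := g1 54 (by decide)
  have ky : (clear.run inp c).reg y = c.reg y := g1 y (by
    rcases hy with ⟨rfl, rfl⟩ | ⟨rfl, rfl⟩ <;> decide)
  have ko : (clear.run inp c).reg o = c.reg o := g1 o (by
    rcases hy with ⟨rfl, rfl⟩ | ⟨rfl, rfl⟩ <;> decide)
  rw [hc.h5] at a1 a2
  simp only [load, run_seq, run_add]
  generalize clear.run inp c = c1 at *
  set c2 := c1.setReg 53 (c1.reg o + c1.reg 0) with hc2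
  have hy53 : y ≠ 53 := by rcases hy with ⟨rfl, rfl⟩ | ⟨rfl, rfl⟩ <;> decide
  have h2 := read_spec (inp := inp) y c2
  have e53 : c2.reg 53 = c.reg o := by simp [hc2, Config.setReg_reg, ko, k0, hc.h0]
  have e54 : c2.reg 54 = c.reg 54 := by simp [hc2, Config.setReg_reg, k54]
  have ey : c2.reg y = m := by simp [hc2, Config.setReg_reg, ky, hy53, hm]
  have e5 : ((read y).run inp c2).reg 5 = total n t := by
    rw [run_reg rfl (by simp [read, writes, Cmd.target])]
    simp [hc2, Config.setReg_reg, k5, hc.h5]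
  have e1 : ((read y).run inp c2).reg 1 = 1 := by
    rw [run_reg rfl (by simp [read, writes, Cmd.target])]
    simp [hc2, Config.setReg_reg, k1, hc.h1]
  rw [e53, e54, ey] at h2
  have hbits : HasBits (total n t) ((read y).run inp c2).mem 0 (shiftInd (c.reg o) S) := by
    intro j hj
    rw [zero_add, h2]
    split_ifs with h
    · have := hS ⟨j - c.reg o, by omega⟩
      rw [this, shiftInd, ind]
      have h3 : ((⟨j - c.reg o, by omega⟩ : Fin m) ∈ S) ↔
          j ∈ S.image fun x : Fin m => c.reg o + (x : ℕ) := by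
        rw [Finset.mem_image]
        refine ⟨fun h4 => ⟨_, h4, Nat.add_sub_cancel' h.1⟩, ?_⟩
        rintro ⟨x, hx, hxj⟩
        convert hx
        rw [← hxj, Nat.add_sub_cancel_left]
      by_cases h4 : j ∈ S.image fun x : Fin m => c.reg o + (x : ℕ)
      · rw [if_pos (h3.2 h4), if_pos h4]; rfl
      · rw [if_neg (mt h3.1 h4), if_neg h4]; rfl
    · have := a1.b j hj
      rw [zero_add] at this
      rw [hc2, Config.setReg_mem, this, shiftInd, ind, if_neg]
      · rfl
      · intro h3
        obtain ⟨x, hx, rfl⟩ := Finset.mem_image.1 h3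
        have := x.2
        omega
  obtain ⟨b1, b2⟩ := half_spec (inp := inp) ((read y).run inp c2) e1
    (b := shiftInd (c.reg o) S) (by rw [e5]; exact hbits)
  rw [e5] at b1
  refine ⟨by rw [b2]; exact hbits, b1, fun a ha => ?_⟩
  rw [b2, h2, if_neg (by omega)]
  exact a2 a ha

theorem mod4_phase (k : ZMod 4) (c : Bool) :
    (if 3 < k.val + 1 + c.toNat + c.toNat then k.val + 1 + c.toNat + c.toNat - 4
      else k.val + 1 + c.toNat + c.toNat) = (k + 1 + if c then 2 else 0).val := by
  revert k c; decide

theorem braid_spec {n t L : ℕ} (A : SimState (2 * t + 2)) (c : Config (2 * t + 2))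
    (hc : Represents n t L A c) (hl : A.gates.length < L) (inv : Bool)
    (S : Finset (Fin (2 * n + 2))) (hinv : inp.getD (c.reg 24 + 1) 0 = inv.toNat)
    (hS : ∀ j : Fin (2 * n + 2), inp.getD (c.reg 24 + 2 + j) 0 = if j ∈ S then 1 else 0) :
    Represents n t L { A with gates := braidRule n t inv S :: A.gates } (braid.run inp c) := by
  have hcon := hc.consts
  set p := c.reg 22 - (2 * total n t + 1) with hp
  have hpN : total n t ≤ p := by
    have := Nat.le_mul_of_pos_left (2 * total n t + 1) (show 0 < L - A.gates.length by omega)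
    have := hc.r22
    omega
  have hframe : ∀ x, x ∉ braid.writes → (braid.run inp c).reg x = c.reg x := fun x hx =>
    run_reg (by decide) hx c
  set c1 := ((c.setReg 22 p).setReg 39 2).setReg 54 (c.reg 24 + 2) with hc1
  have e1 : braid.run inp c = (op (.add 24 24 15)).run inp (copy.run inp ((mod4 28).run inp
      ((op (.add 28 28 57)).run inp ((op (.add 28 28 57)).run inp ((op (.add 28 43 1)).run inp
      ((op (.input 57 39)).run inp ((op (.add 39 24 1)).run inp (copyBits.run inp
      ((op (.add 30 22 0)).run inp ((load 6 0).run inp c1)))))))))) := by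
    simp only [braid, run_seq, run_sub, run_const, run_add, Config.setReg_reg]
    norm_num
    rw [hc1, hp, hcon.h9]
  have con1 : Consts n t L c1 := hcon.of_eq (by simp [hc1, Config.setReg_reg])
  obtain ⟨a1, a2, a3⟩ := load_spec (inp := inp) 6 0 c1 con1 (by simp) con1.h6
    (by rw [con1.h0]; simp only [total]; omega) S (by
      intro j
      rw [← hS j]
      simp [hc1, Config.setReg_reg])
  rw [con1.h0] at a1 a2
  have g1 : ∀ x, x ∉ (load 6 0).writes → ((load 6 0).run inp c1).reg x = c1.reg x := fun x hx =>
    run_reg (by decide) hx c1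
  have k22 : ((load 6 0).run inp c1).reg 22 = p := (g1 22 (by decide)).trans
    (by simp [hc1, Config.setReg_reg])
  have k24 : ((load 6 0).run inp c1).reg 24 = c.reg 24 := (g1 24 (by decide)).trans
    (by simp [hc1, Config.setReg_reg])
  have con2 : Consts n t L ((load 6 0).run inp c1) := con1.of_eq fun x hx =>
    g1 x (by revert x; decide)
  have m1 : c1.mem = c.mem := rfl
  rw [m1] at a3
  generalize (load 6 0).run inp c1 = c2 at *
  have e3 : (op (.add 30 22 0)).run inp c2 = c2.setReg 30 p := by
    rw [run_add, k22, con2.h0]; rfl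
  rw [e3] at e1
  have con3 : Consts n t L (c2.setReg 30 p) := con2.of_eq (by simp [Config.setReg_reg])
  -- The same bits are written twice: here as the test `q`, later by `copy` as the factor `y`. For
  -- strings of even weight, an odd overlap with the generator of the braid is the same as
  -- anticommuting with it.
  obtain ⟨b1, b2⟩ := copyBits_spec (inp := inp) (c2.setReg 30 p)
    (by rw [con3.h5]; simpa [Config.setReg_reg] using hpN) (b := shiftInd 0 S)
    (by rw [con3.h5]; exact a1)
  have e30 : (c2.setReg 30 p).reg 30 = p := by simp [Config.setReg_reg]
  rw [con3.h5, e30] at b1 b2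
  have g2 : ∀ x, x ∉ copyBits.writes → x ≠ 30 →
      (copyBits.run inp (c2.setReg 30 p)).reg x = c2.reg x := fun x hx hx' => by
    rw [run_reg (by decide) hx, Config.setReg_reg, if_neg hx']
  have l30 : (copyBits.run inp (c2.setReg 30 p)).reg 30 = p := by
    rw [run_reg (by decide) (by decide), Config.setReg_reg, if_pos rfl]
  generalize copyBits.run inp (c2.setReg 30 p) = c3 at *
  rw [Config.setReg_mem] at b2
  set c4 := (mod4 28).run inp
      ((op (.add 28 28 57)).run inp ((op (.add 28 28 57)).run inp ((op (.add 28 43 1)).run inp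
      ((op (.input 57 39)).run inp ((op (.add 39 24 1)).run inp c3))))) with hc4
  have l24 : c3.reg 24 = c.reg 24 := (g2 24 (by decide) (by decide)).trans k24
  have l1 : c3.reg 1 = 1 := (g2 1 (by decide) (by decide)).trans con2.h1
  have l43 := (g2 43 (by decide) (by decide)).trans a2
  have l5 : c3.reg 5 = total n t := (g2 5 (by decide) (by decide)).trans con2.h5
  have g4 : ∀ x, x ∉ [28, 39, 57] → x ∉ (mod4 28).writes → c4.reg x = c3.reg x := by
    intro x hx hx'
    simp only [List.mem_cons, not_or, List.not_mem_nil] at hx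
    simp only [hc4, run_add, run_input, Config.setReg_reg,
      run_reg (by decide : (mod4 28).all _) hx', hx, if_false]
  have m4 : c4.mem = c3.mem := by simp [hc4, mod4_mem]
  have w4 : HasWord (total n t) c4 (braidRule n t inv S).y := by
    refine ⟨?_, ?_⟩
    · intro j hj
      rw [m4, b2 _ (by omega)]
      exact a1 j hj
    · have hy : (braidRule n t inv S).y.ph = (halfCount (total n t) (shiftInd 0 S) : ZMod 4) + 1 +
        if inv then 2 else 0 := rfl
      rw [hy]
      generalize (halfCount (total n t) (shiftInd 0 S) : ZMod 4) = k at *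
      simp only [hc4, mod4_reg 28 (by decide), run_add, run_input, Config.setReg_reg, l24, l1, l43]
      norm_num [Config.setReg_reg, l24, l1, l43]
      rw [← List.getD_eq_getElem?_getD, hinv, mod4_phase]
  obtain ⟨d1, d2, d3⟩ := copy_spec (inp := inp) c4
    (w := (braidRule n t inv S).y) (by rw [g4 5 (by decide) (by decide), l5]; exact w4)
  rw [g4 5 (by decide) (by decide), g4 30 (by decide) (by decide), l5, l30, m4] at *
  have g5 : ∀ x, x ∉ copy.writes → (copy.run inp c4).reg x = c4.reg x := fun x hx =>
    run_reg (by decide) hx c4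
  have hmem : (braid.run inp c).mem = (copy.run inp c4).mem := by rw [e1]; rfl
  refine hc.pushGate (braidRule n t inv S) hl rfl rfl rfl rfl
    (fun x hx => hframe x (by revert x; decide)) ?_ ?_ ?_ ?_ ?_ ?_ (run_out (by decide) c)
    (run_hist (by decide) c)
  · rw [e1, run_add, Config.setReg_reg, if_neg (by decide), g5 22 (by decide),
      g4 22 (by decide) (by decide), g2 22 (by decide) (by decide), k22]
  · rw [e1, run_add, Config.setReg_reg, if_pos rfl, g5 24 (by decide), g5 15 (by decide), g4 24 (by decide) (by decide),
      g4 15 (by decide) (by decide), l24, g2 15 (by decide) (by decide), con2.h15]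
  · rw [hframe 25 (by decide), hc.r25]
  · rw [hframe 26 (by decide), hc.r26]
  · rw [hmem]
    refine ⟨fun j hj => ?_, d1, d2⟩
    rw [d3 _ (by omega)]
    exact b1 j hj
  · intro a ha ha'
    rw [hmem, d3 a (by omega), b2 a (by omega), a3 a ha]

end Prog

/-! ### The program for a `T2` gate -/

namespace Prog

/-- Make the current string that of the frame operator at the address in register 25 of the
input, and copy it to the rule at the address in register 22. -/
def loadFrame : Prog :=
  op (.add 54 25 1) ;; load 7 6 ;;
  op (.input 57 25) ;; op (.add 28 43 57) ;; op (.add 28 28 57) ;; mod4 28 ;;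
  op (.add 30 22 0) ;; copy

/-- Make the current string that of the measurement for a `T_2` gate. -/
def loadMagic : Prog :=
  op (.const 39 2) ;; op (.add 39 24 39) ;; op (.input 59 39) ;;
  op (.add 39 24 1) ;; op (.input 58 39) ;; clear ;;
  op (.store 58 1) ;; op (.store 59 1) ;; op (.store 26 1) ;; op (.add 39 26 1) ;;
  op (.store 39 1) ;;
  op (.sub 39 59 58) ;; ite 39 (op (.const 28 2)) skip

/-- Write the rule of a `T_2` gate after the outcome in register 27. -/
def finishMagic : Prog :=
  op (.sub 22 22 9) ;; loadFrame ;; clear ;;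
  ite 27 (op (.store 26 1) ;; op (.add 39 26 1) ;; op (.store 39 1)) skip ;;
  mul ;; copy ;;
  op (.add 39 22 58) ;; op (.store 39 1) ;; op (.add 39 22 59) ;; op (.store 39 1) ;;
  op (.add 25 25 14) ;; op (.add 26 26 1) ;; op (.add 26 26 1) ;; op (.add 24 24 15)

/-- Process a `T_2` gate. -/
def magic : Prog := loadMagic ;; measure ;; finishMagic

/-- Process a gate. -/
def gate : Prog := op (.input 56 24) ;; ite 56 magic braid

variable {M : ℕ} {inp : List ℕ}

theorem loadMagic_spec {n t L : ℕ} (A : SimState (2 * t + 2)) (c : Config (2 * t + 2))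
    (hc : Represents n t L A c) (hi : A.used < t) (a b : Fin (2 * n + 2))
    (ha : inp.getD (c.reg 24 + 1) 0 = a) (hb : inp.getD (c.reg 24 + 2) 0 = b) :
    Represents n t L A (loadMagic.run inp c) ∧
    HasWord (total n t) (loadMagic.run inp c) (magicWord n A.used a b) ∧
    (loadMagic.run inp c).reg 58 = a ∧ (loadMagic.run inp c).reg 59 = b := by
  have hcon := hc.consts
  set c1 := ((((c.setReg 39 2).setReg 39 (c.reg 24 + 2)).setReg 59 b).setReg 39
    (c.reg 24 + 1)).setReg 58 a with hc1
  have con1 : Consts n t L c1 := hcon.of_eq (by simp [hc1, Config.setReg_reg])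
  obtain ⟨a1, a2⟩ := clear_spec (inp := inp) c1
  have g1 : ∀ x, x ∉ clear.writes → (clear.run inp c1).reg x = c1.reg x := fun x hx =>
    run_reg (by decide) hx c1
  have k58 : (clear.run inp c1).reg 58 = a := (g1 58 (by decide)).trans
    (by simp [hc1, Config.setReg_reg])
  have k59 : (clear.run inp c1).reg 59 = b := (g1 59 (by decide)).trans
    (by simp [hc1, Config.setReg_reg])
  have k26 : (clear.run inp c1).reg 26 = 2 * n + 2 + 2 * A.used := (g1 26 (by decide)).trans
    (by rw [← hc.r26]; simp [hc1, Config.setReg_reg])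
  have k1 := (g1 1 (by decide)).trans con1.h1
  have e1 : loadMagic.run inp c = (ite 39 (op (.const 28 2)) skip).run inp
      ((op (.sub 39 59 58)).run inp ((op (.store 39 1)).run inp ((op (.add 39 26 1)).run inp
      ((op (.store 26 1)).run inp ((op (.store 59 1)).run inp
      ((op (.store 58 1)).run inp (clear.run inp c1))))))) := by
    simp only [loadMagic, run_seq, run_input, run_const, run_add, Config.setReg_reg]
    norm_num
    rw [hc1, hcon.h1, ← List.getD_eq_getElem?_getD, ← List.getD_eq_getElem?_getD, ha, hb]
  have hf : ∀ x, x ∉ loadMagic.writes → (loadMagic.run inp c).reg x = c.reg x := fun x hx =>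
    run_reg (by decide) hx c
  rw [con1.h5] at a1 a2
  have m1 : c1.mem = c.mem := rfl
  rw [m1] at a2
  have hout : (loadMagic.run inp c).out = c.out := run_out (by decide) c
  have hhist : (loadMagic.run inp c).hist = c.hist := run_hist (by decide) c
  generalize clear.run inp c1 = c2 at *
  have hmem : ∀ x, (loadMagic.run inp c).mem x =
      if x ∈ ({(a : ℕ), (b : ℕ), 2 * n + 2 + 2 * A.used, 2 * n + 2 + 2 * A.used + 1} : Finset ℕ)
      then 1 else c2.mem x := by
    intro x
    rw [e1, run_ite]
    split_ifs <;> simp_all [Config.setReg_reg, Config.setMem_mem] <;> omega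
  have haN := a.2
  have hbN := b.2
  refine ⟨hc.of_frame (fun x hx => hf x (by revert x; decide)) ?_ hout hhist,
    ⟨fun j hj => ?_, ?_⟩, ?_, ?_⟩
  · intro x hx
    rw [hmem, if_neg, a2 x hx]
    simp only [total] at hx
    simp only [Finset.mem_insert, Finset.mem_singleton]
    omega
  · rw [zero_add, hmem, magicWord]
    change _ = (if _ then _ else _ : ZMod 2).val
    have := a1.b j hj
    rw [zero_add] at this
    rw [this]
    split_ifs <;> rfl
  · rw [e1, run_ite]
    have h28 := a1.ph
    simp only [magicWord]
    -- The truncated difference `b - a` is nonzero exactly in this case, so it decides the phase of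
    -- the string.
    by_cases hab : (a : ℕ) < b
    · have h1 : ((b : ℕ) - a) ≠ 0 := by omega
      simp [Config.setReg_reg, k58, k59, h1, hab]
      rfl
    · have h1 : ((b : ℕ) - a) = 0 := by omega
      simp [Config.setReg_reg, k58, k59, h1, hab, h28]
  · rw [e1, run_ite]; split_ifs <;> simp [Config.setReg_reg, k58]
  · rw [e1, run_ite]; split_ifs <;> simp [Config.setReg_reg, k59]

theorem mod4_phase' (k : ZMod 4) (c : Bool) :
    (if 3 < k.val + c.toNat + c.toNat then k.val + c.toNat + c.toNat - 4
      else k.val + c.toNat + c.toNat) = (k + if c then 2 else 0).val := by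
  revert k c; decide

theorem loadFrame_spec {n t L p : ℕ} (c : Config M) (hc : Consts n t L c) (h22 : c.reg 22 = p)
    (X : FermionParity (2 * t + 2))
    (hX : inp.getD (c.reg 25) 0 = X.neg.toNat)
    (hS : ∀ j : Fin (2 * t + 2), inp.getD (c.reg 25 + 1 + j) 0 = if j ∈ X.support then 1 else 0) :
    HasBits (total n t) (loadFrame.run inp c).mem (p + total n t) (frameWord n X).b ∧
    (loadFrame.run inp c).mem (p + total n t + total n t) = (frameWord n X).ph.val ∧
    (loadFrame.run inp c).reg 30 = p ∧
    ∀ a, total n t ≤ a → a < p + total n t ∨ p + total n t + total n t < a →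
      (loadFrame.run inp c).mem a = c.mem a := by
  set c1 := c.setReg 54 (c.reg 25 + 1) with hc1
  have con1 : Consts n t L c1 := hc.of_eq (by simp [hc1, Config.setReg_reg])
  obtain ⟨a1, a2, a3⟩ := load_spec (inp := inp) 7 6 c1 con1 (by simp) con1.h7
    (by rw [con1.h6]) X.support (by
      intro j
      rw [← hS j]
      simp [hc1, Config.setReg_reg])
  rw [con1.h6] at a1 a2
  have g1 : ∀ x, x ∉ (load 7 6).writes → x ≠ 54 → ((load 7 6).run inp c1).reg x = c.reg x :=
    fun x hx hx' => by
      rw [run_reg (by decide) hx, hc1, Config.setReg_reg, if_neg hx']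
  have e1 : loadFrame.run inp c = copy.run inp ((op (.add 30 22 0)).run inp
      ((mod4 28).run inp ((op (.add 28 28 57)).run inp ((op (.add 28 43 57)).run inp
      ((op (.input 57 25)).run inp ((load 7 6).run inp c1)))))) := by
    simp only [loadFrame, run_seq, run_add]
    rw [hc1, hc.h1]
  have m1 : c1.mem = c.mem := rfl
  rw [m1] at a3
  have k22 := (g1 22 (by decide) (by decide)).trans h22
  have k25 := g1 25 (by decide) (by decide)
  have k0 := (g1 0 (by decide) (by decide)).trans hc.h0
  have k5 := (g1 5 (by decide) (by decide)).trans hc.h5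
  generalize (load 7 6).run inp c1 = c2 at *
  set c4 := (op (.add 30 22 0)).run inp
      ((mod4 28).run inp ((op (.add 28 28 57)).run inp ((op (.add 28 43 57)).run inp
      ((op (.input 57 25)).run inp c2)))) with hc4
  have m4 : c4.mem = c2.mem := by simp [hc4, mod4_mem]
  have g4 : ∀ x, x ∉ [28, 30, 39, 57] → x ∉ (mod4 28).writes → c4.reg x = c2.reg x := by
    intro x hx hx'
    simp only [List.mem_cons, not_or, List.not_mem_nil] at hx
    simp only [hc4, run_add, run_input, Config.setReg_reg,
      run_reg (by decide : (mod4 28).all _) hx', hx, if_false]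
  have e30 : c4.reg 30 = p := by
    have r1 : ∀ d : Config M, ((mod4 28).run inp d).reg 22 = d.reg 22 :=
      run_reg (by decide) (by decide)
    have r2 : ∀ d : Config M, ((mod4 28).run inp d).reg 0 = d.reg 0 :=
      run_reg (by decide) (by decide)
    simp [hc4, Config.setReg_reg, r1, r2, k22, k0]
  have w4 : HasWord (total n t) c4 (frameWord n X) := by
    refine ⟨by rw [m4]; exact a1, ?_⟩
    have hy : (frameWord n X).ph =
      (halfCount (total n t) (shiftInd (2 * n + 2) X.support) : ZMod 4) +
        if X.neg then 2 else 0 := rfl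
    rw [hy]
    generalize (halfCount (total n t) (shiftInd (2 * n + 2) X.support) : ZMod 4) = k at *
    simp only [hc4, mod4_reg 28 (by decide), run_add, run_input, Config.setReg_reg, a2, k25]
    norm_num [Config.setReg_reg, a2, k25]
    rw [← List.getD_eq_getElem?_getD, hX, mod4_phase']
  obtain ⟨d1, d2, d3⟩ := copy_spec (inp := inp) c4
    (w := frameWord n X) (by rw [g4 5 (by decide) (by decide), k5]; exact w4)
  rw [g4 5 (by decide) (by decide), k5, e30] at d1 d2 d3
  rw [e1]
  refine ⟨d1, d2, ?_, fun a ha ha' => ?_⟩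
  · rw [run_reg (by decide) (by decide), e30]
  · rw [d3 a ha', m4, a3 a ha]

-- The place of the new rule doubles as scratch space. It first receives the frame word, which `mul`
-- reads as its second factor; the first factor is the pair of Majoranas of s_i or the identity,
-- depending on the outcome. The product is then copied over the frame word.
set_option maxHeartbeats 1000000 in
theorem finishMagic_spec {n t L : ℕ} (A : SimState (2 * t + 2)) (c : Config (2 * t + 2))
    (hc : Represents n t L A c) (hl : A.gates.length < L) (hi : A.used < t)
    (a b : Fin (2 * n + 2)) (o : Bool) (h58 : c.reg 58 = a) (h59 : c.reg 59 = b)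
    (h27 : c.reg 27 = o.toNat) (X : FermionParity (2 * t + 2))
    (hX : inp.getD (c.reg 25) 0 = X.neg.toNat)
    (hS : ∀ j : Fin (2 * t + 2), inp.getD (c.reg 25 + 1 + j) 0 = if j ∈ X.support then 1 else 0) :
    Represents n t L { A with gates := magicRule n X A.used a b o :: A.gates, used := A.used + 1 }
      (finishMagic.run inp c) := by
  have hcon := hc.consts
  set p := c.reg 22 - (2 * total n t + 1) with hp
  have hpk : p = total n t + (L - A.gates.length - 1) * (2 * total n t + 1) := by
    obtain ⟨k, hk⟩ : ∃ k, L - A.gates.length = k + 1 := ⟨L - A.gates.length - 1, by omega⟩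
    rw [hp, hc.r22, hk, Nat.add_sub_cancel, Nat.succ_mul]
    omega
  have hpN : total n t ≤ p := by omega
  have hidle := hc.rules (L - A.gates.length - 1) (by simp only [places]; omega)
  rw [SimState.slot, if_pos (by omega), ← hpk] at hidle
  have hframe : ∀ x, x ∉ finishMagic.writes → (finishMagic.run inp c).reg x = c.reg x :=
    fun x hx => run_reg (by decide) hx c
  have hout : (finishMagic.run inp c).out = c.out := run_out (by decide) c
  have hhist : (finishMagic.run inp c).hist = c.hist := run_hist (by decide) c
  have con1 : Consts n t L (c.setReg 22 p) := hcon.of_eq (by simp [Config.setReg_reg])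
  obtain ⟨a1, a2, a3, a4⟩ := loadFrame_spec (inp := inp) (c.setReg 22 p) con1 (p := p)
    (by simp [Config.setReg_reg]) X (by simpa [Config.setReg_reg] using hX)
    (by simpa [Config.setReg_reg] using hS)
  have g1 : ∀ x, x ∉ loadFrame.writes → x ≠ 22 →
      (loadFrame.run inp (c.setReg 22 p)).reg x = c.reg x := fun x hx hx' => by
    rw [run_reg (by decide) hx, Config.setReg_reg, if_neg hx']
  have k22 : (loadFrame.run inp (c.setReg 22 p)).reg 22 = p := by
    rw [run_reg (by decide) (by decide), Config.setReg_reg, if_pos rfl]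
  have e1 : finishMagic.run inp c = (op (.add 24 24 15)).run inp ((op (.add 26 26 1)).run inp
      ((op (.add 26 26 1)).run inp ((op (.add 25 25 14)).run inp ((op (.store 39 1)).run inp
      ((op (.add 39 22 59)).run inp ((op (.store 39 1)).run inp ((op (.add 39 22 58)).run inp
      (copy.run inp (mul.run inp ((ite 27 (op (.store 26 1) ;; op (.add 39 26 1) ;;
        op (.store 39 1)) skip).run inp
      (clear.run inp (loadFrame.run inp (c.setReg 22 p))))))))))))) := by
    simp only [finishMagic, run_seq, run_sub]
    rw [hp, hcon.h9]
  rw [Config.setReg_mem] at a4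
  have con2 : Consts n t L (loadFrame.run inp (c.setReg 22 p)) := hcon.of_eq fun x hx =>
    g1 x (by revert x; decide) (by rintro rfl; revert hx; decide)
  generalize loadFrame.run inp (c.setReg 22 p) = c2 at *
  obtain ⟨b1, b2⟩ := clear_spec (inp := inp) c2
  rw [con2.h5] at b1 b2
  have g2 : ∀ x, x ∉ clear.writes → (clear.run inp c2).reg x = c2.reg x := fun x hx =>
    run_reg (by decide) hx c2
  generalize clear.run inp c2 = c3 at *
  set c4 := (ite 27 (op (.store 26 1) ;; op (.add 39 26 1) ;; op (.store 39 1)) skip).run inp c3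
    with hc4
  have l26 : c3.reg 26 = 2 * n + 2 + 2 * A.used :=
    ((g2 26 (by decide)).trans (g1 26 (by decide) (by decide))).trans hc.r26
  have l27 : c3.reg 27 = o.toNat :=
    ((g2 27 (by decide)).trans (g1 27 (by decide) (by decide))).trans h27
  have l1 : c3.reg 1 = 1 := (g2 1 (by decide)).trans con2.h1
  have m4 : ∀ x, c4.mem x = if x ∈ (if o then {2 * n + 2 + 2 * A.used, 2 * n + 2 + 2 * A.used + 1}
      else ∅ : Finset ℕ) then 1 else c3.mem x := by
    intro x
    rw [hc4, run_ite, l27]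
    cases o
    · simp
    · simp [Config.setReg_reg, Config.setMem_mem, l26, l1]
      split_ifs <;> simp_all
  have g4 : ∀ x, x ∉ [39, 60] → c4.reg x = c3.reg x := fun x hx =>
    run_reg (by decide) (fun h => hx (by revert h; simp [writes, Cmd.target, skip])) c3
  have w4 : HasWord (total n t) c4
      ⟨0, ind (if o then {2 * n + 2 + 2 * A.used, 2 * n + 2 + 2 * A.used + 1} else ∅)⟩ := by
    refine ⟨fun j hj => ?_, ?_⟩
    · rw [zero_add, m4]
      change _ = (if _ then _ else _ : ZMod 2).val
      have := b1.b j hj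
      rw [zero_add] at this
      rw [this]
      split_ifs <;> rfl
    · rw [g4 28 (by decide)]; exact b1.ph
  have m4' : ∀ x, total n t ≤ x → c4.mem x = c2.mem x := by
    intro x hx
    rw [m4, if_neg, b2 x hx]
    simp only [total] at hx
    cases o
    · simp
    · simp only [if_true, Finset.mem_insert, Finset.mem_singleton]; omega
  have l30 : c4.reg 30 = p := ((g4 30 (by decide)).trans (g2 30 (by decide))).trans a3
  have l5 : c4.reg 5 = total n t := ((g4 5 (by decide)).trans (g2 5 (by decide))).trans con2.h5
  obtain ⟨f1, f2⟩ := mul_spec (inp := inp) c4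
    (w := ⟨0, ind (if o then {2 * n + 2 + 2 * A.used, 2 * n + 2 + 2 * A.used + 1} else ∅)⟩)
    (y := frameWord n X) (by rw [l5]; exact w4)
    (by rw [l5, l30]; exact a1.mono fun x h1 h2 => m4' x (by omega))
    (by rw [l5, l30, m4' _ (by omega)]; exact a2)
  rw [l5] at f1 f2
  have g5 : ∀ x, x ∉ mul.writes → (mul.run inp c4).reg x = c4.reg x := fun x hx =>
    run_reg (by decide) hx c4
  generalize mul.run inp c4 = c5 at *
  have k30 := (g5 30 (by decide)).trans l30
  have k5 := (g5 5 (by decide)).trans l5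
  obtain ⟨d1, d2, d3⟩ := copy_spec (inp := inp) c5
    (w := (magicRule n X A.used a b o).y) (by rw [k5]; exact f1)
  rw [k5, k30] at d1 d2 d3
  have g6 : ∀ x, x ∉ copy.writes → (copy.run inp c5).reg x = c5.reg x := fun x hx =>
    run_reg (by decide) hx c5
  have hall : ∀ x, x ∉ copy.writes → x ∉ mul.writes → x ∉ [39, 60] → x ∉ clear.writes →
      (copy.run inp c5).reg x = c2.reg x := fun x h1 h2 h3 h4 =>
    (((g6 x h1).trans (g5 x h2)).trans (g4 x h3)).trans (g2 x h4)
  have q22 := (hall 22 (by decide) (by decide) (by decide) (by decide)).trans k22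
  have q58 := ((hall 58 (by decide) (by decide) (by decide) (by decide)).trans
    (g1 58 (by decide) (by decide))).trans h58
  have q59 := ((hall 59 (by decide) (by decide) (by decide) (by decide)).trans
    (g1 59 (by decide) (by decide))).trans h59
  have q1 := (hall 1 (by decide) (by decide) (by decide) (by decide)).trans con2.h1
  have q14 := (hall 14 (by decide) (by decide) (by decide) (by decide)).trans con2.h14
  have q15 := (hall 15 (by decide) (by decide) (by decide) (by decide)).trans con2.h15
  have q24 := ((hall 24 (by decide) (by decide) (by decide) (by decide)).trans
    (g1 24 (by decide) (by decide)))
  have q25 := ((hall 25 (by decide) (by decide) (by decide) (by decide)).trans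
    (g1 25 (by decide) (by decide))).trans hc.r25
  have q26 := ((hall 26 (by decide) (by decide) (by decide) (by decide)).trans
    (g1 26 (by decide) (by decide))).trans hc.r26
  generalize copy.run inp c5 = c6 at *
  have hmem : ∀ x, (finishMagic.run inp c).mem x = if x = p + a ∨ x = p + b then 1 else c6.mem x := by
    intro x
    rw [e1]
    have hx : ∀ u v : ℕ, (if x = p + b then 1 else if x = p + a then 1 else u) =
        if x = p + a ∨ x = p + b then 1 else u := fun u v => by
      split_ifs <;> first | rfl | omega
    simpa only [run_add, run_store, Config.setReg_reg, Config.setMem_mem, Config.setReg_mem, Config.setMem_reg, q22, q58, q59, q1, OfNat.ofNat_eq_ofNat, Nat.reduceEqDiff, if_true, if_false, reduceCtorEq] using hx _ 0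
  have haN := a.2
  have hbN := b.2
  have hN : total n t = 2 * n + 2 + (2 * t + 2) := rfl
  refine hc.pushGate (magicRule n X A.used a b o) hl rfl rfl rfl rfl
    (fun x hx => hframe x (by revert x; decide)) ?_ ?_ ?_ ?_ ?_ ?_ hout hhist
  · rw [e1]; simp [Config.setReg_reg, q22, hp]
  · rw [e1]; simp [Config.setReg_reg, q24, q15]
  · rw [e1]; simp [Config.setReg_reg, q25, q14]; ring
  · rw [e1]; simp [Config.setReg_reg, q26, q1]; ring
  · refine ⟨fun j hj => ?_, fun j hj => ?_, ?_⟩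
    · rw [hmem]
      change _ = (if j ∈ ({(a : ℕ), (b : ℕ)} : Finset ℕ) then 1 else 0 : ZMod 2).val
      have h0 := hidle.q j hj
      by_cases h : j = a ∨ j = b
      · rw [if_pos (by omega), if_pos (by simpa using h)]; rfl
      · rw [if_neg (by omega), if_neg (by simpa using h), d3 _ (by omega), f2 _ (by omega),
          m4' _ (by omega), a4 _ (by omega) (by omega), h0]
        rfl
    · rw [hmem, if_neg (by omega)]; exact d1 j hj
    · rw [hmem, if_neg (by omega)]; exact d2
  · intro x hx hx'
    rw [hmem, if_neg (by omega), d3 _ (by omega), f2 _ (by omega), m4' _ (by omega),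
      a4 _ (by omega) (by omega)]

end Prog

/-! ### Loops with random events, and the readout -/

namespace Prog

variable {M : ℕ} {inp : List ℕ}

/-- A loop refines an iteration on lists. -/
theorem den_for {β : Type*} {x h y : ℕ} {a : Prog} (ha : a.all Cmd.basic)
    (hx : x ≠ h ∧ x ∉ a.writes) (c : Config M) (R : ℕ → Config M → β → Prop)
    (l : ℕ → List β) (G : ℕ → β → List β) {b₀ : β} (hl0 : l 0 = [b₀])
    (hl : ∀ i, l (i + 1) = (l i).flatMap (G i)) (h0 : R 0 (first x h y c) b₀)
    (hs : ∀ i d b, i < c.reg y → d.reg x = i → R i d b →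
      List.Forall₂ (fun e b' => R (i + 1) (next x h y e) b') (a.den inp d) (G i b)) :
    List.Forall₂ (R (c.reg y)) ((Prog.count x h y a).den inp c) (l (c.reg y)) := by
  rw [den]
  suffices H : ∀ k ≤ c.reg y, List.Forall₂ (fun d b => d.reg x = k ∧ R k d b)
      (bindIter (fun d => (a.den inp d).map (next x h y)) k [first x h y c]) (l k) from
    (H _ le_rfl).imp fun d b h => h.2
  intro k
  induction k with
  | zero =>
    intro _
    rw [hl0]
    exact .cons ⟨by simp [first, Config.setReg_reg, hx.1], h0⟩ .nil
  | succ k ih =>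
    intro hk
    rw [bindIter_succ, hl]
    refine List.rel_flatMap (ih (by omega)) fun d b ⟨h1, h2⟩ => ?_
    rw [List.forall₂_map_left_iff]
    have h3 := hs k d b (by omega) h1 h2
    have h4 := (List.forall₂_and_left (p := fun e : Config M => e.reg x = k) _ _).2
      ⟨fun e he => by rw [den_reg ha hx.2 d e he, h1], h3⟩
    refine h4.imp fun e b' ⟨h5, h6⟩ => ⟨?_, h6⟩
    simp [next, Config.setReg_reg, hx.1, h5]

theorem magic_spec {n t L : ℕ} (A : SimState (2 * t + 2)) (c : Config (2 * t + 2))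
    (hc : Represents n t L A c) (hl : A.gates.length < L) (hi : A.used < t)
    (he : L + A.elim.length < places n t L) (a b : Fin (2 * n + 2)) (hab : a ≠ b)
    (ha : inp.getD (c.reg 24 + 1) 0 = a) (hb : inp.getD (c.reg 24 + 2) 0 = b)
    (X : Fin t → FermionParity (2 * t + 2))
    (hX : inp.getD (c.reg 25) 0 = (X ⟨A.used, hi⟩).neg.toNat)
    (hS : ∀ j : Fin (2 * t + 2),
      inp.getD (c.reg 25 + 1 + j) 0 = if j ∈ (X ⟨A.used, hi⟩).support then 1 else 0) :
    List.Forall₂ (fun c' B => Represents n t L B c') (magic.den inp c)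
      (A.gate n X (.T2 a b hab)) := by
  obtain ⟨h1, h2, h3, h4⟩ := loadMagic_spec (inp := inp) A c hc hi a b ha hb
  have hg : ∀ x, x ∉ loadMagic.writes → (loadMagic.run inp c).reg x = c.reg x := fun x hx =>
    run_reg (by decide) hx c
  rw [magic, den_seq_left (by decide), den_seq_right (by decide), List.forall₂_map_left_iff,
    SimState.gate, dif_pos hi, List.forall₂_map_right_iff]
  have e25 := hg 25 (by decide)
  generalize loadMagic.run inp c = c1 at *
  have hm := measure_spec (inp := inp) A c1 h1 he h2
  -- The rule is written after the measurement, so the number of gates and of used magic states must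
  -- be known not to have changed in between.
  have hmem : ∀ x ∈ A.measure n (magicWord n A.used a b),
      x.2.gates = A.gates ∧ x.2.used = A.used := by
    intro x hx
    simp only [SimState.measure, SimState.decide] at hx
    split_ifs at hx <;> simp only [List.mem_map, List.mem_singleton] at hx
    · obtain ⟨d, _, rfl⟩ := hx; exact ⟨rfl, rfl⟩
    · obtain ⟨d, _, rfl⟩ := hx; exact ⟨rfl, rfl⟩
    · subst hx; exact ⟨rfl, rfl⟩
  have hm' := (List.forall₂_and_left (p := fun x : Bool × SimState (2 * t + 2) =>
    x.2.gates = A.gates ∧ x.2.used = A.used) _ _).2 ⟨hmem, hm.flip⟩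
  refine hm'.flip.imp fun c' x ⟨⟨g1, g2⟩, g3, g4, g5⟩ => ?_
  have hf := finishMagic_spec (inp := inp) x.2 c' g3 (by rw [g1]; exact hl) (by rw [g2]; exact hi)
    a b x.1 ((g5 58 (by decide)).trans h3) ((g5 59 (by decide)).trans h4) g4
    (X ⟨A.used, hi⟩) (by rw [g5 25 (by decide), e25]; exact hX)
    (by rw [g5 25 (by decide), e25]; exact hS)
  rw [g2] at hf
  exact hf

/-- Measure `s_j` for the number `j` in register 20, and output the outcome. -/
def readout : Prog :=
  clear ;; op (.add 39 20 20) ;; op (.store 39 1) ;; op (.add 39 39 1) ;; op (.store 39 1) ;;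
  op (.const 28 1) ;; measure ;; op (.output 27)

theorem readout_spec {n t L : ℕ} (A : SimState (2 * t + 2)) (c : Config (2 * t + 2))
    (hc : Represents n t L A c) (he : L + A.elim.length < places n t L) {j : ℕ} (hj : j < n)
    (h20 : c.reg 20 = j) :
    List.Forall₂ (fun c' B => Represents n t L B c') (readout.den inp c) (A.readout n j) := by
  obtain ⟨a1, a2⟩ := clear_spec (inp := inp) c
  have g1 : ∀ x, x ∉ clear.writes → (clear.run inp c).reg x = c.reg x := fun x hx =>
    run_reg (by decide) hx c
  have k20 := (g1 20 (by decide)).trans h20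
  have k1 := (g1 1 (by decide)).trans hc.consts.h1
  rw [hc.consts.h5] at a1 a2
  have o1 : (clear.run inp c).out = c.out := run_out (by decide) c
  have o2 : (clear.run inp c).hist = c.hist := run_hist (by decide) c
  set P : Prog := op (.add 39 20 20) ;; op (.store 39 1) ;; op (.add 39 39 1) ;;
    op (.store 39 1) ;; op (.const 28 1) with hP
  have e1 : readout.den inp c = (measure.den inp (P.run inp (clear.run inp c))).map
      ((op (.output 27)).run inp) := by
    simp only [readout, den_seq_left (P := clear) (by decide), hP, run_seq]
    rw [den_seq_left (by decide), den_seq_left (by decide), den_seq_left (by decide),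
      den_seq_left (by decide), den_seq_left (by decide), den_seq_right (by decide)]
  generalize clear.run inp c = c1 at *
  have m2 : ∀ x, (P.run inp c1).mem x =
      if x ∈ ({2 * j, 2 * j + 1} : Finset ℕ) then 1 else c1.mem x := by
    intro x
    simp [hP, Config.setReg_reg, Config.setMem_mem, k20, k1]
    split_ifs <;> first | rfl | omega
  have g2 : ∀ x, x ∉ [28, 39] → (P.run inp c1).reg x = c1.reg x := fun x hx =>
    run_reg (by decide) (fun h => hx (by revert h; simp [P, writes, Cmd.target]; omega)) c1
  have w2 : HasWord (total n t) (P.run inp c1) (sWord j) := by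
    refine ⟨fun i hi => ?_, by simp [hP, Config.setReg_reg]; rfl⟩
    rw [zero_add, m2, sWord]
    change _ = (if _ then _ else _ : ZMod 2).val
    have := a1.b i hi
    rw [zero_add] at this
    rw [this]
    split_ifs <;> rfl
  have h2 : Represents n t L A (P.run inp c1) := hc.of_frame
    (fun x hx => (g2 x (by revert x; decide)).trans (g1 x (by revert x; decide)))
    (fun a ha => by
      rw [m2, if_neg, a2 a ha]
      simp only [total] at ha
      simp only [Finset.mem_insert, Finset.mem_singleton]
      omega)
    ((run_out (by decide) c1).trans o1) ((run_hist (by decide) c1).trans o2)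
  rw [e1, List.forall₂_map_left_iff, SimState.readout, List.forall₂_map_right_iff]
  refine (measure_spec (inp := inp) A _ h2 he w2).imp fun c' x ⟨r1, r2, _⟩ => ?_
  refine ⟨r1.consts.of_eq fun _ _ => rfl, r1.gates, r1.r22, r1.r23, r1.r24, r1.r25, r1.r26,
    r1.rules, ?_, r1.hist⟩
  change c'.out ++ [decide (c'.reg 27 ≠ 0)] = x.2.out ++ [x.1]
  rw [r1.out, r2]
  cases x.1 <;> rfl

/-- Record the rule of the total parity in register `p` of the `reg y` Majoranas from the position
`reg o` on. -/
def parity (o y p : ℕ) : Prog :=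
  clear ;; op (.add 53 o 0) ;; fill y ;; half ;;
  op (.add 28 43 p) ;; op (.add 28 28 p) ;; mod4 28 ;; op (.add 30 23 0) ;; copy ;;
  op (.add 39 23 o) ;; op (.add 39 39 y) ;; op (.sub 39 39 1) ;; op (.store 39 1) ;;
  op (.add 23 23 9)

/-- The string of a total parity is constantly one on its register, so the last position there can
serve as pivot. The hypothesis `hy` lists the two uses of the program; with concrete registers, all
clashes are settled by `decide`. -/
theorem parity_spec {n t L : ℕ} (A : SimState (2 * t + 2)) (c : Config (2 * t + 2))
    (hc : Represents n t L A c) (hl : L + A.elim.length < places n t L) {o y p : ℕ}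
    (hy : (y = 6 ∧ o = 0 ∧ p = 10) ∨ (y = 7 ∧ o = 6 ∧ p = 11)) {q : Bool}
    (hp : c.reg p = q.toNat) :
    Represents n t L { A with elim := A.elim ++
      [parityRule (total n t) (c.reg o) (c.reg y) q] } ((parity o y p).run inp c) := by
  have hcon := hc.consts
  have hy0 : 0 < c.reg y := by
    rcases hy with ⟨rfl, rfl, rfl⟩ | ⟨rfl, rfl, rfl⟩
    · rw [hcon.h6]; omega
    · rw [hcon.h7]; omega
  have hoy : c.reg o + c.reg y ≤ total n t := by
    rcases hy with ⟨rfl, rfl, rfl⟩ | ⟨rfl, rfl, rfl⟩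
    · rw [hcon.h6, hcon.h0]; simp only [total]; omega
    · rw [hcon.h7, hcon.h6]
  have hdet : (parity o y p).all fun d => d.basic && d.det && d.keepsOut := by
    rcases hy with ⟨rfl, rfl, rfl⟩ | ⟨rfl, rfl, rfl⟩ <;> decide
  have hdet' : (parity o y p).all fun d => d.basic && d.det := by
    rcases hy with ⟨rfl, rfl, rfl⟩ | ⟨rfl, rfl, rfl⟩ <;> decide
  have hw : ∀ x ∈ [0, 1, 2, 4, 5, 6, 7, 8, 9, 14, 15, 22, 24, 25, 26],
      x ∉ (parity o y p).writes := by
    rcases hy with ⟨rfl, rfl, rfl⟩ | ⟨rfl, rfl, rfl⟩ <;> decide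
  have hframe : ∀ x ∈ [0, 1, 2, 4, 5, 6, 7, 8, 9, 14, 15, 22, 24, 25, 26],
      ((parity o y p).run inp c).reg x = c.reg x := fun x hx => run_reg hdet' (hw x hx) c
  have hs : ∀ r ∈ [o, y, p, 0, 1, 5, 9, 23], r ∉ [28, 30, 38, 39, 40] ∧ r ∉ clear.writes ∧
      r ∉ (fill y).writes ∧ r ∉ half.writes ∧ r ≠ 53 ∧ r ∉ (mod4 28).writes ∧ r ∉ copy.writes := by
    rcases hy with ⟨rfl, rfl, rfl⟩ | ⟨rfl, rfl, rfl⟩ <;> decide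
  obtain ⟨a1, a2⟩ := clear_spec (inp := inp) c
  have g1 : ∀ x ∈ [o, y, p, 0, 1, 5, 9, 23], (clear.run inp c).reg x = c.reg x := fun x hx =>
    run_reg (by decide) (hs x hx).2.1 c
  rw [hcon.h5] at a1 a2
  have e1 : (parity o y p).run inp c = (op (.add 23 23 9)).run inp ((op (.store 39 1)).run inp
      ((op (.sub 39 39 1)).run inp ((op (.add 39 39 y)).run inp ((op (.add 39 23 o)).run inp
      (copy.run inp ((op (.add 30 23 0)).run inp ((mod4 28).run inp ((op (.add 28 28 p)).run inp
      ((op (.add 28 43 p)).run inp (half.run inp ((fill y).run inp ((op (.add 53 o 0)).run inp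
      (clear.run inp c))))))))))))) := rfl
  generalize clear.run inp c = c1 at *
  set c2 := (op (.add 53 o 0)).run inp c1 with hc2
  have g2 : ∀ x ∈ [o, y, p, 0, 1, 5, 9, 23], c2.reg x = c.reg x := fun x hx => by
    rw [hc2, run_add, Config.setReg_reg, if_neg (hs x hx).2.2.2.2.1, g1 x hx]
  have f1 := fill_spec (inp := inp) y c2
    ((g2 1 (by simp)).trans hcon.h1)
  have e53 : c2.reg 53 = c.reg o := by
    rw [hc2, run_add, Config.setReg_reg, if_pos rfl, g1 o (by simp), g1 0 (by simp), hcon.h0]; rfl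
  rw [e53, g2 y (by simp)] at f1
  have g3 : ∀ x ∈ [o, y, p, 0, 1, 5, 9, 23], ((fill y).run inp c2).reg x = c.reg x := fun x hx =>
    (run_reg rfl (hs x hx).2.2.1 c2).trans (g2 x hx)
  have m2 : c2.mem = c1.mem := rfl
  generalize (fill y).run inp c2 = c3 at *
  have b3 : HasBits (total n t) c3.mem 0 (ind (Finset.Ico (c.reg o) (c.reg o + c.reg y))) := by
    intro j hj
    have := a1.b j hj
    rw [zero_add] at this ⊢
    rw [f1, m2, this]
    simp only [ind, Finset.mem_Ico]
    split_ifs <;> rfl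
  obtain ⟨d1, d2⟩ := half_spec (inp := inp) c3 ((g3 1 (by simp)).trans hcon.h1)
    (b := ind (Finset.Ico (c.reg o) (c.reg o + c.reg y)))
    (by rw [g3 5 (by simp), hcon.h5]; exact b3)
  rw [g3 5 (by simp), hcon.h5] at d1
  have g4 : ∀ x ∈ [o, y, p, 0, 1, 5, 9, 23], (half.run inp c3).reg x = c.reg x := fun x hx =>
    (run_reg (by decide) (hs x hx).2.2.2.1 c3).trans (g3 x hx)
  generalize half.run inp c3 = c4 at *
  set c5 := (op (.add 30 23 0)).run inp ((mod4 28).run inp ((op (.add 28 28 p)).run inp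
      ((op (.add 28 43 p)).run inp c4))) with hc5
  have g5 : ∀ x ∈ [o, y, p, 0, 1, 5, 9, 23], c5.reg x = c.reg x := fun x hx => by
    obtain ⟨h1, h2, h3, h4, h5, h6, h7⟩ := hs x hx
    simp only [List.mem_cons, not_or, List.not_mem_nil] at h1
    simp only [hc5, run_add, Config.setReg_reg, run_reg (by decide : (mod4 28).all _) h6,
      h1, if_false, g4 x hx]
  have m5 : c5.mem = c3.mem := by
    simp only [hc5, run_add, Config.setReg_mem, mod4_mem, d2]
  have e30 : c5.reg 30 = c.reg 23 := by
    have r1 : ∀ d : Config (2 * t + 2), ((mod4 28).run inp d).reg 23 = d.reg 23 :=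
      run_reg (by decide) (by decide)
    have r2 : ∀ d : Config (2 * t + 2), ((mod4 28).run inp d).reg 0 = d.reg 0 :=
      run_reg (by decide) (by decide)
    simp [hc5, Config.setReg_reg, r1, r2, g4 23 (by simp), g4 0 (by simp), hcon.h0]
  have hp28 : p ≠ 28 := by rcases hy with ⟨rfl, rfl, rfl⟩ | ⟨rfl, rfl, rfl⟩ <;> decide
  have w5 : HasWord (total n t) c5 (parityRule (total n t) (c.reg o) (c.reg y) q).y := by
    refine ⟨by rw [m5]; exact b3, ?_⟩
    have hph : (parityRule (total n t) (c.reg o) (c.reg y) q).y.ph =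
      (halfCount (total n t) (ind (Finset.Ico (c.reg o) (c.reg o + c.reg y))) : ZMod 4) +
        if q then 2 else 0 := rfl
    rw [hph]
    generalize (halfCount (total n t) (ind (Finset.Ico (c.reg o) (c.reg o + c.reg y))) : ZMod 4) =
      k at *
    simp only [hc5, mod4_reg 28 (by decide), run_add, Config.setReg_reg, if_neg hp28,
      g4 p (by simp), hp, d1]
    norm_num
    rw [mod4_phase']
  obtain ⟨b6, b7, b8⟩ := copy_spec (inp := inp) c5
    (w := (parityRule (total n t) (c.reg o) (c.reg y) q).y)
    (by rw [g5 5 (by simp), hcon.h5]; exact w5)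
  rw [g5 5 (by simp), e30, hcon.h5] at b6 b7 b8
  have g6 : ∀ x ∈ [o, y, p, 0, 1, 5, 9, 23], (copy.run inp c5).reg x = c.reg x := fun x hx =>
    (run_reg (by decide) (hs x hx).2.2.2.2.2.2 c5).trans (g5 x hx)
  generalize copy.run inp c5 = c6 at *
  have ho39 : o ≠ 39 ∧ y ≠ 39 := by rcases hy with ⟨rfl, rfl, rfl⟩ | ⟨rfl, rfl, rfl⟩ <;> decide
  have hmem : ∀ a, ((parity o y p).run inp c).mem a =
      if a = c.reg 23 + (c.reg o + c.reg y - 1) then 1 else c6.mem a := by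
    intro a
    rw [e1]
    simp [Config.setReg_reg, Config.setMem_mem, ho39, g6 23 (by simp), g6 o (by simp),
      g6 y (by simp), g6 1 (by simp), hcon.h1]
    rw [show c.reg 23 + (c.reg o + c.reg y - 1) = c.reg 23 + c.reg o + c.reg y - 1 by omega]
  obtain ⟨s1, s2, s3⟩ := slot_elim (A := A) (L := L) hc.gates
    (parityRule (total n t) (c.reg o) (c.reg y) q) (B := { A with elim := A.elim ++
      [parityRule (total n t) (c.reg o) (c.reg y) q] }) rfl rfl
  have hidle := hc.rules _ hl
  rw [s2, ← hc.r23] at hidle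
  have hrest : ∀ a, total n t ≤ a → a < c.reg 23 + total n t ∨ c.reg 23 + total n t + total n t < a →
      c6.mem a = c.mem a := by
    intro a ha ha'
    rw [b8 a ha', m5, f1, if_neg (by omega), m2, a2 a ha]
  have h23 := hc.r23
  refine ⟨hcon.of_eq fun x hx => hframe x (by revert x; decide), hc.gates, ?_, ?_, ?_, ?_, ?_, ?_,
    (run_out hdet c).trans hc.out, (run_hist hdet' c).trans hc.hist⟩
  · rw [hframe 22 (by decide), hc.r22]
  · rw [e1]
    simp [Config.setReg_reg, g6 23 (by simp), g6 9 (by simp), hcon.h9, h23]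
    ring
  · rw [hframe 24 (by decide), hc.r24]
  · rw [hframe 25 (by decide), hc.r25]
  · rw [hframe 26 (by decide), hc.r26]
  · refine hc.rules.update (k := L + A.elim.length) (p := c.reg 23) hc.r23 ?_ ?_
      (fun r _ hr => s3 r hr)
    · intro a ha hap
      rw [hmem, if_neg (by omega), hrest a ha (by omega)]
    · rw [s1]
      refine ⟨fun j hj => ?_, fun j hj => ?_, ?_⟩
      · rw [hmem]
        change _ = (if j ∈ ({c.reg o + c.reg y - 1} : Finset ℕ) then 1 else 0 : ZMod 2).val
        have hj' := hidle.q j hj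
        by_cases hjp : j = c.reg o + c.reg y - 1
        · rw [if_pos (by omega), if_pos (by simpa using hjp)]; rfl
        · rw [if_neg (by omega), if_neg (by simpa using hjp), hrest _ (by omega) (by omega), hj']
          rfl
      · rw [hmem, if_neg (by omega)]; exact b6 j hj
      · rw [hmem, if_neg (by omega)]; exact b7

end Prog

/-! ### Decoding of the input -/

theorem List.flatten_getD {α : Type*} {l : List (List α)} {k : ℕ} (h : ∀ x ∈ l, x.length = k)
    {i j : ℕ} (hi : i < l.length) (hj : j < k) (d : α) (r : List α) :
    (l.flatten ++ r).getD (i * k + j) d = l[i].getD j d := by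
  induction l generalizing i with
  | nil => simp at hi
  | cons x l ih =>
    have hx := h x (by simp)
    rw [List.flatten_cons, List.append_assoc]
    cases i with
    | zero =>
      rw [List.getD_append _ _ _ _ (by omega)]
      simp
    | succ i =>
      rw [List.getD_append_right _ _ _ _ (by rw [hx, Nat.succ_mul]; omega), hx,
        show (i + 1) * k + j - k = i * k + j by rw [Nat.succ_mul]; omega,
        ih (fun y hy => h y (List.mem_cons_of_mem _ hy)) (by simpa using hi)]
      rfl

theorem bitsOf_getD {N : ℕ} (S : Finset (Fin N)) (j : Fin N) :
    (bitsOf S).getD j 0 = if j ∈ S then 1 else 0 := by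
  rw [bitsOf, List.getD_eq_getElem _ _ (by simp)]
  simp

section Input

variable {n t : ℕ} (C : Circuit n) (pn pt : Bool) (X : Fin t → FermionParity (2 * t + 2))

theorem encodeInput_frame (i : Fin t) {j : ℕ} (hj : j < 2 * t + 3) :
    (encodeInput C pn pt X).getD (5 + i * (2 * t + 3) + j) 0 = (X i).encode.getD j 0 := by
  rw [encodeInput, List.append_assoc, List.getD_append_right _ _ _ _ (by simp; omega)]
  rw [show 5 + (i : ℕ) * (2 * t + 3) + j -
    [n, t, C.length, pn.toNat, pt.toNat].length = i * (2 * t + 3) + j by simp; omega]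
  rw [List.flatten_getD (k := 2 * t + 3) _ (by simp) hj]
  · simp
  · intro x hx
    obtain ⟨a, rfl⟩ := (List.mem_ofFn' _ _).1 hx
    simp [FermionParity.encode, bitsOf]

/-- The code of a `T2` gate is padded to the length of that of a braid. With a common length 2n + 4,
the address of the next gate is found by one addition. -/
theorem encodeInput_gate {k j : ℕ} (hk : k < C.length) (hj : j < 2 * n + 4) :
    (encodeInput C pn pt X).getD (5 + t * (2 * t + 3) + k * (2 * n + 4) + j) 0 =
      C[k].encode.getD j 0 := by
  have hl : ((List.ofFn fun j => (X j).encode).flatten).length = t * (2 * t + 3) := by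
    simp [List.length_flatten, FermionParity.encode, bitsOf, Function.comp_def]
  rw [encodeInput, List.getD_append_right _ _ _ _ (by
    rw [List.length_append, hl]; simp; omega), List.length_append, hl]
  rw [show 5 + t * (2 * t + 3) + k * (2 * n + 4) + j -
    ([n, t, C.length, pn.toNat, pt.toNat].length + t * (2 * t + 3)) = k * (2 * n + 4) + j by
      simp; omega]
  have := List.flatten_getD (l := C.map Gate.encode) (k := 2 * n + 4) (i := k) (j := j) (by
    intro x hx
    obtain ⟨g, _, rfl⟩ := List.mem_map.1 hx
    cases g <;> simp [Gate.encode, bitsOf]) (by simpa using hk) hj 0 []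
  rw [List.append_nil] at this
  rw [this]
  simp

end Input

/-- What a gate does to the sizes of the lists. -/
theorem SimState.gate_sizes {n t : ℕ} {X : Fin t → FermionParity (2 * t + 2)}
    {g : Gate (2 * n + 2)} {A B : SimState (2 * t + 2)} (hB : B ∈ A.gate n X g) :
    B.gates.length = A.gates.length + 1 ∧ B.used = A.used + g.isT2.toNat ∧
    B.elim.length = A.elim.length + g.isT2.toNat ∧ B.out = A.out := by
  cases g with
  | braid inv S h =>
    simp only [SimState.gate, List.mem_singleton] at hB
    subst hB
    simp [Gate.isT2]
  | T2 a b h =>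
    simp only [SimState.gate] at hB
    split_ifs at hB with hu
    · obtain ⟨x, hx, rfl⟩ := List.mem_map.1 hB
      simp only [SimState.measure, SimState.decide] at hx
      split_ifs at hx <;> simp only [List.mem_map, List.mem_singleton] at hx
      · obtain ⟨d, _, rfl⟩ := hx; simp [Gate.isT2, SimState.record]
      · obtain ⟨d, _, rfl⟩ := hx; simp [Gate.isT2, SimState.record]
      · subst hx; simp [Gate.isT2, SimState.record]
    · simp at hB

theorem SimState.readout_sizes {n t j : ℕ} {A B : SimState (2 * t + 2)}
    (hB : B ∈ A.readout n j) :
    B.gates = A.gates ∧ B.used = A.used ∧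
    B.elim.length = A.elim.length + 1 ∧ B.out.length = A.out.length + 1 := by
  obtain ⟨x, hx, rfl⟩ := List.mem_map.1 hB
  simp only [SimState.measure, SimState.decide] at hx
  split_ifs at hx <;> simp only [List.mem_map, List.mem_singleton] at hx
  · obtain ⟨d, _, rfl⟩ := hx; simp [SimState.record]
  · obtain ⟨d, _, rfl⟩ := hx; simp [SimState.record]
  · subst hx; simp [SimState.record]

/-- The states of the simulation after the gates. -/
def SimState.afterGates {n t : ℕ} (pn pt : Bool) (X : Fin t → FermionParity (2 * t + 2))
    (C : Circuit n) : List (SimState (2 * t + 2)) :=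
  C.foldl (fun l g => l.flatMap (SimState.gate n X g)) [SimState.init n t pn pt]

/-- The states of the simulation after the measurement of the first `k` of the `s_j`. -/
def SimState.afterReadout {n t : ℕ} (pn pt : Bool) (X : Fin t → FermionParity (2 * t + 2))
    (C : Circuit n) (k : ℕ) : List (SimState (2 * t + 2)) :=
  (List.range k).foldl (fun l j => l.flatMap (SimState.readout n j)) (afterGates pn pt X C)

/-! ### The complete program -/

namespace Prog

/-- Read the input and compute the constants. -/
def initConsts : Prog :=
  op (.const 1 1) ;; op (.input 2 0) ;; op (.input 3 1) ;; op (.const 39 3) ;; op (.input 10 39) ;;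
  op (.const 39 4) ;; op (.input 11 39) ;; op (.const 39 2) ;; op (.input 4 39) ;;
  op (.add 6 2 2) ;; op (.add 6 6 39) ;; op (.add 7 3 3) ;; op (.add 7 7 39) ;; op (.add 14 7 1) ;;
  op (.add 15 6 39) ;; op (.add 5 6 7) ;; op (.add 8 4 39) ;; op (.add 8 8 2) ;; op (.add 8 8 3) ;;
  op (.add 9 5 5) ;; op (.add 9 9 1) ;; op (.const 25 5) ;; op (.const 24 5) ;;
  op (.add 26 6 0) ;; op (.add 23 5 0)

/-- Compute the addresses and record the rules of the total parities. -/
def initRules : Prog :=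
  .count 20 21 4 (op (.add 23 23 9)) ;; op (.add 22 23 0) ;; .count 20 21 3 (op (.add 24 24 14)) ;;
  parity 0 6 10 ;; parity 6 7 11

/-- The program after the initialization of the constants. -/
def work : Prog := initRules ;; .count 20 21 4 gate ;; .count 20 21 2 readout

/-- The simulation. -/
def simulate : Prog := initConsts ;; work

variable {M : ℕ} {inp : List ℕ}

/-- Products such as t(2t + 3), needed for addresses, are formed by repeated addition. -/
theorem run_for_add {y r z : ℕ} (hr : r ∉ [20, 21, y, z]) (hz : z ∉ [20, 21])
    (c : Config M) :
    ((Prog.count 20 21 y (op (.add r r z))).run inp c).reg r = c.reg r + c.reg y * c.reg z := by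
  simp only [List.mem_cons, not_or, List.not_mem_nil] at hr hz
  refine run_for rfl ⟨by decide, by simp [writes, Cmd.target]; omega⟩ c
    (fun i d => d.reg r = c.reg r + i * c.reg z) (by simp [first, Config.setReg_reg, hr]) ?_
  intro i d _ _ h3 h4
  have := h3 z (by simp [writes, Cmd.target, hz]; first | done | omega)
  simp [next, Config.setReg_reg, hr, h4, this]
  ring

/-- The first part bounds the registers that limit the loops, as `leads_compile` requires. The
second part is the start of the refinement; it uses that the memory is zero, so that every place
holds the idle rule until the two total parities are recorded. -/
theorem init_spec {n t : ℕ} (C : Circuit n) (pn pt : Bool)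
    (X : Fin t → FermionParity (2 * t + 2)) (c : Config (2 * t + 2)) (hr : c.reg = fun _ => 0)
    (hm : c.mem = fun _ => 0) (ho : c.out = []) (hh : c.hist = []) :
    (∀ k ∈ [2, 3, 4, 5, 6, 7, 8], (initConsts.run (encodeInput C pn pt X) c).reg k ≤
      4 * (n + t + C.length) + 4) ∧
    Represents n t C.length (SimState.init n t pn pt)
      (initRules.run (encodeInput C pn pt X) (initConsts.run (encodeInput C pn pt X) c)) := by
  set inp := encodeInput C pn pt X with hinp
  have i0 : inp.getD 0 0 = n := by simp [hinp, encodeInput]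
  have i1 : inp.getD 1 0 = t := by simp [hinp, encodeInput]
  have i2 : inp.getD 2 0 = C.length := by simp [hinp, encodeInput]
  have i3 : inp.getD 3 0 = pn.toNat := by simp [hinp, encodeInput]
  have i4 : inp.getD 4 0 = pt.toNat := by simp [hinp, encodeInput]
  generalize inp = inp at *
  set c1 := initConsts.run inp c with hc1
  have con : Consts n t C.length c1 := by
    constructor <;>
      simp only [hc1, initConsts, run_seq, run_const, run_input, run_add, Config.setReg_reg, hr,
        Nat.reduceEqDiff, if_true, if_false, reduceCtorEq, i0, i1, i2, i3, i4, total, places] <;> ring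
  have k3 : c1.reg 3 = t := by
    simp only [hc1, initConsts, run_seq, run_const, run_input, run_add, Config.setReg_reg, hr,
        Nat.reduceEqDiff, if_true, if_false, reduceCtorEq, i1]
  have k10 : c1.reg 10 = pn.toNat := by
    simp only [hc1, initConsts, run_seq, run_const, run_input, run_add, Config.setReg_reg, hr,
        Nat.reduceEqDiff, if_true, if_false, reduceCtorEq, i3]
  have k11 : c1.reg 11 = pt.toNat := by
    simp only [hc1, initConsts, run_seq, run_const, run_input, run_add, Config.setReg_reg, hr,
        Nat.reduceEqDiff, if_true, if_false, reduceCtorEq, i4]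
  have k23 : c1.reg 23 = c1.reg 5 := by
    simp only [hc1, initConsts, run_seq, run_const, run_input, run_add, Config.setReg_reg, hr,
        Nat.reduceEqDiff, if_true, if_false, reduceCtorEq]; ring
  have k24 : c1.reg 24 = 5 := by
    simp only [hc1, initConsts, run_seq, run_const, run_input, run_add, Config.setReg_reg, hr,
        Nat.reduceEqDiff, if_true, if_false, reduceCtorEq]
  have k25 : c1.reg 25 = 5 := by
    simp only [hc1, initConsts, run_seq, run_const, run_input, run_add, Config.setReg_reg, hr,
        Nat.reduceEqDiff, if_true, if_false, reduceCtorEq]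
  have k26 : c1.reg 26 = c1.reg 6 := by
    simp only [hc1, initConsts, run_seq, run_const, run_input, run_add, Config.setReg_reg, hr,
        Nat.reduceEqDiff, if_true, if_false, reduceCtorEq]
  have m1 : c1.mem = fun _ => 0 := (run_mem (by decide) c).trans hm
  have o1 : c1.out = [] := (run_out (by decide) c).trans ho
  have h1 : c1.hist = [] := (run_hist (by decide) c).trans hh
  refine ⟨?_, ?_⟩
  · intro k hk
    fin_cases hk
    · rw [con.h2]; omega
    · rw [k3]; omega
    · rw [con.h4]; omega
    · rw [con.h5]; simp only [total]; omega
    · rw [con.h6]; omega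
    · rw [con.h7]; omega
    · rw [con.h8]; simp only [places]; omega
  generalize c1 = c1 at *
  have e1 : initRules.run inp c1 = (parity 6 7 11).run inp ((parity 0 6 10).run inp
      ((Prog.count 20 21 3 (op (.add 24 24 14))).run inp ((op (.add 22 23 0)).run inp
      ((Prog.count 20 21 4 (op (.add 23 23 9))).run inp c1)))) := rfl
  set c2 := (Prog.count 20 21 4 (op (.add 23 23 9))).run inp c1 with hc2
  have g2 : ∀ x, x ∉ [20, 21, 23] → c2.reg x = c1.reg x := fun x hx =>
    run_reg (by decide) (fun h => hx h) c1
  have l23 : c2.reg 23 = total n t + C.length * (2 * total n t + 1) := by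
    rw [hc2, run_for_add (by decide) (by decide), k23, con.h5, con.h4, con.h9]
  have m2 : c2.mem = c1.mem := run_mem (by decide) c1
  have o2 : c2.out = c1.out := run_out (by decide) c1
  have h2 : c2.hist = c1.hist := run_hist (by decide) c1
  clear_value c2
  set c3 := (op (.add 22 23 0)).run inp c2 with hc3
  have g3 : ∀ x, x ∉ [22] → c3.reg x = c2.reg x := fun x hx =>
    run_reg (by decide) (fun h => hx h) c2
  have l22 : c3.reg 22 = c2.reg 23 := by
    simp [hc3, Config.setReg_reg, g2 0 (by decide), con.h0]
  have m3 : c3.mem = c2.mem := rfl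
  have o3 : c3.out = c2.out := rfl
  have h3 : c3.hist = c2.hist := rfl
  clear_value c3
  set c4 := (Prog.count 20 21 3 (op (.add 24 24 14))).run inp c3 with hc4
  have g4 : ∀ x, x ∉ [20, 21, 24] → c4.reg x = c3.reg x := fun x hx =>
    run_reg (by decide) (fun h => hx h) c3
  have l24 : c4.reg 24 = 5 + t * (2 * t + 3) := by
    rw [hc4, run_for_add (by decide) (by decide), g3 24 (by decide), g2 24 (by decide), k24,
      g3 3 (by decide), g2 3 (by decide), k3, g3 14 (by decide), g2 14 (by decide), con.h14]
  have m4 : c4.mem = c3.mem := run_mem (by decide) c3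
  have o4 : c4.out = c3.out := run_out (by decide) c3
  have h4 : c4.hist = c3.hist := run_hist (by decide) c3
  clear_value c4
  have g : ∀ x, x ∉ [20, 21, 22, 23, 24] → c4.reg x = c1.reg x := fun x hx => by
    simp only [List.mem_cons, not_or, List.not_mem_nil] at hx
    rw [g4 x (by simp; omega), g3 x (by simp; omega), g2 x (by simp; omega)]
  have r4 : Represents n t C.length ⟨[], [], 0, [], []⟩ c4 := by
    refine ⟨con.of_eq fun x hx => g x (by revert x; decide), by simp, ?_, ?_, ?_, ?_, ?_, ?_, ?_, ?_⟩
    · rw [g4 22 (by decide), l22, l23]; rfl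
    · rw [g4 23 (by decide), g3 23 (by decide), l23]; rfl
    · rw [l24]; simp
    · rw [g 25 (by decide), k25]; simp
    · rw [g 26 (by decide), k26, con.h6]; rfl
    · intro r _
      have : SimState.slot C.length (⟨[], [], 0, [], []⟩ : SimState (2 * t + 2)) r = .idle := by
        simp [SimState.slot]
      rw [this, m4, m3, m2, m1]
      exact ⟨fun _ _ => rfl, fun _ _ => rfl, rfl⟩
    · rw [o4, o3, o2, o1]
    · rw [h4, h3, h2, h1]
  have r5 := parity_spec (inp := inp) _ c4 r4 (by simp [places]; omega) (o := 0) (y := 6) (p := 10)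
    (by decide) ((g 10 (by decide)).trans k10)
  have g5 : ∀ x, x ∉ (parity 0 6 10).writes →
      ((parity 0 6 10).run inp c4).reg x = c4.reg x := fun x hx => run_reg (by decide) hx c4
  have r6 := parity_spec (inp := inp) _ _ r5 (by simp [places]; omega) (o := 6) (y := 7) (p := 11)
    (by decide) (q := pt) (by rw [g5 11 (by decide), g 11 (by decide), k11])
  rw [e1]
  rw [g5 6 (by decide), g5 7 (by decide), r4.consts.h0, r4.consts.h6, r4.consts.h7] at r6
  exact r6

theorem gate_spec {n t : ℕ} (C : Circuit n) (pn pt : Bool)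
    (X : Fin t → FermionParity (2 * t + 2)) (A : SimState (2 * t + 2)) (c : Config (2 * t + 2))
    (hc : Represents n t C.length A c) (hl : A.gates.length < C.length)
    (hi : C[A.gates.length].isT2 = true → A.used < t)
    (he : A.elim.length = 2 + A.used) :
    List.Forall₂ (fun c' B => Represents n t C.length B c')
      (gate.den (encodeInput C pn pt X) c) (A.gate n X C[A.gates.length]) := by
  have hin := fun j (hj : j < 2 * n + 4) => encodeInput_gate C pn pt X hl hj
  rw [← hc.r24] at hin
  have h0 := hin 0 (by omega)
  rw [add_zero] at h0
  rw [gate, den_seq_left (by decide), run_input, h0, den]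
  have hc' : ∀ v, Represents n t C.length A (c.setReg 56 v) := fun v =>
    hc.of_frame (by simp [Config.setReg_reg]) (fun _ _ => rfl) rfl rfl
  generalize hg : C[A.gates.length] = g at *
  cases g with
  | braid inv S h =>
    rw [if_neg (by simp [Config.setReg_reg, Gate.encode]), den_eq_run (by decide)]
    refine .cons (braid_spec A _ (hc' _) hl inv S ?_ ?_) .nil
    · have := hin 1 (by omega)
      simpa [Config.setReg_reg, Gate.encode] using this
    · intro j
      have := hin (j + 2) (by omega)
      have h2 : (Gate.braid inv S h).encode.getD (j + 2) 0 = (bitsOf S).getD j 0 := rfl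
      rw [h2, bitsOf_getD] at this
      rw [← this]
      simp [Config.setReg_reg]
      congr 2
      omega
  | T2 a b h =>
    have hi := hi rfl
    rw [if_pos (by simp [Config.setReg_reg, Gate.encode])]
    have hf := fun j (hj : j < 2 * t + 3) => encodeInput_frame C pn pt X ⟨A.used, hi⟩ hj
    simp only [← hc.r25] at hf
    refine magic_spec A _ (hc' _) hl hi (by simp only [places]; omega) a b h ?_ ?_ X ?_ ?_
    · have := hin 1 (by omega)
      simpa [Config.setReg_reg, Gate.encode] using this
    · have := hin 2 (by omega)
      simpa [Config.setReg_reg, Gate.encode] using this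
    · have := hf 0 (by omega)
      simpa [Config.setReg_reg, FermionParity.encode] using this
    · intro j
      have := hf (j + 1) (by omega)
      have h2 : (X ⟨A.used, hi⟩).encode.getD (j + 1) 0 =
        (bitsOf (X ⟨A.used, hi⟩).support).getD j 0 := rfl
      rw [h2, bitsOf_getD] at this
      rw [← this]
      simp [Config.setReg_reg]
      congr 2
      omega

/-- The machine refines the abstract simulation: loop by loop, the tree of its runs has the same
shape as the tree of simulation states. The counts of rules and used magic states are carried along
to guarantee a free place for every new rule. -/
theorem work_spec {n t : ℕ} (C : Circuit n) (hC : C.numT2 = t) (pn pt : Bool)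
    (X : Fin t → FermionParity (2 * t + 2)) (c : Config (2 * t + 2)) (hr : c.reg = fun _ => 0)
    (hm : c.mem = fun _ => 0) (ho : c.out = []) (hh : c.hist = []) :
    List.Forall₂ (fun c' B => Represents n t C.length B c')
      (simulate.den (encodeInput C pn pt X) c) (SimState.afterReadout pn pt X C n) := by
  obtain ⟨_, h1⟩ := init_spec C pn pt X c hr hm ho hh
  rw [simulate, den_seq_left (by decide), work, den_seq_left (by decide), den]
  generalize initRules.run (encodeInput C pn pt X)
    (initConsts.run (encodeInput C pn pt X) c) = c1 at *
  have hnext : ∀ (A : SimState (2 * t + 2)) (y : ℕ) (d : Config (2 * t + 2)),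
      Represents n t C.length A d → Represents n t C.length A (next 20 21 y d) :=
    fun A y d hd => hd.of_frame (by simp [next, Config.setReg_reg]) (fun _ _ => rfl) rfl rfl
  have hfirst : ∀ (A : SimState (2 * t + 2)) (y : ℕ) (d : Config (2 * t + 2)),
      Represents n t C.length A d → Represents n t C.length A (first 20 21 y d) :=
    fun A y d hd => hd.of_frame (by simp [first, Config.setReg_reg]) (fun _ _ => rfl) rfl rfl
  have hG := den_for (inp := encodeInput C pn pt X) (x := 20) (h := 21) (y := 4) (a := gate)
    (by decide) (by decide) c1
    (fun k d (A : SimState (2 * t + 2)) => Represents n t C.length A d ∧ A.gates.length = k ∧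
      A.elim.length = 2 + A.used ∧ A.used = (C.take k).countP Gate.isT2 ∧ A.out = [])
    (fun k => SimState.afterGates pn pt X (C.take k))
    (fun k A => C[k]?.elim [A] fun g => A.gate n X g) (b₀ := SimState.init n t pn pt)
    (by simp [SimState.afterGates]) (fun k => by
      rw [SimState.afterGates, List.take_add_one, List.foldl_append]
      cases C[k]? <;> simp [SimState.afterGates])
    ⟨hfirst _ _ _ h1, rfl, rfl, by simp [SimState.init], rfl⟩ (by
      rintro k d A hk - ⟨g1, rfl, g3, g4, g5⟩
      rw [h1.consts.h4] at hk
      rw [List.getElem?_eq_getElem hk, Option.elim_some]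
      have hcount : (C.take (A.gates.length + 1)).countP Gate.isT2 =
          (C.take A.gates.length).countP Gate.isT2 + C[A.gates.length].isT2.toNat := by
        rw [List.take_add_one, List.countP_append, List.getElem?_eq_getElem hk]
        cases h : C[A.gates.length].isT2 <;> simp [h]
      -- Only `t` gates are `T2` gates, so the current one, if it is of this kind, finds an unused
      -- magic state. This excludes the empty branch of `SimState.gate`.
      have hle : (C.take (A.gates.length + 1)).countP Gate.isT2 ≤ t :=
        ((List.take_sublist _ _).countP_le).trans_eq hC
      have hs := gate_spec C pn pt X A d g1 hk (fun h => by
        rw [hcount, h, ← g4] at hle; exact hle) g3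
      refine ((List.forall₂_and_left (p := fun B => B ∈ A.gate n X C[A.gates.length]) _ _).2
        ⟨fun B hB => hB, hs.flip⟩).flip.imp fun e B ⟨hB, h2⟩ => ?_
      obtain ⟨s1, s2, s3, s4⟩ := SimState.gate_sizes hB
      exact ⟨hnext _ _ _ h2, s1, by omega, by rw [hcount]; omega, s4.trans g5⟩)
  rw [h1.consts.h4, List.take_length] at hG
  rw [SimState.afterReadout]
  have hfold : ∀ (k : ℕ) (l : List (SimState (2 * t + 2))),
      (List.range k).foldl (fun l j => l.flatMap (SimState.readout n j)) l =
        l.flatMap fun A => (List.range k).foldl (fun l j => l.flatMap (SimState.readout n j))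
          [A] := by
    intro k l
    induction k with
    | zero => simp
    | succ k ih =>
      simp only [List.range_succ, List.foldl_append, List.foldl_cons, List.foldl_nil]
      rw [ih, List.flatMap_assoc]
  rw [hfold]
  refine List.rel_flatMap hG fun d A ⟨g1, g2, g3, g4, g5⟩ => ?_
  have hR := den_for (inp := encodeInput C pn pt X) (x := 20) (h := 21) (y := 2) (a := readout)
    (by decide) (by decide) d
    (fun k d (A : SimState (2 * t + 2)) => Represents n t C.length A d ∧
      A.elim.length = 2 + A.used + k ∧ A.used = t)
    (fun k => (List.range k).foldl (fun l j => l.flatMap (SimState.readout n j)) [A])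
    (fun j A => A.readout n j) (b₀ := A) rfl (fun k => by
      simp only [List.range_succ, List.foldl_append, List.foldl_cons, List.foldl_nil])
    ⟨hfirst _ _ _ g1, g3, g4.trans hC⟩ (by
      rintro k d A hk' h20 ⟨r1, r2, r3⟩
      rw [g1.consts.h2] at hk'
      refine ((List.forall₂_and_left (p := fun B => B ∈ A.readout n k) _ _).2
        ⟨fun B hB => hB, (readout_spec A d r1 (by simp only [places]; omega) hk' h20).flip⟩).flip.imp
          fun e B ⟨hB, h2⟩ => ?_
      obtain ⟨s1, s2, s3, s4⟩ := SimState.readout_sizes hB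
      exact ⟨hnext _ _ _ h2, by omega, by omega⟩)
  rw [g1.consts.h2] at hR
  exact hR.imp fun _ _ h => h.1

/-- The step bound makes the finite list of runs coincide with the denotation of the program, and
`work_spec` identifies the latter with the simulation as far as output and random events are
concerned. -/
theorem run_simulate {n t : ℕ} (C : Circuit n) (hC : C.numT2 = t) (pn pt : Bool)
    (X : Fin t → FermionParity (2 * t + 2)) :
    List.Forall₂ (fun c A => c.todo = [] ∧ c.out = A.out ∧ c.hist = A.hist)
      (Config.run (N := 2 * t + 2) (encodeInput C pn pt X)
        ((initConsts.time + work.time.comp (8 * Polynomial.X + 4) + 1).eval (n + C.length))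
        (Config.start simulate.compile))
      (SimState.afterReadout pn pt X C n) := by
  set c0 : Config (2 * t + 2) := ⟨[], fun _ => 0, fun _ => 0, [], []⟩ with hc0
  -- Hence the bound 4(n + t + L) + 4 on the registers is at most 8(n + L) + 4, the polynomial
  -- substituted into the time of `work`.
  have ht : t ≤ C.length := hC ▸ List.countP_le_length
  -- The initialization contains no loop, so it is well formed for the empty list and free to set
  -- the registers that bound the loops of `work`.
  have hw : initConsts.wf [] := by decide
  have hw' : work.wf [2, 3, 4, 5, 6, 7, 8] := by decide
  have hL : Config.Leads (encodeInput C pn pt X)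
      ((initConsts.time + work.time.comp (8 * Polynomial.X + 4) + 1).eval (n + C.length))
      (Config.start simulate.compile) (simulate.den (encodeInput C pn pt X) c0) := by
    simp only [Polynomial.eval_add, Polynomial.eval_one, Polynomial.eval_comp,
      Polynomial.eval_mul, Polynomial.eval_X, Polynomial.eval_ofNat]
    refine Config.Leads.single (c' := (c0.push work.compile).push initConsts.compile) rfl ?_
    refine leads_push (all_of_wf hw) (leads_compile _ hw (c0.push work.compile) (by simp))
      fun e he => ?_
    refine leads_compile _ hw' e fun k hk => ?_
    rw [den_eq_run (by decide), List.mem_singleton] at he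
    rw [he]
    have := (init_spec C pn pt X c0 rfl rfl rfl rfl).1 k hk
    omega
  have htodo : ∀ x ∈ simulate.den (encodeInput C pn pt X) c0, x.todo = [] := fun x hx =>
    den_todo (by decide) c0 x hx
  rw [hL.run_eq htodo]
  refine ((List.forall₂_and_left _ _).2
    ⟨htodo, work_spec C hC pn pt X c0 rfl rfl rfl rfl⟩).imp fun c A ⟨h1, h2⟩ => ?_
  exact ⟨h1, h2.out, h2.hist⟩

end Prog

/-! ### Majorana strings -/

/-- `(-1)^x`. -/
noncomputable def sgn (x : ZMod 2) : ℂ := if x = 0 then 1 else -1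

theorem sgn_zero : sgn 0 = 1 := if_pos rfl

theorem sgn_one : sgn 1 = -1 := if_neg (by decide)

theorem sgn_add (x y : ZMod 2) : sgn (x + y) = sgn x * sgn y := by
  rcases ZMod.two_cases x with rfl | rfl <;> rcases ZMod.two_cases y with rfl | rfl <;>
    simp [sgn, show (1 + 1 : ZMod 2) = 0 from rfl]

theorem sgn_mul_self (x : ZMod 2) : sgn x * sgn x = 1 := by
  rcases ZMod.two_cases x with rfl | rfl <;> simp [sgn]

theorem I_pow_val_add (a b : ZMod 4) :
    Complex.I ^ (a + b).val = Complex.I ^ a.val * Complex.I ^ b.val := by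
  rw [ZMod.val_add, ← pow_eq_pow_mod _ Complex.I_pow_four, pow_add]

theorem I_pow_dbl (x : ZMod 2) : Complex.I ^ (dbl x).val = sgn x := by
  rcases ZMod.two_cases x with rfl | rfl
  · simp [dbl, sgn]
  · rw [dbl, if_neg (by decide), sgn_one, show (2 : ZMod 4).val = 2 from rfl, Complex.I_sq]

theorem I_pow_val_natCast (k : ℕ) : Complex.I ^ (k : ZMod 4).val = Complex.I ^ k := by
  rw [ZMod.val_natCast, ← pow_eq_pow_mod _ Complex.I_pow_four]

/-- A pair of distinct positions, one from each string, is counted by exactly one of the two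
crossings, and a common position by neither. So the sum is the product of the weights minus the
overlap, modulo two. -/
theorem cross_add_cross (k : ℕ) (u v : ℕ → ZMod 2) :
    cross k u v + cross k v u =
      (∑ j ∈ Finset.range k, u j) * (∑ j ∈ Finset.range k, v j) + dot k u v := by
  induction k with
  | zero => simp [cross, dot]
  | succ k ih =>
    rw [cross_succ, cross_succ, dot_succ, Finset.sum_range_succ, Finset.sum_range_succ]
    have h2 : (2 : ZMod 2) = 0 := rfl
    linear_combination ih - (u k * v k) * h2

section SqNorm

variable {ι : Type*} [Fintype ι]

theorem sqNorm_eq (v : ι → ℂ) : (sqNorm v : ℂ) = star v ⬝ᵥ v := by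
  simp only [sqNorm, dotProduct, Pi.star_apply, Complex.ofReal_sum, Complex.ofReal_pow]
  refine Finset.sum_congr rfl fun i _ => ?_
  exact (Complex.conj_mul' _).symm

theorem sqNorm_unitary [DecidableEq ι] {U : Matrix ι ι ℂ} (hU : Uᴴ * U = 1) (v : ι → ℂ) :
    sqNorm (U *ᵥ v) = sqNorm v := by
  have : (sqNorm (U *ᵥ v) : ℂ) = sqNorm v := by
    rw [sqNorm_eq, sqNorm_eq, star_mulVec, dotProduct_mulVec, vecMul_vecMul, hU, vecMul_one]
  exact_mod_cast this

theorem sqNorm_smul (c : ℂ) (v : ι → ℂ) : sqNorm (c • v) = ‖c‖ ^ 2 * sqNorm v := by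
  simp [sqNorm, Finset.mul_sum, mul_pow]

theorem sqNorm_zero : sqNorm (0 : ι → ℂ) = 0 := by simp [sqNorm]

theorem eq_zero_of_sqNorm {v : ι → ℂ} (h : sqNorm v = 0) : v = 0 := by
  rw [sqNorm, Finset.sum_eq_zero_iff_of_nonneg (fun _ _ => by positivity)] at h
  funext i
  simpa using h i (Finset.mem_univ i)

theorem sqNorm_parallelogram (v w : ι → ℂ) :
    sqNorm (v + w) + sqNorm (v - w) = 2 * sqNorm v + 2 * sqNorm w := by
  simp only [sqNorm, Finset.mul_sum, ← Finset.sum_add_distrib]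
  refine Finset.sum_congr rfl fun i _ => ?_
  have := parallelogram_law_with_norm ℝ (v i) (w i)
  simp only [Pi.add_apply, Pi.sub_apply]
  linarith

/-- A projector halves the norm if a stabiliser anticommutes with it. -/
theorem sqNorm_half [DecidableEq ι] {r s : Matrix ι ι ℂ} (hr : rᴴ * r = 1) (hs : sᴴ * s = 1)
    (hrs : s * r = -(r * s)) {v : ι → ℂ} (hv : s *ᵥ v = v) :
    sqNorm ((1 / 2 : ℂ) • (v + r *ᵥ v)) = sqNorm v / 2 := by
  have h1 := sqNorm_parallelogram v (r *ᵥ v)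
  rw [sqNorm_unitary hr] at h1
  -- The stabiliser exchanges the two outcomes, so they have equal norm, and the parallelogram law
  -- determines it.
  have h2 : s *ᵥ (v + r *ᵥ v) = v - r *ᵥ v := by
    rw [mulVec_add, mulVec_mulVec, hrs, neg_mulVec, ← mulVec_mulVec, hv, sub_eq_add_neg]
  rw [← h2, sqNorm_unitary hs] at h1
  rw [sqNorm_smul]
  norm_num
  linarith

end SqNorm

namespace MajoranaRegister

variable {N : ℕ} {ι : Type*} [Fintype ι] [DecidableEq ι] (R : MajoranaRegister N ι)

/-- The Majorana operators, numbered by natural numbers. -/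
noncomputable def gen (j : ℕ) : Matrix ι ι ℂ := if h : j < N then R.γ ⟨j, h⟩ else 1

/-- The ordered product of the Majorana operators below `k` in a set. -/
noncomputable def mono (k : ℕ) (u : ℕ → ZMod 2) : Matrix ι ι ℂ :=
  ((List.range k).map fun j => if u j = 0 then 1 else R.gen j).prod

theorem mono_zero (u : ℕ → ZMod 2) : R.mono 0 u = 1 := rfl

theorem mono_succ (k : ℕ) (u : ℕ → ZMod 2) :
    R.mono (k + 1) u = R.mono k u * if u k = 0 then 1 else R.gen k := by
  simp [mono, List.range_succ]

theorem mono_congr {k : ℕ} {u v : ℕ → ZMod 2} (h : ∀ j < k, u j = v j) :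
    R.mono k u = R.mono k v := by
  refine congrArg List.prod (List.map_congr_left fun j hj => ?_)
  rw [h j (List.mem_range.1 hj)]

theorem mono_eq_one {k : ℕ} {u : ℕ → ZMod 2} (h : ∀ j < k, u j = 0) : R.mono k u = 1 := by
  induction k with
  | zero => rfl
  | succ k ih => rw [mono_succ, ih fun j hj => h j (by omega), if_pos (h k (by omega)), one_mul]

variable {R}

theorem gen_sq {j : ℕ} (hj : j < N) : R.gen j * R.gen j = 1 := by
  have := R.anticomm ⟨j, hj⟩ ⟨j, hj⟩
  rw [if_pos rfl, ← two_smul ℂ] at this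
  rw [gen, dif_pos hj]
  have h2 : (2 : Matrix ι ι ℂ) = (2 : ℂ) • 1 := by rw [two_smul, one_add_one_eq_two]
  rw [h2] at this
  exact smul_right_injective _ (two_ne_zero (α := ℂ)) this

theorem gen_anticomm {j k : ℕ} (hj : j < N) (hk : k < N) (hjk : j ≠ k) :
    R.gen j * R.gen k = -(R.gen k * R.gen j) := by
  have := R.anticomm ⟨j, hj⟩ ⟨k, hk⟩
  rw [if_neg (by simpa using hjk)] at this
  rw [gen, gen, dif_pos hj, dif_pos hk]
  exact eq_neg_of_add_eq_zero_left this

theorem gen_conjTranspose (j : ℕ) : (R.gen j)ᴴ = R.gen j := by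
  rw [gen]
  split_ifs
  · exact R.hermitian _
  · simp

theorem gen_mul_mono {k m : ℕ} (hkm : k ≤ m) (hm : m < N) (u : ℕ → ZMod 2) :
    R.gen m * R.mono k u = sgn (∑ j ∈ Finset.range k, u j) • (R.mono k u * R.gen m) := by
  induction k with
  | zero => simp [mono_zero, sgn]
  | succ k ih =>
    rw [mono_succ, Finset.sum_range_succ, sgn_add, ← mul_assoc, ih (by omega)]
    rcases ZMod.two_cases (u k) with h | h
    · simp [h, sgn]
    · rw [h, if_neg (by decide), smul_mul_assoc, mul_assoc, mul_assoc,
        gen_anticomm hm (by omega) (by omega)]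
      simp [sgn]

/-- When the highest factor of the first string is moved past the lower part of the second, it meets
one sign per factor. These signs are the last summand of `cross`, and equal factors at the end
cancel. -/
theorem mono_mul {k : ℕ} (hk : k ≤ N) (u v : ℕ → ZMod 2) :
    R.mono k u * R.mono k v = sgn (cross k u v) • R.mono k (u + v) := by
  induction k with
  | zero => simp [mono_zero, cross, sgn]
  | succ k ih =>
    rw [mono_succ, mono_succ, mono_succ, cross_succ, sgn_add]
    have ih := ih (by omega)
    have hg := gen_mul_mono (R := R) (le_refl k) (by omega) v
    have h2 : (if u k = 0 then 1 else R.gen k) * R.mono k v =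
        sgn (u k * ∑ j ∈ Finset.range k, v j) •
          (R.mono k v * if u k = 0 then 1 else R.gen k) := by
      rcases ZMod.two_cases (u k) with h | h
      · simp [h, sgn]
      · rw [h, if_neg (by decide), one_mul]; exact hg
    have h3 : (if u k = 0 then 1 else R.gen k) * (if v k = 0 then 1 else R.gen k) =
        if (u + v) k = 0 then 1 else R.gen k := by
      rw [Pi.add_apply]
      rcases ZMod.two_cases (u k) with h | h <;> rcases ZMod.two_cases (v k) with h' | h' <;>
        simp [h, h', gen_sq (R := R) (show k < N by omega), show (1 + 1 : ZMod 2) = 0 from rfl]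
    calc _ = R.mono k u * ((if u k = 0 then 1 else R.gen k) * R.mono k v) *
          (if v k = 0 then 1 else R.gen k) := by simp only [mul_assoc]
      _ = sgn (u k * ∑ j ∈ Finset.range k, v j) • ((R.mono k u * R.mono k v) *
          ((if u k = 0 then 1 else R.gen k) * (if v k = 0 then 1 else R.gen k))) := by
        rw [h2]; simp only [mul_assoc, mul_smul_comm, smul_mul_assoc]
      _ = _ := by
        rw [ih, h3, smul_mul_assoc, smul_smul, mul_comm (sgn _)]

theorem mono_conjTranspose_mul {k : ℕ} (hk : k ≤ N) (u : ℕ → ZMod 2) :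
    (R.mono k u)ᴴ * R.mono k u = 1 := by
  induction k with
  | zero => simp [mono_zero]
  | succ k ih =>
    rw [mono_succ, conjTranspose_mul, mul_assoc, ← mul_assoc (R.mono k u)ᴴ, ih (by omega), one_mul]
    split_ifs
    · simp
    · rw [gen_conjTranspose, gen_sq (by omega)]

variable (R)

/-- The operator that a word denotes. -/
noncomputable def op (w : Word) : Matrix ι ι ℂ := Complex.I ^ w.ph.val • R.mono N w.b

variable {R}

theorem op_mul (u v : Word) : R.op (u.mul N v) = R.op u * R.op v := by
  rw [op, op, op, Word.mul, smul_mul_smul_comm, mono_mul le_rfl, smul_smul, I_pow_val_add,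
    I_pow_val_add, I_pow_dbl]

theorem op_unitary (w : Word) : (R.op w)ᴴ * R.op w = 1 := by
  rw [op, conjTranspose_smul, smul_mul_smul_comm, mono_conjTranspose_mul le_rfl, star_pow,
    ← mul_pow]
  simp

/-- The signs of the two products differ by both crossings together, which `cross_add_cross`
evaluates. If one string has even weight, only the overlap is left, and this is the form used from
here on. -/
theorem op_comm (u v : Word) : R.op u * R.op v =
    sgn ((∑ j ∈ Finset.range N, u.b j) * (∑ j ∈ Finset.range N, v.b j) + dot N u.b v.b) •
      (R.op v * R.op u) := by
  rw [op, op, smul_mul_smul_comm, smul_mul_smul_comm, mono_mul le_rfl, mono_mul le_rfl, add_comm v.b,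
    smul_smul, smul_smul, smul_smul, ← cross_add_cross, sgn_add]
  congr 1
  linear_combination (-Complex.I ^ u.ph.val * Complex.I ^ v.ph.val * sgn (cross N u.b v.b)) *
    sgn_mul_self (cross N v.b u.b)

theorem op_commute {u v : Word} (hu : ∑ j ∈ Finset.range N, u.b j = 0) (h : dot N u.b v.b = 0) :
    R.op u * R.op v = R.op v * R.op u := by
  rw [op_comm, hu, h, zero_mul, zero_add, sgn_zero, one_smul]

theorem op_anticommute {u v : Word} (hu : ∑ j ∈ Finset.range N, u.b j = 0)
    (h : dot N u.b v.b ≠ 0) : R.op u * R.op v = -(R.op v * R.op u) := by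
  rw [op_comm, hu, (ZMod.two_cases _).resolve_left h, zero_mul, zero_add, sgn_one, neg_one_smul]

theorem op_congr {u v : Word} (h1 : u.ph = v.ph) (h2 : ∀ j < N, u.b j = v.b j) :
    R.op u = R.op v := by
  rw [op, op, h1, mono_congr R h2]

theorem op_sq (u : Word) : ∃ c : ℂ, R.op u * R.op u = c • 1 := by
  refine ⟨Complex.I ^ u.ph.val * Complex.I ^ u.ph.val * sgn (cross N u.b u.b), ?_⟩
  rw [op, smul_mul_smul_comm, mono_mul le_rfl, mono_eq_one R (u := u.b + u.b)
    (fun j _ => by rw [Pi.add_apply]; exact CharTwo.add_self_eq_zero _), smul_smul]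

theorem op_flip (w : Word) (c : Bool) : R.op (w.flip c) = bitSign c • R.op w := by
  cases c
  · simp [Word.flip, bitSign, op]
  · simp only [Word.flip, op, bitSign, if_true, I_pow_val_add, smul_smul]
    rw [show (2 : ZMod 4).val = 2 from rfl, Complex.I_sq, mul_comm]

theorem cross_self (k : ℕ) (u : ℕ → ZMod 2) :
    cross k u u = (((Finset.range k).filter fun j => u j ≠ 0).card.choose 2 : ℕ) ∧
    ∑ j ∈ Finset.range k, u j = (((Finset.range k).filter fun j => u j ≠ 0).card : ℕ) := by
  induction k with
  | zero => simp [cross]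
  | succ k ih =>
    rw [cross_succ, Finset.sum_range_succ, ih.1, ih.2, Finset.range_add_one, Finset.filter_insert]
    rcases ZMod.two_cases (u k) with h | h
    · simp [h]
    · simp only [h, ne_eq, one_ne_zero, not_false_eq_true, if_true]
      rw [Finset.card_insert_of_notMem (by simp), Nat.choose_succ_succ' _ 1]
      push_cast
      simp [add_comm]

/-- With weight 2h, squaring the phase gives i^(2h) = (-1)^h, and sorting gives (-1)^(h(2h-1)) =
(-1)^h; the two cancel. -/
theorem op_half_sq {u : ℕ → ZMod 2} (hu : ∑ j ∈ Finset.range N, u j = 0) :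
    R.op ⟨halfCount N u, u⟩ * R.op ⟨halfCount N u, u⟩ = 1 := by
  rw [op, smul_mul_smul_comm, mono_mul le_rfl, mono_eq_one R (u := u + u)
    (fun j _ => by rw [Pi.add_apply]; exact CharTwo.add_self_eq_zero _), smul_smul, (cross_self N u).1,
    I_pow_val_natCast, ← mul_pow, Complex.I_mul_I, halfCount]
  rw [(cross_self N u).2, ZMod.natCast_eq_zero_iff] at hu
  obtain ⟨h, hh⟩ := hu
  rw [hh, Nat.mul_div_cancel_left _ (by norm_num), Nat.choose_two_right]
  have h1 : 2 * h * (2 * h - 1) / 2 = h * (2 * h - 1) := by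
    rw [mul_assoc, Nat.mul_div_cancel_left _ (by norm_num)]
  rw [h1]
  have h2 : sgn ((h * (2 * h - 1) : ℕ) : ZMod 2) = (-1) ^ h := by
    rcases Nat.even_or_odd' h with ⟨c, rfl | rfl⟩
    · rw [(ZMod.natCast_eq_zero_iff _ _).2 ⟨c * (2 * (2 * c) - 1), by ring⟩, sgn_zero,
        pow_mul]
      simp
    · have : (((2 * c + 1) * (2 * (2 * c + 1) - 1) : ℕ) : ZMod 2) = 1 := by
        rw [show (2 * c + 1) * (2 * (2 * c + 1) - 1) = 2 * (4 * c * c + 3 * c) + 1 by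
          rw [show 2 * (2 * c + 1) - 1 = 4 * c + 1 by omega]; ring]
        push_cast
        rw [show (2 : ZMod 2) = 0 from rfl]; ring
      rw [this, sgn_one, pow_succ, pow_mul]
      simp
  rw [h2, ← mul_pow]
  simp

theorem parity_eq (S : Finset (Fin N)) :
    R.parity S = Complex.I ^ (S.card / 2) • R.mono N (shiftInd 0 S) := by
  rw [parity]
  congr 1
  -- Both lists are sorted and have the same members. The product over `S` can then be compared with
  -- `mono`, which runs over all positions and inserts ones.
  have h1 : S.sort (· ≤ ·) = (List.finRange N).filter fun j => j ∈ S := by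
    refine List.Perm.eq_of_pairwise' (S.pairwise_sort (· ≤ ·))
      ((List.pairwise_le_finRange N).filter _) ?_
    refine (List.perm_ext_iff_of_nodup (S.sort_nodup _) ((List.nodup_finRange N).filter _)).2
      fun j => ?_
    simp
  have h2 : List.range N = (List.finRange N).map Fin.val := by simp
  rw [h1, mono, h2, List.map_map]
  generalize List.finRange N = l
  induction l with
  | nil => rfl
  | cons a l ih =>
    rw [List.map_cons, List.prod_cons, ← ih, List.filter_cons]
    have h3 : shiftInd 0 S (a : ℕ) = if a ∈ S then 1 else 0 := by
      simp [shiftInd, ind, ← Fin.ext_iff]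
    simp only [Function.comp_apply, h3, gen, a.2, dif_pos]
    by_cases h : a ∈ S <;> simp [h]

theorem card_filter_ind (k : ℕ) (S : Finset ℕ) (hS : ∀ j ∈ S, j < k) :
    ((Finset.range k).filter fun j => ind S j ≠ 0) = S := by
  ext j
  by_cases h : j ∈ S
  · simp [ind, h, hS j h]
  · simp [ind, h]

theorem parity_eq_op (S : Finset (Fin N)) :
    R.parity S = R.op ⟨halfCount N (shiftInd 0 S), shiftInd 0 S⟩ := by
  rw [parity_eq, op, I_pow_val_natCast, halfCount, shiftInd, card_filter_ind]
  · rw [Finset.card_image_of_injective _ fun a b h => by simpa [Fin.ext_iff] using h]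
  · intro j hj
    obtain ⟨x, _, rfl⟩ := Finset.mem_image.1 hj
    simp

end MajoranaRegister

/-! ### The joint register -/

/-! ### Exponentials of involutions -/

section Exp

variable {ι : Type*} [Fintype ι] [DecidableEq ι]

/-- The algebra generated by an involution. -/
noncomputable def involutionHom (A : Matrix ι ι ℂ) (hA : A * A = 1) : ℂ × ℂ →+* Matrix ι ι ℂ where
  toFun z := ((z.1 + z.2) / 2) • 1 + ((z.1 - z.2) / 2) • A
  map_one' := by simp
  map_zero' := by simp
  map_add' x y := by
    simp only [Prod.fst_add, Prod.snd_add]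
    module
  map_mul' x y := by
    simp only [Prod.fst_mul, Prod.snd_mul, add_mul, mul_add, smul_mul_smul_comm, hA, one_mul,
      mul_one]
    module

/-- The two eigenprojectors of `A` give a continuous ring homomorphism from ℂ × ℂ, where the
exponential is taken componentwise. The matrix `z • A` is the image of (z, -z). -/
theorem exp_smul_involution {A : Matrix ι ι ℂ} (hA : A * A = 1) (z : ℂ) :
    NormedSpace.exp (z • A) = Complex.cosh z • (1 : Matrix ι ι ℂ) + Complex.sinh z • A := by
  have hc : Continuous (involutionHom A hA) := by
    change Continuous fun z : ℂ × ℂ => ((z.1 + z.2) / 2) • (1 : Matrix ι ι ℂ) + ((z.1 - z.2) / 2) • A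
    fun_prop
  let _ : NormedRing (Matrix ι ι ℂ) := Matrix.linftyOpNormedRing
  let _ : NormedAlgebra ℂ (Matrix ι ι ℂ) := Matrix.linftyOpNormedAlgebra
  have h := NormedSpace.map_exp (involutionHom A hA) hc ((z, -z) : ℂ × ℂ)
  have h1 : involutionHom A hA (z, -z) = z • A := by simp [involutionHom]
  have h2 : NormedSpace.exp ((z, -z) : ℂ × ℂ) = (Complex.exp z, Complex.exp (-z)) := by
    rw [Complex.exp_eq_exp_ℂ]
    exact Prod.ext (Prod.fst_exp _) (Prod.snd_exp _)
  rw [h1, h2] at h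
  have h3 : involutionHom A hA (Complex.exp z, Complex.exp (-z)) =
      Complex.cosh z • (1 : Matrix ι ι ℂ) + Complex.sinh z • A := by
    simp [involutionHom, Complex.cosh, Complex.sinh]
  rw [h3] at h
  -- The norms chosen above are local and only serve to apply `map_exp`; after unfolding the
  -- instances, both exponentials are the same.
  with_unfolding_all exact h.symm

theorem conjTranspose_eq_of_sq {A : Matrix ι ι ℂ} (h1 : A * A = 1) (h2 : Aᴴ * A = 1) : Aᴴ = A := by
  calc Aᴴ = Aᴴ * (A * A) := by rw [h1, mul_one]
    _ = A := by rw [← mul_assoc, h2, one_mul]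

end Exp

/-! ### Tensor products of vectors -/

section Tensor

variable {ι κ : Type*}

/-- The tensor product of two vectors. -/
def tensorVec (φ : ι → ℂ) (θ : κ → ℂ) : ι × κ → ℂ := fun p => φ p.1 * θ p.2

open scoped Kronecker

theorem kronecker_mulVec_tensorVec [Fintype ι] [Fintype κ] (A : Matrix ι ι ℂ) (B : Matrix κ κ ℂ) (φ : ι → ℂ) (θ : κ → ℂ) :
    (A ⊗ₖ B) *ᵥ tensorVec φ θ = tensorVec (A *ᵥ φ) (B *ᵥ θ) := by
  funext p
  simp only [mulVec, dotProduct, tensorVec, kroneckerMap_apply, Fintype.sum_prod_type,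
    Finset.sum_mul_sum]
  exact Finset.sum_congr rfl fun i _ => Finset.sum_congr rfl fun j _ => by ring

theorem sqNorm_tensorVec [Fintype ι] [Fintype κ] (φ : ι → ℂ) (θ : κ → ℂ) : sqNorm (tensorVec φ θ) = sqNorm φ * sqNorm θ := by
  simp only [sqNorm, tensorVec, Fintype.sum_prod_type, Finset.sum_mul_sum, norm_mul, mul_pow]

theorem tensorVec_smul (c : ℂ) (φ : ι → ℂ) (θ : κ → ℂ) : tensorVec φ (c • θ) = c • tensorVec φ θ := by
  funext p; simp [tensorVec]; ring

theorem smul_tensorVec (c : ℂ) (φ : ι → ℂ) (θ : κ → ℂ) : tensorVec (c • φ) θ = c • tensorVec φ θ := by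
  funext p; simp [tensorVec]; ring

theorem tensorVec_add (φ : ι → ℂ) (θ θ' : κ → ℂ) : tensorVec φ (θ + θ') = tensorVec φ θ + tensorVec φ θ' := by
  funext p; simp [tensorVec]; ring

end Tensor

theorem shiftInd_zero_univ {m j : ℕ} (hj : j < m) : shiftInd 0 (Finset.univ : Finset (Fin m)) j = 1 := by
  rw [shiftInd, ind, if_pos]
  exact Finset.mem_image.2 ⟨⟨j, hj⟩, Finset.mem_univ _, by simp⟩

theorem dot_ind (N : ℕ) (u : ℕ → ZMod 2) (S : Finset ℕ) (hS : ∀ j ∈ S, j < N) :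
    dot N u (ind S) = ∑ j ∈ S, u j := by
  simp only [dot, ind, mul_ite, mul_one, mul_zero]
  rw [← Finset.sum_filter]
  refine Finset.sum_congr ?_ fun _ _ => rfl
  ext j
  simp only [Finset.mem_filter, Finset.mem_range]
  exact ⟨fun h => h.2, fun h => ⟨hS j h, h⟩⟩

theorem dot_comm (N : ℕ) (u v : ℕ → ZMod 2) : dot N u v = dot N v u :=
  Finset.sum_congr rfl fun _ _ => mul_comm _ _

theorem dot_add (N : ℕ) (u v w : ℕ → ZMod 2) : dot N u (v + w) = dot N u v + dot N u w := by
  simp [dot, mul_add, Finset.sum_add_distrib]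

theorem add_dot (N : ℕ) (u v w : ℕ → ZMod 2) : dot N (u + v) w = dot N u w + dot N v w := by
  simp [dot, add_mul, Finset.sum_add_distrib]

namespace MajoranaRegister

section Single

variable {N m : ℕ} {ι : Type*} [Fintype ι] [DecidableEq ι] {R : MajoranaRegister N ι}

theorem mono_ind_singleton (k j : ℕ) : R.mono k (ind {j}) = if j < k then R.gen j else 1 := by
  induction k with
  | zero => simp [mono_zero]
  | succ k ih =>
    rw [mono_succ, ih]
    simp only [ind, Finset.mem_singleton]
    rcases lt_trichotomy j k with h | h | h
    · rw [if_pos h, if_pos (by omega : j < k + 1), if_pos (by rw [if_neg (by omega)]), mul_one]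
    · subst h; simp
    · rw [if_neg (by omega), if_neg (by omega : ¬ j < k + 1), if_pos (by rw [if_neg (by omega)]),
        mul_one]

theorem op_singleton {j : ℕ} (hj : j < N) : R.op ⟨0, ind {j}⟩ = R.gen j := by
  rw [op, mono_ind_singleton, if_pos hj]
  simp

theorem op_pair (p : ZMod 4) {a b : ℕ} (hab : a < b) (hb : b < N) :
    R.op ⟨p, ind {a, b}⟩ = Complex.I ^ p.val • (R.gen a * R.gen b) := by
  rw [← op_singleton (hab.trans hb), ← op_singleton hb, op, op, op, smul_mul_smul_comm,
    mono_mul le_rfl]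
  have h1 : (ind {a} + ind {b} : ℕ → ZMod 2) = ind {a, b} := by
    funext j
    simp only [Pi.add_apply, ind, Finset.mem_singleton, Finset.mem_insert]
    by_cases h : j = a
    · subst h; simp [hab.ne]
    · simp [h]
  have h2 : cross N (ind {a}) (ind {b}) = 0 := by
    refine Finset.sum_eq_zero fun j _ => ?_
    simp only [ind, Finset.mem_singleton]
    by_cases h : j = a
    · subst h
      rw [Finset.sum_eq_zero, mul_zero]
      intro k hk
      rw [if_neg]
      have := Finset.mem_range.1 hk
      omega
    · simp [h]
  rw [h1, h2, sgn_zero]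
  simp

theorem totalParity_eq_op (R : MajoranaRegister (2 * m + 2) ι) : R.totalParity =
    R.op ⟨halfCount (2 * m + 2) (shiftInd 0 (Finset.univ : Finset (Fin (2 * m + 2)))),
      shiftInd 0 (Finset.univ : Finset (Fin (2 * m + 2)))⟩ := parity_eq_op _

theorem sum_shiftInd_univ (m : ℕ) : ∑ j ∈ Finset.range (2 * m + 2),
    shiftInd 0 (Finset.univ : Finset (Fin (2 * m + 2))) j = 0 := by
  rw [Finset.sum_congr rfl fun j hj => shiftInd_zero_univ (Finset.mem_range.1 hj)]
  simp
  rw [show (2 : ZMod 2) = 0 from rfl]; ring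

theorem totalParity_sq (R : MajoranaRegister (2 * m + 2) ι) :
    R.totalParity * R.totalParity = 1 := by
  rw [totalParity_eq_op, op_half_sq (sum_shiftInd_univ m)]

theorem totalParity_conjTranspose (R : MajoranaRegister (2 * m + 2) ι) :
    R.totalParityᴴ = R.totalParity :=
  conjTranspose_eq_of_sq (totalParity_sq R) (by rw [totalParity_eq_op]; exact op_unitary _)

/-- The total parity has even weight and overlaps with a single Majorana once. As the left factor of
the Majoranas of `R_t` in `joint`, it makes them anticommute with those of `R_n`. -/
theorem totalParity_gen (R : MajoranaRegister (2 * m + 2) ι) {j : ℕ} (hj : j < 2 * m + 2) :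
    R.totalParity * R.gen j = -(R.gen j * R.totalParity) := by
  rw [totalParity_eq_op, ← op_singleton hj, op_anticommute (sum_shiftInd_univ m)]
  simp only
  rw [dot_ind _ _ _ (by simpa using hj), Finset.sum_singleton, shiftInd_zero_univ hj]
  decide

theorem gen_fin (R : MajoranaRegister N ι) (j : Fin N) : R.gen j = R.γ j := dif_pos j.2

end Single

open scoped Kronecker

variable {n t : ℕ} {ι κ : Type*} [Fintype ι] [DecidableEq ι] [Fintype κ] [DecidableEq κ]

/-- The Majorana operators of two registers on their joint Hilbert space. -/
noncomputable def joint (Rn : MajoranaRegister (2 * n + 2) ι) (Rt : MajoranaRegister (2 * t + 2) κ) :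
    MajoranaRegister (total n t) (ι × κ) where
  γ j := if (j : ℕ) < 2 * n + 2 then Rn.gen j ⊗ₖ 1 else Rn.totalParity ⊗ₖ Rt.gen (j - (2 * n + 2))
  hermitian j := by
    rw [IsHermitian]
    split_ifs
    · rw [conjTranspose_kronecker, gen_conjTranspose, conjTranspose_one]
    · rw [conjTranspose_kronecker, gen_conjTranspose, totalParity_conjTranspose]
  anticomm j k := by
    have hj := j.2
    have hk := k.2
    have hN : total n t = 2 * n + 2 + (2 * t + 2) := rfl
    have h2 : (2 : Matrix (ι × κ) (ι × κ) ℂ) = 1 ⊗ₖ 1 + 1 ⊗ₖ 1 := by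
      rw [one_kronecker_one, one_add_one_eq_two]
    by_cases hjn : (j : ℕ) < 2 * n + 2 <;> by_cases hkn : (k : ℕ) < 2 * n + 2 <;>
      simp only [hjn, hkn, if_true, if_false, ← mul_kronecker_mul, mul_one, one_mul]
    · by_cases h : j = k
      · subst h
        rw [if_pos rfl, gen_sq hjn, h2]
      · rw [if_neg h, gen_anticomm hjn hkn (by omega), ← add_kronecker, neg_add_cancel,
          zero_kronecker]
    · rw [if_neg (by rintro rfl; exact hkn hjn), totalParity_gen Rn hjn, ← add_kronecker,
        add_neg_cancel, zero_kronecker]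
    · rw [if_neg (by rintro rfl; exact hjn hkn), totalParity_gen Rn hkn, ← add_kronecker,
        neg_add_cancel, zero_kronecker]
    · rw [totalParity_sq]
      by_cases h : j = k
      · subst h
        rw [if_pos rfl, gen_sq (by omega), h2]
      · rw [if_neg h, gen_anticomm (R := Rt) (by omega) (by omega) (by omega), ← kronecker_add,
          neg_add_cancel, kronecker_zero]

variable {Rn : MajoranaRegister (2 * n + 2) ι} {Rt : MajoranaRegister (2 * t + 2) κ}

theorem joint_gen_left {j : ℕ} (hj : j < 2 * n + 2) :
    (Rn.joint Rt).gen j = Rn.gen j ⊗ₖ (1 : Matrix κ κ ℂ) := by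
  rw [gen, dif_pos (by simp only [total]; omega)]
  simp [joint, hj]

theorem joint_gen_right {j : ℕ} (hj : j < 2 * t + 2) :
    (Rn.joint Rt).gen (2 * n + 2 + j) = Rn.totalParity ⊗ₖ Rt.gen j := by
  rw [gen, dif_pos (by simp only [total]; omega)]
  simp [joint]

/-- The part of a bit string that belongs to the second register. -/
def _root_.tailBits (n : ℕ) (u : ℕ → ZMod 2) : ℕ → ZMod 2 := fun j => u (2 * n + 2 + j)

theorem joint_mono_left {k : ℕ} (hk : k ≤ 2 * n + 2) (u : ℕ → ZMod 2) :
    (Rn.joint Rt).mono k u = Rn.mono k u ⊗ₖ (1 : Matrix κ κ ℂ) := by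
  induction k with
  | zero => simp [mono_zero]
  | succ k ih =>
    rw [mono_succ, mono_succ, ih (by omega)]
    split_ifs
    · simp
    · rw [joint_gen_left (by omega), ← mul_kronecker_mul, one_mul]

/-- Each Majorana of `R_t` brings one copy of the total parity of `R_n`. The copies collect on the
left factor, and an even number of them cancels, so even strings are pure tensor products. -/
theorem joint_mono {k : ℕ} (hk : k ≤ 2 * t + 2) (u : ℕ → ZMod 2) :
    (Rn.joint Rt).mono (2 * n + 2 + k) u =
      (Rn.mono (2 * n + 2) u *
        if ∑ j ∈ Finset.range k, tailBits n u j = 0 then 1 else Rn.totalParity) ⊗ₖ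
      Rt.mono k (tailBits n u) := by
  induction k with
  | zero => simpa [mono_zero] using joint_mono_left (Rt := Rt) le_rfl u
  | succ k ih =>
    rw [← add_assoc, mono_succ _ (2 * n + 2 + k), mono_succ Rt k, ih (by omega),
      Finset.sum_range_succ]
    have h1 : u (2 * n + 2 + k) = tailBits n u k := rfl
    rw [h1]
    rcases ZMod.two_cases (tailBits n u k) with h | h
    · simp [h]
    · rw [h, if_neg one_ne_zero, if_neg one_ne_zero, joint_gen_right (by omega),
        ← mul_kronecker_mul, mul_assoc]
      congr 2
      rcases ZMod.two_cases (∑ j ∈ Finset.range k, tailBits n u j) with h' | h'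
      · simp [h']
      · simp [h', totalParity_sq, show (1 + 1 : ZMod 2) = 0 from rfl]

/-- Strings of even weight on both registers. -/
def _root_.EvenBits (n t : ℕ) (u : ℕ → ZMod 2) : Prop :=
  ∑ j ∈ Finset.range (2 * n + 2), u j = 0 ∧ ∑ j ∈ Finset.range (2 * t + 2), tailBits n u j = 0

theorem _root_.EvenBits.sum {n t : ℕ} {u : ℕ → ZMod 2} (h : EvenBits n t u) :
    ∑ j ∈ Finset.range (total n t), u j = 0 := by
  rw [Finset.sum_range_add, h.1, zero_add]; exact h.2

theorem joint_op {w : Word} (h : EvenBits n t w.b) :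
    (Rn.joint Rt).op w = Complex.I ^ w.ph.val •
      (Rn.mono (2 * n + 2) w.b ⊗ₖ Rt.mono (2 * t + 2) (tailBits n w.b)) := by
  rw [op, joint_mono le_rfl, if_pos h.2, mul_one]

end MajoranaRegister

/-! ### Weights of strings and the operators that they denote -/

open scoped Kronecker

/-- The number of nonzero bits. -/
def weightBelow (k : ℕ) (u : ℕ → ZMod 2) : ℕ := ((Finset.range k).filter fun j => u j ≠ 0).card

theorem sum_eq_weightBelow (k : ℕ) (u : ℕ → ZMod 2) :
    ∑ j ∈ Finset.range k, u j = (weightBelow k u : ZMod 2) := (MajoranaRegister.cross_self k u).2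

theorem weightBelow_total (n t : ℕ) (u : ℕ → ZMod 2) :
    weightBelow (total n t) u = weightBelow (2 * n + 2) u + weightBelow (2 * t + 2) (tailBits n u) := by
  rw [weightBelow, weightBelow, weightBelow, ← Nat.count_eq_card_filter_range,
    ← Nat.count_eq_card_filter_range, ← Nat.count_eq_card_filter_range, total, Nat.count_add]
  rfl

theorem shiftInd_tSupport {n t : ℕ} (u : ℕ → ZMod 2) {j : ℕ} (hj : j < 2 * t + 2) :
    shiftInd 0 (tSupport n t u) j = tailBits n u j := by
  have : j ∈ (tSupport n t u).image (fun x : Fin (2 * t + 2) => 0 + (x : ℕ)) ↔ tailBits n u j ≠ 0 := by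
    simp only [Finset.mem_image, tSupport, Finset.mem_filter, Finset.mem_univ, true_and, zero_add]
    constructor
    · rintro ⟨x, hx, rfl⟩; exact hx
    · intro h; exact ⟨⟨j, hj⟩, h, rfl⟩
  rw [shiftInd, ind]
  rcases ZMod.two_cases (tailBits n u j) with h | h
  · rw [h, if_neg (by rw [this, h]; simp)]
  · rw [h, if_pos (by rw [this, h]; decide)]

theorem weightBelow_congr {k : ℕ} {u v : ℕ → ZMod 2} (h : ∀ j < k, u j = v j) :
    weightBelow k u = weightBelow k v := by
  refine congrArg Finset.card (Finset.filter_congr fun j hj => ?_)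
  rw [h j (Finset.mem_range.1 hj)]

theorem weightBelow_shiftInd {o M k : ℕ} (S : Finset (Fin M)) (h : o + M ≤ k) :
    weightBelow k (shiftInd o S) = S.card := by
  rw [weightBelow, shiftInd, MajoranaRegister.card_filter_ind]
  · rw [Finset.card_image_of_injective _ fun a b h => by simpa [Fin.ext_iff] using h]
  · intro j hj
    obtain ⟨x, _, rfl⟩ := Finset.mem_image.1 hj
    have := x.2
    omega

theorem card_tSupport (n t : ℕ) (u : ℕ → ZMod 2) :
    (tSupport n t u).card = weightBelow (2 * t + 2) (tailBits n u) := by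
  rw [← weightBelow_congr fun j hj => shiftInd_tSupport (n := n) (t := t) u hj,
    weightBelow_shiftInd _ (by omega)]

theorem tailBits_shiftInd {n M : ℕ} (S : Finset (Fin M)) :
    tailBits n (shiftInd (2 * n + 2) S) = shiftInd 0 S := by
  funext j
  simp [tailBits, shiftInd, ind]

theorem tSupport_shiftInd {n t : ℕ} (S : Finset (Fin (2 * t + 2))) :
    tSupport n t (shiftInd (2 * n + 2) S) = S := by
  ext j
  have : shiftInd (2 * n + 2) S (2 * n + 2 + j) = if j ∈ S then 1 else 0 := by
    simp [shiftInd, ind, ← Fin.ext_iff]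
  simp [tSupport, this]

theorem shiftInd_eq_zero {o M j : ℕ} (S : Finset (Fin M)) (h : j < o ∨ o + M ≤ j) :
    shiftInd o S j = 0 := by
  rw [shiftInd, ind, if_neg]
  intro hj
  obtain ⟨x, _, rfl⟩ := Finset.mem_image.1 hj
  have := x.2
  omega

theorem tailBits_shiftInd_left {n : ℕ} (S : Finset (Fin (2 * n + 2))) (j : ℕ) :
    tailBits n (shiftInd 0 S) j = 0 := shiftInd_eq_zero S (by omega)

theorem tSupport_eq_empty {n t : ℕ} {u : ℕ → ZMod 2} (h : ∀ j < 2 * t + 2, tailBits n u j = 0) :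
    tSupport n t u = ∅ := by
  rw [tSupport, Finset.filter_eq_empty_iff]
  intro j _
  rw [not_not]
  exact h j j.2

theorem EvenBits.add {n t : ℕ} {u v : ℕ → ZMod 2} (hu : EvenBits n t u) (hv : EvenBits n t v) :
    EvenBits n t (u + v) := by
  refine ⟨?_, ?_⟩
  · simp only [Pi.add_apply, Finset.sum_add_distrib, hu.1, hv.1, add_zero]
  · have := hu.2
    have := hv.2
    simp only [tailBits] at *
    simp only [Pi.add_apply, Finset.sum_add_distrib, *, add_zero]

theorem EvenBits.weightBelow {n t : ℕ} {u : ℕ → ZMod 2} (h : EvenBits n t u) :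
    Even (weightBelow (2 * n + 2) u) ∧ Even (weightBelow (2 * t + 2) (tailBits n u)) := by
  obtain ⟨h1, h2⟩ := h
  rw [sum_eq_weightBelow, ZMod.natCast_eq_zero_iff_even] at h1 h2
  exact ⟨h1, h2⟩

theorem evenBits_iff {n t : ℕ} {u : ℕ → ZMod 2} : EvenBits n t u ↔
    Even (weightBelow (2 * n + 2) u) ∧ Even (_root_.weightBelow (2 * t + 2) (tailBits n u)) := by
  rw [EvenBits, sum_eq_weightBelow, sum_eq_weightBelow, ZMod.natCast_eq_zero_iff_even,
    ZMod.natCast_eq_zero_iff_even]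

theorem weightBelow_eq_zero {k : ℕ} {u : ℕ → ZMod 2} (h : ∀ j < k, u j = 0) :
    weightBelow k u = 0 := by
  rw [weightBelow, Finset.card_eq_zero, Finset.filter_eq_empty_iff]
  intro j hj
  simpa using h j (Finset.mem_range.1 hj)

theorem evenBits_left {n t : ℕ} {S : Finset (Fin (2 * n + 2))} (hS : Even S.card) :
    EvenBits n t (shiftInd 0 S) := by
  refine evenBits_iff.2 ⟨by rwa [weightBelow_shiftInd _ (by omega)], ?_⟩
  rw [weightBelow_eq_zero fun j _ => tailBits_shiftInd_left S j]
  exact Even.zero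

theorem evenBits_right {n t : ℕ} {S : Finset (Fin (2 * t + 2))} (hS : Even S.card) :
    EvenBits n t (shiftInd (2 * n + 2) S) := by
  refine evenBits_iff.2 ⟨?_, ?_⟩
  · rw [weightBelow_eq_zero fun j hj => shiftInd_eq_zero S (by omega)]
    exact Even.zero
  · rwa [tailBits_shiftInd, weightBelow_shiftInd _ (by omega)]

theorem sum_ind (k : ℕ) (S : Finset ℕ) :
    ∑ j ∈ Finset.range k, ind S j = ((S.filter (· < k)).card : ZMod 2) := by
  simp only [ind]
  rw [Finset.sum_boole]
  congr 2
  ext j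
  simp [and_comm]

theorem tailBits_ind (n : ℕ) (a b : ℕ) :
    tailBits n (ind {2 * n + 2 + a, 2 * n + 2 + b}) = ind {a, b} := by
  funext j; simp [tailBits, ind]

theorem evenBits_pair_left {n t a b : ℕ} (ha : a < 2 * n + 2) (hb : b < 2 * n + 2) (hab : a ≠ b) :
    EvenBits n t (ind {a, b}) := by
  constructor
  · rw [sum_ind, Finset.filter_true_of_mem (by simp; omega), Finset.card_pair hab]; rfl
  · refine Finset.sum_eq_zero fun j _ => ?_
    simp only [tailBits, ind, Finset.mem_insert, Finset.mem_singleton]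
    rw [if_neg (by omega)]

theorem evenBits_pair_right {n t a b : ℕ} (ha : a < 2 * t + 2) (hb : b < 2 * t + 2) (hab : a ≠ b) :
    EvenBits n t (ind {2 * n + 2 + a, 2 * n + 2 + b}) := by
  constructor
  · refine Finset.sum_eq_zero fun j hj => ?_
    have := Finset.mem_range.1 hj
    simp only [ind, Finset.mem_insert, Finset.mem_singleton]
    rw [if_neg (by omega)]
  · rw [tailBits_ind, sum_ind, Finset.filter_true_of_mem (by simp; omega), Finset.card_pair hab]; rfl

/-- Strings that act on the first register as products of the `s_j`. -/
structure ZBits (n : ℕ) (u : ℕ → ZMod 2) : Prop where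
  pair : ∀ j < n, u (2 * j) = u (2 * j + 1)
  last : u (2 * n) = 0 ∧ u (2 * n + 1) = 0

/-- The operator `i γ_a γ_b` of the first register as a word. -/
def pairWord (a b : ℕ) : Word := ⟨if a < b then 1 else 3, ind {a, b}⟩

/-- The operator `s_i` of the second register as a word. -/
def tWord (n i : ℕ) : Word := ⟨1, ind {2 * n + 2 + 2 * i, 2 * n + 2 + (2 * i + 1)}⟩

namespace MajoranaRegister

variable {n t : ℕ} {ι κ : Type*} [Fintype ι] [DecidableEq ι] [Fintype κ] [DecidableEq κ]
  {Rn : MajoranaRegister (2 * n + 2) ι} {Rt : MajoranaRegister (2 * t + 2) κ}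

/-- Both weights are even, so half of the total weight is the sum of the halves, and the normalising
phase splits between the registers. -/
theorem joint_half {u : ℕ → ZMod 2} (h : EvenBits n t u) :
    (Rn.joint Rt).op ⟨halfCount (total n t) u, u⟩ =
      (Complex.I ^ (weightBelow (2 * n + 2) u / 2) • Rn.mono (2 * n + 2) u) ⊗ₖ
        Rt.parity (tSupport n t u) := by
  rw [joint_op h, parity_eq, card_tSupport, I_pow_val_natCast,
    mono_congr Rt fun j hj => shiftInd_tSupport (n := n) (t := t) u hj, smul_kronecker,
    kronecker_smul, smul_smul, ← pow_add]
  congr 2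
  change weightBelow (total n t) u / 2 = _
  rw [weightBelow_total]
  obtain ⟨⟨a, ha⟩, ⟨b, hb⟩⟩ := h.weightBelow
  omega

theorem parity_empty {N : ℕ} {R : MajoranaRegister N ι} : R.parity ∅ = 1 := by
  simp [parity]

theorem joint_left {S : Finset (Fin (2 * n + 2))} (hS : Even S.card) :
    (Rn.joint Rt).op ⟨halfCount (total n t) (shiftInd 0 S), shiftInd 0 S⟩ =
      Rn.parity S ⊗ₖ 1 := by
  rw [joint_half (evenBits_left hS), weightBelow_shiftInd _ (by omega), ← parity_eq,
    tSupport_eq_empty fun j _ => tailBits_shiftInd_left S j,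
    parity_empty]

theorem joint_right {S : Finset (Fin (2 * t + 2))} (hS : Even S.card) :
    (Rn.joint Rt).op ⟨halfCount (total n t) (shiftInd (2 * n + 2) S), shiftInd (2 * n + 2) S⟩ =
      1 ⊗ₖ Rt.parity S := by
  rw [joint_half (evenBits_right hS), tSupport_shiftInd,
    weightBelow_eq_zero fun j hj => shiftInd_eq_zero S (by omega),
    mono_eq_one Rn fun j hj => shiftInd_eq_zero S (by omega)]
  simp

/-- Such a string contains both or neither of the Majoranas of each pair. A full pair raises half
the weight by one, and the resulting factor i completes it to s_j, which fixes the vector. -/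
theorem mono_zBits {φ : ι → ℂ} (hφ : ∀ j, Rn.s j *ᵥ φ = φ) {u : ℕ → ZMod 2} {k : ℕ} (hk : k ≤ n)
    (hu : ∀ j < k, u (2 * j) = u (2 * j + 1)) :
    (Complex.I ^ (weightBelow (2 * k) u / 2) • Rn.mono (2 * k) u) *ᵥ φ = φ ∧
      Even (weightBelow (2 * k) u) := by
  induction k with
  | zero => simp [mono_zero, weightBelow]
  | succ k ih =>
    obtain ⟨h1, h2⟩ := ih (by omega) fun j hj => hu j (by omega)
    have hk' := hu k (by omega)
    rw [show 2 * (k + 1) = 2 * k + 1 + 1 by ring, mono_succ, mono_succ, ← hk']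
    have hw : weightBelow (2 * k + 1 + 1) u =
        weightBelow (2 * k) u + if u (2 * k) = 0 then 0 else 2 := by
      simp only [weightBelow, ← Nat.count_eq_card_filter_range, Nat.count_succ, ← hk']
      split_ifs <;> simp_all
    rw [hw]
    split_ifs with h
    · simpa using ⟨h1, h2⟩
    · refine ⟨?_, by rw [Nat.even_add]; simpa using h2⟩
      have hs := hφ ⟨k, by omega⟩
      rw [MajoranaRegister.s, ← gen_fin, ← gen_fin] at hs
      simp only at hs
      have h3 : Complex.I ^ ((weightBelow (2 * k) u + 2) / 2) •
          (Rn.mono (2 * k) u * Rn.gen (2 * k) * Rn.gen (2 * k + 1)) =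
          (Complex.I ^ (weightBelow (2 * k) u / 2) • Rn.mono (2 * k) u) *
            (Complex.I • (Rn.gen (2 * k) * Rn.gen (2 * k + 1))) := by
        rw [Nat.add_div_right _ (by norm_num), pow_succ, smul_mul_smul_comm, mul_assoc]
      rw [h3, ← mulVec_mulVec, hs]
      exact h1

/-- The reason why `R_n` need not exist physically: on its initial state such strings reduce to
fermion parities of `R_t`. -/
theorem joint_half_tensorVec {φ : ι → ℂ} (hφ : ∀ j, Rn.s j *ᵥ φ = φ) {u : ℕ → ZMod 2}
    (h : EvenBits n t u) (hz : ZBits n u) (θ : κ → ℂ) :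
    (Rn.joint Rt).op ⟨halfCount (total n t) u, u⟩ *ᵥ tensorVec φ θ =
      tensorVec φ (Rt.parity (tSupport n t u) *ᵥ θ) := by
  rw [joint_half h, kronecker_mulVec_tensorVec]
  have h1 := (mono_zBits hφ le_rfl hz.pair).1
  have h2 : weightBelow (2 * n + 2) u = weightBelow (2 * n) u := by
    simp only [weightBelow, ← Nat.count_eq_card_filter_range, Nat.count_succ]
    simp [hz.last]
  rw [h2, mono_succ, mono_succ, hz.last.1, hz.last.2, if_pos rfl, if_pos rfl, mul_one,
    mul_one, h1]

theorem joint_sWord {j : ℕ} (hj : j < n) :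
    (Rn.joint Rt).op (sWord j) = Rn.s ⟨j, hj⟩ ⊗ₖ 1 := by
  rw [sWord, op_pair _ (by omega) (by simp only [total]; omega), joint_gen_left (by omega),
    joint_gen_left (by omega), ← mul_kronecker_mul, mul_one, ← smul_kronecker, MajoranaRegister.s,
    ← gen_fin, ← gen_fin, show (1 : ZMod 4).val = 1 from rfl, pow_one]

theorem joint_pairWord {a b : ℕ} (ha : a < 2 * n + 2) (hb : b < 2 * n + 2) (hab : a ≠ b) :
    (Rn.joint Rt).op (pairWord a b) = (Complex.I • (Rn.gen a * Rn.gen b)) ⊗ₖ 1 := by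
  rcases lt_or_gt_of_ne hab with h | h
  · rw [pairWord, if_pos h, op_pair _ h (by simp only [total]; omega), joint_gen_left ha,
      joint_gen_left hb, ← mul_kronecker_mul, mul_one, ← smul_kronecker,
      show (1 : ZMod 4).val = 1 from rfl, pow_one]
  · rw [pairWord, if_neg (by omega), Finset.pair_comm, op_pair _ h (by simp only [total]; omega),
      joint_gen_left ha, joint_gen_left hb, ← mul_kronecker_mul, mul_one, ← smul_kronecker,
      show (3 : ZMod 4).val = 3 from rfl, gen_anticomm (R := Rn) hb ha (by omega), smul_neg,
      Complex.I_pow_three, neg_smul, neg_neg]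

theorem joint_tWord {i : ℕ} (hi : i < t) :
    (Rn.joint Rt).op (tWord n i) = 1 ⊗ₖ Rt.s ⟨i, hi⟩ := by
  rw [tWord, op_pair _ (by omega) (by simp only [total]; omega), joint_gen_right (by omega),
    joint_gen_right (by omega), ← mul_kronecker_mul, totalParity_sq, ← kronecker_smul,
    MajoranaRegister.s, ← gen_fin, ← gen_fin, show (1 : ZMod 4).val = 1 from rfl, pow_one]

/-- The supports are disjoint and ordered, so no sign arises and the phases add: 1 + 1 = 2 for a <
b, and 3 + 1 = 0 otherwise. -/
theorem joint_magicWord {i a b : ℕ} (ha : a < 2 * n + 2) (hb : b < 2 * n + 2) :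
    (Rn.joint Rt).op (magicWord n i a b) =
      (Rn.joint Rt).op (pairWord a b) * (Rn.joint Rt).op (tWord n i) := by
  rw [← op_mul]
  refine op_congr ?_ fun j hj => ?_
  · have hc : cross (total n t) (pairWord a b).b (tWord n i).b = 0 := by
      refine Finset.sum_eq_zero fun j _ => ?_
      simp only [pairWord, tWord, ind, Finset.mem_insert, Finset.mem_singleton]
      by_cases h : j = a ∨ j = b
      · rw [Finset.sum_eq_zero, mul_zero]
        intro k hk
        have := Finset.mem_range.1 hk
        rw [if_neg (by omega)]
      · rw [if_neg h, zero_mul]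
    rw [Word.mul, hc]
    simp only [magicWord, pairWord, tWord, dbl, if_true]
    split_ifs <;> decide
  · simp only [magicWord, Word.mul, pairWord, tWord, Pi.add_apply, ind, Finset.mem_insert,
      Finset.mem_singleton]
    by_cases h1 : j = a ∨ j = b
    · rw [if_pos (by tauto), if_pos h1, if_neg (by omega), add_zero]
    · rw [if_neg h1, zero_add]
      congr 1
      apply propext
      constructor
      · intro h; omega
      · intro h; omega

theorem joint_frameWord (X : FermionParity (2 * t + 2)) :
    (Rn.joint Rt).op (frameWord n X) = 1 ⊗ₖ X.op Rt := by
  have : frameWord n X = Word.flip ⟨halfCount (total n t) (shiftInd (2 * n + 2) X.support),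
    shiftInd (2 * n + 2) X.support⟩ X.neg := rfl
  rw [this, op_flip, joint_right X.even, FermionParity.op, kronecker_smul]

theorem joint_braidRule (inv : Bool) {S : Finset (Fin (2 * n + 2))} (hS : Even S.card) :
    (Rn.joint Rt).op (braidRule n t inv S).y = (bitSign inv * Complex.I) • (Rn.parity S ⊗ₖ 1) := by
  have : (braidRule n t inv S).y = Word.flip ⟨halfCount (total n t) (shiftInd 0 S) + 1,
    shiftInd 0 S⟩ inv := rfl
  rw [this, op_flip, ← joint_left hS, op, op, mul_smul]
  simp only [I_pow_val_add]
  rw [show (1 : ZMod 4).val = 1 from rfl, pow_one, mul_comm, mul_smul]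

theorem ind_Ico (o k : ℕ) :
    ind (Finset.Ico o (o + k)) = shiftInd o (Finset.univ : Finset (Fin k)) := by
  rw [shiftInd]
  congr 1
  ext j
  simp only [Finset.mem_Ico, Finset.mem_image, Finset.mem_univ, true_and]
  constructor
  · intro h; exact ⟨⟨j - o, by omega⟩, by simp; omega⟩
  · rintro ⟨x, rfl⟩; have := x.2; omega

theorem even_card_univ (m : ℕ) : Even (Finset.univ : Finset (Fin (2 * m + 2))).card := by
  simp; exact ⟨m + 1, by ring⟩

theorem joint_parityRule_left (p : Bool) :
    (Rn.joint Rt).op (parityRule (total n t) 0 (2 * n + 2) p).y =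
      bitSign p • (Rn.totalParity ⊗ₖ 1) := by
  have : (parityRule (total n t) 0 (2 * n + 2) p).y = Word.flip
    ⟨halfCount (total n t) (ind (Finset.Ico 0 (0 + (2 * n + 2)))),
      ind (Finset.Ico 0 (0 + (2 * n + 2)))⟩ p := rfl
  rw [this, op_flip, ind_Ico, joint_left (even_card_univ n)]
  rfl

theorem joint_parityRule_right (p : Bool) :
    (Rn.joint Rt).op (parityRule (total n t) (2 * n + 2) (2 * t + 2) p).y =
      bitSign p • (1 ⊗ₖ Rt.totalParity) := by
  have : (parityRule (total n t) (2 * n + 2) (2 * t + 2) p).y = Word.flip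
    ⟨halfCount (total n t) (ind (Finset.Ico (2 * n + 2) (2 * n + 2 + (2 * t + 2)))),
      ind (Finset.Ico (2 * n + 2) (2 * n + 2 + (2 * t + 2)))⟩ p := rfl
  rw [this, op_flip, ind_Ico, joint_right (even_card_univ t)]
  rfl

end MajoranaRegister

/-! ### The measured strings -/

theorem bitSign_xor (a b : Bool) : bitSign (xor a b) = bitSign a * bitSign b := by
  cases a <;> cases b <;> simp [bitSign]

section Proj

variable {ι : Type*} [Fintype ι] [DecidableEq ι]

theorem outcomeProj_mulVec (A : Matrix ι ι ℂ) (b : Bool) (v : ι → ℂ) :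
    outcomeProj A b *ᵥ v = (1 / 2 : ℂ) • (v + bitSign b • A *ᵥ v) := by
  rw [outcomeProj, smul_mulVec, add_mulVec, one_mulVec, smul_mulVec]

theorem outcomeProj_commute {A B : Matrix ι ι ℂ} (h : A * B = B * A) (b : Bool) :
    outcomeProj A b * B = B * outcomeProj A b := by
  simp only [outcomeProj, smul_mul_assoc, mul_smul_comm, add_mul, mul_add, one_mul, mul_one, h]

theorem mul_outcomeProj {A : Matrix ι ι ℂ} (h : A * A = 1) (b : Bool) :
    (bitSign b • A) * outcomeProj A b = outcomeProj A b := by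
  simp only [outcomeProj, mul_smul_comm, smul_mul_assoc, mul_add, mul_one, smul_smul, h,
    bitSign_sq, one_smul]
  rw [add_comm]

end Proj

namespace MajoranaRegister

section Single

variable {N : ℕ} {ι : Type*} [Fintype ι] [DecidableEq ι] (R : MajoranaRegister N ι)

/-- The string is i^d times its normalised form. Both square to one, which leaves d = 0 or d = 2, so
that the comparison of phases in `signBit` does read off a sign. -/
theorem op_eq_signBit [Nonempty ι] {w : Word} (hw : ∑ j ∈ Finset.range N, w.b j = 0)
    (h : R.op w * R.op w = 1) :
    R.op w = bitSign (signBit N w) • R.op ⟨halfCount N w.b, w.b⟩ := by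
  obtain ⟨d, hd⟩ : ∃ d : ZMod 4, w.ph = halfCount N w.b + d := ⟨w.ph - halfCount N w.b, by ring⟩
  have h1 : R.op w = Complex.I ^ d.val • R.op ⟨halfCount N w.b, w.b⟩ := by
    rw [op, op, smul_smul, hd, I_pow_val_add, mul_comm]
  rw [h1, smul_mul_smul_comm, op_half_sq hw] at h
  have h2 : Complex.I ^ d.val * Complex.I ^ d.val = 1 := by
    have i : ι := Classical.arbitrary ι
    simpa using congrFun (congrFun h i) i
  rw [h1, signBit, hd]
  congr 1
  have hd4 : d = 0 ∨ d = 2 := by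
    by_contra hne
    rw [← pow_add] at h2
    have key : ∀ d : ZMod 4, ¬(d = 0 ∨ d = 2) → d = 1 ∨ d = 3 := by decide
    rcases key d hne with rfl | rfl
    · rw [show (1 : ZMod 4).val + (1 : ZMod 4).val = 2 from rfl, Complex.I_sq] at h2
      norm_num at h2
    · rw [show (3 : ZMod 4).val + (3 : ZMod 4).val = 4 + 2 from rfl, pow_add, Complex.I_pow_four,
        Complex.I_sq] at h2
      norm_num at h2
  rcases hd4 with rfl | rfl
  · simp [bitSign]
  · have : (halfCount N w.b : ZMod 4) + 2 ≠ halfCount N w.b := by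
      intro h; rw [add_eq_left] at h; revert h; decide
    rw [show (2 : ZMod 4).val = 2 from rfl, Complex.I_sq]
    simp [bitSign, this]

/-- Project onto the states that are stabilised by the strings of the rules. -/
noncomputable def stabProj (K : List Rule) (v : ι → ℂ) : ι → ℂ :=
  K.foldr (fun r v => outcomeProj (R.op r.y) false *ᵥ v) v

variable {R}

theorem mulVec_stabProj {K : List Rule} {B : Matrix ι ι ℂ}
    (h : ∀ r ∈ K, R.op r.y * B = B * R.op r.y) (v : ι → ℂ) :
    B *ᵥ R.stabProj K v = R.stabProj K (B *ᵥ v) := by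
  induction K with
  | nil => rfl
  | cons r K ih =>
    simp only [stabProj, List.foldr_cons] at ih ⊢
    rw [mulVec_mulVec, ← outcomeProj_commute (h r (by simp)), ← mulVec_mulVec,
      ih fun r' hr' => h r' (by simp [hr'])]

end Single

end MajoranaRegister

theorem reduce_induction {N : ℕ} (Q : Word → Prop) {l : List Rule}
    (h : ∀ r ∈ l, ∀ w, Q w → Q (r.app N w)) {w : Word} (hw : Q w) : Q (reduce N l w) := by
  induction l generalizing w with
  | nil => exact hw
  | cons r l ih =>
    exact ih (fun r' hr' => h r' (by simp [hr'])) (h r (by simp) w hw)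

theorem Rule.app_b (N : ℕ) (r : Rule) (w : Word) :
    (r.app N w).b = w.b + dot N w.b r.q • r.y.b := by
  rw [Rule.app]
  rcases ZMod.two_cases (dot N w.b r.q) with h | h
  · simp [h]
  · simp [h, Word.mul]

theorem smul_dot (N : ℕ) (c : ZMod 2) (u v : ℕ → ZMod 2) : dot N (c • u) v = c * dot N u v := by
  simp [dot, Finset.mul_sum, mul_assoc]

theorem dot_app (N : ℕ) (r : Rule) (w : Word) (v : ℕ → ZMod 2) :
    dot N (r.app N w).b v = dot N w.b v + dot N w.b r.q * dot N r.y.b v := by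
  rw [Rule.app_b, add_dot, smul_dot]

theorem EvenBits.app {n t N : ℕ} {r : Rule} {w : Word} (hr : EvenBits n t r.y.b)
    (hw : EvenBits n t w.b) : EvenBits n t (r.app N w).b := by
  rw [Rule.app]
  split_ifs
  · exact hw
  · exact hw.add hr

/-- Triangular rules clear their pivots. -/
theorem dot_reduce_pivot {N : ℕ} {l : List Rule}
    (htri : l.Pairwise fun r r' => dot N r'.y.b r.q = 0)
    (hpiv : ∀ r ∈ l, dot N r.y.b r.q = 1 ∨ ∀ u, dot N u r.q = 0) (w : Word) :
    ∀ r ∈ l, dot N (reduce N l w).b r.q = 0 := by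
  induction l generalizing w with
  | nil => simp
  | cons r l ih =>
    obtain ⟨h1, h2⟩ := List.pairwise_cons.1 htri
    intro r' hr'
    rcases List.mem_cons.1 hr' with rfl | hr'
    · change dot N (reduce N l (r'.app N w)).b r'.q = 0
      -- Later rules multiply by strings that vanish on this pivot, so it is enough that the rule
      -- itself clears it.
      refine reduce_induction (fun w => dot N w.b r'.q = 0) (fun s hs w hw => ?_) ?_
      · rw [dot_app, hw, h1 s hs]; ring
      -- An odd overlap is corrected by adding one. A rule with an empty pivot set, which comes from
      -- a string with certain outcome, has nothing to clear.
      · rw [dot_app]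
        rcases hpiv r' (by simp) with h | h
        · rw [h, mul_one]; exact CharTwo.add_self_eq_zero _
        · rw [h, h]; ring
    · exact ih h2 (fun s hs => hpiv s (by simp [hs])) _ r' hr'

/-! ### The invariant: known strings, coins and measured parities -/

section Tracks

variable {n t : ℕ} {ι κ : Type*} [Fintype ι] [DecidableEq ι] [Fintype κ] [DecidableEq κ]

/-- A configuration with the output and the events of a state of the simulation. -/
def SimState.config {M : ℕ} (A : SimState M) : Config M := ⟨[], fun _ => 0, fun _ => 0, A.out, A.hist⟩

/-- The state of a register after the events of a run. -/
noncomputable def histState {M : ℕ} (Rt : MajoranaRegister M κ) (ψ : κ → ℂ)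
    (l : List (RunEvent M)) : κ → ℂ :=
  l.foldl (fun v e => match e with
      | .coin _ => v
      | .measured S b => outcomeProj (Rt.parity S) b *ᵥ v) ψ

/-- The vector `Ψ` of the joint register is the state of the simulated process. -/
structure Tracks (Rn : MajoranaRegister (2 * n + 2) ι) (Rt : MajoranaRegister (2 * t + 2) κ)
    (φ : ι → ℂ) (ψ : κ → ℂ) (pn pt : Bool) (A : SimState (2 * t + 2)) (Ψ : ι × κ → ℂ) : Prop where
  stab : ∀ r ∈ A.elim, (Rn.joint Rt).op r.y *ᵥ Ψ = Ψ
  sq : ∀ r ∈ A.elim, (Rn.joint Rt).op r.y * (Rn.joint Rt).op r.y = 1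
  iso : ∀ r ∈ A.elim, ∀ r' ∈ A.elim, dot (total n t) r.y.b r'.y.b = 0
  even : ∀ r ∈ A.elim, EvenBits n t r.y.b
  tri : A.elim.Pairwise fun r r' => dot (total n t) r'.y.b r.q = 0
  piv : ∀ r ∈ A.elim, dot (total n t) r.y.b r.q = 1 ∨ ∀ u, dot (total n t) u r.q = 0
  left : parityRule (total n t) 0 (2 * n + 2) pn ∈ A.elim
  coins : ∃ K : List Rule, K.Sublist A.elim ∧
    (∀ r ∈ K, ∃ j < n, r.q = ind {2 * j, 2 * j + 1} ∧ dot (total n t) r.y.b r.q = 1) ∧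
    K.length = A.config.numCoins ∧
    Ψ = (Rn.joint Rt).stabProj K (tensorVec φ (histState Rt ψ A.hist))
  measured : ∃ K : List Rule,
    (parityRule (total n t) (2 * n + 2) (2 * t + 2) pt :: K).Sublist A.elim ∧
    (∀ r ∈ K, ZBits n r.y.b ∧ ∃ j < 2 * t + 2, r.q = ind {2 * n + 2 + j} ∧
      dot (total n t) r.y.b r.q = 1) ∧
    A.config.measuredParities = K.map fun r => tSupport n t r.y.b

variable {Rn : MajoranaRegister (2 * n + 2) ι} {Rt : MajoranaRegister (2 * t + 2) κ}
  {φ : ι → ℂ} {ψ : κ → ℂ} {pn pt : Bool} {A : SimState (2 * t + 2)} {Ψ : ι × κ → ℂ}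

open MajoranaRegister

/-- The projections for the coins halve the norm. -/
theorem sqNorm_stabProj (hφ : ∀ j, Rn.s j *ᵥ φ = φ) (θ : κ → ℂ) {K : List Rule}
    (heven : ∀ r ∈ K, EvenBits n t r.y.b)
    (htri : K.Pairwise fun r r' => dot (total n t) r'.y.b r.q = 0)
    (hK : ∀ r ∈ K, ∃ j < n, r.q = ind {2 * j, 2 * j + 1} ∧ dot (total n t) r.y.b r.q = 1) :
    sqNorm ((Rn.joint Rt).stabProj K (tensorVec φ θ)) =
      (1 / 2) ^ K.length * sqNorm (tensorVec φ θ) := by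
  induction K with
  | nil => simp [stabProj]
  | cons r K ih =>
    obtain ⟨h1, h2⟩ := List.pairwise_cons.1 htri
    obtain ⟨j, hj, hq, hd⟩ := hK r (by simp)
    have ih := ih (fun r hr => heven r (by simp [hr])) h2 fun r hr => hK r (by simp [hr])
    -- The strings recorded after `r` are cleared on its pivot, so they commute with s_j. Their
    -- projections therefore leave s_j a stabiliser, while `r` itself anticommutes with it.
    have hs : (Rn.joint Rt).op (sWord j) *ᵥ (Rn.joint Rt).stabProj K (tensorVec φ θ) =
        (Rn.joint Rt).stabProj K (tensorVec φ θ) := by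
      rw [mulVec_stabProj, joint_sWord hj, kronecker_mulVec_tensorVec, hφ, one_mulVec]
      intro r' hr'
      exact op_commute (heven r' (by simp [hr'])).sum (by
        have := h1 r' hr'
        rwa [hq] at this)
    have hrs : (Rn.joint Rt).op (sWord j) * (Rn.joint Rt).op r.y =
        -((Rn.joint Rt).op r.y * (Rn.joint Rt).op (sWord j)) := by
      rw [op_anticommute (heven r (by simp)).sum (v := sWord j), neg_neg]
      rw [hq] at hd
      change dot (total n t) r.y.b (ind {2 * j, 2 * j + 1}) ≠ 0
      rw [hd]; exact one_ne_zero
    change sqNorm (outcomeProj ((Rn.joint Rt).op r.y) false *ᵥ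
      (Rn.joint Rt).stabProj K (tensorVec φ θ)) = _
    rw [outcomeProj_mulVec]
    simp only [bitSign, Bool.false_eq_true, if_false, one_smul]
    rw [sqNorm_half (op_unitary _) (op_unitary _) hrs hs, ih, List.length_cons, pow_succ]
    ring

/-- Probabilities become norms: the factor 1/2 of a coin is the loss of norm under its projector,
and the Born factors make up the norm of the state of `R_t`. -/
theorem Tracks.weight_eq (h : Tracks Rn Rt φ ψ pn pt A Ψ) (hφ1 : sqNorm φ = 1)
    (hφ : ∀ j, Rn.s j *ᵥ φ = φ) : A.config.weight Rt ψ = sqNorm Ψ := by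
  obtain ⟨K, h1, h2, h3, h4⟩ := h.coins
  rw [h4, sqNorm_stabProj hφ _ (fun r hr => h.even r (h1.subset hr)) (h.tri.sublist h1) h2, h3,
    sqNorm_tensorVec, hφ1, one_mul]
  rfl

/-- What elimination does to a string that commutes with all strings of the rules. -/
theorem Tracks.reduce (h : Tracks Rn Rt φ ψ pn pt A Ψ) {w : Word} (hw : EvenBits n t w.b)
    (hc : ∀ r ∈ A.elim, dot (total n t) w.b r.y.b = 0)
    (hsq : (Rn.joint Rt).op w * (Rn.joint Rt).op w = 1) :
    EvenBits n t (reduce (total n t) A.elim w).b ∧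
    (∀ r ∈ A.elim, dot (total n t) (reduce (total n t) A.elim w).b r.y.b = 0) ∧
    (Rn.joint Rt).op (reduce (total n t) A.elim w) *
      (Rn.joint Rt).op (reduce (total n t) A.elim w) = 1 ∧
    (Rn.joint Rt).op (reduce (total n t) A.elim w) *ᵥ Ψ = (Rn.joint Rt).op w *ᵥ Ψ := by
  refine reduce_induction (fun w' => EvenBits n t w'.b ∧
    (∀ r ∈ A.elim, dot (total n t) w'.b r.y.b = 0) ∧
    (Rn.joint Rt).op w' * (Rn.joint Rt).op w' = 1 ∧
    (Rn.joint Rt).op w' *ᵥ Ψ = (Rn.joint Rt).op w *ᵥ Ψ) ?_ ⟨hw, hc, hsq, rfl⟩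
  rintro r hr w' ⟨a1, a2, a3, a4⟩
  refine ⟨(h.even r hr).app a1, fun r' hr' => ?_, ?_⟩
  · rw [dot_app, a2 r' hr', h.iso r hr r' hr']; ring
  · rw [Rule.app]
    split_ifs
    · exact ⟨a3, a4⟩
    · rw [op_mul]
      have hcm := op_commute (R := Rn.joint Rt) a1.sum (a2 r hr)
      refine ⟨?_, by rw [← mulVec_mulVec, h.stab r hr, a4]⟩
      rw [mul_assoc, ← mul_assoc _ ((Rn.joint Rt).op w'), ← hcm, mul_assoc, h.sq r hr, mul_one, a3]

theorem sum_pairs {n : ℕ} {u : ℕ → ZMod 2} (h : ∀ j < n, u (2 * j) = u (2 * j + 1)) :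
    ∑ j ∈ Finset.range (2 * n), u j = 0 := by
  induction n with
  | zero => simp
  | succ n ih =>
    rw [show 2 * (n + 1) = 2 * n + 1 + 1 by ring, Finset.sum_range_succ, Finset.sum_range_succ,
      ih fun j hj => h j (by omega), h n (by omega), zero_add]
    exact CharTwo.add_self_eq_zero _

/-- Without a coin pivot the bits agree in each of the first n pairs. The total parity of `R_n` has
its pivot at the last Majorana, which is therefore cleared, and the even weight forces the other
Majorana of that pair to be absent too. -/
theorem Tracks.zBits (h : Tracks Rn Rt φ ψ pn pt A Ψ) {u : ℕ → ZMod 2} (hu : EvenBits n t u)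
    (hq : ∀ r ∈ A.elim, dot (total n t) u r.q = 0) (hn : nPivot n u = none) : ZBits n u := by
  have h1 : ∀ j < n, u (2 * j) = u (2 * j + 1) := fun j hj => by
    by_contra hne
    exact Prog.lastTrue_eq_none.1 hn j hj hne
  have h2 := hq _ h.left
  have h3 : (parityRule (total n t) 0 (2 * n + 2) pn).q = ind {2 * n + 1} := by
    rw [parityRule]; simp
  rw [h3, dot_ind _ _ _ (by simp only [Finset.mem_singleton, total]; omega),
    Finset.sum_singleton] at h2
  refine ⟨h1, ?_, h2⟩
  have h4 := hu.1
  rwa [Finset.sum_range_succ, Finset.sum_range_succ, sum_pairs h1, h2, zero_add, add_zero] at h4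

/-- Since `R_n` contributes only the value +1, an outcome of the joint string is an outcome of a
parity of `R_t`, shifted by the sign of the string. -/
theorem zBits_outcome [Nonempty ι] [Nonempty κ] (hφ : ∀ j, Rn.s j *ᵥ φ = φ) {w : Word}
    (hw : EvenBits n t w.b) (hz : ZBits n w.b)
    (hsq : (Rn.joint Rt).op w * (Rn.joint Rt).op w = 1) (θ : κ → ℂ) (d : Bool) :
    outcomeProj ((Rn.joint Rt).op w) (xor d (signBit (total n t) w)) *ᵥ tensorVec φ θ =
      tensorVec φ (outcomeProj (Rt.parity (tSupport n t w.b)) d *ᵥ θ) := by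
  rw [outcomeProj_mulVec, outcomeProj_mulVec, op_eq_signBit (Rn.joint Rt) hw.sum hsq, smul_mulVec,
    joint_half_tensorVec hφ hw hz, smul_smul, bitSign_xor, mul_assoc, bitSign_sq, mul_one,
    tensorVec_smul, tensorVec_add, tensorVec_smul]

end Tracks

/-! ### One measurement -/

section Decide

variable {n t : ℕ} {ι κ : Type*} [Fintype ι] [DecidableEq ι] [Fintype κ] [DecidableEq κ]
  {Rn : MajoranaRegister (2 * n + 2) ι} {Rt : MajoranaRegister (2 * t + 2) κ}
  {φ : ι → ℂ} {ψ : κ → ℂ} {pn pt : Bool} {A : SimState (2 * t + 2)} {Ψ : ι × κ → ℂ}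

open MajoranaRegister

theorem stabProj_append {N : ℕ} (R : MajoranaRegister N ι) (K K' : List Rule) (v : ι → ℂ) :
    R.stabProj (K ++ K') v = R.stabProj K (R.stabProj K' v) := List.foldr_append

/-- Add the rule of a measured string. -/
theorem Tracks.extend (h : Tracks Rn Rt φ ψ pn pt A Ψ) {w : Word} (hw : EvenBits n t w.b)
    (hc : ∀ r ∈ A.elim, dot (total n t) w.b r.y.b = 0)
    (hsq : (Rn.joint Rt).op w * (Rn.joint Rt).op w = 1)
    (hp : ∀ r ∈ A.elim, dot (total n t) w.b r.q = 0) (c : Bool) {q : ℕ → ZMod 2}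
    (hq : dot (total n t) w.b q = 1 ∨ ∀ u, dot (total n t) u q = 0)
    (e : List (RunEvent (2 * t + 2)))
    (hcoins : ∃ K : List Rule, K.Sublist (A.elim ++ [⟨q, w.flip c⟩]) ∧
      (∀ r ∈ K, ∃ j < n, r.q = ind {2 * j, 2 * j + 1} ∧ dot (total n t) r.y.b r.q = 1) ∧
      K.length = (SimState.config ⟨A.gates, A.elim, A.used, A.out, A.hist ++ e⟩).numCoins ∧
      outcomeProj ((Rn.joint Rt).op w) c *ᵥ Ψ =
        (Rn.joint Rt).stabProj K (tensorVec φ (histState Rt ψ (A.hist ++ e))))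
    (hmeas : ∃ K : List Rule,
      (parityRule (total n t) (2 * n + 2) (2 * t + 2) pt :: K).Sublist
        (A.elim ++ [⟨q, w.flip c⟩]) ∧
      (∀ r ∈ K, ZBits n r.y.b ∧ ∃ j < 2 * t + 2, r.q = ind {2 * n + 2 + j} ∧
        dot (total n t) r.y.b r.q = 1) ∧
      (SimState.config ⟨A.gates, A.elim, A.used, A.out, A.hist ++ e⟩).measuredParities =
        K.map fun r => tSupport n t r.y.b) :
    Tracks Rn Rt φ ψ pn pt { A with elim := A.elim ++ [⟨q, w.flip c⟩], hist := A.hist ++ e }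
      (outcomeProj ((Rn.joint Rt).op w) c *ᵥ Ψ) := by
  have hf : (w.flip c).b = w.b := rfl
  -- A string of even weight overlaps evenly with itself, so the enlarged list stays isotropic.
  have hself : dot (total n t) w.b w.b = 0 := by
    have : ∀ x : ZMod 2, x * x = x := by decide
    simp only [dot, this]
    exact hw.sum
  refine ⟨fun r hr => ?_, fun r hr => ?_, fun r hr r' hr' => ?_, fun r hr => ?_, ?_, fun r hr => ?_,
    List.mem_append_left _ h.left, hcoins, hmeas⟩
  · rw [mulVec_mulVec]
    rcases List.mem_append.1 hr with hr | hr
    · rw [← outcomeProj_commute (op_commute hw.sum (hc r hr)), ← mulVec_mulVec, h.stab r hr]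
    · rw [List.mem_singleton] at hr
      subst hr
      rw [op_flip, mul_outcomeProj hsq]
  · rcases List.mem_append.1 hr with hr | hr
    · exact h.sq r hr
    · rw [List.mem_singleton] at hr
      subst hr
      rw [op_flip, smul_mul_smul_comm, bitSign_sq, hsq, one_smul]
  · rcases List.mem_append.1 hr with hr | hr <;> rcases List.mem_append.1 hr' with hr' | hr'
    · exact h.iso r hr r' hr'
    · rw [List.mem_singleton] at hr'
      subst hr'
      rw [hf, dot_comm]; exact hc r hr
    · rw [List.mem_singleton] at hr
      subst hr
      exact hc r' hr'
    · rw [List.mem_singleton] at hr hr'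
      subst hr hr'
      exact hself
  · rcases List.mem_append.1 hr with hr | hr
    · exact h.even r hr
    · rw [List.mem_singleton] at hr
      subst hr
      exact hw
  · refine List.pairwise_append.2 ⟨h.tri, by simp, fun r hr r' hr' => ?_⟩
    rw [List.mem_singleton] at hr'
    subst hr'
    exact hp r hr
  · rcases List.mem_append.1 hr with hr | hr
    · exact h.piv r hr
    · rw [List.mem_singleton] at hr
      subst hr
      exact hq

theorem dot_pair {N : ℕ} (u : ℕ → ZMod 2) {a b : ℕ} (ha : a < N) (hb : b < N) (hab : a ≠ b) :
    dot N u (ind {a, b}) = u a + u b := by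
  rw [dot_ind _ _ _ (by simp [ha, hb]), Finset.sum_pair hab]

theorem dot_singleton {N : ℕ} (u : ℕ → ZMod 2) {a : ℕ} (ha : a < N) :
    dot N u (ind {a}) = u a := by
  rw [dot_ind _ _ _ (by simp [ha]), Finset.sum_singleton]

theorem dot_ind_empty {N : ℕ} (u : ℕ → ZMod 2) : dot N u (ind ∅) = 0 := by
  simp [dot, ind]

/-- The possible outcomes of a reduced string. -/
theorem Tracks.decide [Nonempty ι] [Nonempty κ] (h : Tracks Rn Rt φ ψ pn pt A Ψ)
    (hφ : ∀ j, Rn.s j *ᵥ φ = φ) {w : Word} (hw : EvenBits n t w.b)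
    (hc : ∀ r ∈ A.elim, dot (total n t) w.b r.y.b = 0)
    (hsq : (Rn.joint Rt).op w * (Rn.joint Rt).op w = 1)
    (hp : ∀ r ∈ A.elim, dot (total n t) w.b r.q = 0) :
    (∀ x ∈ A.decide n w,
      Tracks Rn Rt φ ψ pn pt x.2 (outcomeProj ((Rn.joint Rt).op w) x.1 *ᵥ Ψ)) ∧
    ∀ f : Bool → ℝ, (∀ c, outcomeProj ((Rn.joint Rt).op w) c *ᵥ Ψ = 0 → f c = 0) →
      ((A.decide n w).map fun x => f x.1).sum = f false + f true := by
  obtain ⟨K, k1, k2, k3, k4⟩ := h.coins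
  obtain ⟨M, m1, m2, m3⟩ := h.measured
  -- The string commutes with all recorded ones, so its projector can be moved through the
  -- projectors of the coins to the product vector.
  have hcom : ∀ c v, outcomeProj ((Rn.joint Rt).op w) c *ᵥ (Rn.joint Rt).stabProj K v =
      (Rn.joint Rt).stabProj K (outcomeProj ((Rn.joint Rt).op w) c *ᵥ v) := fun c v =>
    mulVec_stabProj (fun r hr =>
      (outcomeProj_commute (op_commute hw.sum (hc r (k1.subset hr))) c).symm) v
  -- Shifting by the sign of the string only permutes the two outcomes.
  have hpair : ∀ (σ : Bool) (f : Bool → ℝ), ([false, true].map fun d => f (xor d σ)).sum =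
      f false + f true := by
    intro σ f
    cases σ <;> simp [add_comm]
  rw [SimState.decide]
  by_cases hn : nPivot n w.b = none
  · have hz := h.zBits hw hp hn
    have hout : ∀ d, outcomeProj ((Rn.joint Rt).op w) (xor d (signBit (total n t) w)) *ᵥ Ψ =
        (Rn.joint Rt).stabProj K (tensorVec φ
          (outcomeProj (Rt.parity (tSupport n t w.b)) d *ᵥ histState Rt ψ A.hist)) := fun d => by
      rw [k4, hcom, zBits_outcome hφ hw hz hsq]
    rw [if_neg (by simp [hn])]
    by_cases ht : tPivot n t w.b = none
    · rw [if_neg (by simp [ht])]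
      have hS : tSupport n t w.b = ∅ := tSupport_eq_empty fun j hj => by
        by_contra hne
        exact Prog.lastTrue_eq_none.1 ht j hj hne
      rw [hS, parity_empty] at hout
      refine ⟨fun x hx => ?_, fun f hf => ?_⟩
      · rw [List.mem_singleton] at hx
        subst hx
        refine h.extend hw hc hsq hp _ (Or.inr fun u => ?_) [] ⟨K, k1.trans (by simp), k2, ?_, ?_⟩
          ⟨M, m1.trans (by simp), m2, ?_⟩
        · simp only [pivotSet, hn, ht]
          exact dot_ind_empty u
        · simpa using k3
        · rw [hout, outcomeProj_mulVec]
          congr 2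
          simp only [bitSign, List.append_nil, one_mulVec]
          funext i
          simp
          ring
        · simpa using m3
      -- The identity on `R_t` has only the outcome +1. The opposite outcome gives the zero vector,
      -- where `f` vanishes, so the single listed branch carries the whole sum.
      · have h0 : f (xor true (signBit (total n t) w)) = 0 := by
          refine hf _ ?_
          rw [hout, outcomeProj_mulVec, one_mulVec]
          have : histState Rt ψ A.hist + bitSign true • histState Rt ψ A.hist = 0 := by
            simp [bitSign]
          rw [this, smul_zero]
          have h0 : tensorVec φ (0 : κ → ℂ) = 0 := by funext x; simp [tensorVec]
          rw [h0]
          clear k1 k2 k3 k4 hcom hout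
          have : ∀ r : Word, outcomeProj ((Rn.joint Rt).op r) false *ᵥ (0 : ι × κ → ℂ) = 0 :=
            fun r => mulVec_zero _
          induction K with
          | nil => rfl
          | cons r K ih =>
            change outcomeProj _ false *ᵥ (Rn.joint Rt).stabProj K 0 = 0
            rw [ih, mulVec_zero]
        rw [← hpair (signBit (total n t) w)]
        simp only [List.map_cons, List.map_nil, List.sum_cons, List.sum_nil, h0, SimState.record]
        ring
    · rw [if_pos ht]
      obtain ⟨j, hj⟩ := Option.ne_none_iff_exists'.1 ht
      obtain ⟨j1, j2⟩ := Prog.lastTrue_eq_some hj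
      have hd : dot (total n t) w.b (ind {2 * n + 2 + j}) = 1 := by
        rw [dot_singleton _ (by simp only [total]; omega)]
        exact (ZMod.two_cases _).resolve_left j2
      refine ⟨fun x hx => ?_, fun f hf => ?_⟩
      · obtain ⟨d, -, rfl⟩ := List.mem_map.1 hx
        have hq : pivotSet n t w.b = {2 * n + 2 + j} := by simp only [pivotSet, hn, hj]
        refine h.extend hw hc hsq hp _ (Or.inl (by rw [hq]; exact hd)) _
          ⟨K, k1.trans (by simp), k2, ?_, ?_⟩ ⟨M ++ [_], m1.append_right _, ?_, ?_⟩
        · rw [k3]; simp [SimState.config, Config.numCoins]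
        · rw [hout, histState, histState, List.foldl_append]; rfl
        · intro r hr
          rcases List.mem_append.1 hr with hr | hr
          · exact m2 r hr
          · rw [List.mem_singleton] at hr
            subst hr
            exact ⟨hz, j, j1, by rw [hq], by rw [hq]; exact hd⟩
        · rw [List.map_append, ← m3]
          simp [SimState.config, Config.measuredParities, Word.flip]
      · rw [← hpair (signBit (total n t) w), List.map_map]; rfl
  · rw [if_pos hn]
    obtain ⟨j, hj⟩ := Option.ne_none_iff_exists'.1 hn
    obtain ⟨j1, j2⟩ := Prog.lastTrue_eq_some hj
    have hd : dot (total n t) w.b (ind {2 * j, 2 * j + 1}) = 1 := by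
      rw [dot_pair _ (by simp only [total]; omega) (by simp only [total]; omega) (by omega)]
      have : ∀ x y : ZMod 2, x ≠ y → x + y = 1 := by decide
      exact this _ _ j2
    have hq : pivotSet n t w.b = {2 * j, 2 * j + 1} := by simp only [pivotSet, hj]
    refine ⟨fun x hx => ?_, fun f hf => ?_⟩
    · obtain ⟨d, -, rfl⟩ := List.mem_map.1 hx
      refine h.extend hw hc hsq hp _ (Or.inl (by rw [hq]; exact hd)) _
        ⟨K ++ [_], k1.append_right _, ?_, ?_, ?_⟩ ⟨M, m1.trans (by simp), m2, ?_⟩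
      · intro r hr
        rcases List.mem_append.1 hr with hr | hr
        · exact k2 r hr
        · rw [List.mem_singleton] at hr
          subst hr
          exact ⟨j, j1, by rw [hq], by rw [hq]; exact hd⟩
      · rw [List.length_append, k3]; simp [SimState.config, Config.numCoins]
      -- A coin leaves `R_t` alone. Its projector is added innermost, next to the product vector, so
      -- that the projectors keep the order of `elim`, on which the triangular shape depends.
      · rw [stabProj_append, k4, hcom, histState, histState, List.foldl_append]
        congr 1
        simp [stabProj, op_flip, outcomeProj, bitSign]
      · rw [← m3]
        simp [SimState.config, Config.measuredParities]
    · rw [← hpair (signBit (total n t) w), List.map_map]; rfl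

/-- The state of the simulation before and after an outcome has been found. -/
theorem SimState.decide_fields (w : Word) : ∀ x ∈ A.decide n w,
    x.2.gates = A.gates ∧ x.2.used = A.used ∧ x.2.out = A.out ∧
      ∀ r ∈ x.2.elim, r ∈ A.elim ∨ r.y.b = w.b := by
  have key : ∀ d e, (A.record (n := n) w d e).2.gates = A.gates ∧
      (A.record (n := n) w d e).2.used = A.used ∧ (A.record (n := n) w d e).2.out = A.out ∧
      ∀ r ∈ (A.record (n := n) w d e).2.elim, r ∈ A.elim ∨ r.y.b = w.b := by
    intro d e
    refine ⟨rfl, rfl, rfl, fun r hr => ?_⟩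
    rcases List.mem_append.1 hr with hr | hr
    · exact Or.inl hr
    · rw [List.mem_singleton] at hr
      subst hr
      exact Or.inr rfl
  intro x hx
  rw [SimState.decide] at hx
  split_ifs at hx
  · obtain ⟨d, -, rfl⟩ := List.mem_map.1 hx
    exact key _ _
  · obtain ⟨d, -, rfl⟩ := List.mem_map.1 hx
    exact key _ _
  · rw [List.mem_singleton] at hx
    subst hx
    exact key _ _

/-- The possible outcomes of a string after the gates have been absorbed. -/
theorem Tracks.measure [Nonempty ι] [Nonempty κ] (h : Tracks Rn Rt φ ψ pn pt A Ψ)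
    (hφ : ∀ j, Rn.s j *ᵥ φ = φ) {w : Word}
    (hw : EvenBits n t (_root_.reduce (total n t) A.gates w).b)
    (hc : ∀ r ∈ A.elim, dot (total n t) (_root_.reduce (total n t) A.gates w).b r.y.b = 0)
    (hsq : (Rn.joint Rt).op (_root_.reduce (total n t) A.gates w) *
      (Rn.joint Rt).op (_root_.reduce (total n t) A.gates w) = 1) :
    (∀ x ∈ A.measure n w,
      Tracks Rn Rt φ ψ pn pt x.2
        (outcomeProj ((Rn.joint Rt).op (_root_.reduce (total n t) A.gates w)) x.1 *ᵥ Ψ) ∧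
      x.2.gates = A.gates ∧ x.2.used = A.used ∧ x.2.out = A.out ∧
      ∀ u, (∀ r ∈ A.elim, dot (total n t) u r.y.b = 0) →
        dot (total n t) u (_root_.reduce (total n t) A.gates w).b = 0 →
        ∀ r ∈ x.2.elim, dot (total n t) u r.y.b = 0) ∧
    ∀ f : Bool → ℝ,
      (∀ c, outcomeProj ((Rn.joint Rt).op (_root_.reduce (total n t) A.gates w)) c *ᵥ Ψ = 0 →
        f c = 0) →
      ((A.measure n w).map fun x => f x.1).sum = f false + f true := by
  obtain ⟨h1, h2, h3, h4⟩ := h.reduce hw hc hsq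
  have hd := h.decide hφ h1 h2 h3 (dot_reduce_pivot h.tri h.piv _)
  have hΨ : ∀ c, outcomeProj ((Rn.joint Rt).op (_root_.reduce (total n t) A.elim
      (_root_.reduce (total n t) A.gates w))) c *ᵥ Ψ =
      outcomeProj ((Rn.joint Rt).op (_root_.reduce (total n t) A.gates w)) c *ᵥ Ψ := fun c => by
    rw [outcomeProj_mulVec, outcomeProj_mulVec, h4]
  simp only [hΨ] at hd
  rw [SimState.measure, reduce_append]
  refine ⟨fun x hx => ⟨hd.1 x hx, ?_⟩, hd.2⟩
  obtain ⟨g1, g2, g3, g4⟩ := SimState.decide_fields _ x hx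
  refine ⟨g1, g2, g3, fun u hu hu' r hr => ?_⟩
  rcases g4 r hr with hr | hr
  · exact hu r hr
  · rw [hr]
    -- Elimination multiplies only by recorded strings, all of which overlap evenly with `u`.
    refine reduce_induction (fun v => dot (total n t) u v.b = 0) (fun s hs v hv => ?_) hu'
    rw [dot_comm, dot_app, dot_comm, hv, dot_comm (u := s.y.b), hu s hs]; ring

end Decide

/-! ### The number of measured parities -/

section Measured

theorem dot_total (n t : ℕ) (u v : ℕ → ZMod 2) : dot (total n t) u v =
    dot (2 * n + 2) u v + dot (2 * t + 2) (tailBits n u) (tailBits n v) := by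
  simp only [dot, total, Finset.sum_range_add]; rfl

theorem ZBits.dot_eq_zero {n : ℕ} {u v : ℕ → ZMod 2} (hu : ZBits n u) (hv : ZBits n v) :
    dot (2 * n + 2) u v = 0 := by
  rw [dot, Finset.sum_range_succ, Finset.sum_range_succ,
    sum_pairs (u := fun j => u j * v j) fun j hj => by simp only [hu.pair j hj, hv.pair j hj],
    hu.last.1, hu.last.2]
  ring

theorem zBits_parityRule (n t : ℕ) (p : Bool) :
    ZBits n (parityRule (total n t) (2 * n + 2) (2 * t + 2) p).y.b := by
  have h : ∀ j < 2 * n + 2, (parityRule (total n t) (2 * n + 2) (2 * t + 2) p).y.b j = 0 :=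
    fun j hj => by
      change ind (Finset.Ico (2 * n + 2) (2 * n + 2 + (2 * t + 2))) j = 0
      rw [ind, if_neg]
      rw [Finset.mem_Ico]; omega
  exact ⟨fun j hj => by rw [h _ (by omega), h _ (by omega)], h _ (by omega), h _ (by omega)⟩

theorem dot_parityRule {N o k : ℕ} (hk : 0 < k) (hN : o + k ≤ N) (p : Bool) :
    dot N (parityRule N o k p).y.b (parityRule N o k p).q = 1 := by
  change dot N (ind (Finset.Ico o (o + k))) (ind {o + k - 1}) = 1
  rw [dot_singleton _ (by omega), ind, if_pos]
  rw [Finset.mem_Ico]; omega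

/-- The strings on the second register that commute and can be measured together with its total
parity are few. -/
theorem length_le_of_isotropic {n t : ℕ} {L : List Rule}
    (hL : ∀ r ∈ L, ZBits n r.y.b ∧ ∃ j < 2 * t + 2, r.q = ind {2 * n + 2 + j} ∧
      dot (total n t) r.y.b r.q = 1)
    (htri : L.Pairwise fun r r' => dot (total n t) r'.y.b r.q = 0)
    (hiso : ∀ r ∈ L, ∀ r' ∈ L, dot (total n t) r.y.b r'.y.b = 0) : L.length ≤ t + 1 := by
  let M : Matrix (Fin L.length) (Fin (2 * t + 2)) (ZMod 2) :=
    Matrix.of fun i j => tailBits n (L.get i).y.b j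
  let E : Matrix (Fin (2 * t + 2)) (Fin L.length) (ZMod 2) :=
    Matrix.of fun j i => tailBits n (L.get i).q j
  have hME : ∀ i' i, (M * E) i' i = dot (total n t) (L.get i').y.b (L.get i).q := fun i' i => by
    obtain ⟨_, j, _, hq, _⟩ := hL _ (L.get_mem i)
    rw [dot_total, hq]
    have : dot (2 * n + 2) (L.get i').y.b (ind {2 * n + 2 + j}) = 0 :=
      Finset.sum_eq_zero fun k hk => by
        have := Finset.mem_range.1 hk
        simp only [ind, Finset.mem_singleton]
        rw [if_neg (by omega), mul_zero]
    rw [this, zero_add, mul_apply, dot, Finset.sum_range, ← hq]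
    rfl
  -- The strings commute and have no odd overlap on `R_n`, so their parts on `R_t` are isotropic;
  -- hence twice the rank of `M` is at most 2t + 2.
  have hMM : M * Mᵀ = 0 := by
    ext i' i
    have h := hiso _ (L.get_mem i') _ (L.get_mem i)
    rw [dot_total, (hL _ (L.get_mem i')).1.dot_eq_zero (hL _ (L.get_mem i)).1, zero_add, dot,
      Finset.sum_range] at h
    rw [mul_apply]
    exact h
  -- Later strings vanish on earlier pivots, so this matrix is triangular with ones on the diagonal.
  -- Thus the rows of `M` are independent and its rank is the number of strings.
  have hdet : (M * E).det = 1 := by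
    rw [det_of_isUpperTriangular]
    · exact Finset.prod_eq_one fun i _ => by
        rw [hME]
        obtain ⟨_, j, _, _, h⟩ := hL _ (L.get_mem i)
        exact h
    · intro i' i hi
      rw [hME]
      exact List.pairwise_iff_get.1 htri i i' hi
  have h1 : (M * E).rank = L.length := by
    rw [rank_of_isUnit _ ((isUnit_iff_isUnit_det _).2 (by rw [hdet]; exact isUnit_one)),
      Fintype.card_fin]
  have h2 := rank_mul_le_left M E
  have h3 := rank_add_rank_le_card_of_mul_eq_zero hMM
  rw [rank_transpose, Fintype.card_fin] at h3
  omega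

variable {n t : ℕ} {ι κ : Type*} [Fintype ι] [DecidableEq ι] [Fintype κ] [DecidableEq κ]
  {Rn : MajoranaRegister (2 * n + 2) ι} {Rt : MajoranaRegister (2 * t + 2) κ}
  {φ : ι → ℂ} {ψ : κ → ℂ} {pn pt : Bool} {A : SimState (2 * t + 2)} {Ψ : ι × κ → ℂ}

/-- The measured parities are few, even, and commute. -/
theorem Tracks.measuredParities (h : Tracks Rn Rt φ ψ pn pt A Ψ) :
    A.config.measuredParities.length ≤ t ∧
    (∀ S ∈ A.config.measuredParities, Even S.card) ∧
    ∀ S ∈ A.config.measuredParities, ∀ S' ∈ A.config.measuredParities,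
      Commute (Rt.parity S) (Rt.parity S') := by
  obtain ⟨K, h1, h2, h3⟩ := h.measured
  have hm : ∀ r ∈ K, r ∈ A.elim := fun r hr => h1.subset (List.mem_cons_of_mem _ hr)
  rw [h3]
  refine ⟨?_, ?_, ?_⟩
  -- The total parity of `R_t` is one of the t + 1 possible strings, though it is never measured;
  -- this leaves `t` for the others.
  · have := length_le_of_isotropic (n := n) (t := t) (L := _ :: K) (fun r hr => ?_)
      (h.tri.sublist h1) fun r hr r' hr' => h.iso r (h1.subset hr) r' (h1.subset hr')
    · simpa using this
    · rcases List.mem_cons.1 hr with rfl | hr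
      · exact ⟨zBits_parityRule n t pt, 2 * t + 1, by omega, rfl,
          dot_parityRule (by omega) le_rfl pt⟩
      · exact h2 r hr
  · intro S hS
    obtain ⟨r, hr, rfl⟩ := List.mem_map.1 hS
    rw [card_tSupport]
    exact (h.even r (hm r hr)).weightBelow.2
  · intro S hS S' hS'
    obtain ⟨r, hr, rfl⟩ := List.mem_map.1 hS
    obtain ⟨r', hr', rfl⟩ := List.mem_map.1 hS'
    have hd := h.iso r (hm r hr) r' (hm r' hr')
    rw [dot_total, (h2 r hr).1.dot_eq_zero (h2 r' hr').1, zero_add] at hd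
    have hc : ∀ {u u' : ℕ → ZMod 2} (v v' : ℕ → ZMod 2), (∀ j < 2 * t + 2, u j = v j) →
        (∀ j < 2 * t + 2, u' j = v' j) → dot (2 * t + 2) u u' = dot (2 * t + 2) v v' :=
      fun v v' h h' => Finset.sum_congr rfl fun j hj => by
        rw [h j (Finset.mem_range.1 hj), h' j (Finset.mem_range.1 hj)]
    rw [MajoranaRegister.parity_eq_op, MajoranaRegister.parity_eq_op]
    refine MajoranaRegister.op_commute ?_ ?_
    · refine Eq.trans (Finset.sum_congr rfl fun j hj => ?_) (h.even r (hm r hr)).2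
      exact shiftInd_tSupport _ (Finset.mem_range.1 hj)
    · rw [← hd]
      exact hc _ _ (fun j hj => shiftInd_tSupport _ hj) fun j hj => shiftInd_tSupport _ hj

end Measured

/-! ### Gates and conjugation -/

section Algebra

variable {ι : Type*} [Fintype ι] [DecidableEq ι]

/-- The exponential `exp ((π / 4) Y)` for `Y² = -1`. -/
noncomputable def quarterTurn (Y : Matrix ι ι ℂ) : Matrix ι ι ℂ :=
  ((Real.cos (Real.pi / 4) : ℝ) : ℂ) • (1 + Y)

theorem two_mul_cos_sq : (2 : ℂ) * (((Real.cos (Real.pi / 4) : ℝ) : ℂ) *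
    ((Real.cos (Real.pi / 4) : ℝ) : ℂ)) = 1 := by
  rw [Real.cos_pi_div_four]
  have h : (√2 / 2) * (√2 / 2) = (1 / 2 : ℝ) := by
    rw [div_mul_div_comm, Real.mul_self_sqrt (by norm_num)]; norm_num
  rw [← Complex.ofReal_mul, h]
  norm_num

theorem quarterTurn_neg_mul {Y : Matrix ι ι ℂ} (h : Y * Y = -1) :
    quarterTurn (-Y) * quarterTurn Y = 1 := by
  rw [quarterTurn, quarterTurn, smul_mul_smul_comm]
  have : (1 + -Y) * (1 + Y) = (2 : ℂ) • 1 := by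
    rw [mul_add, add_mul, add_mul, neg_mul, neg_mul, h, two_smul]
    simp
  rw [this, smul_smul, mul_comm, two_mul_cos_sq, one_smul]

theorem quarterTurn_conjTranspose {Y : Matrix ι ι ℂ} (h : Y * Y = -1) (hY : Yᴴ * Y = 1) :
    (quarterTurn Y)ᴴ = quarterTurn (-Y) := by
  have : Yᴴ = -Y := by
    have h1 : Yᴴ * (Y * Y) = Y := by rw [← mul_assoc, hY, one_mul]
    rw [h, mul_neg, mul_one] at h1
    rw [← neg_eq_iff_eq_neg, h1]
  rw [quarterTurn, conjTranspose_smul, conjTranspose_add, conjTranspose_one, this, quarterTurn]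
  congr 1
  exact Complex.conj_ofReal _

theorem quarterTurn_unitary {Y : Matrix ι ι ℂ} (h : Y * Y = -1) (hY : Yᴴ * Y = 1) :
    (quarterTurn Y)ᴴ * quarterTurn Y = 1 := by
  rw [quarterTurn_conjTranspose h hY, quarterTurn_neg_mul h]

theorem quarterTurn_commute {Y w : Matrix ι ι ℂ} (h : w * Y = Y * w) :
    quarterTurn Y * w = w * quarterTurn Y := by
  simp only [quarterTurn, smul_mul_assoc, mul_smul_comm, add_mul, mul_add, one_mul, mul_one, h]

/-- Moving `w` past the turn inverts it, and exp(πY/4) = Y exp(-πY/4) because exp(πY/2) = Y. This is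
the reason for the form "multiply by `y`" of a rule. -/
theorem quarterTurn_neg_anticommute {Y w : Matrix ι ι ℂ} (h : Y * Y = -1) (hw : w * Y = -(Y * w)) :
    quarterTurn (-Y) * w = w * Y * quarterTurn (-Y) := by
  have h1 : w * Y * Y = -w := by rw [mul_assoc, h, mul_neg, mul_one]
  rw [quarterTurn, smul_mul_assoc, mul_smul_comm, add_mul, mul_add, one_mul, mul_one, mul_neg, h1,
    neg_neg, neg_mul, ← hw, add_comm]

/-- The exponential `exp (-i (π / 8) Q)` for `Q² = 1`. -/
noncomputable def eighthTurn (Q : Matrix ι ι ℂ) : Matrix ι ι ℂ :=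
  ((Real.cos (Real.pi / 8) : ℝ) : ℂ) • 1 - (Complex.I * ((Real.sin (Real.pi / 8) : ℝ) : ℂ)) • Q

/-- The angle π/4 less π/8 is π/8: the correction relates the eighth turns in the two directions.
The two trigonometric identities come from the subtraction formulas at these angles. -/
theorem quarterTurn_mul_eighthTurn {Q : Matrix ι ι ℂ} (hQ : Q * Q = 1) :
    quarterTurn (Complex.I • Q) * eighthTurn Q = eighthTurn (-Q) := by
  have h1 : Real.cos (Real.pi / 4) * (Real.cos (Real.pi / 8) + Real.sin (Real.pi / 8)) =
      Real.cos (Real.pi / 8) := by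
    have := Real.cos_sub (Real.pi / 4) (Real.pi / 8)
    rw [show Real.pi / 4 - Real.pi / 8 = Real.pi / 8 by ring, Real.sin_pi_div_four,
      ← Real.cos_pi_div_four] at this
    linarith
  have h2 : Real.cos (Real.pi / 4) * (Real.cos (Real.pi / 8) - Real.sin (Real.pi / 8)) =
      Real.sin (Real.pi / 8) := by
    have := Real.sin_sub (Real.pi / 4) (Real.pi / 8)
    rw [show Real.pi / 4 - Real.pi / 8 = Real.pi / 8 by ring, Real.sin_pi_div_four,
      ← Real.cos_pi_div_four] at this
    linarith
  have h1' := congrArg (fun x : ℝ => (x : ℂ)) h1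
  have h2' := congrArg (fun x : ℝ => (x : ℂ)) h2
  simp only [Complex.ofReal_mul, Complex.ofReal_add, Complex.ofReal_sub] at h1' h2'
  rw [quarterTurn, eighthTurn, eighthTurn]
  generalize ((Real.cos (Real.pi / 4) : ℝ) : ℂ) = r at *
  generalize ((Real.cos (Real.pi / 8) : ℝ) : ℂ) = c at *
  generalize ((Real.sin (Real.pi / 8) : ℝ) : ℂ) = s at *
  have : (1 + Complex.I • Q) * (c • 1 - (Complex.I * s) • Q) =
      (c + s) • (1 : Matrix ι ι ℂ) + (Complex.I * (c - s)) • Q := by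
    simp only [add_mul, mul_sub, one_mul, smul_mul_smul_comm, mul_one, hQ]
    rw [← mul_assoc, Complex.I_mul_I]
    module
  rw [smul_mul_assoc, this, smul_add, smul_smul, smul_smul, h1',
    show r * (Complex.I * (c - s)) = Complex.I * (r * (c - s)) by ring, h2']
  simp

/-- The correction after the outcome `c` of the measurement of `Q S`. -/
noncomputable def correction (Q : Matrix ι ι ℂ) (c : Bool) : Matrix ι ι ℂ :=
  if c then quarterTurn (Complex.I • Q) else 1

theorem I_smul_sq {Q : Matrix ι ι ℂ} (hQ : Q * Q = 1) :
    (Complex.I • Q) * (Complex.I • Q) = -1 := by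
  rw [smul_mul_smul_comm, hQ, Complex.I_mul_I]; simp

theorem correction_unitary {Q : Matrix ι ι ℂ} (hQ : Q * Q = 1) (hQ' : Qᴴ * Q = 1) (c : Bool) :
    (correction Q c)ᴴ * correction Q c = 1 := by
  rw [correction]
  split_ifs
  · refine quarterTurn_unitary (I_smul_sq hQ) ?_
    rw [conjTranspose_smul, smul_mul_smul_comm, hQ']
    simp
  · simp

theorem correction_commute {Q w : Matrix ι ι ℂ} (h : w * Q = Q * w) (c : Bool) :
    correction Q c * w = w * correction Q c := by
  rw [correction]
  split_ifs
  · exact quarterTurn_commute (by rw [mul_smul_comm, smul_mul_assoc, h])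
  · simp

/-- Gate teleportation. -/
theorem outcomeProj_mul_eighthTurn {Q S : Matrix ι ι ℂ} (hQ : Q * Q = 1) (hS : S * S = 1)
    (hQS : Q * S = S * Q) (c : Bool) : outcomeProj (Q * S) c * eighthTurn S =
      outcomeProj (Q * S) c * correction Q c * eighthTurn Q := by
  -- After the outcome (-1)^c of QS, the involutions S and (-1)^c Q are interchangeable.
  have h1 : outcomeProj (Q * S) c * S = bitSign c • (outcomeProj (Q * S) c * Q) := by
    have e1 : Q * S * S = Q := by rw [mul_assoc, hS, mul_one]
    have e2 : Q * S * Q = S := by rw [hQS, mul_assoc, hQ, mul_one]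
    simp only [outcomeProj, smul_mul_assoc, add_mul, one_mul, e1, e2]
    rw [smul_comm (bitSign c), smul_add (bitSign c), smul_smul (bitSign c), bitSign_sq,
      one_smul, add_comm]
  cases c
  · simp only [eighthTurn, correction, Bool.false_eq_true, if_false, mul_one, mul_sub,
      mul_smul_comm, h1]
    simp [bitSign]
  · rw [correction, if_pos rfl, mul_assoc, quarterTurn_mul_eighthTurn hQ]
    simp only [eighthTurn, mul_sub, mul_smul_comm, mul_one, h1]
    simp [bitSign]

/-- How the strings change when a magic state is consumed. -/
theorem teleport_conj {Q S X w : Matrix ι ι ℂ} (hQ : Q * Q = 1) (hS : S * S = 1)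
    (hQS : Q * S = S * Q) (hXQ : X * Q = Q * X) (hXS : X * S = -(S * X)) (hwQ : w * Q = -(Q * w))
    (hwS : w * S = S * w) (c : Bool) :
    outcomeProj (Q * S) c * correction Q c * (w * X) =
      w * ((if c then -Complex.I • S else 1) * X) * (outcomeProj (Q * S) c * correction Q c) := by
  have h1 : Q * (w * X) = -(w * X * Q) := by
    rw [mul_assoc, hXQ, ← mul_assoc, ← mul_assoc, hwQ, neg_mul, neg_neg]
  have h2 : S * (w * X) = -(w * X * S) := by
    rw [mul_assoc, hXS, mul_neg, neg_neg, ← mul_assoc, ← hwS, mul_assoc]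
  have h3 : w * (S * X) = -(w * X * S) := by rw [← h2, ← mul_assoc, ← mul_assoc, hwS]
  cases c
  · simp only [correction, Bool.false_eq_true, if_false, mul_one, one_mul]
    refine outcomeProj_commute ?_ false
    rw [mul_assoc, h2, mul_neg, ← mul_assoc, h1, neg_mul, neg_neg, mul_assoc]
  -- The string wX anticommutes with both Q and S, hence commutes with QS. Passing it through the
  -- correction inverts the turn, which produces a factor -iQ, and Q equals -S on the outcome -1.
  · have h4 : w * ((-Complex.I • S) * X) = Complex.I • (w * X * S) := by
      rw [smul_mul_assoc, mul_smul_comm, h3, smul_neg, neg_smul, neg_neg]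
    simp only [correction, if_true, h4]
    have h5 : (1 + bitSign true • (Q * S)) * (1 + Complex.I • Q) =
        1 + Complex.I • Q - Q * S - Complex.I • S := by
      have : Q * S * Q = S := by rw [hQS, mul_assoc, hQ, mul_one]
      simp only [bitSign, if_true, neg_smul, one_smul, add_mul, mul_add, one_mul, mul_one, neg_mul,
        mul_smul_comm, this, smul_add, smul_neg]
      abel
    have h6 : outcomeProj (Q * S) true * quarterTurn (Complex.I • Q) =
        ((1 / 2 : ℂ) * ((Real.cos (Real.pi / 4) : ℝ) : ℂ)) •
          (1 + Complex.I • Q - Q * S - Complex.I • S) := by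
      rw [outcomeProj, quarterTurn, smul_mul_smul_comm, h5]
    rw [h6]
    generalize w * X = u at *
    have e1 : Q * S * u = u * (Q * S) := by
      rw [mul_assoc, h2, mul_neg, ← mul_assoc, h1, neg_mul, neg_neg, mul_assoc]
    have e2 : S * (Q * S) = Q := by rw [← mul_assoc, ← hQS, mul_assoc, hS, mul_one]
    rw [smul_mul_assoc, mul_smul_comm]
    congr 1
    simp only [sub_mul, add_mul, one_mul, mul_sub, mul_add, mul_one, smul_mul_assoc, mul_smul_comm,
      h1, h2, e1, smul_smul, Complex.I_mul_I, mul_assoc u, hS, e2, ← hQS]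
    simp only [smul_neg, neg_smul, one_smul, sub_neg_eq_add]
    abel

end Algebra

section Kronecker

variable {ι κ : Type*} [DecidableEq ι] [DecidableEq κ]

theorem eighthTurn_kronecker_one (Q : Matrix ι ι ℂ) :
    eighthTurn Q ⊗ₖ (1 : Matrix κ κ ℂ) = eighthTurn (Q ⊗ₖ 1) := by
  rw [eighthTurn, eighthTurn, sub_eq_add_neg, sub_eq_add_neg, ← neg_smul, ← neg_smul,
    add_kronecker, smul_kronecker, smul_kronecker, one_kronecker_one]

theorem one_kronecker_eighthTurn (Q : Matrix κ κ ℂ) :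
    (1 : Matrix ι ι ℂ) ⊗ₖ eighthTurn Q = eighthTurn (1 ⊗ₖ Q) := by
  rw [eighthTurn, eighthTurn, sub_eq_add_neg, sub_eq_add_neg, ← neg_smul, ← neg_smul,
    kronecker_add, kronecker_smul, kronecker_smul, one_kronecker_one]

theorem quarterTurn_kronecker_one (Q : Matrix ι ι ℂ) :
    quarterTurn Q ⊗ₖ (1 : Matrix κ κ ℂ) = quarterTurn (Q ⊗ₖ 1) := by
  rw [quarterTurn, quarterTurn, smul_kronecker, add_kronecker, one_kronecker_one]

end Kronecker

/-! ### The gates as turns by strings -/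

namespace MajoranaRegister

variable {n t : ℕ} {ι κ : Type*} [Fintype ι] [DecidableEq ι] [Fintype κ] [DecidableEq κ]
  {Rn : MajoranaRegister (2 * n + 2) ι} {Rt : MajoranaRegister (2 * t + 2) κ}

theorem gen_mul_gen_eq {N : ℕ} (R : MajoranaRegister N ι) {a b : ℕ} (ha : a < N) (hb : b < N)
    (hab : a ≠ b) : (Complex.I • (R.gen a * R.gen b)) * (Complex.I • (R.gen a * R.gen b)) = 1 := by
  have : R.gen a * R.gen b * (R.gen a * R.gen b) = -1 := by
    rw [mul_assoc, ← mul_assoc (R.gen b), R.gen_anticomm hb ha hab.symm, neg_mul, mul_neg,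
      mul_assoc, R.gen_sq hb, mul_one, R.gen_sq ha]
  rw [smul_mul_smul_comm, this, Complex.I_mul_I]
  simp

/-- The `T_2` gate. -/
theorem T2_eq {N : ℕ} (R : MajoranaRegister N ι) {a b : Fin N} (hab : a ≠ b) :
    R.T2 a b = eighthTurn (Complex.I • (R.gen a * R.gen b)) := by
  have hab' : (a : ℕ) ≠ b := fun h => hab (Fin.ext h)
  have h := exp_smul_involution (R.gen_mul_gen_eq a.2 b.2 hab')
    (((-(Real.pi / 8) : ℝ) : ℂ) * Complex.I)
  rw [Complex.cosh_mul_I, Complex.sinh_mul_I] at h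
  rw [T2, ← gen_fin, ← gen_fin, eighthTurn, sub_eq_add_neg, ← neg_smul]
  convert h using 2
  · rw [smul_smul, mul_assoc, Complex.I_mul_I]
    push_cast
    congr 1
    ring
  · rw [← Complex.ofReal_cos, Real.cos_neg]
  · congr 1
    rw [← Complex.ofReal_sin, Real.sin_neg]
    push_cast
    ring

theorem parity_sq {N : ℕ} (R : MajoranaRegister N ι) {S : Finset (Fin N)} (hS : Even S.card) :
    R.parity S * R.parity S = 1 := by
  rw [parity_eq_op, op_half_sq]
  rw [sum_eq_weightBelow, weightBelow_shiftInd _ (by omega), ZMod.natCast_eq_zero_iff_even]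
  exact hS

/-- The braid gates. -/
theorem braid_eq {N : ℕ} (R : MajoranaRegister N ι) (inv : Bool) {S : Finset (Fin N)}
    (hS : Even S.card) :
    R.braid inv S = quarterTurn ((bitSign inv * Complex.I) • R.parity S) := by
  have h := exp_smul_involution (R.parity_sq hS)
    ((((if inv then -1 else 1) * (Real.pi / 4) : ℝ) : ℂ) * Complex.I)
  rw [Complex.cosh_mul_I, Complex.sinh_mul_I, ← Complex.ofReal_cos, ← Complex.ofReal_sin] at h
  have e : bitSign inv * Complex.I * (Real.pi / 4 : ℂ) =
      (((if inv then -1 else 1) * (Real.pi / 4) : ℝ) : ℂ) * Complex.I := by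
    cases inv <;> simp [bitSign] <;> ring
  rw [braid, e, h, quarterTurn, smul_add, smul_smul]
  have hs : Real.sin (Real.pi / 4) = Real.cos (Real.pi / 4) := by
    rw [Real.sin_pi_div_four, Real.cos_pi_div_four]
  cases inv
  · simp only [Bool.false_eq_true, if_false, one_mul, hs, bitSign]
  · simp only [if_true, neg_one_mul, Real.cos_neg, Real.sin_neg, hs, bitSign]
    push_cast
    congr 2
    ring

theorem joint_braid (inv : Bool) {S : Finset (Fin (2 * n + 2))} (hS : Even S.card) :
    Rn.braid inv S ⊗ₖ (1 : Matrix κ κ ℂ) =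
      quarterTurn ((Rn.joint Rt).op (braidRule n t inv S).y) := by
  rw [braid_eq _ _ hS, quarterTurn_kronecker_one, joint_braidRule _ hS, smul_kronecker]

theorem joint_T2_left {a b : Fin (2 * n + 2)} (hab : a ≠ b) :
    Rn.T2 a b ⊗ₖ (1 : Matrix κ κ ℂ) = eighthTurn ((Rn.joint Rt).op (pairWord a b)) := by
  rw [T2_eq _ hab, eighthTurn_kronecker_one,
    joint_pairWord a.2 b.2 fun h => hab (Fin.ext h)]

theorem T2_eq_s (R : MajoranaRegister (2 * t + 2) κ) (i : Fin t) :
    R.T2 ⟨2 * i, by omega⟩ ⟨2 * i + 1, by omega⟩ = eighthTurn (R.s i) := by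
  rw [T2_eq _ (by simp [Fin.ext_iff]), s, ← gen_fin, ← gen_fin]

end MajoranaRegister

/-! ### Absorbed gates -/

open MajoranaRegister

theorem eq_zero_of_neg_eq_self {ι : Type*} {B : Matrix ι ι ℂ} (h : -B = B) : B = 0 := by
  ext x y
  exact neg_eq_self.1 (congrFun (congrFun h x) y)

/-- An odd overlap would make two unitaries anticommute as well as commute; their product would then
vanish, which is impossible on a nonzero space. -/
theorem dot_eq_zero_of_commute {N : ℕ} {ι : Type*} [Fintype ι] [DecidableEq ι] [Nonempty ι]
    (R : MajoranaRegister N ι) {u v : Word} (hu : ∑ j ∈ Finset.range N, u.b j = 0)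
    (h : R.op u * R.op v = R.op v * R.op u) : dot N u.b v.b = 0 := by
  by_contra hne
  have h1 := R.op_anticommute hu hne
  replace h1 := eq_zero_of_neg_eq_self (h.symm.trans h1).symm
  have h2 := R.op_unitary v
  have h3 := R.op_unitary u
  have h4 : R.op u = 0 := by
    calc R.op u = (R.op v)ᴴ * (R.op v * R.op u) := by rw [← mul_assoc, h2, one_mul]
      _ = 0 := by rw [h1, mul_zero]
  rw [h4, mul_zero] at h3
  exact zero_ne_one h3

theorem dot_eq_one_of_anticommute {N : ℕ} {ι : Type*} [Fintype ι] [DecidableEq ι] [Nonempty ι]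
    (R : MajoranaRegister N ι) {u v : Word} (hu : ∑ j ∈ Finset.range N, u.b j = 0)
    (h : R.op u * R.op v + R.op v * R.op u = 0) : dot N u.b v.b = 1 := by
  by_contra hne
  have h1 := R.op_commute hu ((ZMod.two_cases _).resolve_right hne)
  rw [h1, ← neg_eq_iff_add_eq_zero] at h
  replace h := eq_zero_of_neg_eq_self h
  have h2 := R.op_unitary v
  have h3 := R.op_unitary u
  have h4 : R.op u = 0 := by
    calc R.op u = (R.op v)ᴴ * (R.op v * R.op u) := by rw [← mul_assoc, h2, one_mul]
      _ = 0 := by rw [h, mul_zero]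
  rw [h4, mul_zero] at h3
  exact zero_ne_one h3

section Absorbed

variable {n t : ℕ} {ι κ : Type*} [Fintype ι] [DecidableEq ι] [Fintype κ] [DecidableEq κ]
  (Rn : MajoranaRegister (2 * n + 2) ι) (Rt : MajoranaRegister (2 * t + 2) κ)
  (X : Fin t → FermionParity (2 * t + 2))

theorem evenBits_tWord {i : ℕ} (hi : i < t) : EvenBits n t (tWord n i).b :=
  evenBits_pair_right (by omega) (by omega) (by omega)

theorem evenBits_frameWord (Y : FermionParity (2 * t + 2)) : EvenBits n t (frameWord n Y).b :=
  evenBits_right Y.even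

-- The relations of a magic frame are given for operators, while the algorithm uses overlaps of bit
-- strings. Commutation determines the overlap by the preceding lemmas.
variable {Rt X} in
theorem IsMagicFrame.dot_eq [Nonempty ι] [Nonempty κ] (Rn : MajoranaRegister (2 * n + 2) ι)
    (h : IsMagicFrame Rt X) :
    (∀ i, dot (total n t) (frameWord n (X i)).b (tWord n i).b = 1) ∧
    (∀ i k, k ≠ i → dot (total n t) (frameWord n (X i)).b (tWord n k).b = 0) ∧
    ∀ i k, k ≠ i → dot (total n t) (frameWord n (X i)).b (frameWord n (X k)).b = 0 := by
  obtain ⟨h1, h2, h3⟩ := h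
  refine ⟨fun i => ?_, fun i k hk => ?_, fun i k hk => ?_⟩
  · refine dot_eq_one_of_anticommute (Rn.joint Rt) (evenBits_frameWord _).sum ?_
    rw [joint_frameWord, joint_tWord i.2, ← mul_kronecker_mul, ← mul_kronecker_mul,
      ← kronecker_add, add_comm, h1]
    simp
  · refine dot_eq_zero_of_commute (Rn.joint Rt) (evenBits_frameWord _).sum ?_
    rw [joint_frameWord, joint_tWord k.2, ← mul_kronecker_mul, ← mul_kronecker_mul]
    rw [(h2 i k hk).eq]
  · refine dot_eq_zero_of_commute (Rn.joint Rt) (evenBits_frameWord _).sum ?_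
    rw [joint_frameWord, joint_frameWord, ← mul_kronecker_mul, ← mul_kronecker_mul,
      (h3 i k hk).eq]

/-- Strings that act on the first register and the magic states from number `i` on. -/
structure FreeBits (n i : ℕ) (u : ℕ → ZMod 2) : Prop where
  even : EvenBits n t u
  s : ∀ k : Fin t, (k : ℕ) < i → dot (total n t) u (tWord n k).b = 0
  x : ∀ k : Fin t, (k : ℕ) < i → dot (total n t) u (frameWord n (X k)).b = 0

/-- The first `i` magic states are in the state they had before the `T_2` gates. -/
def Settled (i : ℕ) (z : ι × κ → ℂ) : Prop :=
  ∀ k : Fin t, (k : ℕ) < i → (Rn.joint Rt).op (frameWord n (X k)) *ᵥ z = z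

/-- `V` intertwines the circuit and its simulation. -/
structure Absorbed (A : SimState (2 * t + 2)) (V : Matrix (ι × κ) (ι × κ) ℂ) : Prop where
  even : ∀ r ∈ A.gates, EvenBits n t r.y.b
  conj : ∀ w : Word, FreeBits X n A.used w.b → ∀ z, Settled Rn Rt X A.used z →
    V *ᵥ ((Rn.joint Rt).op w *ᵥ z) =
      (Rn.joint Rt).op (reduce (total n t) A.gates w) *ᵥ (V *ᵥ z)
  norm : ∀ z, Settled Rn Rt X A.used z → sqNorm (V *ᵥ z) = (1 / 2) ^ A.used * sqNorm z
  iso : ∀ w : Word, FreeBits X n A.used w.b → ∀ r ∈ A.elim,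
    dot (total n t) (reduce (total n t) A.gates w).b r.y.b = 0

variable {Rn Rt X} {A : SimState (2 * t + 2)} {V : Matrix (ι × κ) (ι × κ) ℂ} {z : ι × κ → ℂ}

theorem Settled.mono {i j : ℕ} (h : Settled Rn Rt X j z) (hij : i ≤ j) : Settled Rn Rt X i z :=
  fun k hk => h k (hk.trans_le hij)

theorem FreeBits.mono {i j : ℕ} {u : ℕ → ZMod 2} (h : FreeBits X n j u) (hij : i ≤ j) :
    FreeBits X n i u :=
  ⟨h.even, fun k hk => h.s k (hk.trans_le hij), fun k hk => h.x k (hk.trans_le hij)⟩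

theorem FreeBits.add {i : ℕ} {u v : ℕ → ZMod 2} (h : FreeBits X n i u) (h' : FreeBits X n i v) :
    FreeBits X n i (u + v) :=
  ⟨h.even.add h'.even, fun k hk => by rw [add_dot, h.s k hk, h'.s k hk, add_zero],
    fun k hk => by rw [add_dot, h.x k hk, h'.x k hk, add_zero]⟩

theorem FreeBits.app {i : ℕ} {r : Rule} {w : Word} (h : FreeBits X n i w.b)
    (hr : FreeBits X n i r.y.b) : FreeBits X n i (r.app (total n t) w).b := by
  rw [Rule.app]
  split_ifs
  · exact h
  · exact h.add hr

theorem Settled.mulVec {i : ℕ} (h : Settled Rn Rt X i z) {B : Matrix (ι × κ) (ι × κ) ℂ}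
    (hB : ∀ k : Fin t, (k : ℕ) < i → (Rn.joint Rt).op (frameWord n (X k)) * B =
      B * (Rn.joint Rt).op (frameWord n (X k))) : Settled Rn Rt X i (B *ᵥ z) := fun k hk => by
  rw [mulVec_mulVec, hB k hk, ← mulVec_mulVec, h k hk]

theorem FreeBits.commute_frame {i : ℕ} {w : Word} (hw : FreeBits X n i w.b) (k : Fin t)
    (hk : (k : ℕ) < i) : (Rn.joint Rt).op (frameWord n (X k)) * (Rn.joint Rt).op w =
      (Rn.joint Rt).op w * (Rn.joint Rt).op (frameWord n (X k)) :=
  (op_commute hw.even.sum (hw.x k hk)).symm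

theorem freeBits_left {u : ℕ → ZMod 2} (hu : EvenBits n t u)
    (h : ∀ j < 2 * t + 2, tailBits n u j = 0) (i : ℕ) : FreeBits X n i u := by
  have key : ∀ v : ℕ → ZMod 2, (∀ j < 2 * n + 2, v j = 0) → dot (total n t) u v = 0 := by
    intro v hv
    rw [dot_total]
    rw [dot, Finset.sum_eq_zero fun j hj => by rw [hv j (Finset.mem_range.1 hj), mul_zero], dot,
      Finset.sum_eq_zero fun j hj => by rw [h j (Finset.mem_range.1 hj), zero_mul], add_zero]
  refine ⟨hu, fun k _ => key _ fun j hj => ?_, fun k _ => key _ fun j hj => ?_⟩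
  · simp only [tWord, ind, Finset.mem_insert, Finset.mem_singleton]
    rw [if_neg (by omega)]
  · exact shiftInd_eq_zero _ (by omega)

theorem Absorbed.evenBits (h : Absorbed Rn Rt X A V) {w : Word} (hw : EvenBits n t w.b) :
    EvenBits n t (reduce (total n t) A.gates w).b :=
  reduce_induction (fun w => EvenBits n t w.b) (fun r hr _ hw => (h.even r hr).app hw) hw

/-- Each consumed magic state costs exactly a factor 1/2 of squared norm, whatever the outcome, so
no branch dies. This allows identities between strings to be tested on one vector. -/
theorem Absorbed.ne_zero (h : Absorbed Rn Rt X A V) (hz : Settled Rn Rt X A.used z)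
    (hz1 : sqNorm z ≠ 0) : V *ᵥ z ≠ 0 := by
  intro h0
  have := h.norm z hz
  rw [h0, sqNorm_zero] at this
  have h2 : (1 / 2 : ℝ) ^ A.used * sqNorm z ≠ 0 := mul_ne_zero (by positivity) hz1
  exact h2 this.symm

/-- The square of any string is a scalar. Evaluated on the nonzero vector `V *ᵥ z` by the
intertwining relation, the scalar is one. -/
theorem Absorbed.sq (h : Absorbed Rn Rt X A V) (hz : Settled Rn Rt X A.used z)
    (hz1 : sqNorm z ≠ 0) {w : Word} (hw : FreeBits X n A.used w.b)
    (hsq : (Rn.joint Rt).op w * (Rn.joint Rt).op w = 1) :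
    (Rn.joint Rt).op (reduce (total n t) A.gates w) *
      (Rn.joint Rt).op (reduce (total n t) A.gates w) = 1 := by
  have h1 := h.conj w hw _ (hz.mulVec hw.commute_frame)
  rw [mulVec_mulVec (M := (Rn.joint Rt).op w), hsq, one_mulVec, h.conj w hw z hz, mulVec_mulVec] at h1
  obtain ⟨c, hc⟩ := (Rn.joint Rt).op_sq (reduce (total n t) A.gates w)
  rw [hc] at h1 ⊢
  rw [smul_mulVec, one_mulVec] at h1
  obtain ⟨p, hp⟩ := Function.ne_iff.1 (h.ne_zero hz hz1)
  have h2 := congrFun h1 p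
  rw [Pi.smul_apply, smul_eq_mul] at h2
  rw [mul_right_cancel₀ hp (h2.symm.trans (one_mul _).symm), one_smul]

/-- The pullback need not be a group homomorphism on all strings, yet on free strings it preserves
commutation: exchanging the two factors before and after the intertwining with `V` must give the
same sign. -/
theorem Absorbed.dot_reduce (h : Absorbed Rn Rt X A V) (hz : Settled Rn Rt X A.used z)
    (hz1 : sqNorm z ≠ 0) {u v : Word} (hu : FreeBits X n A.used u.b)
    (hv : FreeBits X n A.used v.b) :
    dot (total n t) (reduce (total n t) A.gates u).b (reduce (total n t) A.gates v).b =
      dot (total n t) u.b v.b := by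
  have key : ∀ u v : Word, FreeBits X n A.used u.b → FreeBits X n A.used v.b →
      V *ᵥ ((Rn.joint Rt).op u * (Rn.joint Rt).op v) *ᵥ z =
      ((Rn.joint Rt).op (reduce (total n t) A.gates u) *
        (Rn.joint Rt).op (reduce (total n t) A.gates v)) *ᵥ V *ᵥ z := fun u v hu hv => by
    rw [← mulVec_mulVec, h.conj u hu _ (hz.mulVec hv.commute_frame), h.conj v hv z hz, mulVec_mulVec]
  have hne : ((Rn.joint Rt).op (reduce (total n t) A.gates v) *
        (Rn.joint Rt).op (reduce (total n t) A.gates u)) *ᵥ V *ᵥ z ≠ 0 := by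
    intro h0
    have h1 := sqNorm_unitary ((Rn.joint Rt).op_unitary (reduce (total n t) A.gates v))
      ((Rn.joint Rt).op (reduce (total n t) A.gates u) *ᵥ V *ᵥ z)
    rw [mulVec_mulVec, h0, sqNorm_zero, sqNorm_unitary (op_unitary _)] at h1
    exact h.ne_zero hz hz1 (eq_zero_of_sqNorm h1.symm)
  have h1 := key u v hu hv
  rw [op_comm, op_comm (u := reduce _ _ u), hu.even.sum, (h.evenBits hu.even).sum, zero_mul, zero_add,
    zero_mul, zero_add, smul_mulVec, mulVec_smul, key v u hv hu, smul_mulVec] at h1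
  have h2 := smul_left_injective ℂ hne h1
  rcases ZMod.two_cases (dot (total n t) u.b v.b) with h3 | h3 <;>
    rcases ZMod.two_cases (dot (total n t) (reduce (total n t) A.gates u).b
      (reduce (total n t) A.gates v).b) with h4 | h4 <;>
    rw [h3, h4] at h2 ⊢
  · rw [sgn_zero, sgn_one] at h2; norm_num at h2
  · rw [sgn_zero, sgn_one] at h2; norm_num at h2

/-- At the beginning only the two total parities are known, and they commute with every string that
is even on both registers. -/
theorem Absorbed.init (n t : ℕ) {Rn : MajoranaRegister (2 * n + 2) ι}
    {Rt : MajoranaRegister (2 * t + 2) κ} {X : Fin t → FermionParity (2 * t + 2)} (pn pt : Bool) :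
    Absorbed Rn Rt X (SimState.init n t pn pt) 1 := by
  refine ⟨by simp [SimState.init], fun w _ z _ => by rw [one_mulVec, one_mulVec]; rfl,
    fun z _ => by simp [SimState.init], fun w hw r hr => ?_⟩
  have key : ∀ (o k : ℕ), o + (k + 1) ≤ total n t →
      ∑ j ∈ Finset.Ico o (o + (k + 1)), w.b j = 0 → ∀ p,
      dot (total n t) w.b (parityRule (total n t) o (k + 1) p).y.b = 0 := by
    intro o k hk hs p
    change dot (total n t) w.b (ind (Finset.Ico o (o + (k + 1)))) = 0
    rw [dot_ind _ _ _ fun j hj => by have := (Finset.mem_Ico.1 hj).2; omega, hs]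
  change dot (total n t) w.b r.y.b = 0
  simp only [SimState.init, List.mem_cons, List.not_mem_nil, or_false] at hr
  rcases hr with rfl | rfl
  · refine key 0 (2 * n + 1) (by simp only [total]; omega) ?_ pn
    rw [zero_add, ← Finset.range_eq_Ico]; exact hw.even.1
  · refine key (2 * n + 2) (2 * t + 1) (by simp only [total]; omega) ?_ pt
    rw [Finset.sum_Ico_eq_sum_range, Nat.add_sub_cancel_left]; exact hw.even.2

end Absorbed

/-! ### Absorbing a braid or a magic state -/

section AbsorbGate

variable {n t : ℕ} {ι κ : Type*} [Fintype ι] [DecidableEq ι] [Fintype κ] [DecidableEq κ]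
  {Rn : MajoranaRegister (2 * n + 2) ι} {Rt : MajoranaRegister (2 * t + 2) κ}
  {X : Fin t → FermionParity (2 * t + 2)} {A : SimState (2 * t + 2)}
  {V : Matrix (ι × κ) (ι × κ) ℂ} {z : ι × κ → ℂ}

theorem braidRule_sq (inv : Bool) {S : Finset (Fin (2 * n + 2))} (hS : Even S.card) :
    (Rn.joint Rt).op (braidRule n t inv S).y * (Rn.joint Rt).op (braidRule n t inv S).y = -1 := by
  rw [joint_braidRule inv hS, smul_mul_smul_comm, ← mul_kronecker_mul, parity_sq _ hS, mul_one,
    one_kronecker_one, mul_mul_mul_comm, bitSign_sq, Complex.I_mul_I]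
  simp

/-- The joint vector does not move. The circuit state is multiplied by the braid, and the inverse of
the braid is appended to `V`; strings are pulled back accordingly. -/
theorem Absorbed.braid (h : Absorbed Rn Rt X A V) (inv : Bool) {S : Finset (Fin (2 * n + 2))}
    (hS : Even S.card) :
    Absorbed Rn Rt X { A with gates := braidRule n t inv S :: A.gates }
      (V * quarterTurn (-(Rn.joint Rt).op (braidRule n t inv S).y)) := by
  have hy : FreeBits X n A.used (braidRule n t inv S).y.b :=
    freeBits_left (evenBits_left hS) (fun j _ => tailBits_shiftInd_left S j) _
  have hsq := braidRule_sq (Rn := Rn) (Rt := Rt) inv hS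
  have hU : (quarterTurn (-(Rn.joint Rt).op (braidRule n t inv S).y))ᴴ *
      quarterTurn (-(Rn.joint Rt).op (braidRule n t inv S).y) = 1 :=
    quarterTurn_unitary (by rw [neg_mul_neg, hsq])
      (by rw [conjTranspose_neg, neg_mul_neg, op_unitary])
  have hset : ∀ z, Settled Rn Rt X A.used z →
      Settled Rn Rt X A.used (quarterTurn (-(Rn.joint Rt).op (braidRule n t inv S).y) *ᵥ z) :=
    fun z hz => hz.mulVec fun k hk => (quarterTurn_commute
      (by rw [mul_neg, neg_mul, hy.commute_frame k hk])).symm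
  refine ⟨?_, fun w hw z hz => ?_, fun z hz => ?_, fun w hw r hr => ?_⟩
  · intro r hr
    rcases List.mem_cons.1 hr with rfl | hr
    · exact hy.even
    · exact h.even r hr
  · change _ = (Rn.joint Rt).op (reduce (total n t) A.gates
      ((braidRule n t inv S).app (total n t) w)) *ᵥ _
    rw [← mulVec_mulVec (M := V), ← mulVec_mulVec (M := V),
      ← h.conj _ (hw.app hy) _ (hset z hz)]
    refine congrArg (fun v => V *ᵥ v) ?_
    rw [mulVec_mulVec, mulVec_mulVec]
    refine congrArg (fun M => M *ᵥ z) ?_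
    rw [Rule.app]
    split_ifs with hd
    · exact quarterTurn_commute (by
        rw [mul_neg, neg_mul, op_commute hw.even.sum (v := (braidRule n t inv S).y) hd])
    · rw [op_mul, quarterTurn_neg_anticommute hsq
        (op_anticommute hw.even.sum (v := (braidRule n t inv S).y) hd)]
  · rw [← mulVec_mulVec, h.norm _ (hset z hz), sqNorm_unitary hU]
  · exact h.iso _ (hw.app hy) r hr

theorem magicWord_b {i a b : ℕ} (ha : a < 2 * n + 2) (hb : b < 2 * n + 2) :
    (magicWord n i a b).b = (pairWord a b).b + (tWord n i).b := by
  funext j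
  simp only [magicWord, pairWord, tWord, ind, Pi.add_apply, Finset.mem_insert,
    Finset.mem_singleton, ← add_assoc]
  by_cases h : j = a ∨ j = b
  · rw [if_pos (by tauto), if_pos h, if_neg (by omega), add_zero]
  · rw [if_neg h, zero_add]
    refine if_congr ?_ rfl rfl
    tauto

theorem freeBits_pairWord {a b : ℕ} (ha : a < 2 * n + 2) (hb : b < 2 * n + 2) (hab : a ≠ b)
    (i : ℕ) : FreeBits X n i (pairWord a b).b :=
  freeBits_left (evenBits_pair_left ha hb hab) (fun j _ => by
    simp only [tailBits, ind, Finset.mem_insert, Finset.mem_singleton]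
    rw [if_neg (by omega)]) i

theorem dot_tWord_tWord (i k : ℕ) (hk : k < t) :
    dot (total n t) (tWord n i).b (tWord n k).b = 0 := by
  rw [show (tWord n k).b = ind {2 * n + 2 + 2 * k, 2 * n + 2 + (2 * k + 1)} from rfl,
    dot_pair _ (by simp only [total]; omega) (by simp only [total]; omega) (by omega)]
  simp only [tWord, ind, Finset.mem_insert, Finset.mem_singleton]
  by_cases h : k = i
  · subst h; simp; rfl
  · rw [if_neg (by omega), if_neg (by omega), add_zero]

theorem freeBits_tWord [Nonempty ι] [Nonempty κ] (Rn : MajoranaRegister (2 * n + 2) ι)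
    (hX : IsMagicFrame Rt X) {i : ℕ} (hi : i < t) : FreeBits X n i (tWord n i).b := by
  refine ⟨evenBits_tWord hi, fun k _ => dot_tWord_tWord _ _ k.2, fun k hk => ?_⟩
  rw [dot_comm]
  refine (hX.dot_eq Rn).2.1 k ⟨i, hi⟩ fun h => ?_
  rw [← h] at hk
  exact lt_irrefl _ hk

theorem freeBits_frameWord [Nonempty ι] [Nonempty κ] (Rn : MajoranaRegister (2 * n + 2) ι)
    (hX : IsMagicFrame Rt X) {i : ℕ} (hi : i < t) :
    FreeBits X n i (frameWord n (X ⟨i, hi⟩)).b := by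
  refine ⟨evenBits_frameWord _, fun k hk => ?_, fun k hk => ?_⟩
  · exact (hX.dot_eq Rn).2.1 _ k fun h => by rw [h] at hk; exact lt_irrefl _ hk
  · exact (hX.dot_eq Rn).2.2 _ k fun h => by rw [h] at hk; exact lt_irrefl _ hk

theorem magicRule_y_b (Y : FermionParity (2 * t + 2)) (i a b : ℕ) (c : Bool) :
    (magicRule n Y i a b c).y.b = (if c then (tWord n i).b else 0) + (frameWord n Y).b := by
  cases c
  · have : ind ∅ = 0 := by funext j; simp [ind]
    simp [magicRule, Word.mul, this]
  · rfl

/-- The bare product of the two Majoranas is -i s_i, the factor that `teleport_conj` asks for on the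
outcome -1. -/
theorem op_magicRule (Y : FermionParity (2 * t + 2)) (i a b : ℕ) (c : Bool) :
    (Rn.joint Rt).op (magicRule n Y i a b c).y =
      (if c then -Complex.I • (Rn.joint Rt).op (tWord n i) else 1) *
        (Rn.joint Rt).op (frameWord n Y) := by
  rw [magicRule, op_mul]
  congr 1
  cases c
  · have : ind ∅ = 0 := by funext j; simp [ind]
    simp [op, this, mono_eq_one]
  · simp only [if_true, tWord, op, smul_smul]
    rw [show (1 : ZMod 4).val = 1 from rfl, pow_one, neg_mul, Complex.I_mul_I, neg_neg,
      show (0 : ZMod 4).val = 0 from rfl, pow_zero]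
    rfl

theorem pairWord_sq {a b : ℕ} (ha : a < 2 * n + 2) (hb : b < 2 * n + 2) (hab : a ≠ b) :
    (Rn.joint Rt).op (pairWord a b) * (Rn.joint Rt).op (pairWord a b) = 1 := by
  rw [joint_pairWord ha hb hab, ← mul_kronecker_mul, gen_mul_gen_eq _ ha hb hab, mul_one,
    one_kronecker_one]

theorem tWord_sq {i : ℕ} (hi : i < t) :
    (Rn.joint Rt).op (tWord n i) * (Rn.joint Rt).op (tWord n i) = 1 := by
  have := gen_mul_gen_eq Rt (a := 2 * i) (b := 2 * i + 1) (by omega) (by omega) (by omega)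
  rw [joint_tWord hi, ← mul_kronecker_mul, MajoranaRegister.s, ← gen_fin, ← gen_fin, this, mul_one,
    one_kronecker_one]

theorem pairWord_comm_tWord {i a b : ℕ} (ha : a < 2 * n + 2) (hb : b < 2 * n + 2) (hab : a ≠ b)
    (hi : i < t) : (Rn.joint Rt).op (pairWord a b) * (Rn.joint Rt).op (tWord n i) =
      (Rn.joint Rt).op (tWord n i) * (Rn.joint Rt).op (pairWord a b) :=
  op_commute (evenBits_pair_left (t := t) ha hb hab).sum
    ((freeBits_pairWord (X := fun _ : Fin t => ⟨false, ∅, by simp⟩) ha hb hab (i + 1)).s ⟨i, hi⟩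
      (Nat.lt_succ_self i))

theorem freeBits_magicWord [Nonempty ι] [Nonempty κ] (Rn : MajoranaRegister (2 * n + 2) ι)
    (hX : IsMagicFrame Rt X) {i a b : ℕ} (hi : i < t) (ha : a < 2 * n + 2) (hb : b < 2 * n + 2)
    (hab : a ≠ b) : FreeBits X n i (magicWord n i a b).b := by
  rw [magicWord_b ha hb]
  exact (freeBits_pairWord ha hb hab i).add (freeBits_tWord Rn hX hi)

theorem magicWord_sq {i a b : ℕ} (hi : i < t) (ha : a < 2 * n + 2) (hb : b < 2 * n + 2)
    (hab : a ≠ b) : (Rn.joint Rt).op (magicWord n i a b) * (Rn.joint Rt).op (magicWord n i a b) = 1 := by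
  rw [joint_magicWord ha hb, mul_assoc, ← mul_assoc _ _ ((Rn.joint Rt).op (tWord n i)),
    ← pairWord_comm_tWord ha hb hab hi, mul_assoc, tWord_sq hi, mul_one, pairWord_sq ha hb hab]

/-- Consume a magic state. -/
theorem Absorbed.magic [Nonempty ι] [Nonempty κ] (h : Absorbed Rn Rt X A V)
    (hX : IsMagicFrame Rt X) (hi : A.used < t) {a b : ℕ} (ha : a < 2 * n + 2) (hb : b < 2 * n + 2)
    (hab : a ≠ b) (hz0 : Settled Rn Rt X A.used z) (hz1 : sqNorm z ≠ 0) (c : Bool)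
    {B : SimState (2 * t + 2)} (hB : B.gates = magicRule n (X ⟨A.used, hi⟩) A.used a b c :: A.gates)
    (hused : B.used = A.used + 1)
    (hE : ∀ u, (∀ r ∈ A.elim, dot (total n t) u r.y.b = 0) →
      dot (total n t) u (reduce (total n t) A.gates (magicWord n A.used a b)).b = 0 →
        ∀ r ∈ B.elim, dot (total n t) u r.y.b = 0) :
    Absorbed Rn Rt X B (V * (outcomeProj ((Rn.joint Rt).op (magicWord n A.used a b)) c *
      correction ((Rn.joint Rt).op (pairWord a b)) c)) := by
  set i := A.used with hi'
  have hpair : ∀ j, FreeBits X n j (pairWord a b).b := freeBits_pairWord ha hb hab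
  have hM := freeBits_magicWord Rn hX hi ha hb hab
  have hx := freeBits_frameWord Rn hX hi
  have hy : FreeBits X n i (magicRule n (X ⟨i, hi⟩) i a b c).y.b := by
    rw [magicRule_y_b]
    cases c
    · simpa using hx
    · exact (freeBits_tWord Rn hX hi).add hx
  have hQ := pairWord_sq (Rn := Rn) (Rt := Rt) ha hb hab
  have hS := tWord_sq (Rn := Rn) (Rt := Rt) hi
  have hQS := pairWord_comm_tWord (Rn := Rn) (Rt := Rt) ha hb hab hi
  have hXQ : (Rn.joint Rt).op (frameWord n (X ⟨i, hi⟩)) * (Rn.joint Rt).op (pairWord a b) =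
      (Rn.joint Rt).op (pairWord a b) * (Rn.joint Rt).op (frameWord n (X ⟨i, hi⟩)) :=
    (hpair (i + 1)).commute_frame ⟨i, hi⟩ (Nat.lt_succ_self i)
  have hXS : (Rn.joint Rt).op (frameWord n (X ⟨i, hi⟩)) * (Rn.joint Rt).op (tWord n i) =
      -((Rn.joint Rt).op (tWord n i) * (Rn.joint Rt).op (frameWord n (X ⟨i, hi⟩))) :=
    op_anticommute hx.even.sum (by rw [(hX.dot_eq Rn).1 ⟨i, hi⟩]; exact one_ne_zero)
  have hMop := joint_magicWord (Rn := Rn) (Rt := Rt) (i := i) ha hb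
  have hDX : ∀ k : Fin t, (k : ℕ) < i + 1 → (Rn.joint Rt).op (frameWord n (X k)) *
      correction ((Rn.joint Rt).op (pairWord a b)) c =
      correction ((Rn.joint Rt).op (pairWord a b)) c * (Rn.joint Rt).op (frameWord n (X k)) :=
    fun k hk => (correction_commute ((hpair (i + 1)).commute_frame k hk) c).symm
  -- The projector of the measurement preserves the stabilisers X_k with k < i but not X_i, with
  -- which the measured string anticommutes.
  have hset : ∀ z, Settled Rn Rt X (i + 1) z →
      Settled Rn Rt X i ((outcomeProj ((Rn.joint Rt).op (magicWord n i a b)) c *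
        correction ((Rn.joint Rt).op (pairWord a b)) c) *ᵥ z) := by
    intro z hz
    rw [← mulVec_mulVec]
    exact ((hz.mulVec hDX).mono (Nat.le_succ i)).mulVec fun k hk =>
      (outcomeProj_commute (hM.commute_frame k hk).symm c).symm
  refine ⟨?_, fun w hw z hz => ?_, fun z hz => ?_, fun w hw r hr => ?_⟩
  · intro r hr
    rw [hB] at hr
    rcases List.mem_cons.1 hr with rfl | hr
    · exact hy.even
    · exact h.even r hr
  · rw [hused] at hw hz
    rw [hB]
    change _ = (Rn.joint Rt).op (reduce (total n t) A.gates
      ((magicRule n (X ⟨i, hi⟩) i a b c).app (total n t) w)) *ᵥ _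
    rw [← mulVec_mulVec (M := V), ← mulVec_mulVec (M := V),
      ← h.conj _ ((hw.mono (Nat.le_succ i)).app hy) _ (hset z hz)]
    refine congrArg (fun v => V *ᵥ v) ?_
    have hwS : (Rn.joint Rt).op w * (Rn.joint Rt).op (tWord n i) =
        (Rn.joint Rt).op (tWord n i) * (Rn.joint Rt).op w :=
      op_commute hw.even.sum (hw.s ⟨i, hi⟩ (Nat.lt_succ_self i))
    rw [Rule.app]
    split_ifs with hd
    · have hwQ : (Rn.joint Rt).op w * (Rn.joint Rt).op (pairWord a b) =
          (Rn.joint Rt).op (pairWord a b) * (Rn.joint Rt).op w := op_commute hw.even.sum hd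
      rw [mulVec_mulVec, mulVec_mulVec, mul_assoc, correction_commute hwQ, ← mul_assoc,
        outcomeProj_commute, mul_assoc]
      rw [hMop, mul_assoc, ← hwS, ← mul_assoc, ← hwQ, mul_assoc]
    · have hwQ : (Rn.joint Rt).op w * (Rn.joint Rt).op (pairWord a b) =
          -((Rn.joint Rt).op (pairWord a b) * (Rn.joint Rt).op w) := op_anticommute hw.even.sum hd
      -- As X_i fixes `z`, the string `w` may be replaced by w X_i before the projector, and that
      -- one passes through it.
      have hzX := hz ⟨i, hi⟩ (Nat.lt_succ_self i)
      have key := teleport_conj hQ hS hQS hXQ hXS hwQ hwS c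
      rw [← hMop] at key
      rw [op_mul, op_magicRule, mulVec_mulVec, mulVec_mulVec, ← key, ← mul_assoc,
        ← mulVec_mulVec z _ ((Rn.joint Rt).op (frameWord n (X ⟨i, hi⟩))), hzX]
  -- X_i stabilises the corrected vector and anticommutes with the measured string, so either
  -- outcome has half the squared norm.
  · rw [hused] at hz ⊢
    rw [← mulVec_mulVec, h.norm _ (hset z hz), ← mulVec_mulVec, outcomeProj_mulVec, ← smul_mulVec,
      sqNorm_half (s := (Rn.joint Rt).op (frameWord n (X ⟨i, hi⟩))) _ (op_unitary _) _
        ((hz.mulVec hDX) ⟨i, hi⟩ (Nat.lt_succ_self i)),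
      sqNorm_unitary (correction_unitary hQ (op_unitary _) c), pow_succ]
    · ring
    · rw [← op_flip, op_unitary]
    · have : (Rn.joint Rt).op (frameWord n (X ⟨i, hi⟩)) * (Rn.joint Rt).op (magicWord n i a b) =
          -((Rn.joint Rt).op (magicWord n i a b) * (Rn.joint Rt).op (frameWord n (X ⟨i, hi⟩))) := by
        rw [hMop, ← mul_assoc, hXQ, mul_assoc, hXS, mul_neg, mul_assoc]
      rw [mul_smul_comm, smul_mul_assoc, this, smul_neg]
  · rw [hused] at hw
    have happ : FreeBits X n i ((magicRule n (X ⟨i, hi⟩) i a b c).app (total n t) w).b :=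
      (hw.mono (Nat.le_succ i)).app hy
    rw [hB]
    change dot (total n t) (reduce (total n t) A.gates
      ((magicRule n (X ⟨i, hi⟩) i a b c).app (total n t) w)).b r.y.b = 0
    refine hE _ (h.iso _ happ) ?_ r hr
    -- An odd overlap of `w` with the pair a, b is cancelled by the overlap of the added X_i with
    -- s_i. So the pulled-back string commutes with the string just measured.
    rw [h.dot_reduce hz0 hz1 happ hM, dot_app, magicWord_b ha hb, dot_add, dot_add,
      hw.s ⟨i, hi⟩ (Nat.lt_succ_self i), add_zero]
    have hxs := (hX.dot_eq Rn).1 ⟨i, hi⟩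
    have hxp : dot (total n t) (frameWord n (X ⟨i, hi⟩)).b (pairWord a b).b = 0 := by
      rw [dot_comm]; exact (hpair (i + 1)).x ⟨i, hi⟩ (Nat.lt_succ_self i)
    have hsp : dot (total n t) (tWord n i).b (pairWord a b).b = 0 := by
      rw [dot_comm]; exact (hpair (i + 1)).s ⟨i, hi⟩ (Nat.lt_succ_self i)
    have e1 : dot (total n t) (magicRule n (X ⟨i, hi⟩) i a b c).y.b (pairWord a b).b = 0 := by
      rw [magicRule_y_b, add_dot, hxp, add_zero]
      cases c
      · simp [dot]
      · exact hsp
    have e2 : dot (total n t) (magicRule n (X ⟨i, hi⟩) i a b c).y.b (tWord n i).b = 1 := by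
      rw [magicRule_y_b, add_dot]
      rw [show dot (total n t) (frameWord n (X ⟨i, hi⟩)).b (tWord n i).b = 1 from hxs]
      cases c
      · simp [dot]
      · simp [dot_tWord_tWord i i hi]
    rw [e1, e2, zero_add, mul_one]
    exact CharTwo.add_self_eq_zero _

end AbsorbGate

/-! ### The circuit and its simulation -/

section Unitary

variable {ι : Type*} [Fintype ι] [DecidableEq ι]

theorem eighthTurn_unitary {Q : Matrix ι ι ℂ} (hQ : Q * Q = 1) (hQ' : Qᴴ * Q = 1) :
    (eighthTurn Q)ᴴ * eighthTurn Q = 1 := by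
  have h := congrArg (fun x : ℝ => (x : ℂ)) (Real.cos_sq_add_sin_sq (Real.pi / 8))
  simp only [Complex.ofReal_add, Complex.ofReal_pow, Complex.ofReal_one] at h
  rw [eighthTurn, conjTranspose_sub, conjTranspose_smul, conjTranspose_smul, conjTranspose_one,
    conjTranspose_eq_of_sq hQ hQ']
  have hI : star (Complex.I * ((Real.sin (Real.pi / 8) : ℝ) : ℂ)) =
      -(Complex.I * ((Real.sin (Real.pi / 8) : ℝ) : ℂ)) := by
    rw [star_mul, mul_comm]
    exact (congrArg₂ _ Complex.conj_I (Complex.conj_ofReal _)).trans (neg_mul _ _)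
  have hc : star ((Real.cos (Real.pi / 8) : ℝ) : ℂ) = ((Real.cos (Real.pi / 8) : ℝ) : ℂ) :=
    Complex.conj_ofReal _
  rw [hI, hc]
  generalize ((Real.cos (Real.pi / 8) : ℝ) : ℂ) = c at *
  generalize ((Real.sin (Real.pi / 8) : ℝ) : ℂ) = s at *
  simp only [sub_mul, mul_sub, smul_mul_smul_comm, one_mul, mul_one, hQ]
  match_scalars
  · have := Complex.I_mul_I
    linear_combination h - s ^ 2 * this
  · ring

theorem parity_unitary {N : ℕ} (R : MajoranaRegister N ι) (S : Finset (Fin N)) :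
    (R.parity S)ᴴ * R.parity S = 1 := by
  rw [parity_eq_op, op_unitary]

theorem pair_unitary {N : ℕ} (R : MajoranaRegister N ι) {a b : ℕ} (ha : a < N) (hb : b < N) :
    (Complex.I • (R.gen a * R.gen b))ᴴ * (Complex.I • (R.gen a * R.gen b)) = 1 := by
  rw [conjTranspose_smul, conjTranspose_mul, gen_conjTranspose, gen_conjTranspose,
    smul_mul_smul_comm, mul_assoc, ← mul_assoc (R.gen a), R.gen_sq ha, one_mul, R.gen_sq hb]
  simp

theorem Gate.op_unitary {N : ℕ} (R : MajoranaRegister N ι) (g : Gate N) :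
    (g.op R)ᴴ * g.op R = 1 := by
  cases g with
  | braid inv S hS =>
    change (R.braid inv S)ᴴ * R.braid inv S = 1
    rw [R.braid_eq inv hS]
    refine quarterTurn_unitary ?_ ?_
    · rw [smul_mul_smul_comm, R.parity_sq hS, mul_mul_mul_comm, bitSign_sq, Complex.I_mul_I]
      simp
    · rw [conjTranspose_smul, smul_mul_smul_comm, parity_unitary]
      cases inv <;> simp [bitSign]
  | T2 a b hab =>
    change (R.T2 a b)ᴴ * R.T2 a b = 1
    rw [R.T2_eq hab]
    exact eighthTurn_unitary (R.gen_mul_gen_eq a.2 b.2 fun h => hab (Fin.ext h))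
      (pair_unitary R a.2 b.2)

end Unitary

/-! ### The magic states that are not yet consumed -/

section RestState

variable {t : ℕ} {κ : Type*} [Fintype κ] [DecidableEq κ] (Rt : MajoranaRegister (2 * t + 2) κ)

/-- The magic states from number `i` on, the others being reset. -/
noncomputable def restState (ψ : κ → ℂ) (i : ℕ) : κ → ℂ :=
  (((List.finRange t).drop i).map fun j => eighthTurn (Rt.s j)).prod *ᵥ ψ

variable {Rt} {ψ : κ → ℂ}

theorem restState_zero : restState Rt ψ 0 = magicState Rt ψ := by
  rw [restState, magicState, List.drop_zero, List.ofFn_eq_map]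
  simp only [T2_eq_s]

theorem restState_of_le {i : ℕ} (h : t ≤ i) : restState Rt ψ i = ψ := by
  rw [restState, List.drop_eq_nil_of_le (by simpa using h), List.map_nil, List.prod_nil,
    one_mulVec]

theorem restState_succ {i : ℕ} (hi : i < t) :
    restState Rt ψ i = eighthTurn (Rt.s ⟨i, hi⟩) *ᵥ restState Rt ψ (i + 1) := by
  rw [restState, restState, List.drop_eq_getElem_cons (by simpa using hi), List.map_cons,
    List.prod_cons, mulVec_mulVec, List.getElem_finRange]
  rfl

/-- An eigenvector of `B` stays one under turns that commute with `B`. This serves for the total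
parity and for the X_k of consumed magic states, which commute with all later s_j. -/
theorem mulVec_restState {B : Matrix κ κ ℂ} {c : ℂ} {i : ℕ}
    (hB : ∀ j : Fin t, i ≤ j → B * Rt.s j = Rt.s j * B) (hψ : B *ᵥ ψ = c • ψ) :
    B *ᵥ restState Rt ψ i = c • restState Rt ψ i := by
  have h : Commute B (((List.finRange t).drop i).map fun j => eighthTurn (Rt.s j)).prod := by
    refine Commute.list_prod_right _ _ fun y hy => ?_
    obtain ⟨j, hj, rfl⟩ := List.mem_map.1 hy
    obtain ⟨k, hk, rfl⟩ := List.mem_drop_iff_getElem.1 hj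
    have := hB ((List.finRange t)[i + k]) (by simp)
    rw [Commute, SemiconjBy]
    simp only [eighthTurn, sub_mul, mul_sub, smul_mul_assoc, mul_smul_comm, one_mul, mul_one, this]
  rw [restState, mulVec_mulVec, h.eq, ← mulVec_mulVec, hψ, mulVec_smul]

theorem s_sq (j : Fin t) : Rt.s j * Rt.s j = 1 := by
  have := gen_mul_gen_eq Rt (a := 2 * j) (b := 2 * j + 1) (by omega) (by omega) (by omega)
  rw [MajoranaRegister.s, ← gen_fin, ← gen_fin]
  exact this

theorem s_unitary (j : Fin t) : (Rt.s j)ᴴ * Rt.s j = 1 := by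
  have := pair_unitary Rt (a := 2 * j) (b := 2 * j + 1) (by omega) (by omega)
  rw [MajoranaRegister.s, ← gen_fin, ← gen_fin]
  exact this

theorem sqNorm_restState (i : ℕ) : sqNorm (restState Rt ψ i) = sqNorm ψ := by
  rw [restState]
  induction (List.finRange t).drop i with
  | nil => simp
  | cons j l ih =>
    rw [List.map_cons, List.prod_cons, ← mulVec_mulVec,
      sqNorm_unitary (eighthTurn_unitary (s_sq j) (s_unitary j)), ih]

end RestState

/-! ### Following the circuit gate by gate -/

section Simulates

variable {n t : ℕ} {ι κ : Type*} [Fintype ι] [DecidableEq ι] [Fintype κ] [DecidableEq κ]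
  {Rn : MajoranaRegister (2 * n + 2) ι} {Rt : MajoranaRegister (2 * t + 2) κ}
  {X : Fin t → FermionParity (2 * t + 2)} {φ : ι → ℂ} {ψ : κ → ℂ} {pn pt : Bool}
  {A : SimState (2 * t + 2)} {V : Matrix (ι × κ) (ι × κ) ℂ}

theorem Tracks.congr {θ : κ → ℂ} {Ψ : ι × κ → ℂ} (h : Tracks Rn Rt φ θ pn pt A Ψ)
    {B : SimState (2 * t + 2)} (he : B.elim = A.elim) (hh : B.hist = A.hist) :
    Tracks Rn Rt φ θ pn pt B Ψ := by
  cases A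
  cases B
  subst he hh
  exact ⟨h.stab, h.sq, h.iso, h.even, h.tri, h.piv, h.left, h.coins, h.measured⟩

/-- The s_j are even, so the magic state inherits the total parity of `ψ`. The two total parities
are the first known strings, and they have disjoint supports. -/
theorem Tracks.init (hpn : Rn.totalParity *ᵥ φ = bitSign pn • φ)
    (hpt : Rt.totalParity *ᵥ ψ = bitSign pt • ψ) :
    Tracks Rn Rt φ (magicState Rt ψ) pn pt (SimState.init n t pn pt)
      (tensorVec φ (magicState Rt ψ)) := by
  have hl := joint_parityRule_left (Rn := Rn) (Rt := Rt) pn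
  have hr := joint_parityRule_right (Rn := Rn) (Rt := Rt) pt
  have hm : Rt.totalParity *ᵥ magicState Rt ψ = bitSign pt • magicState Rt ψ := by
    rw [← restState_zero]
    refine mulVec_restState (fun j _ => ?_) hpt
    rw [MajoranaRegister.s, ← gen_fin, ← gen_fin, mul_smul_comm, smul_mul_assoc, ← mul_assoc,
      totalParity_gen _ (Fin.is_lt _), neg_mul, mul_assoc, totalParity_gen _ (Fin.is_lt _),
      mul_neg, neg_neg, mul_assoc]
  have heven : ∀ r ∈ (SimState.init n t pn pt).elim, EvenBits n t r.y.b := by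
    intro r hr
    simp only [SimState.init, List.mem_cons, List.not_mem_nil, or_false] at hr
    rcases hr with rfl | rfl
    · change EvenBits n t (ind (Finset.Ico 0 (0 + (2 * n + 2))))
      rw [ind_Ico]; exact evenBits_left (even_card_univ n)
    · change EvenBits n t (ind (Finset.Ico (2 * n + 2) (2 * n + 2 + (2 * t + 2))))
      rw [ind_Ico]; exact evenBits_right (even_card_univ t)
  refine ⟨fun r h => ?_, fun r h => ?_, fun r h r' h' => ?_, heven, ?_, fun r h => ?_, ?_,
    ⟨[], by simp, by simp, rfl, rfl⟩, ⟨[], ?_, by simp, rfl⟩⟩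
  · simp only [SimState.init, List.mem_cons, List.not_mem_nil, or_false] at h
    rcases h with rfl | rfl
    · rw [hl, smul_mulVec, kronecker_mulVec_tensorVec, hpn, one_mulVec, smul_tensorVec, smul_smul,
        bitSign_sq, one_smul]
    · rw [hr, smul_mulVec, kronecker_mulVec_tensorVec, hm, one_mulVec, tensorVec_smul, smul_smul,
        bitSign_sq, one_smul]
  · simp only [SimState.init, List.mem_cons, List.not_mem_nil, or_false] at h
    rcases h with rfl | rfl
    · rw [hl, smul_mul_smul_comm, bitSign_sq, ← mul_kronecker_mul, totalParity_sq, mul_one,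
        one_kronecker_one, one_smul]
    · rw [hr, smul_mul_smul_comm, bitSign_sq, ← mul_kronecker_mul, totalParity_sq, mul_one,
        one_kronecker_one, one_smul]
  · exact (Absorbed.init n t (Rn := Rn) (Rt := Rt) (X := fun _ => ⟨false, ∅, by simp⟩) pn pt).iso r.y
      ⟨heven r h, fun k hk => absurd hk (Nat.not_lt_zero _),
        fun k hk => absurd hk (Nat.not_lt_zero _)⟩ r' h'
  · refine List.pairwise_pair.2 ?_
    change dot (total n t) (ind (Finset.Ico (2 * n + 2) (2 * n + 2 + (2 * t + 2))))
      (ind {0 + (2 * n + 2) - 1}) = 0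
    rw [dot_singleton _ (by simp only [total]; omega), ind, if_neg]
    rw [Finset.mem_Ico]; omega
  · simp only [SimState.init, List.mem_cons, List.not_mem_nil, or_false] at h
    rcases h with rfl | rfl
    · exact Or.inl (dot_parityRule (by omega) (by simp only [total]; omega) pn)
    · exact Or.inl (dot_parityRule (by omega) le_rfl pt)
  · simp [SimState.init]
  · exact List.sublist_cons_self _ _

variable (Rn Rt X φ ψ pn pt) in
/-- The simulation has reached the state `A` when the circuit has reached the state `η`. -/
def Simulates (A : SimState (2 * t + 2)) (η : ι → ℂ) : Prop :=
  ∃ V, Tracks Rn Rt φ (magicState Rt ψ) pn pt A (V *ᵥ tensorVec η (restState Rt ψ A.used)) ∧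
    Absorbed Rn Rt X A V

theorem settled_tensorVec (hX : IsMagicFrame Rt X) (hψ : ∀ j, (X j).op Rt *ᵥ ψ = ψ) (i : ℕ)
    (η : ι → ℂ) : Settled Rn Rt X i (tensorVec η (restState Rt ψ i)) := fun k hk => by
  have := mulVec_restState (Rt := Rt) (ψ := ψ) (B := (X k).op Rt) (c := 1) (i := i)
    (fun j hj => ((hX.2.1 k j fun h => by rw [h] at hj; omega).eq).symm) (by rw [hψ, one_smul])
  rw [joint_frameWord, kronecker_mulVec_tensorVec, one_mulVec, this, one_smul]

theorem Absorbed.outcomeProj_reduce (h : Absorbed Rn Rt X A V) {w : Word}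
    (hw : FreeBits X n A.used w.b) {z : ι × κ → ℂ} (hz : Settled Rn Rt X A.used z) (c : Bool) :
    outcomeProj ((Rn.joint Rt).op (reduce (total n t) A.gates w)) c *ᵥ (V *ᵥ z) =
      V *ᵥ (outcomeProj ((Rn.joint Rt).op w) c *ᵥ z) := by
  rw [outcomeProj_mulVec, outcomeProj_mulVec, ← h.conj w hw z hz, mulVec_smul, mulVec_add,
    mulVec_smul]

/-- For a braid the joint vector is unchanged; for a `T2` gate it is projected, and teleportation
rewrites the result as the image of the next circuit state. The count of branches is needed because
every branch will contribute the same weight. -/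
theorem Simulates.gate [Nonempty ι] [Nonempty κ] (hX : IsMagicFrame Rt X)
    (hφ : ∀ j, Rn.s j *ᵥ φ = φ) (hψ : ∀ j, (X j).op Rt *ᵥ ψ = ψ) (hψ1 : sqNorm ψ = 1)
    {η : ι → ℂ} (h : Simulates Rn Rt X φ ψ pn pt A η) (hη : sqNorm η = 1)
    {g : Gate (2 * n + 2)} (hg : A.used + g.isT2.toNat ≤ t) :
    (∀ B ∈ A.gate n X g, Simulates Rn Rt X φ ψ pn pt B (g.op Rn *ᵥ η)) ∧
      (A.gate n X g).length = 2 ^ g.isT2.toNat := by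
  obtain ⟨V, hT, hV⟩ := h
  cases g with
  | braid inv S hS =>
    refine ⟨fun B hB => ?_, rfl⟩
    rw [SimState.gate, List.mem_singleton] at hB
    subst hB
    refine ⟨_, ?_, hV.braid inv hS⟩
    refine Tracks.congr (A := A) ?_ rfl rfl
    change Tracks _ _ _ _ _ _ A (_ *ᵥ tensorVec (Rn.braid inv S *ᵥ η) (restState Rt ψ A.used))
    have := kronecker_mulVec_tensorVec (Rn.braid inv S) 1 η (restState Rt ψ A.used)
    rw [one_mulVec] at this
    rw [← this, joint_braid (Rt := Rt) inv hS, mulVec_mulVec, mul_assoc,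
      quarterTurn_neg_mul (braidRule_sq inv hS), mul_one]
    exact hT
  | T2 a b hab =>
    have hi : A.used < t := hg
    have hab' : (a : ℕ) ≠ b := fun h => hab (Fin.ext h)
    have hM := freeBits_magicWord Rn hX hi a.2 b.2 hab'
    have hz := settled_tensorVec (Rn := Rn) hX hψ A.used η
    have hz1 : sqNorm (tensorVec η (restState Rt ψ A.used)) ≠ 0 := by
      rw [sqNorm_tensorVec, hη, sqNorm_restState, hψ1]; norm_num
    obtain ⟨m1, m2⟩ := hT.measure hφ (hV.evenBits hM.even) (hV.iso _ hM)
      (hV.sq hz hz1 hM (magicWord_sq hi a.2 b.2 hab'))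
    have hΨ : ∀ c, outcomeProj ((Rn.joint Rt).op (reduce (total n t) A.gates
        (magicWord n A.used a b))) c *ᵥ (V *ᵥ tensorVec η (restState Rt ψ A.used)) =
        (V * (outcomeProj ((Rn.joint Rt).op (magicWord n A.used a b)) c *
          correction ((Rn.joint Rt).op (pairWord a b)) c)) *ᵥ
          tensorVec (Rn.T2 a b *ᵥ η) (restState Rt ψ (A.used + 1)) := fun c => by
      rw [hV.outcomeProj_reduce hM hz]
      have e1 := kronecker_mulVec_tensorVec 1 (eighthTurn (Rt.s ⟨A.used, hi⟩)) η
        (restState Rt ψ (A.used + 1))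
      rw [one_mulVec, ← restState_succ, one_kronecker_eighthTurn, ← joint_tWord (Rn := Rn)] at e1
      have e2 := kronecker_mulVec_tensorVec (Rn.T2 a b) 1 η (restState Rt ψ (A.used + 1))
      rw [one_mulVec, joint_T2_left (Rt := Rt) hab] at e2
      rw [← e1, ← e2, ← mulVec_mulVec (M := V)]
      refine congrArg (fun v => V *ᵥ v) ?_
      rw [mulVec_mulVec, mulVec_mulVec, joint_magicWord a.2 b.2, outcomeProj_mul_eighthTurn (pairWord_sq a.2 b.2 hab') (tWord_sq hi)
          (pairWord_comm_tWord a.2 b.2 hab' hi)]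
    have habs : ∀ c (B : SimState (2 * t + 2)),
        B.gates = magicRule n (X ⟨A.used, hi⟩) A.used a b c :: A.gates → B.used = A.used + 1 →
        (∀ u, (∀ r ∈ A.elim, dot (total n t) u r.y.b = 0) →
          dot (total n t) u (reduce (total n t) A.gates (magicWord n A.used a b)).b = 0 →
          ∀ r ∈ B.elim, dot (total n t) u r.y.b = 0) → Absorbed Rn Rt X B
          (V * (outcomeProj ((Rn.joint Rt).op (magicWord n A.used a b)) c *
            correction ((Rn.joint Rt).op (pairWord a b)) c)) := fun c B h1 h2 h3 =>
      hV.magic hX hi a.2 b.2 hab' hz hz1 c h1 h2 h3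
    rw [SimState.gate, dif_pos hi]
    refine ⟨fun B hB => ?_, ?_⟩
    · obtain ⟨x, hx, rfl⟩ := List.mem_map.1 hB
      obtain ⟨x1, x2, x3, x4, x5⟩ := m1 x hx
      refine ⟨_, ?_, habs x.1 _ (by rw [x2]) rfl x5⟩
      change Tracks _ _ _ _ _ _ _ (_ *ᵥ tensorVec (Rn.T2 a b *ᵥ η) (restState Rt ψ (A.used + 1)))
      rw [← hΨ]
      exact x1.congr rfl rfl
    -- Summing the constant 1 counts the branches, once both outcomes are known to be possible; a
    -- certain outcome never occurs here.
    · have hsum := m2 (fun _ => 1) fun c hc => by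
        rw [hΨ] at hc
        exfalso
        -- An auxiliary state without recorded strings suffices, since the norm does not depend on
        -- them and the condition on them becomes void.
        refine (habs c ⟨magicRule n (X ⟨A.used, hi⟩) A.used a b c :: A.gates, [], A.used + 1, [], []⟩
          rfl rfl (by simp)).ne_zero (settled_tensorVec hX hψ (A.used + 1) _) ?_ hc
        rw [sqNorm_tensorVec, sqNorm_restState, hψ1,
          sqNorm_unitary (show (Rn.T2 a b)ᴴ * Rn.T2 a b = 1 from Gate.op_unitary Rn (.T2 a b hab)), hη]
        norm_num
      rw [List.map_const', List.sum_replicate] at hsum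
      rw [List.length_map]
      change _ = 2
      have : ((A.measure n (magicWord n A.used a b)).length : ℝ) = 2 := by
        rw [nsmul_eq_mul, mul_one] at hsum
        rw [hsum]; norm_num
      exact_mod_cast this

theorem foldl_flatMap {α β : Type*} (F : β → α → List α) (L : List β) (l : List α) :
    L.foldl (fun l b => l.flatMap (F b)) l =
      l.flatMap fun a => L.foldl (fun l b => l.flatMap (F b)) [a] := by
  induction L generalizing l with
  | nil => simp
  | cons b L ih =>
    simp only [List.foldl_cons, List.flatMap_singleton]
    rw [ih, List.flatMap_assoc]
    congr 1
    funext a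
    rw [ih (F b a)]

theorem Simulates.gates [Nonempty ι] [Nonempty κ] (hX : IsMagicFrame Rt X)
    (hφ : ∀ j, Rn.s j *ᵥ φ = φ) (hψ : ∀ j, (X j).op Rt *ᵥ ψ = ψ) (hψ1 : sqNorm ψ = 1)
    (C : Circuit n) {A : SimState (2 * t + 2)} {η : ι → ℂ}
    (h : Simulates Rn Rt X φ ψ pn pt A η) (hη : sqNorm η = 1) (hC : A.used + C.numT2 = t) :
    (∀ B ∈ C.foldl (fun l g => l.flatMap (SimState.gate n X g)) [A],
      Simulates Rn Rt X φ ψ pn pt B (C.apply Rn η) ∧ B.used = t ∧ B.out = A.out) ∧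
      (C.foldl (fun l g => l.flatMap (SimState.gate n X g)) [A]).length = 2 ^ C.numT2 := by
  induction C generalizing A η with
  | nil =>
    refine ⟨fun B hB => ?_, rfl⟩
    rw [List.foldl_nil, List.mem_singleton] at hB
    subst hB
    exact ⟨h, hC, rfl⟩
  | cons g C ih =>
    have hn : Circuit.numT2 (g :: C) = g.isT2.toNat + Circuit.numT2 C := by
      rw [Circuit.numT2, List.countP_cons, add_comm, Circuit.numT2]
      cases g.isT2 <;> rfl
    rw [hn, ← add_assoc] at hC
    obtain ⟨h1, h2⟩ := h.gate hX hφ hψ hψ1 hη (g := g) (by omega)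
    have ih' : ∀ B ∈ A.gate n X g, _ := fun B hB => ih (h1 B hB)
      (by rw [sqNorm_unitary (Gate.op_unitary Rn g), hη])
      (by rw [(SimState.gate_sizes hB).2.1, hC])
    rw [List.foldl_cons, List.flatMap_singleton, foldl_flatMap]
    refine ⟨fun B hB => ?_, ?_⟩
    · obtain ⟨B', hB', hB⟩ := List.mem_flatMap.1 hB
      obtain ⟨i1, i2, i3⟩ := (ih' B' hB').1 B hB
      exact ⟨i1, i2, i3.trans (SimState.gate_sizes hB').2.2.2⟩
    · rw [List.length_flatMap, List.map_congr_left fun B hB => (ih' B hB).2, List.map_const',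
        List.sum_replicate, h2, hn, pow_add, smul_eq_mul]

end Simulates

/-! ### The readout -/

section Readout

variable {n t : ℕ} {ι κ : Type*} [Fintype ι] [DecidableEq ι] [Fintype κ] [DecidableEq κ]
  {Rn : MajoranaRegister (2 * n + 2) ι} {Rt : MajoranaRegister (2 * t + 2) κ}
  {X : Fin t → FermionParity (2 * t + 2)} {φ : ι → ℂ} {ψ : κ → ℂ} {pn pt : Bool}
  {A : SimState (2 * t + 2)}

variable (Rn Rt X φ ψ pn pt) in
/-- The simulation has reached the state `A` when the measurements on the state after the circuit
have led to `η`. -/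
def ReadsOut (A : SimState (2 * t + 2)) (η : ι → ℂ) : Prop :=
  ∃ (V : Matrix (ι × κ) (ι × κ) ℂ) (A₀ : SimState (2 * t + 2)),
    Absorbed Rn Rt X A₀ V ∧ A₀.gates = A.gates ∧ A₀.used = t ∧
    Tracks Rn Rt φ (magicState Rt ψ) pn pt A (V *ᵥ tensorVec η ψ) ∧
    ∀ k : Fin n, ∀ r ∈ A.elim, dot (total n t) (reduce (total n t) A.gates (sWord k)).b r.y.b = 0

theorem freeBits_sWord (k : Fin n) (i : ℕ) : FreeBits X n i (sWord k).b :=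
  freeBits_pairWord (a := 2 * k) (b := 2 * k + 1) (by omega) (by omega) (by omega) i

theorem dot_sWord_sWord (j k : Fin n) : dot (total n t) (sWord j).b (sWord k).b = 0 := by
  rw [show (sWord k).b = ind {2 * (k : ℕ), 2 * (k : ℕ) + 1} from rfl,
    dot_pair _ (by simp only [total]; omega) (by simp only [total]; omega) (by omega)]
  simp only [sWord, ind, Finset.mem_insert, Finset.mem_singleton]
  by_cases h : k = j
  · subst h; simp; rfl
  · have : (k : ℕ) ≠ j := fun e => h (Fin.ext e)
    rw [if_neg (by omega), if_neg (by omega), add_zero]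

/-- From here on the gates and `V` are frozen while readouts extend the list of known strings. The
state at the end of the gates is kept as a witness for `V`, and commutation with the pulled-back s_k
is carried separately. -/
theorem Simulates.readsOut (h : Simulates Rn Rt X φ ψ pn pt A η) (hA : A.used = t) :
    ReadsOut Rn Rt X φ ψ pn pt A η := by
  obtain ⟨V, h1, h2⟩ := h
  rw [hA, restState_of_le le_rfl] at h1
  exact ⟨V, A, h2, rfl, hA, h1, fun k => h2.iso _ (freeBits_sWord k _)⟩

theorem settled_ψ (hψ : ∀ j, (X j).op Rt *ᵥ ψ = ψ) (i : ℕ) (η : ι → ℂ) :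
    Settled Rn Rt X i (tensorVec η ψ) := fun k _ => by
  rw [joint_frameWord, kronecker_mulVec_tensorVec, one_mulVec, hψ]

/-- No teleportation is involved: the projection onto an outcome of s_j on the circuit state goes
through `V` to the pulled-back string. The pulled-back s_k still commute with each other, as the s_k
do. -/
theorem ReadsOut.readout [Nonempty ι] [Nonempty κ] (hφ1 : sqNorm φ = 1)
    (hφ : ∀ j, Rn.s j *ᵥ φ = φ) (hψ : ∀ j, (X j).op Rt *ᵥ ψ = ψ) (hψ1 : sqNorm ψ = 1)
    {η : ι → ℂ} (h : ReadsOut Rn Rt X φ ψ pn pt A η) (j : Fin n) :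
    (∀ x ∈ A.measure n (sWord j), ReadsOut Rn Rt X φ ψ pn pt
      { x.2 with out := x.2.out ++ [x.1] } (outcomeProj (Rn.s j) x.1 *ᵥ η) ∧ x.2.out = A.out) ∧
    ∀ f : Bool → ℝ, (∀ c, outcomeProj (Rn.s j) c *ᵥ η = 0 → f c = 0) →
      ((A.measure n (sWord j)).map fun x => f x.1).sum = f false + f true := by
  obtain ⟨V, A₀, hV, hG, hu, hT, hiso⟩ := h
  have hw : FreeBits X n A₀.used (sWord j).b := freeBits_sWord j _
  have hz1 : sqNorm (tensorVec φ ψ) ≠ 0 := by rw [sqNorm_tensorVec, hφ1, hψ1]; norm_num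
  have hz := settled_ψ (Rn := Rn) hψ A₀.used φ
  have hsq : (Rn.joint Rt).op (sWord j) * (Rn.joint Rt).op (sWord j) = 1 := by
    rw [joint_sWord j.2, ← mul_kronecker_mul, s_sq, mul_one, one_kronecker_one]
  have hΨ : ∀ c, outcomeProj ((Rn.joint Rt).op (reduce (total n t) A.gates (sWord j))) c *ᵥ
      (V *ᵥ tensorVec η ψ) = V *ᵥ tensorVec (outcomeProj (Rn.s j) c *ᵥ η) ψ := fun c => by
    rw [← hG, hV.outcomeProj_reduce hw (settled_ψ hψ _ η), joint_sWord j.2, outcomeProj_mulVec,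
      kronecker_mulVec_tensorVec, one_mulVec, outcomeProj_mulVec, smul_tensorVec]
    congr 2
    funext p
    simp [tensorVec]
    ring
  have he := hV.evenBits hw.even
  have hs := hV.sq hz hz1 hw hsq
  rw [hG] at he hs
  obtain ⟨m1, m2⟩ := hT.measure hφ he (hiso j) hs
  refine ⟨fun x hx => ?_, fun f hf => m2 f fun c hc => hf c ?_⟩
  · obtain ⟨x1, x2, x3, x4, x5⟩ := m1 x hx
    refine ⟨⟨V, A₀, hV, hG.trans x2.symm, hu, ?_, fun k r hr => ?_⟩, x4⟩
    · rw [← hΨ]; exact x1.congr rfl rfl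
    · change dot (total n t) (reduce (total n t) x.2.gates (sWord k)).b r.y.b = 0
      rw [x2]
      refine x5 _ (hiso k) ?_ r hr
      rw [← hG, hV.dot_reduce hz hz1 (freeBits_sWord k _) hw, dot_sWord_sWord]
  · rw [hΨ] at hc
    -- The operator `V` scales squared norms by a positive constant, so an outcome that is
    -- impossible for the simulation is impossible for the circuit.
    have h0 := hV.norm _ (settled_ψ hψ _ (outcomeProj (Rn.s j) c *ᵥ η))
    rw [hc, sqNorm_zero, sqNorm_tensorVec, hψ1, mul_one] at h0
    exact eq_zero_of_sqNorm ((mul_eq_zero.1 h0.symm).resolve_left (by positivity))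

theorem sum_map_flatMap {α β : Type*} (F : α → List β) (g : β → ℝ) (l : List α) :
    ((l.flatMap F).map g).sum = (l.map fun a => ((F a).map g).sum).sum := by
  induction l with
  | nil => rfl
  | cons a l ih => rw [List.flatMap_cons, List.map_append, List.sum_append, ih, List.map_cons,
      List.sum_cons]

/-- The factor (1/2)^t is the price of the consumed magic states in one branch of the gates. In the
induction only the branches with the right next bit count, and an outcome missing from the list has
probability zero in the circuit as well. -/
theorem ReadsOut.readouts [Nonempty ι] [Nonempty κ] (hφ1 : sqNorm φ = 1)
    (hφ : ∀ j, Rn.s j *ᵥ φ = φ) (hψ : ∀ j, (X j).op Rt *ᵥ ψ = ψ) (hψ1 : sqNorm ψ = 1)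
    (b : Fin n → Bool) (L : List (Fin n)) {A : SimState (2 * t + 2)} {η : ι → ℂ}
    (h : ReadsOut Rn Rt X φ ψ pn pt A η) :
    (∀ B ∈ L.foldl (fun l (j : Fin n) => l.flatMap (SimState.readout n j)) [A],
      (∃ Ψ, Tracks Rn Rt φ (magicState Rt ψ) pn pt B Ψ) ∧
        ∃ l, l.length = L.length ∧ B.out = A.out ++ l) ∧
    ((L.foldl (fun l (j : Fin n) => l.flatMap (SimState.readout n j)) [A]).map fun B =>
      if B.out = A.out ++ L.map b then B.config.weight Rt (magicState Rt ψ) else 0).sum =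
      (1 / 2) ^ t * sqNorm (L.foldl (fun v j => outcomeProj (Rn.s j) (b j) *ᵥ v) η) := by
  induction L generalizing A η with
  | nil =>
    obtain ⟨V, A₀, hV, hG, hu, hT, hiso⟩ := h
    refine ⟨fun B hB => ?_, ?_⟩
    · rw [List.foldl_nil, List.mem_singleton] at hB
      subst hB
      exact ⟨⟨_, hT⟩, [], rfl, by simp⟩
    · simp only [List.foldl_nil, List.map_cons, List.map_nil, List.append_nil, if_true,
        List.sum_singleton]
      rw [hT.weight_eq hφ1 hφ, hV.norm _ (settled_ψ hψ _ η), hu, sqNorm_tensorVec, hψ1, mul_one]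
  | cons j L ih =>
    obtain ⟨h1, h2⟩ := h.readout hφ1 hφ hψ hψ1 j
    have ih' : ∀ x ∈ A.measure n (sWord j), _ := fun x hx => ih (h1 x hx).1
    rw [List.foldl_cons, List.flatMap_singleton, foldl_flatMap]
    refine ⟨fun B hB => ?_, ?_⟩
    · obtain ⟨B', hB', hB⟩ := List.mem_flatMap.1 hB
      obtain ⟨x, hx, rfl⟩ := List.mem_map.1 hB'
      obtain ⟨i1, l, hl, hB⟩ := (ih' x hx).1 B hB
      refine ⟨i1, x.1 :: l, by simp [hl], hB.trans ?_⟩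
      change (x.2.out ++ [x.1]) ++ l = _
      rw [(h1 x hx).2, List.append_assoc]
      rfl
    -- The function is supported on the prescribed bit and vanishes on impossible outcomes, so the
    -- sum over the listed branches equals its value at that bit.
    · have hsum := h2 (fun c => if c = b j then (1 / 2) ^ t * sqNorm (L.foldl
        (fun v j => outcomeProj (Rn.s j) (b j) *ᵥ v) (outcomeProj (Rn.s j) c *ᵥ η)) else 0) (by
          intro c hc
          have hz : L.foldl (fun v j => outcomeProj (Rn.s j) (b j) *ᵥ v) (0 : ι → ℂ) = 0 := by
            clear ih ih'
            induction L with
            | nil => rfl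
            | cons j L ih => rw [List.foldl_cons, mulVec_zero, ih]
          simp only [hc, hz, sqNorm_zero, mul_zero, ite_self])
      have hval : ((1 / 2) ^ t * sqNorm ((j :: L).foldl
          (fun v j => outcomeProj (Rn.s j) (b j) *ᵥ v) η)) = ((A.measure n (sWord j)).map fun x =>
            if x.1 = b j then (1 / 2) ^ t * sqNorm (L.foldl
              (fun v j => outcomeProj (Rn.s j) (b j) *ᵥ v) (outcomeProj (Rn.s j) x.1 *ᵥ η))
            else 0).sum := by
        rw [hsum]
        cases hbj : b j <;> simp [hbj]
      rw [hval, sum_map_flatMap, SimState.readout, List.map_map]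
      congr 1
      refine List.map_congr_left fun x hx => ?_
      have hout := (h1 x hx).2
      rw [Function.comp_apply]
      split_ifs with hb
      · rw [← (ih' x hx).2]
        congr 1
        refine List.map_congr_left fun B _ => ?_
        have : A.out ++ List.map b (j :: L) = (x.2.out ++ [x.1]) ++ List.map b L := by
          rw [hout, hb, List.append_assoc]; rfl
        rw [this]
      · refine List.sum_eq_zero fun y hy => ?_
        obtain ⟨B, hB, rfl⟩ := List.mem_map.1 hy
        obtain ⟨-, l, hl, hB⟩ := (ih' x hx).1 B hB
        rw [if_neg]
        intro he
        rw [hB] at he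
        change (x.2.out ++ [x.1]) ++ l = A.out ++ b j :: List.map b L at he
        rw [hout, List.append_assoc] at he
        exact hb (List.cons.inj (List.append_cancel_left he)).1

/-- The runs of the simulation and their outputs. -/
theorem SimState.afterReadout_spec (hφ1 : sqNorm φ = 1)
    (hφ : ∀ j, Rn.s j *ᵥ φ = φ) (hpn : Rn.totalParity *ᵥ φ = bitSign pn • φ)
    (hX : IsMagicFrame Rt X) (hψ1 : sqNorm ψ = 1) (hψ : ∀ j, (X j).op Rt *ᵥ ψ = ψ)
    (hpt : Rt.totalParity *ᵥ ψ = bitSign pt • ψ) (C : Circuit n) (hC : C.numT2 = t) :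
    (∀ B ∈ SimState.afterReadout pn pt X C n,
      (∃ Ψ, Tracks Rn Rt φ (magicState Rt ψ) pn pt B Ψ) ∧ B.out.length = n) ∧
    ∀ b : Fin n → Bool, ((SimState.afterReadout pn pt X C n).map fun B =>
      if B.out = List.ofFn b then B.config.weight Rt (magicState Rt ψ) else 0).sum =
      C.prob Rn φ b := by
  -- A unit vector cannot exist on the zero space.
  have hι : Nonempty ι := by
    by_contra hne
    rw [not_nonempty_iff] at hne
    simp [sqNorm] at hφ1
  have hκ : Nonempty κ := by
    by_contra hne
    rw [not_nonempty_iff] at hne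
    simp [sqNorm] at hψ1
  have h0 : Simulates Rn Rt X φ ψ pn pt (SimState.init n t pn pt) φ := by
    refine ⟨1, ?_, Absorbed.init n t pn pt⟩
    rw [one_mulVec]
    change Tracks _ _ _ _ _ _ _ (tensorVec φ (restState Rt ψ 0))
    rw [restState_zero]
    exact Tracks.init hpn hpt
  obtain ⟨g1, g2⟩ := h0.gates hX hφ hψ hψ1 C hφ1 (by rw [hC]; exact zero_add t)
  have hleaf : SimState.afterReadout pn pt X C n =
      (C.foldl (fun l g => l.flatMap (SimState.gate n X g)) [SimState.init n t pn pt]).flatMap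
        fun A => (List.finRange n).foldl (fun l (j : Fin n) => l.flatMap (SimState.readout n j))
          [A] := by
    rw [← foldl_flatMap, SimState.afterReadout, ← List.map_coe_finRange_eq_range, List.foldl_map]
    rfl
  have hr := fun b A hA => ((g1 A hA).1.readsOut (g1 A hA).2.1).readouts hφ1 hφ hψ hψ1 b
    (List.finRange n)
  have hout : ∀ A ∈ C.foldl (fun l g => l.flatMap (SimState.gate n X g))
      [SimState.init n t pn pt], A.out = [] := fun A hA => (g1 A hA).2.2
  rw [hleaf]
  refine ⟨fun B hB => ?_, fun b => ?_⟩
  · obtain ⟨A, hA, hB⟩ := List.mem_flatMap.1 hB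
    obtain ⟨i1, l, hl, i2⟩ := (hr (fun _ => false) A hA).1 B hB
    refine ⟨i1, ?_⟩
    rw [i2, hout A hA, List.nil_append, hl, List.length_finRange]
  -- All 2^t branches of the gates contribute the same amount, and the powers of two cancel.
  · rw [sum_map_flatMap, List.map_congr_left (g := fun _ => (1 / 2) ^ t * C.prob Rn φ b),
      List.map_const', List.sum_replicate, g2, hC, nsmul_eq_mul, ← mul_assoc]
    · rw [Nat.cast_pow, ← mul_pow]; norm_num
    · intro A hA
      have := (hr b A hA).2
      rw [hout A hA, List.nil_append, ← List.ofFn_eq_map] at this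
      exact this

end Readout

/-! ### From the simulation back to the machine -/

theorem List.Forall₂.sum_eq {α β : Type*} {R : α → β → Prop} {f : α → ℝ} {g : β → ℝ}
    {l : List α} {l' : List β} (h : List.Forall₂ R l l') (hR : ∀ a b, R a b → f a = g b) :
    (l.map f).sum = (l'.map g).sum := by
  induction h with
  | nil => rfl
  | cons h _ ih => rw [List.map_cons, List.map_cons, List.sum_cons, List.sum_cons, ih, hR _ _ h]

theorem List.Forall₂.exists_of_mem {α β : Type*} {R : α → β → Prop}
    {l : List α} {l' : List β} (h : List.Forall₂ R l l') {a : α} (ha : a ∈ l) :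
    ∃ b ∈ l', R a b := by
  induction h with
  | nil => simp at ha
  | cons h _ ih =>
    rcases List.mem_cons.1 ha with rfl | ha
    · exact ⟨_, List.mem_cons_self, h⟩
    · obtain ⟨b, hb, hR⟩ := ih ha
      exact ⟨b, List.mem_cons_of_mem _ hb, hR⟩

theorem sum_map_filter {α : Type*} (p : α → Bool) (f : α → ℝ) (l : List α) :
    ((l.filter p).map f).sum = (l.map fun a => if p a then f a else 0).sum := by
  induction l with
  | nil => rfl
  | cons a l ih =>
    rw [List.filter_cons, List.map_cons, List.sum_cons, ← ih]
    split_ifs <;> simp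

theorem mainTheorem2 :
    ∃ (P : Cmd) (p : Polynomial ℕ),
      ∀ (n t : ℕ) (C : Circuit n), C.numT2 = t →
      -- the register `R_n`, initially in the `+1` eigenstate of all `s_j`
      ∀ {ι : Type} [Fintype ι] [DecidableEq ι] (Rn : MajoranaRegister (2 * n + 2) ι)
        (pn : Bool) (φ : ι → ℂ),
      sqNorm φ = 1 → (∀ j, Rn.s j *ᵥ φ = φ) → Rn.totalParity *ᵥ φ = bitSign pn • φ →
      -- the register `R_t` with its magic states
      ∀ {κ : Type} [Fintype κ] [DecidableEq κ] (Rt : MajoranaRegister (2 * t + 2) κ)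
        (pt : Bool) (X : Fin t → FermionParity (2 * t + 2)) (ψX : κ → ℂ),
      IsMagicFrame Rt X → sqNorm ψX = 1 → (∀ j, (X j).op Rt *ᵥ ψX = ψX) →
      Rt.totalParity *ᵥ ψX = bitSign pt • ψX →
      (∀ c ∈ Config.run (N := 2 * t + 2) (encodeInput C pn pt X) (p.eval (n + C.length))
          (Config.start P),
        c.todo = [] ∧ c.out.length = n ∧
        c.measuredParities.length ≤ t ∧
        (∀ S ∈ c.measuredParities, Even S.card) ∧
        (∀ S ∈ c.measuredParities, ∀ S' ∈ c.measuredParities,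
          Commute (Rt.parity S) (Rt.parity S'))) ∧
      ∀ b : Fin n → Bool,
        outputProb P (encodeInput C pn pt X) (p.eval (n + C.length)) Rt (magicState Rt ψX)
            (List.ofFn b) =
          C.prob Rn φ b := by
  refine ⟨Prog.simulate.compile,
    Prog.initConsts.time + Prog.work.time.comp (8 * Polynomial.X + 4) + 1, ?_⟩
  intro n t C hC ι _ _ Rn pn φ hφ1 hφ hpn κ _ _ Rt pt X ψX hX hψ1 hψ hpt
  have hrun := Prog.run_simulate C hC pn pt X
  obtain ⟨h1, h2⟩ := SimState.afterReadout_spec hφ1 hφ hpn hX hψ1 hψ hpt C hC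
  refine ⟨fun c hc => ?_, fun b => ?_⟩
  · obtain ⟨A, hA, e1, e2, e3⟩ := hrun.exists_of_mem hc
    obtain ⟨⟨Ψ, hΨ⟩, hlen⟩ := h1 A hA
    have hm : c.measuredParities = A.config.measuredParities := by
      rw [Config.measuredParities, e3]; rfl
    rw [hm, e2]
    exact ⟨e1, hlen, hΨ.measuredParities⟩
  · rw [outputProb, sum_map_filter, ← h2 b]
    refine hrun.sum_eq ?_
    rintro c A ⟨e1, e2, e3⟩
    have hw : c.weight Rt (magicState Rt ψX) = A.config.weight Rt (magicState Rt ψX) := by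
      rw [Config.weight, Config.numCoins, e3]; rfl
    rw [e1, e2, hw]
    simp
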